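/- Consider, for $x\in\mathbf R$ and $t\ge 0$, the p-system $$\partial_t a=\partial_x b,\qquad \partial_t b=\partial_x a+\partial_x g(a,b)+2\big(\partial_x^2 b+\partial_x(f(a,b)\,\partial_x b)\big),\qquad (a,b)|_{t=0}=\mathbf z_0=(a_0,b_0).$$ *Nonlinearities.* The maps $f,g:\mathbf R^2\to\mathbf R$ are called admissible if there are a quadratic form $g_0$ on $\mathbf R^2$ and a constant $C$ such that, with $\Delta g=g-g_0$, for all sufficiently small $\mathbf z,\mathbf z_1,\mathbf z_2\in\mathbf R^2$: $|g(\mathbf z)|\le C|\mathbf z|^2$, $|g(\mathbf z_1)-g(\mathbf z_2)|\le C|\mathbf z_1-\mathbf z_2|(|\mathbf z_1|+|\mathbf z_2|)$, $|\Delta g(\mathbf z)|\le C|\mathbf z|^3$, $|\Delta g(\mathbf z_1)-\Delta g(\mathbf z_2)|\le C|\mathbf z_1-\mathbf z_2|(|\mathbf z_1|+|\mathbf z_2|)^2$, $|f(\mathbf z)|\le C|\mathbf z|$ and $|f(\mathbf z_1)-f(\mathbf z_2)|\le C|\mathbf z_1-\mathbf z_2|$. *Spaces.* Let $D=\partial_x$,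 let $\hat{\ }$ be the Fourier transform in $x$, and $\|\cdot\|_p$ the norm of $L^p(\mathbf R)$. The space $\mathcal B_0$ is the closure of $C_0^\infty(\mathbf R,\mathbf R^2)$ under $$|\mathbf z_0|=\|\hat{\mathbf z}_0\|_\infty+\|\mathbf z_0\|_2+\|D\mathbf z_0\|_2+\|D^2b_0\|_2 .$$ The space $\mathcal B$ consists of the functions $\mathbf z=(a,b):[0,\infty)\to\mathcal B_0$ that are continuous in $t$ with respect to $\|\hat{\mathbf z}\|_\infty+\|\mathbf z\|_2+\|D\mathbf z\|_2$ and for which $$\|\mathbf z\|=\sup_{t\ge0}\|\hat{\mathbf z}(t)\|_\infty+\sup_{t\ge0}(1+t)^{\frac14}\|\mathbf z(t)\|_2+\sup_{t\ge0}(1+t)^{\frac34}\|D\mathbf z(t)\|_2+\sup_{t\ge0}\frac{(1+t)^{\frac54}}{\ln(2+t)}\|D^2b(t)\|_2$$ is finite. *Solutions.* A solution is a mild solution: with $h(\mathbf z)=g(a,b)+2f(a,b)\partial_xb$ and $\mathcal L$ the operator with Fourier symbol $\begin{pmatrix}0&ik\\ ik&-2k^2\end{pmatrix}$, $$\mathbf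 z(t)=e^{\mathcal Lt}\mathbf z_0+\int_0^te^{\mathcal L(t-s)}\begin{pmatrix}0\\ \partial_xh(\mathbf z(s))\end{pmatrix}ds\qquad(t\ge0).$$ **Theorem.** Let $f,g$ be admissible. There are $c>1$ and $\epsilon_1>0$ such that for every $\epsilon_0\in(0,\epsilon_1]$ the Cauchy problem is well posed in $\mathcal B$ for data $\mathbf z_0\in\mathcal B_0$ with $|\mathbf z_0|\le\epsilon_0$, in the following sense. 1. For every such $\mathbf z_0$ there is a solution $\mathbf z\in\mathcal B$ with $\|\mathbf z\|\le c\epsilon_0$, and it is the only solution in $\mathcal B$ that satisfies this bound. 2. The solution depends continuously on the data: for every $\eta>0$ there is $\delta>0$ such that if $\mathbf z,\mathbf z'$ are the solutions with two such data $\mathbf z_0,\mathbf z_0'$ and $|\mathbf z_0-\mathbf z_0'|\le\delta$, then $\sup_{t\ge0}\|\mathbf z(t)-\mathbf z'(t)\|_2\le\eta$. 3. If moreover $f$ and $g$ are of class $C^2$ near the origin, then each of these solutions is continuous in $t$ with respect to the norm $|\cdot|$ of $\mathcal B_0$, and there is a constant $K$ such that $\|\mathbf z-\mathbf z'\|\le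 K|\mathbf z_0-\mathbf z_0'|$ for all such data. -/

import Mathlib

open MeasureTheory Filter Topology
open scoped ENNReal NNReal ContDiff FourierTransform

noncomputable section

namespace PSystem

/-- The phase space `ℝ²` (Euclidean norm); `z 0` is the component `a`, `z 1` the component `b`. -/
abbrev V : Type := EuclideanSpace ℝ (Fin 2)

/-- The complexified phase space `ℂ²`. -/
abbrev VC : Type := EuclideanSpace ℂ (Fin 2)

/-- `L²(ℝ, E)`. -/
abbrev L2 (E : Type) [NormedAddCommGroup E] : Type := Lp (α := ℝ) E 2 volume

/-! ### Admissible nonlinearities -/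

/-- Admissible nonlinearities `f, g : ℝ² → ℝ`. -/
def Admissible (f g : V → ℝ) : Prop :=
  ∃ (g₀ : QuadraticForm ℝ V) (C r : ℝ), 0 < r ∧
    ∀ z z₁ z₂ : V, ‖z‖ < r → ‖z₁‖ < r → ‖z₂‖ < r →
      |g z| ≤ C * ‖z‖ ^ 2 ∧
      |g z₁ - g z₂| ≤ C * (‖z₁ - z₂‖ * (‖z₁‖ + ‖z₂‖)) ∧
      |g z - g₀ z| ≤ C * ‖z‖ ^ 3 ∧
      |(g z₁ - g₀ z₁) - (g z₂ - g₀ z₂)| ≤ C * (‖z₁ - z₂‖ * (‖z₁‖ + ‖z₂‖) ^ 2) ∧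
      |f z| ≤ C * ‖z‖ ∧
      |f z₁ - f z₂| ≤ C * ‖z₁ - z₂‖

/-! ### Fourier transform and weak derivatives of `L²` functions -/

/-- The inclusion `ℝ² → ℂ²`. -/
def complexify : V →L[ℝ] VC :=
  LinearMap.toContinuousLinearMap
    { toFun := fun v => WithLp.toLp 2 (fun i => ((v i : ℝ) : ℂ))
      map_add' := by intro v w; ext i; simp
      map_smul' := by intro r v; ext i; simp }

/-- The `L²` Fourier transform `ξ ↦ ∫ exp(-2πixξ) z(x) dx` of an `ℝ²`-valued function;
the wave number is `k = 2πξ`. -/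
def fourierL2 (z : L2 V) : L2 VC := 𝓕 (complexify.compLp z : L2 VC)

/-- The second component `b` of `z = (a, b)`. -/
def compB (z : L2 V) : L2 ℝ := (EuclideanSpace.proj (𝕜 := ℝ) (1 : Fin 2)).compLp z

/-- `v` is the `n`-th weak derivative of `u`. -/
def HasWeakDeriv {E : Type} [NormedAddCommGroup E] [NormedSpace ℝ E]
    (n : ℕ) (u v : L2 E) : Prop :=
  ∀ φ : ℝ → ℝ, ContDiff ℝ ∞ φ → HasCompactSupport φ →
    ∫ x, iteratedDeriv n φ x • u x = (-1 : ℝ) ^ n • ∫ x, φ x • v x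

/-- `‖Dⁿu‖₂`, with the value `∞` if `u` has no `n`-th weak derivative in `L²`. -/
def derivNorm {E : Type} [NormedAddCommGroup E] [NormedSpace ℝ E]
    (n : ℕ) (u : L2 E) : ℝ≥0∞ :=
  ⨅ (v : L2 E) (_ : HasWeakDeriv n u v), ‖v‖ₑ

open Classical in
/-- The first weak derivative (zero if there is none in `L²`). -/
def weakDeriv {E : Type} [NormedAddCommGroup E] [NormedSpace ℝ E] (u : L2 E) : L2 E :=
  if h : ∃ v, HasWeakDeriv 1 u v then h.choose else 0

/-! ### The spaces `𝓑₀` and `𝓑` -/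

/-- `‖ẑ‖_∞ + ‖z‖₂ + ‖Dz‖₂`. -/
def normLow (z : L2 V) : ℝ≥0∞ :=
  eLpNorm (fourierL2 z) ⊤ volume + ‖z‖ₑ + derivNorm 1 z

/-- The norm of `𝓑₀`: `|z| = ‖ẑ‖_∞ + ‖z‖₂ + ‖Dz‖₂ + ‖D²b‖₂`. -/
def normB0 (z : L2 V) : ℝ≥0∞ := normLow z + derivNorm 2 (compB z)

/-- `z` is (the class of) a smooth compactly supported function. -/
def IsTestFunction (z : L2 V) : Prop :=
  ∃ φ : ℝ → V, ContDiff ℝ ∞ φ ∧ HasCompactSupport φ ∧ z =ᵐ[volume] φ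

/-- `𝓑₀` is the closure of the smooth compactly supported functions under `normB0`. -/
def MemB0 (z : L2 V) : Prop :=
  ∀ ε : ℝ≥0∞, 0 < ε → ∃ w : L2 V, IsTestFunction w ∧ normB0 (z - w) < ε

/-- `sup_{t ≥ 0} w(t) N(t)` for a weight `w` and a norm `N`. -/
def weightedSup (w : ℝ → ℝ) (N : ℝ → ℝ≥0∞) : ℝ≥0∞ :=
  ⨆ (t : ℝ) (_ : 0 ≤ t), ENNReal.ofReal (w t) * N t

/-- The norm of `𝓑`. A space-time function is a map `t ↦ z(·,t)`; only `t ≥ 0` matters. -/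
def normB (z : ℝ → L2 V) : ℝ≥0∞ :=
  weightedSup (fun _ => 1) (fun t => eLpNorm (fourierL2 (z t)) ⊤ volume) +
  weightedSup (fun t => (1 + t) ^ (1 / 4 : ℝ)) (fun t => ‖z t‖ₑ) +
  weightedSup (fun t => (1 + t) ^ (3 / 4 : ℝ)) (fun t => derivNorm 1 (z t)) +
  weightedSup (fun t => (1 + t) ^ (5 / 4 : ℝ) / Real.log (2 + t))
    (fun t => derivNorm 2 (compB (z t)))

/-- `t ↦ z(t)`, `t ≥ 0`, is continuous with respect to the (extended) norm `N`. -/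
def ContinuousInTime (N : L2 V → ℝ≥0∞) (z : ℝ → L2 V) : Prop :=
  ∀ t : ℝ, 0 ≤ t → Tendsto (fun s => N (z s - z t)) (𝓝[Set.Ici 0] t) (𝓝 0)

/-- The space `𝓑`: `z(t) ∈ 𝓑₀` for all `t ≥ 0`, continuous in time for
`‖ẑ‖_∞ + ‖z‖₂ + ‖Dz‖₂`, of finite norm. -/
def MemB (z : ℝ → L2 V) : Prop :=
  (∀ t : ℝ, 0 ≤ t → MemB0 (z t)) ∧ ContinuousInTime normLow z ∧ normB z < ⊤

/-! ### Mild solutions of the p-system -/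

/-- The symbol `[[0, ik], [ik, -2k²]]` of the linearization. -/
def symbol (k : ℝ) : Matrix (Fin 2) (Fin 2) ℂ :=
  !![0, Complex.I * k; Complex.I * k, -2 * (k : ℂ) ^ 2]

/-- The semigroup `e^{𝓛t}` at the wave number `k`. -/
def semigroup (k t : ℝ) : Matrix (Fin 2) (Fin 2) ℂ := NormedSpace.exp ((t : ℂ) • symbol k)

/-- The nonlinear flux `h(z) = g(a,b) + 2 f(a,b) ∂ₓb`. -/
def flux (f g : V → ℝ) (z : L2 V) (x : ℝ) : ℝ :=
  g (z x) + 2 * f (z x) * weakDeriv (compB z) x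

/-- Mild solutions of
`∂ₜa = ∂ₓb`, `∂ₜb = ∂ₓa + ∂ₓg(a,b) + 2(∂ₓ²b + ∂ₓ(f(a,b)∂ₓb))`, `z(0) = z₀`,
i.e. `z(t) = e^{𝓛t} z₀ + ∫₀ᵗ e^{𝓛(t-s)} (0, ∂ₓh(z(s))) ds`, written in Fourier variables. -/
def IsMildSolution (f g : V → ℝ) (z₀ : L2 V) (z : ℝ → L2 V) : Prop :=
  ∀ t : ℝ, 0 ≤ t → ∀ᵐ ξ : ℝ, ∀ i : Fin 2,
    fourierL2 (z t) ξ i =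
      (semigroup (2 * Real.pi * ξ) t).mulVec (fun j => fourierL2 z₀ ξ j) i +
      ∫ s in (0 : ℝ)..t, (semigroup (2 * Real.pi * ξ) (t - s)).mulVec
        ![0, Complex.I * ((2 * Real.pi * ξ : ℝ) : ℂ) *
          𝓕 (fun x : ℝ => ((flux f g (z s) x : ℝ) : ℂ)) ξ] i

/-- `z ∈ 𝓑` is a mild solution with initial value `z₀` and `‖z‖ ≤ R`. -/
def SolvesInBall (f g : V → ℝ) (R : ℝ) (z₀ : L2 V) (z : ℝ → L2 V) : Prop :=
  MemB z ∧ IsMildSolution f g z₀ z ∧ normB z ≤ ENNReal.ofReal R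

end PSystem

namespace PSystem

open scoped SchwartzMap

set_option linter.unusedSectionVars false

section FourierBasics

variable {F : Type} [NormedAddCommGroup F] [InnerProductSpace ℂ F] [CompleteSpace F]

theorem integral_fourier_smul_L2 (u : L2 F) (g : 𝓢(ℝ, ℂ)) :
    ∫ x, 𝓕 g x • u x = ∫ ξ, g ξ • (𝓕 u : L2 F) ξ := by
  have h := congrArg (fun T => T g) (Lp.fourier_toTemperedDistribution_eq u)
  simpa [TemperedDistribution.fourier_apply] using h

theorem integral_fourierInv_smul_L2 (u : L2 F) (g : 𝓢(ℝ, ℂ)) :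
    ∫ x, 𝓕⁻ g x • u x = ∫ ξ, g ξ • (𝓕⁻ u : L2 F) ξ := by
  have h := congrArg (fun T => T g) (Lp.fourierInv_toTemperedDistribution_eq u)
  simpa [TemperedDistribution.fourierInv_apply] using h

theorem ae_eq_of_integral_schwartz_smul_eq {u m : ℝ → F} (hu : LocallyIntegrable u)
    (hm : LocallyIntegrable m) (h : ∀ g : 𝓢(ℝ, ℂ), ∫ x, g x • u x = ∫ x, g x • m x) :
    u =ᵐ[volume] m := by
  refine ae_eq_of_integral_contDiff_smul_eq hu hm fun g hg hgc => ?_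
  have hg₁ : HasCompactSupport (Complex.ofRealCLM ∘ g) := hgc.comp_left rfl
  have hg₂ : ContDiff ℝ ∞ (Complex.ofRealCLM ∘ g) := by fun_prop
  simpa using h (hg₁.toSchwartzMap hg₂)

theorem locallyIntegrable_L2 {E : Type} [NormedAddCommGroup E] (u : L2 E) :
    LocallyIntegrable u volume :=
  (Lp.memLp u).locallyIntegrable (by norm_num)

theorem fourier_L2_ae_eq (u : L2 F) {m : ℝ → F} (hm : LocallyIntegrable m)
    (h : ∀ g : 𝓢(ℝ, ℂ), ∫ x, 𝓕 g x • u x = ∫ ξ, g ξ • m ξ) :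
    (𝓕 u : L2 F) =ᵐ[volume] m :=
  ae_eq_of_integral_schwartz_smul_eq (locallyIntegrable_L2 _) hm fun g => by
    rw [← integral_fourier_smul_L2, h]

theorem integral_fourier_smul_eq (g : 𝓢(ℝ, ℂ)) {u : ℝ → F} (hu : Integrable u) :
    ∫ x, 𝓕 g x • u x = ∫ ξ, g ξ • 𝓕 u ξ := by
  have := VectorFourier.integral_fourierIntegral_smul_eq_flip (μ := volume) (ν := volume)
    (L := innerₗ ℝ) Real.continuous_fourierChar (by fun_prop) (g.integrable (μ := volume)) hu
  rw [flip_innerₗ] at this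
  exact this

theorem integral_fourierInv_smul_eq (g : 𝓢(ℝ, ℂ)) {u : ℝ → F} (hu : Integrable u) :
    ∫ x, 𝓕⁻ g x • u x = ∫ ξ, g ξ • 𝓕⁻ u ξ := by
  have := VectorFourier.integral_fourierIntegral_smul_eq_flip (μ := volume) (ν := volume)
    (L := -innerₗ ℝ) Real.continuous_fourierChar (by fun_prop) (g.integrable (μ := volume)) hu
  have hflip : (-innerₗ ℝ).flip = -innerₗ ℝ := by
    ext; simp
  rw [hflip] at this
  rw [SchwartzMap.fourierInv_coe]
  exact this

theorem continuous_fourier_of_integrable {u : ℝ → F} (hu : Integrable u) : Continuous (𝓕 u) :=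
  VectorFourier.fourierIntegral_continuous Real.continuous_fourierChar
    (by fun_prop) hu

theorem continuous_fourierInv_of_integrable {u : ℝ → F} (hu : Integrable u) :
    Continuous (𝓕⁻ u) := by
  have : 𝓕⁻ u = fun x => 𝓕 u (-x) := by
    ext x; rw [Real.fourierInv_eq_fourier_neg]
  rw [this]
  exact (continuous_fourier_of_integrable hu).comp continuous_neg

/-- On `L¹ ∩ L²` the `L²` Fourier transform is given by the Fourier integral. -/
theorem fourier_L2_eq_integral (u : L2 F) (hu : Integrable u) :
    (𝓕 u : L2 F) =ᵐ[volume] 𝓕 (u : ℝ → F) :=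
  fourier_L2_ae_eq u (continuous_fourier_of_integrable hu).locallyIntegrable fun g =>
    integral_fourier_smul_eq g hu

theorem fourierInv_L2_eq_integral (u : L2 F) (hu : Integrable u) :
    (𝓕⁻ u : L2 F) =ᵐ[volume] 𝓕⁻ (u : ℝ → F) :=
  ae_eq_of_integral_schwartz_smul_eq (locallyIntegrable_L2 _)
    (continuous_fourierInv_of_integrable hu).locallyIntegrable fun g => by
      rw [← integral_fourierInv_smul_L2, integral_fourierInv_smul_eq g hu]

theorem eLpNorm_fourier_eq {u : ℝ → F} (hu : Integrable u) (hu2 : MemLp u 2) :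
    eLpNorm (𝓕 u) 2 volume = eLpNorm u 2 volume := by
  have hcoe := hu2.coeFn_toLp
  have h1 := fourier_L2_eq_integral (hu2.toLp u) (hu.congr hcoe.symm)
  have h2 : 𝓕 (hu2.toLp u : ℝ → F) = 𝓕 u := by
    ext x; exact Real.fourier_congr_ae hcoe x
  rw [h2] at h1
  have h3 := Lp.norm_fourier_eq (hu2.toLp u)
  rw [Lp.norm_def, Lp.norm_def, ENNReal.toReal_eq_toReal_iff' (Lp.eLpNorm_ne_top _)
    (Lp.eLpNorm_ne_top _), eLpNorm_congr_ae h1, eLpNorm_congr_ae hcoe] at h3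
  exact h3

theorem eLpNorm_fourierInv_eq {u : ℝ → F} (hu : Integrable u) (hu2 : MemLp u 2) :
    eLpNorm (𝓕⁻ u) 2 volume = eLpNorm u 2 volume := by
  have : 𝓕⁻ u = (𝓕 u) ∘ (fun x => -x) := by
    ext x; simp [Real.fourierInv_eq_fourier_neg]
  rw [this, eLpNorm_comp_measurePreserving
    (continuous_fourier_of_integrable hu).aestronglyMeasurable
    (Measure.measurePreserving_neg volume), eLpNorm_fourier_eq hu hu2]

/-- Fourier inversion: an `L²` function with integrable Fourier transform `m` is the inverse
Fourier integral of `m`. -/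
theorem ae_eq_fourierInv_of_fourier_ae_eq (u : L2 F) {m : ℝ → F} (hm : Integrable m)
    (h : (𝓕 u : L2 F) =ᵐ[volume] m) : u =ᵐ[volume] 𝓕⁻ m := by
  have h1 := fourierInv_L2_eq_integral (𝓕 u) (hm.congr h.symm)
  rw [FourierTransform.fourierInv_fourier_eq] at h1
  refine h1.trans (Eq.eventuallyEq ?_)
  ext x; exact Real.fourierInv_congr_ae h x

theorem eLpNorm_coe_fourier (u : L2 F) :
    eLpNorm (𝓕 u : L2 F) 2 volume = eLpNorm u 2 volume := by
  have h3 := Lp.norm_fourier_eq u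
  rwa [Lp.norm_def, Lp.norm_def, ENNReal.toReal_eq_toReal_iff' (Lp.eLpNorm_ne_top _)
    (Lp.eLpNorm_ne_top _)] at h3

/-- The Fourier transform commutes with continuous linear maps. -/
theorem fourier_compLp {G : Type} [NormedAddCommGroup G] [InnerProductSpace ℂ G]
    [CompleteSpace G] (A : F →L[ℂ] G) (u : L2 F) :
    (𝓕 (A.compLp u : L2 G) : L2 G) =ᵐ[volume] fun ξ => A ((𝓕 u : L2 F) ξ) := by
  have hloc : LocallyIntegrable (fun ξ => A ((𝓕 u : L2 F) ξ)) volume :=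
    (locallyIntegrable_L2 (A.compLp (𝓕 u : L2 F) : L2 G)).congr (A.coeFn_compLp' _)
  have hinteg : ∀ (g : 𝓢(ℝ, ℂ)) (v : L2 F), Integrable (fun x => g x • v x) volume := by
    intro g v
    exact memLp_one_iff_integrable.1 ((Lp.memLp v).smul (g.memLp 2 volume))
  refine fourier_L2_ae_eq _ hloc fun g => ?_
  have h1 : ∫ x, 𝓕 g x • (A.compLp u : L2 G) x = ∫ x, A (𝓕 g x • u x) := by
    refine integral_congr_ae ?_
    filter_upwards [A.coeFn_compLp u] with x hx
    rw [hx, map_smul]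
  rw [h1, A.integral_comp_comm (hinteg _ u), integral_fourier_smul_L2,
    ← A.integral_comp_comm (hinteg _ _)]
  simp

end FourierBasics

end PSystem

namespace PSystem

open scoped SchwartzMap

/-! ### Integral inequalities -/

theorem eLpNorm_two_sq {α E : Type} [MeasurableSpace α] {μ : Measure α} [NormedAddCommGroup E]
    (f : α → E) : eLpNorm f 2 μ ^ 2 = ∫⁻ x, ‖f x‖ₑ ^ 2 ∂μ := by
  have h := eLpNorm_nnreal_pow_eq_lintegral (μ := μ) (f := f) (p := 2) (by norm_num)
  simpa using h

theorem eLpNorm_two_le_iff {α E : Type} [MeasurableSpace α] {μ : Measure α}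
    [NormedAddCommGroup E] (f : α → E) {A : ℝ} (hA : 0 ≤ A) :
    eLpNorm f 2 μ ≤ ENNReal.ofReal A ↔ ∫⁻ x, ‖f x‖ₑ ^ 2 ∂μ ≤ ENNReal.ofReal (A ^ 2) := by
  rw [← eLpNorm_two_sq, ENNReal.ofReal_pow hA]
  exact (ENNReal.pow_le_pow_left_iff two_ne_zero).symm

/-- The Cauchy–Schwarz inequality. -/
theorem lintegral_mul_sq_le {α : Type} [MeasurableSpace α] {μ : Measure α} {f g : α → ℝ≥0∞}
    (hf : AEMeasurable f μ) (hg : AEMeasurable g μ) :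
    (∫⁻ x, f x * g x ∂μ) ^ 2 ≤ (∫⁻ x, f x ^ 2 ∂μ) * ∫⁻ x, g x ^ 2 ∂μ := by
  have h := ENNReal.lintegral_mul_le_Lp_mul_Lq μ (Real.HolderConjugate.two_two) hf hg
  have h2 := pow_le_pow_left' h 2
  rw [mul_pow, ← ENNReal.rpow_natCast, ← ENNReal.rpow_natCast, ← ENNReal.rpow_natCast,
    ← ENNReal.rpow_mul, ← ENNReal.rpow_mul] at h2
  simpa using h2

section Conj

/-- Complex conjugation on `ℂ²`. -/
def conjVC : VC →L[ℝ] VC :=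
  LinearMap.toContinuousLinearMap
    { toFun := fun v => WithLp.toLp 2 (fun i => (starRingEnd ℂ) (v i))
      map_add' := by intro v w; ext i; simp
      map_smul' := by intro r v; ext i; simp }

/-- The real part of a vector of `ℂ²`. -/
def reVC : VC →L[ℝ] V :=
  LinearMap.toContinuousLinearMap
    { toFun := fun v => WithLp.toLp 2 (fun i => (v i).re)
      map_add' := by intro v w; ext i; simp
      map_smul' := by intro r v; ext i; simp }

@[simp] theorem conjVC_apply (v : VC) (i : Fin 2) : conjVC v i = (starRingEnd ℂ) (v i) := rfl
@[simp] theorem reVC_apply (v : VC) (i : Fin 2) : reVC v i = (v i).re := rfl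
@[simp] theorem complexify_apply (v : V) (i : Fin 2) : complexify v i = ((v i : ℝ) : ℂ) := rfl

@[simp] theorem norm_complexify (v : V) : ‖complexify v‖ = ‖v‖ := by
  simp [EuclideanSpace.norm_eq]

@[simp] theorem norm_conjVC (v : VC) : ‖conjVC v‖ = ‖v‖ := by
  simp [EuclideanSpace.norm_eq]

theorem conjVC_smul (c : ℂ) (v : VC) : conjVC (c • v) = (starRingEnd ℂ) c • conjVC v := by
  ext i; simp

theorem conj_fourier (u : ℝ → ℂ) (ξ : ℝ) :
    (starRingEnd ℂ) (𝓕 u ξ) = 𝓕 (fun x => (starRingEnd ℂ) (u x)) (-ξ) := by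
  simp only [Real.fourier_real_eq_integral_exp_smul]
  rw [← integral_conj]
  congr 1
  ext x
  simp only [smul_eq_mul, map_mul, ← Complex.exp_conj]
  congr 2
  simp [Complex.conj_ofReal, map_ofNat (starRingEnd ℂ) 2]

/-- The Schwartz function `x ↦ conj (g (-x))`. -/
def conjNeg (g : 𝓢(ℝ, ℂ)) : 𝓢(ℝ, ℂ) :=
  SchwartzMap.compCLMOfContinuousLinearEquiv ℝ (ContinuousLinearEquiv.neg ℝ)
    (SchwartzMap.postcompCLM (𝕜 := ℝ) (Complex.conjCLE : ℂ →L[ℝ] ℂ) g)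

theorem conjNeg_apply (g : 𝓢(ℝ, ℂ)) (x : ℝ) : conjNeg g x = (starRingEnd ℂ) (g (-x)) := rfl

theorem fourier_conjNeg (g : 𝓢(ℝ, ℂ)) (x : ℝ) :
    𝓕 (conjNeg g) x = (starRingEnd ℂ) (𝓕 g x) := by
  rw [SchwartzMap.fourier_coe, SchwartzMap.fourier_coe, conj_fourier]
  simp only [Real.fourier_real_eq_integral_exp_smul, conjNeg_apply]
  rw [← integral_neg_eq_self]
  simp

theorem locallyIntegrable_conj_neg (u : L2 VC) :
    LocallyIntegrable (fun ξ => conjVC (u (-ξ))) volume := by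
  have h := ((Lp.memLp (conjVC.compLp u : L2 VC)).comp_measurePreserving
    (Measure.measurePreserving_neg (volume : Measure ℝ)))
  refine (h.locallyIntegrable (by norm_num)).congr ?_
  exact (Measure.measurePreserving_neg (volume : Measure ℝ)).quasiMeasurePreserving.ae_eq
    (conjVC.coeFn_compLp' u)

theorem fourier_conj_L2 (u : L2 VC) :
    (𝓕 (conjVC.compLp u : L2 VC) : L2 VC) =ᵐ[volume] fun ξ => conjVC ((𝓕 u : L2 VC) (-ξ)) := by
  have hinteg : ∀ (g : 𝓢(ℝ, ℂ)) (v : L2 VC), Integrable (fun x => g x • v x) volume := by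
    intro g v
    exact memLp_one_iff_integrable.1 ((Lp.memLp v).smul (g.memLp 2 volume))
  refine fourier_L2_ae_eq _ (locallyIntegrable_conj_neg _) fun g => ?_
  have h1 : ∫ x, 𝓕 g x • (conjVC.compLp u : L2 VC) x
      = ∫ x, conjVC (𝓕 (conjNeg g) x • u x) := by
    refine integral_congr_ae ?_
    filter_upwards [conjVC.coeFn_compLp u] with x hx
    rw [hx, conjVC_smul, fourier_conjNeg, Complex.conj_conj]
  rw [h1, conjVC.integral_comp_comm (hinteg _ u), integral_fourier_smul_L2,
    ← conjVC.integral_comp_comm (hinteg _ _), ← integral_neg_eq_self]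
  simp [conjVC_smul, conjNeg_apply]

theorem fourierL2_neg (z : L2 V) :
    ∀ᵐ ξ, fourierL2 z (-ξ) = conjVC (fourierL2 z ξ) := by
  have h := fourier_conj_L2 (complexify.compLp z : L2 VC)
  have h2 : (conjVC.compLp (complexify.compLp z : L2 VC) : L2 VC) = complexify.compLp z := by
    ext1
    filter_upwards [conjVC.coeFn_compLp (complexify.compLp z : L2 VC), complexify.coeFn_compLp z]
      with x h1 h2
    rw [h1, h2]
    ext i; simp
  rw [h2] at h
  filter_upwards [h] with ξ hξ
  change fourierL2 z ξ = conjVC (fourierL2 z (-ξ)) at hξ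
  rw [hξ]
  ext i; simp

theorem norm_fourierL2 (z : L2 V) : ‖fourierL2 z‖ = ‖z‖ := by
  rw [fourierL2, Lp.norm_fourier_eq, Lp.norm_def, Lp.norm_def,
    eLpNorm_congr_ae (complexify.coeFn_compLp' z)]
  congr 1
  exact eLpNorm_congr_norm_ae (by simp)

theorem eLpNorm_fourierL2 (z : L2 V) : eLpNorm (fourierL2 z) 2 volume = ‖z‖ₑ := by
  rw [← ofReal_norm, ← norm_fourierL2, ofReal_norm, Lp.enorm_def]

theorem fourierL2_sub (z w : L2 V) : fourierL2 (z - w) = fourierL2 z - fourierL2 w := by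
  have h : (complexify.compLp (z - w) : L2 VC) = complexify.compLp z - complexify.compLp w :=
    map_sub (complexify.compLpL 2 volume) z w
  rw [fourierL2, h, fourierL2, fourierL2]
  exact map_sub (Lp.fourierTransformₗᵢ ℝ VC) _ _

theorem fourierL2_sub_ae (z w : L2 V) :
    fourierL2 (z - w) =ᵐ[volume] fun ξ => fourierL2 z ξ - fourierL2 w ξ := by
  rw [fourierL2_sub]; exact Lp.coeFn_sub _ _

/-- A square integrable function with the symmetry of the Fourier transform of a real function is
the Fourier transform of a real function. -/
theorem exists_fourierL2_eq {m : ℝ → VC} (hm : MemLp m 2)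
    (hsymm : ∀ᵐ ξ, m (-ξ) = conjVC (m ξ)) : ∃ z : L2 V, fourierL2 z =ᵐ[volume] m := by
  set u : L2 VC := 𝓕⁻ (hm.toLp m) with hu
  have hFu : (𝓕 u : L2 VC) = hm.toLp m := by simp [hu]
  have hcoe := hm.coeFn_toLp
  have hcoe' := (Measure.measurePreserving_neg (volume : Measure ℝ)).quasiMeasurePreserving.ae
    hcoe
  have hconj : (conjVC.compLp u : L2 VC) = u := by
    have h1 : (𝓕 (conjVC.compLp u : L2 VC) : L2 VC) = 𝓕 u := by
      ext1
      filter_upwards [fourier_conj_L2 u, hcoe, hcoe', hsymm] with ξ h1 h2 h3 h4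
      rw [h1, hFu, h2, h3, h4]
      ext i; simp
    have := congrArg (fun u : L2 VC => 𝓕⁻ u) h1
    simpa using this
  refine ⟨reVC.compLp u, ?_⟩
  have hz : (complexify.compLp (reVC.compLp u : L2 V) : L2 VC) = u := by
    ext1
    filter_upwards [complexify.coeFn_compLp (reVC.compLp u : L2 V), reVC.coeFn_compLp u,
      conjVC.coeFn_compLp u] with x h1 h2 h3
    rw [h1, h2]
    rw [hconj] at h3
    ext i
    have := congrArg (fun v : VC => v i) h3
    simp only [conjVC_apply] at this
    simp only [complexify_apply, reVC_apply]
    exact (Complex.conj_eq_iff_re.1 this.symm)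
  rw [fourierL2, hz, hFu]
  exact hcoe

end Conj

end PSystem

namespace PSystem

open scoped SchwartzMap

/-! ### Weak derivatives and the Fourier transform -/

/-- The `n`-th derivative of a Schwartz function. -/
def iterDerivSchwartz {G : Type} [NormedAddCommGroup G] [NormedSpace ℝ G] (n : ℕ)
    (φ : 𝓢(ℝ, G)) : 𝓢(ℝ, G) := (SchwartzMap.derivCLM ℝ G)^[n] φ

theorem coe_iterDerivSchwartz {G : Type} [NormedAddCommGroup G] [NormedSpace ℝ G] (n : ℕ)
    (φ : 𝓢(ℝ, G)) : (iterDerivSchwartz n φ : ℝ → G) = iteratedDeriv n φ := by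
  induction n with
  | zero => simp [iterDerivSchwartz]
  | succ n ih =>
    ext x
    rw [iteratedDeriv_succ, ← ih, iterDerivSchwartz, Function.iterate_succ_apply']
    rfl

/-- Smooth cutoffs of Schwartz functions: they converge pointwise with all derivatives, and are
dominated. -/
theorem exists_cutoff : ∃ χ : ℕ → ℝ → ℝ, (∀ N, ContDiff ℝ ∞ (χ N)) ∧
    (∀ N, HasCompactSupport (χ N)) ∧
    ∀ (G : Type) [NormedAddCommGroup G] [NormedSpace ℝ G] (φ : 𝓢(ℝ, G)) (n : ℕ),
      (∀ x, ∀ᶠ N in atTop, iteratedDeriv n (fun y => χ N y • φ y) x = iteratedDeriv n φ x) ∧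
      ∃ B : ℝ → ℝ, (∀ p, MemLp B p volume) ∧
        ∀ N x, ‖iteratedDeriv n (fun y => χ N y • φ y) x‖ ≤ B x := by
  let b : ContDiffBump (0 : ℝ) := ⟨1, 2, one_pos, one_lt_two⟩
  have hbs : ContDiff ℝ ∞ b := b.contDiff
  have hbc : HasCompactSupport b := b.hasCompactSupport
  let c : ℕ → ℝ := fun N => ((N : ℝ) + 1)⁻¹
  have hc0 : ∀ N, 0 < c N := fun N => by positivity
  have hc1 : ∀ N, c N ≤ 1 := fun N => inv_le_one_of_one_le₀ (by simp)
  refine ⟨fun N x => b (c N * x), fun N => hbs.comp (by fun_prop), fun N => ?_, ?_⟩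
  · exact hbc.comp_homeomorph (Homeomorph.mulLeft₀ (c N) (hc0 N).ne')
  intro G _ _ φ n
  constructor
  · intro x
    have hev : ∀ᶠ N : ℕ in atTop, |x| < N := by
      obtain ⟨M, hM⟩ := exists_nat_gt |x|
      filter_upwards [eventually_ge_atTop M] with N hN
      exact hM.trans_le (by exact_mod_cast hN)
    filter_upwards [hev] with N hN
    refine Filter.EventuallyEq.iteratedDeriv_eq n ?_
    have hopen : {y : ℝ | |y| < N} ∈ 𝓝 x := (isOpen_lt (by fun_prop) (by fun_prop)).mem_nhds hN
    filter_upwards [hopen] with y hy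
    have h1 : b (c N * y) = 1 := by
      apply b.one_of_mem_closedBall
      rw [mem_closedBall_zero_iff, Real.norm_eq_abs, abs_mul, abs_of_pos (hc0 N)]
      change c N * |y| ≤ 1
      have : |y| < N := hy
      calc c N * |y| ≤ c N * (N + 1) := by
            apply mul_le_mul_of_nonneg_left _ (hc0 N).le
            linarith
        _ = 1 := by simp only [c]; field_simp
    simp [h1]
  · have hK : ∀ i : ℕ, ∃ K : ℝ, ∀ x, ‖iteratedDeriv i b x‖ ≤ K := by
      intro i
      refine ⟨SchwartzMap.seminorm ℝ 0 0 (iterDerivSchwartz i (hbc.toSchwartzMap hbs)),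
        fun x => ?_⟩
      have h := (iterDerivSchwartz i (hbc.toSchwartzMap hbs)).norm_le_seminorm ℝ x
      rw [coe_iterDerivSchwartz] at h
      exact h
    choose K hK using hK
    refine ⟨fun x => ∑ i ∈ Finset.range (n + 1),
      (n.choose i : ℝ) * K i * ‖iterDerivSchwartz (n - i) φ x‖, fun p => ?_, fun N x => ?_⟩
    · refine memLp_finsetSum _ fun i _ => ?_
      exact ((iterDerivSchwartz (n - i) φ).memLp p volume).norm.const_mul _
    · have hχ : ContDiff ℝ ∞ (fun y => b (c N * y)) := hbs.comp (by fun_prop)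
      have h1 := iteratedDerivWithin_smul (𝕜 := ℝ) (n := n) (x := x) (s := Set.univ)
        (f := fun y => b (c N * y)) (g := φ) (Set.mem_univ x) uniqueDiffOn_univ
        (hχ.of_le (by exact_mod_cast le_top)).contDiffAt.contDiffWithinAt
        ((φ.smooth n).contDiffAt.contDiffWithinAt)
      simp only [iteratedDerivWithin_univ] at h1
      change ‖iteratedDeriv n ((fun y => b (c N * y)) • (φ : ℝ → G)) x‖ ≤ _
      rw [h1]
      refine (norm_sum_le _ _).trans (Finset.sum_le_sum fun i _ => ?_)
      rw [iteratedDeriv_comp_const_smul (hbs.of_le (by exact_mod_cast le_top)),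
        coe_iterDerivSchwartz]
      rw [← Nat.cast_smul_eq_nsmul ℝ, norm_smul, norm_smul, Real.norm_natCast, mul_assoc]
      gcongr
      rw [norm_smul]
      calc ‖c N ^ i‖ * ‖iteratedDeriv i b (c N * x)‖ ≤ 1 * K i := by
            gcongr
            · rw [norm_pow, Real.norm_eq_abs, abs_of_pos (hc0 N)]
              exact pow_le_one₀ (hc0 N).le (hc1 N)
            · exact hK i _
        _ = K i := one_mul _

section Weak

set_option linter.unusedSectionVars false

variable {E : Type} [NormedAddCommGroup E] [NormedSpace ℝ E]

theorem HasWeakDeriv.integral_schwartz {n : ℕ} {u v : L2 E} (h : HasWeakDeriv n u v)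
    (ψ : 𝓢(ℝ, ℝ)) :
    ∫ x, iteratedDeriv n ψ x • u x = (-1 : ℝ) ^ n • ∫ x, ψ x • v x := by
  obtain ⟨χ, hχ, hχc, hcut⟩ := exists_cutoff
  have key : ∀ (m : ℕ) (w : L2 E), Tendsto
      (fun N => ∫ x, iteratedDeriv m (fun y => χ N y • ψ y) x • w x) atTop
      (𝓝 (∫ x, iteratedDeriv m ψ x • w x)) := by
    intro m w
    obtain ⟨hlim, B, hB, hbound⟩ := hcut ℝ ψ m
    refine tendsto_integral_of_dominated_convergence (fun x => B x * ‖w x‖) (fun N => ?_) ?_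
      (fun N => ?_) ?_
    · have hs : ContDiff ℝ ∞ (fun y => χ N y • ψ y) := (hχ N).smul (ψ.smooth ⊤)
      exact (hs.continuous_iteratedDeriv m (by exact_mod_cast le_top)).aestronglyMeasurable.smul
        (Lp.aestronglyMeasurable w)
    · exact memLp_one_iff_integrable.1 ((Lp.memLp w).norm.mul (hB 2))
    · filter_upwards with x
      rw [norm_smul]
      gcongr
      exact hbound N x
    · filter_upwards with x
      refine Tendsto.congr' ?_ tendsto_const_nhds
      filter_upwards [hlim x] with N hN
      rw [hN]
  have h1 := key n u
  have h2 := (key 0 v).const_smul ((-1 : ℝ) ^ n)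
  simp only [iteratedDeriv_zero] at h2
  refine tendsto_nhds_unique h1 (h2.congr fun N => ?_)
  exact (h _ ((hχ N).smul (ψ.smooth ⊤)) ((hχc N).smul_right)).symm

variable {F : Type} [NormedAddCommGroup F] [InnerProductSpace ℂ F] [CompleteSpace F]

theorem iteratedDeriv_clm_comp {G H : Type} [NormedAddCommGroup G] [NormedSpace ℝ G]
    [NormedAddCommGroup H] [NormedSpace ℝ H] (A : G →L[ℝ] H) {φ : ℝ → G} (hφ : ContDiff ℝ ∞ φ)
    (n : ℕ) (x : ℝ) : iteratedDeriv n (fun y => A (φ y)) x = A (iteratedDeriv n φ x) := by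
  have h := A.iteratedFDeriv_comp_left (hφ.contDiffAt (x := x)) (i := n)
    (by exact_mod_cast le_top)
  simp only [iteratedDeriv]
  change iteratedFDeriv ℝ n (A ∘ φ) x _ = _
  rw [h]; rfl

variable [CompleteSpace E] (ι : E →L[ℝ] F)

theorem integrable_schwartz_smul_L2 {𝕜 G : Type} [RCLike 𝕜] [NormedAddCommGroup G]
    [NormedSpace 𝕜 G] (g : 𝓢(ℝ, 𝕜)) (v : L2 G) : Integrable (fun x => g x • v x) volume :=
  memLp_one_iff_integrable.1 ((Lp.memLp v).smul (g.memLp 2 volume))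

theorem HasWeakDeriv.integral_schwartz_complex {n : ℕ} {u v : L2 E} (h : HasWeakDeriv n u v)
    (g : 𝓢(ℝ, ℂ)) :
    ∫ x, iterDerivSchwartz n g x • ι (u x) = (-1 : ℂ) ^ n • ∫ x, g x • ι (v x) := by
  have decomp : ∀ (G : 𝓢(ℝ, ℂ)) (w : L2 E), ∫ x, G x • ι (w x)
      = ι (∫ x, (G x).re • w x) + Complex.I • ι (∫ x, (G x).im • w x) := by
    intro G w
    have hre := integrable_schwartz_smul_L2
      (SchwartzMap.postcompCLM (𝕜 := ℝ) Complex.reCLM G) w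
    have him := integrable_schwartz_smul_L2
      (SchwartzMap.postcompCLM (𝕜 := ℝ) Complex.imCLM G) w
    simp only [SchwartzMap.postcompCLM_apply, Complex.reCLM_apply, Complex.imCLM_apply] at hre him
    rw [← ι.integral_comp_comm hre, ← ι.integral_comp_comm him, ← integral_smul,
      ← integral_add (ι.integrable_comp hre) ((ι.integrable_comp him).fun_smul _)]
    congr 1
    ext x
    simp only [map_smul, ← Complex.coe_smul, smul_smul, ← add_smul]
    congr 1
    conv_lhs => rw [← Complex.re_add_im (G x)]
    ring
  have hre := h.integral_schwartz (SchwartzMap.postcompCLM (𝕜 := ℝ) Complex.reCLM g)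
  have him := h.integral_schwartz (SchwartzMap.postcompCLM (𝕜 := ℝ) Complex.imCLM g)
  have e1 : ∀ x, iteratedDeriv n (SchwartzMap.postcompCLM (𝕜 := ℝ) Complex.reCLM g) x
      = (iterDerivSchwartz n g x).re := by
    intro x
    rw [coe_iterDerivSchwartz]
    exact iteratedDeriv_clm_comp Complex.reCLM (g.smooth ⊤) n x
  have e2 : ∀ x, iteratedDeriv n (SchwartzMap.postcompCLM (𝕜 := ℝ) Complex.imCLM g) x
      = (iterDerivSchwartz n g x).im := by
    intro x
    rw [coe_iterDerivSchwartz]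
    exact iteratedDeriv_clm_comp Complex.imCLM (g.smooth ⊤) n x
  simp only [e1, SchwartzMap.postcompCLM_apply, Complex.reCLM_apply] at hre
  simp only [e2, SchwartzMap.postcompCLM_apply, Complex.imCLM_apply] at him
  rw [decomp, decomp, hre, him]
  simp only [map_smul, smul_add, smul_comm Complex.I, ← Complex.coe_smul]
  congr 2 <;> simp

theorem locallyIntegrable_pow_smul (n : ℕ) (w : L2 F) :
    LocallyIntegrable (fun ξ : ℝ => (2 * Real.pi * Complex.I * ξ) ^ n • w ξ) volume := by
  have h := LocallyIntegrableOn.continuousOn_smul (g := fun ξ : ℝ =>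
    (2 * Real.pi * Complex.I * ξ) ^ n) isClosed_univ.isLocallyClosed
    ((locallyIntegrable_L2 w).locallyIntegrableOn Set.univ) (by fun_prop)
  exact locallyIntegrableOn_univ.1 h

/-- The Fourier transform of an `n`-th weak derivative. -/
theorem HasWeakDeriv.fourier {n : ℕ} {u v : L2 E} (h : HasWeakDeriv n u v) :
    (𝓕 (ι.compLp v : L2 F) : L2 F) =ᵐ[volume]
      fun ξ => (2 * Real.pi * Complex.I * ξ) ^ n • (𝓕 (ι.compLp u : L2 F) : L2 F) ξ := by
  refine fourier_L2_ae_eq _ (locallyIntegrable_pow_smul n _) fun g => ?_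
  have hgrowth : (fun ξ : ℝ => (-2 * Real.pi * Complex.I * ξ) ^ n).HasTemperateGrowth := by
    fun_prop
  set G : 𝓢(ℝ, ℂ) := SchwartzMap.smulLeftCLM ℂ (fun ξ : ℝ => (-2 * Real.pi * Complex.I * ξ) ^ n) g
  have hG : ∀ ξ, G ξ = (-2 * Real.pi * Complex.I * ξ) ^ n • g ξ := fun ξ =>
    SchwartzMap.smulLeftCLM_apply_apply hgrowth g ξ
  have hFG : 𝓕 G = iterDerivSchwartz n (𝓕 g) := by
    ext x
    have h1 := Real.iteratedDeriv_fourier (f := g) (N := ⊤) (n := n) (fun m _ => by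
      refine (g.integrable_pow_mul volume m).mono
        (by fun_prop) ?_
      filter_upwards with x
      simp) le_top
    rw [coe_iterDerivSchwartz, SchwartzMap.fourier_coe, SchwartzMap.fourier_coe, h1]
    rw [show (G : ℝ → ℂ) = _ from funext hG]
  have hw := h.integral_schwartz_complex ι (𝓕 g)
  have hv : ∫ x, 𝓕 g x • (ι.compLp v : L2 F) x = ∫ x, 𝓕 g x • ι (v x) := by
    refine integral_congr_ae ?_
    filter_upwards [ι.coeFn_compLp v] with x hx
    rw [hx]
  have hu : ∫ x, 𝓕 G x • (ι.compLp u : L2 F) x = ∫ x, 𝓕 G x • ι (u x) := by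
    refine integral_congr_ae ?_
    filter_upwards [ι.coeFn_compLp u] with x hx
    rw [hx]
  have hneg : ((-1 : ℂ) ^ n) * (-1 : ℂ) ^ n = 1 := by
    rw [← mul_pow]; simp
  calc ∫ x, 𝓕 g x • (ι.compLp v : L2 F) x
      = ((-1 : ℂ) ^ n) • ∫ x, 𝓕 G x • (ι.compLp u : L2 F) x := by
        rw [hu, hFG, hw, smul_smul, hneg, one_smul, hv]
    _ = ((-1 : ℂ) ^ n) • ∫ ξ, G ξ • (𝓕 (ι.compLp u : L2 F) : L2 F) ξ := by
        rw [integral_fourier_smul_L2]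
    _ = _ := by
        rw [← integral_smul]
        congr 1
        ext ξ
        rw [hG, smul_smul, smul_smul]
        congr 1
        rw [smul_eq_mul, show (-2 * (Real.pi : ℂ) * Complex.I * ξ)
          = (-1) * (2 * Real.pi * Complex.I * ξ) by ring, mul_pow, ← mul_assoc, ← mul_assoc, hneg]
        ring

/-- Conversely, the weak derivative is detected on the Fourier side. -/
theorem hasWeakDeriv_of_fourier (hι : Function.Injective ι) {n : ℕ} {u v : L2 E}
    (h : (𝓕 (ι.compLp v : L2 F) : L2 F) =ᵐ[volume]
      fun ξ => (2 * Real.pi * Complex.I * ξ) ^ n • (𝓕 (ι.compLp u : L2 F) : L2 F) ξ) :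
    HasWeakDeriv n u v := by
  intro φ hφ hφc
  have hΦc : HasCompactSupport (Complex.ofRealCLM ∘ φ) := hφc.comp_left rfl
  have hΦs : ContDiff ℝ ∞ (Complex.ofRealCLM ∘ φ) := by fun_prop
  set Φ : 𝓢(ℝ, ℂ) := hΦc.toSchwartzMap hΦs with hΦ
  have hΦx : ∀ x, Φ x = (φ x : ℂ) := fun x => rfl
  have hDΦ : ∀ x, iterDerivSchwartz n Φ x = ((iteratedDeriv n φ x : ℝ) : ℂ) := fun x => by
    rw [coe_iterDerivSchwartz]
    exact iteratedDeriv_clm_comp Complex.ofRealCLM hφ n x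
  have hinv : ∀ ξ, 𝓕⁻ (iterDerivSchwartz n Φ) ξ
      = (-1) ^ n * (2 * Real.pi * Complex.I * ξ) ^ n * 𝓕⁻ Φ ξ := by
    intro ξ
    have h1 := Real.fourier_iteratedDeriv (f := Φ) (N := ⊤) (n := n) (Φ.smooth ⊤)
      (fun m _ => by rw [← coe_iterDerivSchwartz]; exact SchwartzMap.integrable _) le_top
    rw [SchwartzMap.fourierInv_coe, SchwartzMap.fourierInv_coe, Real.fourierInv_eq_fourier_neg,
      Real.fourierInv_eq_fourier_neg, coe_iterDerivSchwartz, h1, ← mul_pow]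
    simp only [smul_eq_mul]
    congr 2
    push_cast; ring
  have cpl : ∀ (ψ : 𝓢(ℝ, ℂ)) (q : ℝ → ℝ) (w : L2 E), (∀ x, ψ x = (q x : ℂ)) →
      ι (∫ x, q x • w x) = ∫ ξ, 𝓕⁻ ψ ξ • (𝓕 (ι.compLp w : L2 F) : L2 F) ξ := by
    intro ψ q w hq
    have hinteg : Integrable (fun x => q x • w x) := by
      have := integrable_schwartz_smul_L2 (SchwartzMap.postcompCLM (𝕜 := ℝ) Complex.reCLM ψ) w
      refine this.congr ?_
      filter_upwards with x
      simp [SchwartzMap.postcompCLM_apply, hq]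
    rw [← integral_fourier_smul_L2, FourierTransform.fourier_fourierInv_eq,
      ← ι.integral_comp_comm hinteg]
    refine integral_congr_ae ?_
    filter_upwards [ι.coeFn_compLp w] with x hx
    rw [hx, hq, map_smul, Complex.coe_smul]
  apply hι
  rw [cpl (iterDerivSchwartz n Φ) _ u hDΦ, map_smul, cpl Φ _ v hΦx, ← integral_smul]
  refine integral_congr_ae ?_
  filter_upwards [h] with ξ hξ
  rw [hξ, hinv, ← Complex.coe_smul, smul_smul, smul_smul]
  congr 1
  push_cast
  ring

end Weak

end PSystem

namespace PSystem

open scoped SchwartzMap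

/-- `‖k ẑ‖₂`, which is `‖Dz‖₂`. -/
def fourierNormOne (z : L2 V) : ℝ≥0∞ :=
  eLpNorm (fun ξ => (2 * Real.pi * ξ) • fourierL2 z ξ) 2 volume

/-- `‖k² b̂‖₂`, which is `‖D²b‖₂`. -/
def fourierNormTwo (z : L2 V) : ℝ≥0∞ :=
  eLpNorm (fun ξ => (2 * Real.pi * ξ) ^ 2 • fourierL2 z ξ 1) 2 volume

theorem fourier_ofReal_compB (z : L2 V) :
    (𝓕 (Complex.ofRealCLM.compLp (compB z) : L2 ℂ) : L2 ℂ) =ᵐ[volume]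
      fun ξ => fourierL2 z ξ 1 := by
  have h := fourier_compLp (EuclideanSpace.proj (𝕜 := ℂ) (1 : Fin 2))
    (complexify.compLp z : L2 VC)
  have h2 : ((EuclideanSpace.proj (𝕜 := ℂ) (1 : Fin 2)).compLp (complexify.compLp z : L2 VC) :
      L2 ℂ) = Complex.ofRealCLM.compLp (compB z) := by
    ext1
    filter_upwards [(EuclideanSpace.proj (𝕜 := ℂ) (1 : Fin 2)).coeFn_compLp
      (complexify.compLp z : L2 VC), complexify.coeFn_compLp z,
      Complex.ofRealCLM.coeFn_compLp (compB z),
      (EuclideanSpace.proj (𝕜 := ℝ) (1 : Fin 2)).coeFn_compLp z] with x h1 h2 h3 h4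
    rw [h1, h2, h3, compB, h4]
    simp
  rw [h2] at h
  exact h

theorem norm_two_pi_I_mul (ξ : ℝ) : ‖(2 * Real.pi * Complex.I * ξ : ℂ)‖ = |2 * Real.pi * ξ| := by
  simp [abs_mul]

theorem enorm_L2_eq {E F : Type} [NormedAddCommGroup E] [NormedSpace ℝ E]
    [NormedAddCommGroup F] [InnerProductSpace ℂ F] [CompleteSpace F] (ι : E →L[ℝ] F)
    (hι : ∀ x, ‖ι x‖ = ‖x‖) (v : L2 E) :
    eLpNorm (𝓕 (ι.compLp v : L2 F) : L2 F) 2 volume = ‖v‖ₑ := by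
  rw [eLpNorm_coe_fourier, Lp.enorm_def, eLpNorm_congr_ae (ι.coeFn_compLp' v)]
  exact eLpNorm_congr_norm_ae (by simp [hι])

theorem injective_of_norm_eq {E F : Type} [NormedAddCommGroup E] [NormedSpace ℝ E]
    [NormedAddCommGroup F] [NormedSpace ℝ F] {ι : E →L[ℝ] F}
    (hι : ∀ x, ‖ι x‖ = ‖x‖) : Function.Injective ι := by
  intro x y hxy
  rw [← sub_eq_zero, ← norm_eq_zero, ← hι, map_sub, hxy, sub_self, norm_zero]

theorem HasWeakDeriv.enorm_eq {E F : Type} [NormedAddCommGroup E] [NormedSpace ℝ E]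
    [CompleteSpace E]
    [NormedAddCommGroup F] [InnerProductSpace ℂ F] [CompleteSpace F] (ι : E →L[ℝ] F)
    (hι : ∀ x, ‖ι x‖ = ‖x‖) {n : ℕ} {u v : L2 E} (h : HasWeakDeriv n u v) :
    ‖v‖ₑ = eLpNorm (fun ξ => (2 * Real.pi * ξ) ^ n • (𝓕 (ι.compLp u : L2 F) : L2 F) ξ) 2
      volume := by
  rw [← enorm_L2_eq ι hι, eLpNorm_congr_ae (h.fourier ι)]
  refine eLpNorm_congr_norm_ae ?_
  filter_upwards with ξ
  rw [norm_smul, norm_smul, norm_pow, norm_pow, norm_two_pi_I_mul, Real.norm_eq_abs]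

theorem derivNorm_eq {E F : Type} [NormedAddCommGroup E] [NormedSpace ℝ E] [CompleteSpace E]
    [NormedAddCommGroup F] [InnerProductSpace ℂ F] [CompleteSpace F] (ι : E →L[ℝ] F)
    (hι : ∀ x, ‖ι x‖ = ‖x‖) {n : ℕ} {u : L2 E}
    (hex : eLpNorm (fun ξ => (2 * Real.pi * ξ) ^ n • (𝓕 (ι.compLp u : L2 F) : L2 F) ξ) 2
      volume < ⊤ → ∃ v, HasWeakDeriv n u v) :
    derivNorm n u
      = eLpNorm (fun ξ => (2 * Real.pi * ξ) ^ n • (𝓕 (ι.compLp u : L2 F) : L2 F) ξ) 2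
      volume := by
  apply le_antisymm
  · rcases eq_or_ne (eLpNorm (fun ξ => (2 * Real.pi * ξ) ^ n •
      (𝓕 (ι.compLp u : L2 F) : L2 F) ξ) 2 volume) ⊤ with h | h
    · rw [h]; exact le_top
    · obtain ⟨v, hv⟩ := hex h.lt_top
      rw [← hv.enorm_eq ι hι]
      exact iInf₂_le v hv
  · exact le_iInf₂ fun v hv => (hv.enorm_eq ι hι).ge

theorem conjVC_two_pi_I_smul (n : ℕ) (ξ : ℝ) (v : VC) :
    conjVC ((2 * Real.pi * Complex.I * ξ) ^ n • v)
      = (2 * Real.pi * Complex.I * ((-ξ : ℝ) : ℂ)) ^ n • conjVC v := by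
  rw [conjVC_smul]
  congr 1
  rw [map_pow]
  congr 1
  simp [Complex.conj_ofReal, map_ofNat (starRingEnd ℂ) 2]

theorem exists_hasWeakDeriv_one {z : L2 V} (h : fourierNormOne z < ⊤) :
    ∃ v : L2 V, HasWeakDeriv 1 z v := by
  have hm : MemLp (fun ξ : ℝ => (2 * Real.pi * Complex.I * ξ) ^ 1 • fourierL2 z ξ) 2 := by
    refine ⟨(by fun_prop : Continuous fun ξ : ℝ =>
      (2 * Real.pi * Complex.I * ξ) ^ 1).aestronglyMeasurable.smul (Lp.aestronglyMeasurable _), ?_⟩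
    refine lt_of_le_of_lt (le_of_eq (eLpNorm_congr_norm_ae ?_)) h
    filter_upwards with ξ
    rw [norm_smul, norm_smul, pow_one, norm_two_pi_I_mul, Real.norm_eq_abs]
  obtain ⟨v, hv⟩ := exists_fourierL2_eq hm (by
    filter_upwards [fourierL2_neg z] with ξ hξ
    rw [hξ, conjVC_two_pi_I_smul])
  exact ⟨v, hasWeakDeriv_of_fourier complexify (injective_of_norm_eq norm_complexify) hv⟩

theorem exists_hasWeakDeriv_compB {z : L2 V} {n : ℕ}
    (h : eLpNorm (fun ξ => (2 * Real.pi * ξ) ^ n • fourierL2 z ξ 1) 2 volume < ⊤) :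
    ∃ v : L2 ℝ, HasWeakDeriv n (compB z) v := by
  let P : VC →L[ℂ] VC := (EuclideanSpace.proj (𝕜 := ℂ) (1 : Fin 2)).smulRight
    (EuclideanSpace.single (1 : Fin 2) (1 : ℂ))
  have hP : ∀ v : VC, P v = v 1 • EuclideanSpace.single (1 : Fin 2) (1 : ℂ) := fun v => rfl
  have hm : MemLp (fun ξ : ℝ => (2 * Real.pi * Complex.I * ξ) ^ n • P (fourierL2 z ξ)) 2 := by
    refine ⟨(by fun_prop : Continuous fun ξ : ℝ =>
      (2 * Real.pi * Complex.I * ξ) ^ n).aestronglyMeasurable.smul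
      (P.continuous.comp_aestronglyMeasurable (Lp.aestronglyMeasurable _)), ?_⟩
    refine lt_of_le_of_lt (le_of_eq (eLpNorm_congr_norm_ae ?_)) h
    filter_upwards with ξ
    rw [norm_smul, norm_smul, norm_pow, norm_pow, norm_two_pi_I_mul, Real.norm_eq_abs, hP,
      norm_smul]
    simp
  obtain ⟨w, hw⟩ := exists_fourierL2_eq hm (by
    filter_upwards [fourierL2_neg z] with ξ hξ
    rw [hξ, conjVC_two_pi_I_smul, hP, hP, conjVC_smul]
    congr 2
    ext i
    fin_cases i <;> simp)
  refine ⟨compB w, hasWeakDeriv_of_fourier Complex.ofRealCLM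
    (injective_of_norm_eq (by simp)) ?_⟩
  filter_upwards [fourier_ofReal_compB w, fourier_ofReal_compB z, hw] with ξ h1 h2 h3
  rw [h1, h2, h3, hP]
  simp

theorem derivNorm_one_eq (z : L2 V) : derivNorm 1 z = fourierNormOne z := by
  rw [derivNorm_eq complexify norm_complexify (fun h => exists_hasWeakDeriv_one (by
    simpa [fourierNormOne, fourierL2] using h))]
  simp [fourierNormOne, fourierL2]

theorem eLpNorm_pow_compB (z : L2 V) (n : ℕ) :
    eLpNorm (fun ξ => (2 * Real.pi * ξ) ^ n •
      (𝓕 (Complex.ofRealCLM.compLp (compB z) : L2 ℂ) : L2 ℂ) ξ) 2 volume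
      = eLpNorm (fun ξ => (2 * Real.pi * ξ) ^ n • fourierL2 z ξ 1) 2 volume := by
  refine eLpNorm_congr_ae ?_
  filter_upwards [fourier_ofReal_compB z] with ξ hξ
  rw [hξ]

theorem derivNorm_two_compB_eq (z : L2 V) : derivNorm 2 (compB z) = fourierNormTwo z := by
  rw [derivNorm_eq Complex.ofRealCLM (by simp) (fun h => exists_hasWeakDeriv_compB (by
    rwa [eLpNorm_pow_compB] at h)), eLpNorm_pow_compB, fourierNormTwo]

/-- The derivative `∂ₓb`. -/
def derivB (z : L2 V) : L2 ℝ := weakDeriv (compB z)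

theorem norm_apply_le (v : VC) (i : Fin 2) : ‖v i‖ ≤ ‖v‖ := PiLp.norm_apply_le v i

theorem eLpNorm_smul_apply_le (z : L2 V) :
    eLpNorm (fun ξ => (2 * Real.pi * ξ) • fourierL2 z ξ 1) 2 volume ≤ fourierNormOne z := by
  refine eLpNorm_mono fun ξ => ?_
  rw [norm_smul, norm_smul]
  gcongr
  exact norm_apply_le _ _

theorem hasWeakDeriv_derivB {z : L2 V} (h : fourierNormOne z < ⊤) :
    HasWeakDeriv 1 (compB z) (derivB z) := by
  have hex : ∃ v, HasWeakDeriv 1 (compB z) v := exists_hasWeakDeriv_compB (by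
    simpa using (eLpNorm_smul_apply_le z).trans_lt h)
  rw [derivB, weakDeriv, dif_pos hex]
  exact hex.choose_spec

theorem fourier_derivB {z : L2 V} (h : fourierNormOne z < ⊤) :
    (𝓕 (Complex.ofRealCLM.compLp (derivB z) : L2 ℂ) : L2 ℂ) =ᵐ[volume]
      fun ξ => (2 * Real.pi * Complex.I * ξ) • fourierL2 z ξ 1 := by
  filter_upwards [(hasWeakDeriv_derivB h).fourier Complex.ofRealCLM, fourier_ofReal_compB z]
    with ξ h1 h2
  rw [h1, h2, pow_one]

theorem enorm_derivB {z : L2 V} (h : fourierNormOne z < ⊤) :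
    ‖derivB z‖ₑ = eLpNorm (fun ξ => (2 * Real.pi * ξ) • fourierL2 z ξ 1) 2 volume := by
  rw [(hasWeakDeriv_derivB h).enorm_eq Complex.ofRealCLM (by simp), eLpNorm_pow_compB]
  simp

theorem derivB_sub {z w : L2 V} (hz : fourierNormOne z < ⊤) (hw : fourierNormOne w < ⊤)
    (hzw : fourierNormOne (z - w) < ⊤) : derivB (z - w) = derivB z - derivB w := by
  have h : (𝓕 (Complex.ofRealCLM.compLp (derivB (z - w)) : L2 ℂ) : L2 ℂ)
      = 𝓕 (Complex.ofRealCLM.compLp (derivB z - derivB w) : L2 ℂ) := by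
    have e : (Complex.ofRealCLM.compLp (derivB z - derivB w) : L2 ℂ)
        = Complex.ofRealCLM.compLp (derivB z) - Complex.ofRealCLM.compLp (derivB w) :=
      map_sub (Complex.ofRealCLM.compLpL 2 volume) _ _
    have e2 : (𝓕 (Complex.ofRealCLM.compLp (derivB z) - Complex.ofRealCLM.compLp (derivB w) :
      L2 ℂ) : L2 ℂ) = 𝓕 (Complex.ofRealCLM.compLp (derivB z) : L2 ℂ)
        - 𝓕 (Complex.ofRealCLM.compLp (derivB w) : L2 ℂ) :=
      map_sub (Lp.fourierTransformₗᵢ ℝ ℂ) _ _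
    rw [e, e2]
    ext1
    filter_upwards [fourier_derivB hz, fourier_derivB hw, fourier_derivB hzw,
      Lp.coeFn_sub (𝓕 (Complex.ofRealCLM.compLp (derivB z) : L2 ℂ) : L2 ℂ)
        (𝓕 (Complex.ofRealCLM.compLp (derivB w) : L2 ℂ)), fourierL2_sub_ae z w]
      with ξ h1 h2 h3 h4 h5
    rw [h4, Pi.sub_apply, h1, h2, h3, h5, ← smul_sub]
    simp
  have h2 := congrArg (fun u : L2 ℂ => 𝓕⁻ u) h
  simp only [FourierTransform.fourierInv_fourier_eq] at h2
  ext1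
  filter_upwards [Complex.ofRealCLM.coeFn_compLp (derivB (z - w)),
    Complex.ofRealCLM.coeFn_compLp (derivB z - derivB w)] with x h3 h4
  rw [h2, h4] at h3
  exact (Complex.ofReal_injective h3).symm

/-! ### Sobolev embedding and translations -/

section Sobolev

set_option linter.unusedSectionVars false

variable {F : Type} [NormedAddCommGroup F] [InnerProductSpace ℂ F] [CompleteSpace F]

theorem lintegral_inv_sq_add_sq {l : ℝ} (hl : 0 < l) :
    ∫⁻ ξ : ℝ, ENNReal.ofReal ((l ^ 2 + (2 * Real.pi * ξ) ^ 2)⁻¹) = ENNReal.ofReal (1 / (2 * l)) := by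
  have hpi := Real.pi_pos
  have h0 : ∀ ξ : ℝ, (l ^ 2 + (2 * Real.pi * ξ) ^ 2)⁻¹
      = l⁻¹ ^ 2 * (1 + ((2 * Real.pi / l) * ξ) ^ 2)⁻¹ := by
    intro ξ; field_simp
  have hinteg : Integrable fun ξ : ℝ => (l ^ 2 + (2 * Real.pi * ξ) ^ 2)⁻¹ := by
    simp only [h0]
    exact (integrable_inv_one_add_sq.comp_mul_left' (by positivity)).const_mul _
  rw [← ofReal_integral_eq_lintegral_ofReal hinteg (Eventually.of_forall fun ξ => by positivity)]
  congr 1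
  simp only [h0]
  rw [integral_const_mul,
    Measure.integral_comp_mul_left (fun x : ℝ => (1 + x ^ 2)⁻¹) (2 * Real.pi / l),
    integral_univ_inv_one_add_sq, abs_of_pos (by positivity), smul_eq_mul]
  field_simp

theorem lintegral_enorm_le_of_weighted {m : ℝ → F} (hm : AEStronglyMeasurable m volume)
    {A₀ A₁ l : ℝ} (hA₀ : 0 ≤ A₀) (hA₁ : 0 ≤ A₁) (hl : 0 < l)
    (h0 : eLpNorm m 2 volume ≤ ENNReal.ofReal A₀)
    (h1 : eLpNorm (fun ξ => (2 * Real.pi * ξ) • m ξ) 2 volume ≤ ENNReal.ofReal A₁) :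
    ∫⁻ ξ, ‖m ξ‖ₑ ≤ ENNReal.ofReal (√((l ^ 2 * A₀ ^ 2 + A₁ ^ 2) / (2 * l))) := by
  rw [eLpNorm_two_le_iff _ hA₀] at h0
  rw [eLpNorm_two_le_iff _ hA₁] at h1
  have hw : ∀ ξ : ℝ, 0 < l ^ 2 + (2 * Real.pi * ξ) ^ 2 := fun ξ => by positivity
  have hmeas : Measurable fun ξ : ℝ => √(l ^ 2 + (2 * Real.pi * ξ) ^ 2) := by fun_prop
  have hcs := lintegral_mul_sq_le (μ := volume)
    (f := fun ξ : ℝ => ENNReal.ofReal ((√(l ^ 2 + (2 * Real.pi * ξ) ^ 2))⁻¹))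
    (g := fun ξ : ℝ => ENNReal.ofReal (√(l ^ 2 + (2 * Real.pi * ξ) ^ 2)) * ‖m ξ‖ₑ)
    (by fun_prop) (by fun_prop)
  have e1 : ∀ ξ : ℝ, ENNReal.ofReal ((√(l ^ 2 + (2 * Real.pi * ξ) ^ 2))⁻¹) *
      (ENNReal.ofReal (√(l ^ 2 + (2 * Real.pi * ξ) ^ 2)) * ‖m ξ‖ₑ) = ‖m ξ‖ₑ := by
    intro ξ
    rw [← mul_assoc, ← ENNReal.ofReal_mul (by positivity), inv_mul_cancel₀, ENNReal.ofReal_one,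
      one_mul]
    exact (Real.sqrt_pos.2 (hw ξ)).ne'
  have e2 : ∀ ξ : ℝ, ENNReal.ofReal ((√(l ^ 2 + (2 * Real.pi * ξ) ^ 2))⁻¹) ^ 2
      = ENNReal.ofReal ((l ^ 2 + (2 * Real.pi * ξ) ^ 2)⁻¹) := by
    intro ξ
    rw [← ENNReal.ofReal_pow (by positivity), inv_pow, Real.sq_sqrt (hw ξ).le]
  have e3 : ∀ ξ : ℝ, (ENNReal.ofReal (√(l ^ 2 + (2 * Real.pi * ξ) ^ 2)) * ‖m ξ‖ₑ) ^ 2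
      = ENNReal.ofReal (l ^ 2) * ‖m ξ‖ₑ ^ 2 + ‖(2 * Real.pi * ξ) • m ξ‖ₑ ^ 2 := by
    intro ξ
    rw [mul_pow, ← ENNReal.ofReal_pow (by positivity), Real.sq_sqrt (hw ξ).le,
      ENNReal.ofReal_add (by positivity) (by positivity), add_mul, enorm_smul,
      mul_pow ‖(2 * Real.pi * ξ : ℝ)‖ₑ]
    congr 2
    rw [← ofReal_norm, ← ENNReal.ofReal_pow (norm_nonneg _), Real.norm_eq_abs, sq_abs]
  simp only [e1, e2, e3] at hcs
  rw [lintegral_inv_sq_add_sq hl, lintegral_add_left' (by fun_prop),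
    lintegral_const_mul'' _ (by fun_prop)] at hcs
  have h3 : (∫⁻ ξ, ‖m ξ‖ₑ) ^ 2 ≤ (ENNReal.ofReal (√((l ^ 2 * A₀ ^ 2 + A₁ ^ 2) / (2 * l)))) ^ 2 := by
    refine hcs.trans ?_
    rw [← ENNReal.ofReal_pow (by positivity), Real.sq_sqrt (by positivity)]
    calc _ ≤ ENNReal.ofReal (1 / (2 * l)) * (ENNReal.ofReal (l ^ 2) * ENNReal.ofReal (A₀ ^ 2)
          + ENNReal.ofReal (A₁ ^ 2)) := by gcongr
      _ = _ := by
        rw [← ENNReal.ofReal_mul (by positivity), ← ENNReal.ofReal_add (by positivity)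
          (by positivity), ← ENNReal.ofReal_mul (by positivity)]
        congr 1
        field_simp
  exact (ENNReal.pow_le_pow_left_iff two_ne_zero).1 h3

/-- Sobolev's inequality `‖u‖_∞² ≤ (λ²‖u‖₂² + ‖Du‖₂²) / (2λ)`. -/
theorem ae_norm_le_of_fourier {u : L2 F} {m : ℝ → F} (hm : (𝓕 u : L2 F) =ᵐ[volume] m)
    {A₀ A₁ l : ℝ} (hA₀ : 0 ≤ A₀) (hA₁ : 0 ≤ A₁) (hl : 0 < l)
    (h0 : eLpNorm m 2 volume ≤ ENNReal.ofReal A₀)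
    (h1 : eLpNorm (fun ξ => (2 * Real.pi * ξ) • m ξ) 2 volume ≤ ENNReal.ofReal A₁) :
    ∀ᵐ x, ‖u x‖ ≤ √((l ^ 2 * A₀ ^ 2 + A₁ ^ 2) / (2 * l)) := by
  have hmm : AEStronglyMeasurable m volume := (Lp.aestronglyMeasurable _).congr hm
  have h := lintegral_enorm_le_of_weighted hmm hA₀ hA₁ hl h0 h1
  have hinteg : Integrable m := ⟨hmm, h.trans_lt ENNReal.ofReal_lt_top⟩
  filter_upwards [ae_eq_fourierInv_of_fourier_ae_eq u hinteg hm] with x hx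
  rw [hx, Real.fourierInv_eq_fourier_neg]
  refine (VectorFourier.norm_fourierIntegral_le_integral_norm _ _ _ _ _).trans ?_
  rw [integral_norm_eq_lintegral_enorm hmm]
  exact ENNReal.toReal_le_of_le_ofReal (by positivity) h

/-- Translations of an `H¹` function: `‖u(· + a) - u‖₂ ≤ |a| ‖Du‖₂`. -/
theorem eLpNorm_translate_sub_le {u : L2 F} {m : ℝ → F} (hm : (𝓕 u : L2 F) =ᵐ[volume] m)
    (h1 : eLpNorm (fun ξ => (2 * Real.pi * ξ) • m ξ) 2 volume < ⊤) (a : ℝ) :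
    eLpNorm (fun x => u (x + a) - u x) 2 volume
      ≤ ‖a‖ₑ * eLpNorm (fun ξ => (2 * Real.pi * ξ) • m ξ) 2 volume := by
  have hmm : AEStronglyMeasurable m volume := (Lp.aestronglyMeasurable _).congr hm
  have hm2 : MemLp m 2 := (Lp.memLp (𝓕 u : L2 F)).ae_eq hm
  have h := lintegral_enorm_le_of_weighted hmm ENNReal.toReal_nonneg ENNReal.toReal_nonneg
    one_pos (ENNReal.ofReal_toReal hm2.2.ne).ge (ENNReal.ofReal_toReal h1.ne).ge
  have hinteg : Integrable m := ⟨hmm, h.trans_lt ENNReal.ofReal_lt_top⟩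
  have hu := ae_eq_fourierInv_of_fourier_ae_eq u hinteg hm
  have hu' := (measurePreserving_add_right volume a).quasiMeasurePreserving.ae hu
  have hcont : Continuous fun ξ : ℝ => (Real.fourierChar (a * ξ) : ℂ) - 1 := by
    fun_prop
  set q : ℝ → F := fun ξ => ((Real.fourierChar (a * ξ) : ℂ) - 1) • m ξ with hq
  have hbd : ∀ ξ : ℝ, ‖(Real.fourierChar (a * ξ) : ℂ) - 1‖ ≤ 2 := fun ξ =>
    (norm_sub_le _ _).trans (by rw [Circle.norm_coe, norm_one]; norm_num)
  have hbd2 : ∀ ξ : ℝ, ‖(Real.fourierChar (a * ξ) : ℂ) - 1‖ ≤ |a| * |2 * Real.pi * ξ| := by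
    intro ξ
    rw [Real.fourierChar_apply, mul_comm _ Complex.I]
    refine (Real.norm_exp_I_mul_ofReal_sub_one_le).trans ?_
    rw [Real.norm_eq_abs, ← abs_mul]
    apply le_of_eq; congr 1; ring
  have hqint : Integrable q := by
    refine (hinteg.norm.const_mul 2).mono' (hcont.aestronglyMeasurable.smul hmm) ?_
    filter_upwards with ξ
    rw [hq, norm_smul]; gcongr; exact hbd ξ
  have hq2 : MemLp q 2 := by
    refine (hm2.norm.const_mul 2).mono' (hcont.aestronglyMeasurable.smul hmm) ?_
    filter_upwards with ξ
    rw [hq, norm_smul]; gcongr; exact hbd ξ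
  have e : (fun x => u (x + a) - u x) =ᵐ[volume] 𝓕⁻ q := by
    filter_upwards [hu, hu'] with x h1 h2
    rw [h1, h2, Real.fourierInv_eq, Real.fourierInv_eq, Real.fourierInv_eq, ← integral_sub]
    · congr 1
      ext ξ
      simp only [hq, Circle.smul_def, smul_smul, ← sub_smul]
      congr 1
      rw [inner_add_right, AddChar.map_add_eq_mul]
      simp only [Circle.coe_mul, RCLike.inner_apply, conj_trivial]
      ring
    · have := (Real.fourierIntegral_convergent_iff (μ := volume) (f := m) (-(x + a))).2 hinteg
      simpa only [inner_neg_right, neg_neg] using this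
    · have := (Real.fourierIntegral_convergent_iff (μ := volume) (f := m) (-x)).2 hinteg
      simpa using this
  rw [eLpNorm_congr_ae e, eLpNorm_fourierInv_eq hqint hq2, ← enorm_norm a]
  have e3 : ‖‖a‖‖ₑ * eLpNorm (fun ξ => (2 * Real.pi * ξ) • m ξ) 2 volume
      = eLpNorm (‖a‖ • fun ξ => (2 * Real.pi * ξ) • m ξ) 2 volume := by
    rw [eLpNorm_const_smul]
  rw [e3]
  refine eLpNorm_mono fun ξ => ?_
  simp only [hq, Pi.smul_apply, norm_smul, Real.norm_eq_abs]
  rw [← mul_assoc, abs_abs]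
  gcongr
  exact hbd2 ξ

end Sobolev

end PSystem

namespace PSystem

/-! ### Energy estimates at a fixed wave number -/

/-- Gronwall's inequality in integral form. -/
theorem le_of_deriv_le_neg_mul_add {E E' r : ℝ → ℝ} {κ : ℝ} (hE : ∀ t, HasDerivAt E (E' t) t)
    (hr : Continuous r) (h : ∀ t, E' t ≤ -κ * E t + r t) {t₀ t : ℝ} (ht : t₀ ≤ t) :
    E t ≤ Real.exp (-κ * (t - t₀)) * E t₀
      + ∫ s in t₀..t, Real.exp (-κ * (t - s)) * r s := by
  have hexp : ∀ s, HasDerivAt (fun s => Real.exp (κ * s)) (Real.exp (κ * s) * κ) s := fun s => by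
    simpa using ((hasDerivAt_id s).const_mul κ).exp
  have hcont : Continuous fun s => Real.exp (κ * s) * r s := by fun_prop
  set Φ : ℝ → ℝ := fun s => Real.exp (κ * s) * E s - ∫ u in t₀..s, Real.exp (κ * u) * r u with hΦ
  have hderiv : ∀ s, HasDerivAt Φ
      ((Real.exp (κ * s) * κ) * E s + Real.exp (κ * s) * E' s - Real.exp (κ * s) * r s) s :=
    fun s => ((hexp s).mul (hE s)).sub (intervalIntegral.integral_hasDerivAt_right
      (hcont.intervalIntegrable _ _) hcont.stronglyMeasurable.stronglyMeasurableAtFilter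
      hcont.continuousAt)
  have hanti : Antitone Φ := antitone_of_hasDerivAt_nonpos hderiv fun s => by
    have := h s
    have hp := Real.exp_pos (κ * s)
    change _ ≤ (0 : ℝ)
    nlinarith
  have h1 := hanti ht
  simp only [hΦ, intervalIntegral.integral_same, sub_zero] at h1
  have e1 : ∫ s in t₀..t, Real.exp (-κ * (t - s)) * r s
      = Real.exp (-κ * t) * ∫ s in t₀..t, Real.exp (κ * s) * r s := by
    rw [← intervalIntegral.integral_const_mul]
    congr 1; ext s
    rw [← mul_assoc, ← Real.exp_add]; congr 2; ring
  have e2 : Real.exp (-κ * (t - t₀)) = Real.exp (-κ * t) * Real.exp (κ * t₀) := by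
    rw [← Real.exp_add]; congr 1; ring
  have e3 : E t = Real.exp (-κ * t) * (Real.exp (κ * t) * E t) := by
    rw [← mul_assoc, ← Real.exp_add]; simp
  rw [e1, e2, e3, mul_assoc, ← mul_add]
  exact mul_le_mul_of_nonneg_left (by linarith) (Real.exp_pos _).le

/-- `(α, β)` solves the forced linear system `α' = ikβ`, `β' = ikα - 2k²β + ikη`. -/
structure IsFlow (k : ℝ) (η α β : ℝ → ℂ) : Prop where
  left : ∀ t, HasDerivAt α (Complex.I * k * β t) t
  right : ∀ t, HasDerivAt β (Complex.I * k * α t - 2 * (k : ℂ) ^ 2 * β t + Complex.I * k * η t) t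

namespace IsFlow

variable {k : ℝ} {η α β : ℝ → ℂ}

theorem sub {η' α' β' : ℝ → ℂ} (h : IsFlow k η α β) (h' : IsFlow k η' α' β') :
    IsFlow k (fun t => η t - η' t) (fun t => α t - α' t) (fun t => β t - β' t) where
  left t := ((h.left t).sub (h'.left t)).congr_deriv (by ring)
  right t := ((h.right t).sub (h'.right t)).congr_deriv (by ring)

theorem shift (h : IsFlow k η α β) (δ : ℝ) :
    IsFlow k (fun t => η (t + δ)) (fun t => α (t + δ)) (fun t => β (t + δ)) where
  left t := (h.left (t + δ)).comp_add_const t δ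
  right t := (h.right (t + δ)).comp_add_const t δ

theorem hasDerivAt_re {u : ℝ → ℂ} {u' : ℂ} {t : ℝ} (h : HasDerivAt u u' t) :
    HasDerivAt (fun s => (u s).re) u'.re t := Complex.reCLM.hasFDerivAt.comp_hasDerivAt t h

theorem hasDerivAt_im {u : ℝ → ℂ} {u' : ℂ} {t : ℝ} (h : HasDerivAt u u' t) :
    HasDerivAt (fun s => (u s).im) u'.im t := Complex.imCLM.hasFDerivAt.comp_hasDerivAt t h

theorem norm_sq_eq (w : ℂ) : ‖w‖ ^ 2 = w.re ^ 2 + w.im ^ 2 := by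
  rw [← Complex.normSq_eq_norm_sq, Complex.normSq_apply]; ring

theorem components (h : IsFlow k η α β) (t : ℝ) :
    HasDerivAt (fun s => (α s).re) (-(k * (β t).im)) t ∧
    HasDerivAt (fun s => (α s).im) (k * (β t).re) t ∧
    HasDerivAt (fun s => (β s).re)
      (-(k * (α t).im) - 2 * k ^ 2 * (β t).re - k * (η t).im) t ∧
    HasDerivAt (fun s => (β s).im)
      (k * (α t).re - 2 * k ^ 2 * (β t).im + k * (η t).re) t := by
  have hk : ((k : ℂ) ^ 2).re = k ^ 2 ∧ ((k : ℂ) ^ 2).im = 0 := by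
    rw [← Complex.ofReal_pow]
    exact ⟨Complex.ofReal_re _, Complex.ofReal_im _⟩
  refine ⟨(hasDerivAt_re (h.left t)).congr_deriv ?_, (hasDerivAt_im (h.left t)).congr_deriv ?_,
    (hasDerivAt_re (h.right t)).congr_deriv ?_, (hasDerivAt_im (h.right t)).congr_deriv ?_⟩ <;>
  (simp [hk.1, hk.2]; try ring)

theorem hasDerivAt_energy (h : IsFlow k η α β) (c t : ℝ) :
    HasDerivAt (fun s => ‖α s‖ ^ 2 + ‖β s‖ ^ 2
        - c * ((α s).re * (β s).im - (α s).im * (β s).re))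
      (-4 * k ^ 2 * ((β t).re ^ 2 + (β t).im ^ 2)
        + 2 * k * ((β t).im * (η t).re - (β t).re * (η t).im)
        - c * (k * ((α t).re ^ 2 + (α t).im ^ 2) - k * ((β t).re ^ 2 + (β t).im ^ 2)
          - 2 * k ^ 2 * ((α t).re * (β t).im - (α t).im * (β t).re)
          + k * ((α t).re * (η t).re + (α t).im * (η t).im))) t := by
  obtain ⟨h1, h2, h3, h4⟩ := h.components t
  simp only [norm_sq_eq]
  refine (((((h1.pow 2).add (h2.pow 2)).add ((h3.pow 2).add (h4.pow 2))).sub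
    (((h1.mul h4).sub (h2.mul h3)).const_mul c))).congr_deriv ?_
  simp
  ring

/-- The basic energy inequality. -/
theorem energy_le (h : IsFlow k η α β) (hη : Continuous η) (hβ : Continuous β) {t₀ t : ℝ}
    (ht : t₀ ≤ t) :
    ‖α t‖ ^ 2 + ‖β t‖ ^ 2 + ∫ s in t₀..t, k ^ 2 * ‖β s‖ ^ 2
      ≤ ‖α t₀‖ ^ 2 + ‖β t₀‖ ^ 2 + ∫ s in t₀..t, ‖η s‖ ^ 2 := by
  have hc1 : Continuous fun s => ‖η s‖ ^ 2 := by fun_prop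
  have hc2 : Continuous fun s => k ^ 2 * ‖β s‖ ^ 2 := by fun_prop
  have key := le_of_deriv_le_neg_mul_add (κ := 0) (r := fun s => ‖η s‖ ^ 2 - k ^ 2 * ‖β s‖ ^ 2)
    (fun t => h.hasDerivAt_energy 0 t) (hc1.sub hc2) (fun t => by
      simp only [norm_sq_eq]
      nlinarith [sq_nonneg (k * (β t).im - (η t).re), sq_nonneg (k * (β t).re + (η t).im),
        sq_nonneg (k * (β t).re), sq_nonneg (k * (β t).im)]) ht
  simp only [neg_zero, zero_mul, Real.exp_zero, one_mul, sub_zero] at key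
  rw [intervalIntegral.integral_sub (hc1.intervalIntegrable _ _) (hc2.intervalIntegrable _ _)]
    at key
  linarith

theorem abs_cross_le (a b c d : ℝ) : |a * d - b * c| ≤ (a ^ 2 + b ^ 2 + (c ^ 2 + d ^ 2)) / 2 := by
  rw [abs_le]
  constructor <;> nlinarith [sq_nonneg (a - d), sq_nonneg (a + d), sq_nonneg (b - c),
    sq_nonneg (b + c)]

/-- Exponential decay at high frequency. -/
theorem decay_high (h : IsFlow k η α β) (hη : Continuous η) (hk : 1 ≤ |k|) {t₀ t : ℝ}
    (ht : t₀ ≤ t) :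
    ‖α t‖ ^ 2 + ‖β t‖ ^ 2 ≤ 3 * Real.exp (-(t - t₀) / 6) * (‖α t₀‖ ^ 2 + ‖β t₀‖ ^ 2)
      + 6 * ∫ s in t₀..t, Real.exp (-(t - s) / 6) * ‖η s‖ ^ 2 := by
  have hk0 : k ≠ 0 := by rintro rfl; simp at hk; linarith
  have hk2 : 1 ≤ k ^ 2 := by rw [← sq_abs]; nlinarith [abs_nonneg k]
  have hinv : |k⁻¹| ≤ 1 := by rw [abs_inv]; exact inv_le_one_of_one_le₀ hk
  have hcross : ∀ s, |k⁻¹ * ((α s).re * (β s).im - (α s).im * (β s).re)|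
      ≤ (‖α s‖ ^ 2 + ‖β s‖ ^ 2) / 2 := by
    intro s
    rw [abs_mul, norm_sq_eq, norm_sq_eq]
    calc _ ≤ 1 * |(α s).re * (β s).im - (α s).im * (β s).re| := by gcongr
      _ ≤ _ := by rw [one_mul]; exact abs_cross_le _ _ _ _
  have hc : Continuous fun s => 3 * ‖η s‖ ^ 2 := by fun_prop
  have key := le_of_deriv_le_neg_mul_add (κ := 1 / 6) (r := fun s => 3 * ‖η s‖ ^ 2)
    (fun t => h.hasDerivAt_energy k⁻¹ t) hc (fun t => by
      have hx := (abs_le.1 (hcross t)).1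
      simp only [norm_sq_eq] at hx ⊢
      set a := (α t).re; set b := (α t).im; set c := (β t).re; set d := (β t).im
      set p := (η t).re; set q := (η t).im
      have e : k⁻¹ * (k * (a ^ 2 + b ^ 2) - k * (c ^ 2 + d ^ 2) - 2 * k ^ 2 * (a * d - b * c)
          + k * (a * p + b * q))
          = (a ^ 2 + b ^ 2) - (c ^ 2 + d ^ 2) - 2 * k * (a * d - b * c) + (a * p + b * q) := by
        field_simp
      rw [e]
      have hkc : c ^ 2 + d ^ 2 ≤ k ^ 2 * (c ^ 2 + d ^ 2) := by
        nlinarith [sq_nonneg c, sq_nonneg d]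
      nlinarith [sq_nonneg (a - 2 * k * d), sq_nonneg (b + 2 * k * c),
        sq_nonneg (k * d - 2 * p), sq_nonneg (k * c + 2 * q), sq_nonneg (a + 2 * p),
        sq_nonneg (b + 2 * q), hx, hkc]) ht
  have h1 := (abs_le.1 (hcross t)).2
  have h2 := (abs_le.1 (hcross t₀)).1
  have e1 : -(1 / 6 : ℝ) * (t - t₀) = -(t - t₀) / 6 := by ring
  have e2 : ∫ s in t₀..t, Real.exp (-(1 / 6) * (t - s)) * (3 * ‖η s‖ ^ 2)
      = 3 * ∫ s in t₀..t, Real.exp (-(t - s) / 6) * ‖η s‖ ^ 2 := by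
    rw [← intervalIntegral.integral_const_mul]
    congr 1; ext s
    rw [show -(1 / 6 : ℝ) * (t - s) = -(t - s) / 6 by ring]; ring
  rw [e1, e2] at key
  have hpos := Real.exp_pos (-(t - t₀) / 6)
  nlinarith

/-- Parabolic decay at low frequency. -/
theorem decay_low (h : IsFlow k (fun _ => 0) α β) (hk : |k| ≤ 1) {t₀ t : ℝ} (ht : t₀ ≤ t) :
    ‖α t‖ ^ 2 + ‖β t‖ ^ 2
      ≤ 3 * Real.exp (-(k ^ 2 * (t - t₀)) / 3) * (‖α t₀‖ ^ 2 + ‖β t₀‖ ^ 2) := by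
  have hk2 : k ^ 2 ≤ 1 := by rw [← sq_abs]; nlinarith [abs_nonneg k]
  have hcross : ∀ s, |k * ((α s).re * (β s).im - (α s).im * (β s).re)|
      ≤ (‖α s‖ ^ 2 + ‖β s‖ ^ 2) / 2 := by
    intro s
    rw [abs_mul, norm_sq_eq, norm_sq_eq]
    calc _ ≤ 1 * |(α s).re * (β s).im - (α s).im * (β s).re| := by gcongr
      _ ≤ _ := by rw [one_mul]; exact abs_cross_le _ _ _ _
  have key := le_of_deriv_le_neg_mul_add (κ := k ^ 2 / 3) (r := fun _ => 0)
    (fun t => h.hasDerivAt_energy k t) continuous_const (fun t => by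
      have hx := (abs_le.1 (hcross t)).1
      simp only [norm_sq_eq] at hx ⊢
      set a := (α t).re; set b := (α t).im; set c := (β t).re; set d := (β t).im
      simp only [Complex.zero_re, Complex.zero_im, mul_zero, add_zero, sub_zero]
      have hy : 2 * k * (a * d - b * c) ≤ (a ^ 2 + b ^ 2) / 2 + 2 * (c ^ 2 + d ^ 2) := by
        have h1 : 2 * (k * a) * d ≤ (k * a) ^ 2 / 2 + 2 * d ^ 2 := by
          nlinarith [sq_nonneg (k * a - 2 * d)]
        have h2 : -(2 * (k * b) * c) ≤ (k * b) ^ 2 / 2 + 2 * c ^ 2 := by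
          nlinarith [sq_nonneg (k * b + 2 * c)]
        nlinarith [sq_nonneg a, sq_nonneg b]
      have hk0 := sq_nonneg k
      nlinarith [mul_le_mul_of_nonneg_left hy hk0, mul_le_mul_of_nonneg_left hx hk0,
        mul_nonneg hk0 (sq_nonneg a), mul_nonneg hk0 (sq_nonneg b),
        mul_nonneg hk0 (sq_nonneg c), mul_nonneg hk0 (sq_nonneg d)]) ht
  have h1 := (abs_le.1 (hcross t)).2
  have h2 := (abs_le.1 (hcross t₀)).1
  simp only [mul_zero, intervalIntegral.integral_zero, add_zero] at key
  rw [show -(k ^ 2 / 3) * (t - t₀) = -(k ^ 2 * (t - t₀)) / 3 by ring] at key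
  have hpos := Real.exp_pos (-(k ^ 2 * (t - t₀)) / 3)
  nlinarith

end IsFlow

end PSystem

namespace PSystem

/-! ### The semigroup and Duhamel's formula at a fixed wave number -/

section Semigroup

open scoped Matrix.Norms.Operator

theorem continuous_semigroup : Continuous fun p : ℝ × ℝ => semigroup p.1 p.2 := by
  unfold semigroup
  refine (NormedSpace.exp_continuous (𝔸 := Matrix (Fin 2) (Fin 2) ℂ)).comp ?_
  have h1 : Continuous fun p : ℝ × ℝ => (p.2 : ℂ) := by fun_prop
  have h2 : Continuous fun p : ℝ × ℝ => symbol p.1 := by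
    refine continuous_matrix fun i j => ?_
    fin_cases i <;> fin_cases j <;> simp [symbol] <;> fun_prop
  exact h1.smul h2

theorem semigroup_zero (k : ℝ) : semigroup k 0 = 1 := by
  simp [semigroup]

theorem semigroup_add (k s t : ℝ) : semigroup k (s + t) = semigroup k s * semigroup k t := by
  rw [semigroup, semigroup, semigroup, Complex.ofReal_add, add_smul,
    Matrix.exp_add_of_commute]
  exact (Commute.refl (symbol k)).smul_left _ |>.smul_right _

theorem hasDerivAt_semigroup (k t : ℝ) :
    HasDerivAt (fun s => semigroup k s) (symbol k * semigroup k t) t := by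
  have h := hasDerivAt_exp_smul_const' (𝕂 := ℂ) (symbol k) (t : ℂ)
  have h2 := h.scomp t (Complex.ofRealCLM.hasDerivAt (x := t))
  rw [Complex.ofRealCLM_apply, Complex.ofReal_one, one_smul] at h2
  exact h2

theorem hasDerivAt_semigroup_apply (k t : ℝ) (i j : Fin 2) :
    HasDerivAt (fun s => semigroup k s i j) ((symbol k * semigroup k t) i j) t := by
  have h := hasDerivAt_semigroup k t
  have hL : Continuous (fun M : Matrix (Fin 2) (Fin 2) ℂ => M i j) := by fun_prop
  let L : Matrix (Fin 2) (Fin 2) ℂ →L[ℝ] ℂ :=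
    ⟨{ toFun := fun M => M i j, map_add' := fun _ _ => rfl, map_smul' := fun _ _ => rfl }, hL⟩
  exact L.hasFDerivAt.comp_hasDerivAt t h

theorem semigroup_neg_apply (k t : ℝ) (i j : Fin 2) :
    semigroup (-k) t i j = (starRingEnd ℂ) (semigroup k t i j) := by
  let Φ : Matrix (Fin 2) (Fin 2) ℂ →+* Matrix (Fin 2) (Fin 2) ℂ := (starRingEnd ℂ).mapMatrix
  have hΦ : Continuous Φ := by
    refine continuous_matrix fun i j => ?_
    simp only [Φ, RingHom.mapMatrix_apply, Matrix.map_apply]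
    exact Complex.continuous_conj.comp (by fun_prop)
  have h := NormedSpace.map_exp Φ hΦ ((t : ℂ) • symbol k)
  have h2 : Φ ((t : ℂ) • symbol k) = (t : ℂ) • symbol (-k) := by
    ext i j
    fin_cases i <;> fin_cases j <;>
      simp [Φ, symbol, Complex.conj_ofReal, map_ofNat (starRingEnd ℂ) 2]
  rw [h2] at h
  exact (congrFun (congrFun h i) j).symm

end Semigroup

theorem continuous_semigroup_apply (i j : Fin 2) :
    Continuous fun p : ℝ × ℝ => semigroup p.1 p.2 i j :=
  (continuous_apply_apply i j).comp continuous_semigroup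

/-- The Duhamel integral of the forcing `(0, ikη)` for the data `Z₀`. -/
def duhamel (Z₀ : ℝ → VC) (η : ℝ → ℝ → ℂ) (t ξ : ℝ) : VC :=
  WithLp.toLp 2 fun i => (semigroup (2 * Real.pi * ξ) t).mulVec (fun j => Z₀ ξ j) i +
    ∫ s in (0 : ℝ)..t, (semigroup (2 * Real.pi * ξ) (t - s)).mulVec
      ![0, Complex.I * ((2 * Real.pi * ξ : ℝ) : ℂ) * η s ξ] i

/-- The integral that remains when the semigroup is factored out of Duhamel's formula. -/
def duhamelAux (η : ℝ → ℝ → ℂ) (t ξ : ℝ) (j : Fin 2) : ℂ :=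
  ∫ s in (0 : ℝ)..t, semigroup (2 * Real.pi * ξ) (-s) j 1 *
    (Complex.I * ((2 * Real.pi * ξ : ℝ) : ℂ) * η s ξ)

theorem duhamel_apply (Z₀ : ℝ → VC) {η : ℝ → ℝ → ℂ} (hη : Continuous (Function.uncurry η))
    (t ξ : ℝ) (i : Fin 2) :
    duhamel Z₀ η t ξ i = ∑ j, semigroup (2 * Real.pi * ξ) t i j * (Z₀ ξ j + duhamelAux η t ξ j) := by
  have hηξ : Continuous fun s => η s ξ :=
    hη.comp (by fun_prop : Continuous fun s : ℝ => (s, ξ))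
  have hS : ∀ j, Continuous fun s : ℝ => semigroup (2 * Real.pi * ξ) (-s) j 1 := fun j =>
    (continuous_semigroup_apply j 1).comp (by fun_prop : Continuous fun s : ℝ =>
      ((2 * Real.pi * ξ, -s) : ℝ × ℝ))
  have hinteg : ∀ j, IntervalIntegrable (fun s => semigroup (2 * Real.pi * ξ) (-s) j 1 *
    (Complex.I * ((2 * Real.pi * ξ : ℝ) : ℂ) * η s ξ)) volume 0 t := fun j =>
    ((hS j).mul (continuous_const.mul hηξ)).intervalIntegrable _ _
  have e : ∀ s, (semigroup (2 * Real.pi * ξ) (t - s)).mulVec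
      ![0, Complex.I * ((2 * Real.pi * ξ : ℝ) : ℂ) * η s ξ] i
      = ∑ j, semigroup (2 * Real.pi * ξ) t i j * (semigroup (2 * Real.pi * ξ) (-s) j 1 *
        (Complex.I * ((2 * Real.pi * ξ : ℝ) : ℂ) * η s ξ)) := by
    intro s
    rw [sub_eq_add_neg, semigroup_add]
    simp only [Matrix.mulVec, dotProduct, Fin.sum_univ_two, Matrix.mul_apply, Matrix.cons_val_zero,
      Matrix.cons_val_one]
    ring
  simp only [duhamel, e]
  rw [intervalIntegral.integral_finsetSum fun j _ => (hinteg j).const_mul _]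
  simp only [intervalIntegral.integral_const_mul, ← Finset.sum_add_distrib, Matrix.mulVec,
    dotProduct, mul_add, duhamelAux]

theorem continuous_duhamelAux {η : ℝ → ℝ → ℂ} (hη : Continuous (Function.uncurry η)) (j : Fin 2) :
    Continuous fun p : ℝ × ℝ => duhamelAux η p.1 p.2 j := by
  have hS : Continuous fun q : (ℝ × ℝ) × ℝ => semigroup (2 * Real.pi * q.1.2) (-q.2) j 1 :=
    (continuous_semigroup_apply j 1).comp (by fun_prop : Continuous fun q : (ℝ × ℝ) × ℝ =>
      ((2 * Real.pi * q.1.2, -q.2) : ℝ × ℝ))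
  have hη' : Continuous fun q : (ℝ × ℝ) × ℝ => η q.2 q.1.2 :=
    hη.comp (by fun_prop : Continuous fun q : (ℝ × ℝ) × ℝ => ((q.2, q.1.2) : ℝ × ℝ))
  have hF : Continuous (Function.uncurry fun (p : ℝ × ℝ) (s : ℝ) =>
      semigroup (2 * Real.pi * p.2) (-s) j 1 *
      (Complex.I * ((2 * Real.pi * p.2 : ℝ) : ℂ) * η s p.2)) := by
    refine hS.mul (Continuous.mul ?_ hη')
    fun_prop
  exact intervalIntegral.continuous_parametric_intervalIntegral_of_continuous hF continuous_fst

theorem measurable_duhamel {Z₀ : ℝ → VC} (hZ : Measurable Z₀) {η : ℝ → ℝ → ℂ}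
    (hη : Continuous (Function.uncurry η)) :
    Measurable fun p : ℝ × ℝ => duhamel Z₀ η p.1 p.2 := by
  have h : ∀ i, Measurable fun p : ℝ × ℝ => duhamel Z₀ η p.1 p.2 i := by
    intro i
    simp only [duhamel_apply Z₀ hη]
    refine Finset.measurable_sum _ fun j _ => ?_
    have h1 : Continuous fun p : ℝ × ℝ => semigroup (2 * Real.pi * p.2) p.1 i j :=
      (continuous_semigroup_apply i j).comp (by fun_prop : Continuous fun q : ℝ × ℝ =>
      ((2 * Real.pi * q.2, q.1) : ℝ × ℝ))
    have h2 : Measurable fun p : ℝ × ℝ => Z₀ p.2 j := by fun_prop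
    exact h1.measurable.mul (h2.add (continuous_duhamelAux hη j).measurable)
  exact (MeasurableEquiv.toLp 2 (Fin 2 → ℂ)).measurable.comp (measurable_pi_iff.2 h)

theorem continuous_duhamel {Z₀ : ℝ → VC} (hZ : Continuous Z₀) {η : ℝ → ℝ → ℂ}
    (hη : Continuous (Function.uncurry η)) :
    Continuous fun p : ℝ × ℝ => duhamel Z₀ η p.1 p.2 := by
  have h : ∀ i, Continuous fun p : ℝ × ℝ => duhamel Z₀ η p.1 p.2 i := by
    intro i
    simp only [duhamel_apply Z₀ hη]
    refine continuous_finsetSum _ fun j _ => ?_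
    have h1 : Continuous fun p : ℝ × ℝ => semigroup (2 * Real.pi * p.2) p.1 i j :=
      (continuous_semigroup_apply i j).comp (by fun_prop : Continuous fun q : ℝ × ℝ =>
      ((2 * Real.pi * q.2, q.1) : ℝ × ℝ))
    have h2 : Continuous fun p : ℝ × ℝ => Z₀ p.2 j := by fun_prop
    exact h1.mul (h2.add (continuous_duhamelAux hη j))
  exact (PiLp.continuous_toLp 2 _).comp (continuous_pi h)

theorem hasDerivAt_duhamel (Z₀ : ℝ → VC) {η : ℝ → ℝ → ℂ} (hη : Continuous (Function.uncurry η))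
    (t ξ : ℝ) (i : Fin 2) :
    HasDerivAt (fun s => duhamel Z₀ η s ξ i)
      ((symbol (2 * Real.pi * ξ)).mulVec (fun j => duhamel Z₀ η t ξ j) i
        + ![0, Complex.I * ((2 * Real.pi * ξ : ℝ) : ℂ) * η t ξ] i) t := by
  have hηξ : Continuous fun s => η s ξ :=
    hη.comp (by fun_prop : Continuous fun s : ℝ => (s, ξ))
  have hS : ∀ j, Continuous fun s : ℝ => semigroup (2 * Real.pi * ξ) (-s) j 1 := fun j =>
    (continuous_semigroup_apply j 1).comp (by fun_prop : Continuous fun s : ℝ =>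
      ((2 * Real.pi * ξ, -s) : ℝ × ℝ))
  have hcont : ∀ j, Continuous (fun s => semigroup (2 * Real.pi * ξ) (-s) j 1 *
    (Complex.I * ((2 * Real.pi * ξ : ℝ) : ℂ) * η s ξ)) := fun j =>
    (hS j).mul (continuous_const.mul hηξ)
  have hA : ∀ j, HasDerivAt (fun s => Z₀ ξ j + duhamelAux η s ξ j)
      (semigroup (2 * Real.pi * ξ) (-t) j 1 *
    (Complex.I * ((2 * Real.pi * ξ : ℝ) : ℂ) * η t ξ)) t := fun j =>
    (intervalIntegral.integral_hasDerivAt_right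
      ((hcont j).intervalIntegrable _ _) (hcont j).stronglyMeasurable.stronglyMeasurableAtFilter
      (hcont j).continuousAt).const_add _
  have hsum := HasDerivAt.fun_sum (u := Finset.univ) fun j _ =>
    (hasDerivAt_semigroup_apply (2 * Real.pi * ξ) t i j).mul (hA j)
  simp only [duhamel_apply Z₀ hη]
  refine hsum.congr_deriv ?_
  have hone : semigroup (2 * Real.pi * ξ) t * semigroup (2 * Real.pi * ξ) (-t) = 1 := by
    rw [← semigroup_add, add_neg_cancel, semigroup_zero]
  have h1 : ∑ j, semigroup (2 * Real.pi * ξ) t i j * semigroup (2 * Real.pi * ξ) (-t) j 1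
      = (1 : Matrix (Fin 2) (Fin 2) ℂ) i 1 := by
    rw [← hone, Matrix.mul_apply]
  have h2 : ![0, Complex.I * ((2 * Real.pi * ξ : ℝ) : ℂ) * η t ξ] i
      = (1 : Matrix (Fin 2) (Fin 2) ℂ) i 1 *
        (Complex.I * ((2 * Real.pi * ξ : ℝ) : ℂ) * η t ξ) := by
    revert i
    simp [Fin.forall_fin_two]
  rw [h2, ← h1]
  simp only [Matrix.mulVec, dotProduct, Fin.sum_univ_two, Matrix.mul_apply]
  ring

theorem isFlow_duhamel (Z₀ : ℝ → VC) {η : ℝ → ℝ → ℂ} (hη : Continuous (Function.uncurry η))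
    (ξ : ℝ) : IsFlow (2 * Real.pi * ξ) (fun s => η s ξ) (fun s => duhamel Z₀ η s ξ 0)
      (fun s => duhamel Z₀ η s ξ 1) where
  left t := (hasDerivAt_duhamel Z₀ hη t ξ 0).congr_deriv (by
    simp [symbol, Matrix.mulVec, dotProduct, Fin.sum_univ_two])
  right t := (hasDerivAt_duhamel Z₀ hη t ξ 1).congr_deriv (by
    simp [symbol, Matrix.mulVec, dotProduct, Fin.sum_univ_two]
    try ring)

theorem duhamel_zero (Z₀ : ℝ → VC) (η : ℝ → ℝ → ℂ) (ξ : ℝ) : duhamel Z₀ η 0 ξ = Z₀ ξ := by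
  ext i
  simp [duhamel, semigroup_zero]

theorem normVC_sq (v : VC) : ‖v‖ ^ 2 = ‖v 0‖ ^ 2 + ‖v 1‖ ^ 2 := by
  rw [EuclideanSpace.norm_sq_eq, Fin.sum_univ_two]

theorem continuous_duhamel_time (Z₀ : ℝ → VC) {η : ℝ → ℝ → ℂ}
    (hη : Continuous (Function.uncurry η)) (ξ : ℝ) : Continuous fun t => duhamel Z₀ η t ξ := by
  have h : ∀ i, Continuous fun t => duhamel Z₀ η t ξ i := fun i =>
    continuous_iff_continuousAt.2 fun t => (hasDerivAt_duhamel Z₀ hη t ξ i).continuousAt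
  exact (PiLp.continuous_toLp 2 _).comp (continuous_pi h)

/-- The action of the semigroup on vectors. -/
def semigroupVec (k t : ℝ) (v : VC) : VC := WithLp.toLp 2 ((semigroup k t).mulVec fun j => v j)

theorem norm_semigroupVec_le {k : ℝ} (hk : |k| ≤ 1) {t : ℝ} (ht : 0 ≤ t) (v : VC) :
    ‖semigroupVec k t v‖ ≤ 2 * Real.exp (-(k ^ 2 * t) / 6) * ‖v‖ := by
  have hpi : (2 * Real.pi) ≠ 0 := by positivity
  have hflow := isFlow_duhamel (fun _ => v) (η := fun _ _ => 0) (by fun_prop) (k / (2 * Real.pi))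
  rw [mul_div_cancel₀ _ hpi] at hflow
  have h := hflow.decay_low hk ht
  have e : ∀ t, duhamel (fun _ => v) (fun _ _ => 0) t (k / (2 * Real.pi)) = semigroupVec k t v := by
    intro t
    ext i
    revert i
    simp [Fin.forall_fin_two, duhamel, semigroupVec, mul_div_cancel₀ _ hpi, Matrix.mulVec,
      dotProduct]
  rw [← normVC_sq, ← normVC_sq, e, e, sub_zero] at h
  have e0 : semigroupVec k 0 v = v := by ext i; simp [semigroupVec, semigroup_zero]
  rw [e0] at h
  have hexp : Real.exp (-(k ^ 2 * t) / 3) = Real.exp (-(k ^ 2 * t) / 6) ^ 2 := by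
    rw [← Real.exp_nat_mul]; congr 1; push_cast; ring
  rw [hexp] at h
  refine abs_le_of_sq_le_sq' ?_ (by positivity) |>.2
  refine h.trans ?_
  nlinarith [mul_nonneg (sq_nonneg (Real.exp (-(k ^ 2 * t) / 6))) (sq_nonneg ‖v‖)]

theorem continuous_semigroupVec (k : ℝ) {u : ℝ → ℝ} (hu : Continuous u) {v : ℝ → VC}
    (hv : Continuous v) : Continuous fun s => semigroupVec k (u s) (v s) := by
  refine (PiLp.continuous_toLp 2 _).comp (continuous_pi fun i => ?_)
  simp only [Matrix.mulVec, dotProduct]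
  refine continuous_finsetSum _ fun j _ => Continuous.mul ?_ (by fun_prop)
  exact (continuous_semigroup_apply i j).comp (by fun_prop : Continuous fun s : ℝ =>
      ((k, u s) : ℝ × ℝ))

theorem norm_duhamel_le_low (Z₀ : ℝ → VC) {η : ℝ → ℝ → ℂ} (hη : Continuous (Function.uncurry η))
    {ξ : ℝ} (hξ : |2 * Real.pi * ξ| ≤ 1) {t : ℝ} (ht : 0 ≤ t) :
    ‖duhamel Z₀ η t ξ‖ ≤ 2 * Real.exp (-((2 * Real.pi * ξ) ^ 2 * t) / 6) * ‖Z₀ ξ‖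
      + ∫ s in (0 : ℝ)..t, 2 * Real.exp (-((2 * Real.pi * ξ) ^ 2 * (t - s)) / 6) *
        (|2 * Real.pi * ξ| * ‖η s ξ‖) := by
  have hηξ : Continuous fun s => η s ξ :=
    hη.comp (by fun_prop : Continuous fun s : ℝ => (s, ξ))
  set k := 2 * Real.pi * ξ with hk
  set w : ℝ → VC := fun s => WithLp.toLp 2 ![0, Complex.I * (k : ℂ) * η s ξ] with hw
  have hwc : Continuous w := by
    refine (PiLp.continuous_toLp 2 _).comp (continuous_pi fun i => ?_)
    fin_cases i
    · simpa using continuous_const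
    · exact continuous_const.mul hηξ
  have hwn : ∀ s, ‖w s‖ = |k| * ‖η s ξ‖ := by
    intro s
    rw [EuclideanSpace.norm_eq, Fin.sum_univ_two]
    simp only [hw, Matrix.cons_val_zero, Matrix.cons_val_one, norm_zero, norm_mul, Complex.norm_I,
      Complex.norm_real, Real.norm_eq_abs, one_mul]
    rw [zero_pow two_ne_zero, zero_add, Real.sqrt_sq (by positivity)]
  have hvc : Continuous fun s => semigroupVec k (t - s) (w s) :=
    continuous_semigroupVec k (by fun_prop) hwc
  have e : duhamel Z₀ η t ξ = semigroupVec k t (Z₀ ξ)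
      + ∫ s in (0 : ℝ)..t, semigroupVec k (t - s) (w s) := by
    ext i
    have h1 := (EuclideanSpace.proj (𝕜 := ℂ) i).intervalIntegral_comp_comm
      (hvc.intervalIntegrable (μ := volume) 0 t)
    rw [PiLp.add_apply]
    change _ = _ + EuclideanSpace.proj (𝕜 := ℂ) i (∫ s in (0 : ℝ)..t, semigroupVec k (t - s) (w s))
    rw [← h1]
    rfl
  rw [e]
  refine (norm_add_le _ _).trans (add_le_add (norm_semigroupVec_le hξ ht _) ?_)
  refine (intervalIntegral.norm_integral_le_integral_norm ht).trans ?_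
  refine intervalIntegral.integral_mono_on ht (hvc.norm.intervalIntegrable _ _) ?_ ?_
  · exact Continuous.intervalIntegrable (by fun_prop) _ _
  · intro s hs
    rw [← hwn]
    exact norm_semigroupVec_le hξ (by linarith [hs.2]) _

theorem duhamel_neg {Z₀ : ℝ → VC} {η : ℝ → ℝ → ℂ} (hη : Continuous (Function.uncurry η)) {ξ : ℝ}
    (hZ : Z₀ (-ξ) = conjVC (Z₀ ξ)) (hs : ∀ s, η s (-ξ) = (starRingEnd ℂ) (η s ξ)) (t : ℝ) :
    duhamel Z₀ η t (-ξ) = conjVC (duhamel Z₀ η t ξ) := by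
  have hA : ∀ j, duhamelAux η t (-ξ) j = (starRingEnd ℂ) (duhamelAux η t ξ j) := by
    intro j
    have hηξ : Continuous fun s => η s ξ :=
      hη.comp (by fun_prop : Continuous fun s : ℝ => (s, ξ))
    have hS : Continuous fun s : ℝ => semigroup (2 * Real.pi * ξ) (-s) j 1 :=
      (continuous_semigroup_apply j 1).comp (by fun_prop : Continuous fun s : ℝ =>
        ((2 * Real.pi * ξ, -s) : ℝ × ℝ))
    have hc : Continuous (fun s => semigroup (2 * Real.pi * ξ) (-s) j 1 *
      (Complex.I * ((2 * Real.pi * ξ : ℝ) : ℂ) * η s ξ)) := hS.mul (continuous_const.mul hηξ)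
    have h := (Complex.conjCLE : ℂ →L[ℝ] ℂ).intervalIntegral_comp_comm
      (hc.intervalIntegrable (μ := volume) 0 t)
    simp only [ContinuousLinearEquiv.coe_coe, Complex.conjCLE_apply] at h
    rw [duhamelAux, duhamelAux, ← h]
    congr 1
    ext s
    rw [show 2 * Real.pi * -ξ = -(2 * Real.pi * ξ) by ring, semigroup_neg_apply, hs]
    simp only [map_mul, Complex.conj_I, Complex.conj_ofReal]
    push_cast; ring
  ext i
  rw [conjVC_apply, duhamel_apply _ hη, duhamel_apply _ hη, map_sum]
  refine Finset.sum_congr rfl fun j _ => ?_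
  rw [map_mul, map_add, hA, hZ, conjVC_apply, show 2 * Real.pi * -ξ = -(2 * Real.pi * ξ) by ring,
    semigroup_neg_apply]

theorem duhamel_sub (Z₀ Z₀' : ℝ → VC) {η η' : ℝ → ℝ → ℂ} (hη : Continuous (Function.uncurry η))
    (hη' : Continuous (Function.uncurry η')) (t ξ : ℝ) :
    duhamel (fun ξ => Z₀ ξ - Z₀' ξ) (fun s ξ => η s ξ - η' s ξ) t ξ
      = duhamel Z₀ η t ξ - duhamel Z₀' η' t ξ := by
  have hd : Continuous (Function.uncurry fun s ξ => η s ξ - η' s ξ) := hη.sub hη'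
  have hS : ∀ j, Continuous fun s : ℝ => semigroup (2 * Real.pi * ξ) (-s) j 1 := fun j =>
    (continuous_semigroup_apply j 1).comp (by fun_prop : Continuous fun s : ℝ =>
      ((2 * Real.pi * ξ, -s) : ℝ × ℝ))
  have hinteg : ∀ (η : ℝ → ℝ → ℂ), Continuous (Function.uncurry η) → ∀ j,
      IntervalIntegrable (fun s => semigroup (2 * Real.pi * ξ) (-s) j 1 *
    (Complex.I * ((2 * Real.pi * ξ : ℝ) : ℂ) * η s ξ)) volume 0 t := fun η hη j =>
    ((hS j).mul (continuous_const.mul (hη.comp (by fun_prop :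
      Continuous fun s : ℝ => (s, ξ))))).intervalIntegrable _ _
  have hA : ∀ j, duhamelAux (fun s ξ => η s ξ - η' s ξ) t ξ j
      = duhamelAux η t ξ j - duhamelAux η' t ξ j := by
    intro j
    rw [duhamelAux, duhamelAux, duhamelAux, ← intervalIntegral.integral_sub (hinteg η hη j)
      (hinteg η' hη' j)]
    congr 1; ext s; ring
  ext i
  rw [PiLp.sub_apply, duhamel_apply _ hd, duhamel_apply _ hη, duhamel_apply _ hη',
    ← Finset.sum_sub_distrib]
  refine Finset.sum_congr rfl fun j _ => ?_
  rw [hA, PiLp.sub_apply]; ring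

end PSystem

namespace PSystem

/-! ### Decay weights -/

/-- The decay weight `(1 + t)^{-1/4}`. -/
def rho (t : ℝ) : ℝ := (1 + t) ^ (-(1 / 4) : ℝ)

theorem rho_pos {t : ℝ} (ht : 0 ≤ t) : 0 < rho t := Real.rpow_pos_of_pos (by linarith) _

theorem rho_pow_four {t : ℝ} (ht : 0 ≤ t) : rho t ^ 4 = (1 + t)⁻¹ := by
  rw [rho, ← Real.rpow_natCast, ← Real.rpow_mul (by linarith)]
  norm_num
  exact Real.rpow_neg_one _

theorem rho_zero : rho 0 = 1 := by simp [rho]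

theorem rho_anti {s t : ℝ} (hs : 0 ≤ s) (h : s ≤ t) : rho t ≤ rho s :=
  Real.rpow_le_rpow_of_nonpos (by linarith) (by linarith) (by norm_num)

theorem rho_le_one {t : ℝ} (ht : 0 ≤ t) : rho t ≤ 1 := by
  simpa [rho_zero] using rho_anti le_rfl ht

theorem rho_le_mul {s t c : ℝ} (hs : 0 ≤ s) (ht : 0 ≤ t) (hc : 0 < c)
    (h : 1 + t ≤ c ^ 4 * (1 + s)) : rho s ≤ c * rho t := by
  refine (pow_le_pow_iff_left₀ (rho_pos hs).le (mul_nonneg hc.le (rho_pos ht).le)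
    (four_ne_zero)).1 ?_
  rw [mul_pow, rho_pow_four hs, rho_pow_four ht, inv_eq_one_div, ← div_eq_mul_inv,
    div_le_div_iff₀ (by linarith) (by linarith)]
  linarith

theorem rho_sq_mul_sqrt {t : ℝ} (ht : 0 ≤ t) : rho t ^ 2 * √(1 + t) = 1 := by
  have h : 0 < 1 + t := by linarith
  refine (pow_left_inj₀ (by positivity) zero_le_one two_ne_zero).1 ?_
  rw [mul_pow, ← pow_mul, rho_pow_four ht, Real.sq_sqrt h.le, inv_mul_cancel₀ h.ne', one_pow]

theorem rho_sq {t : ℝ} (ht : 0 ≤ t) : rho t ^ 2 = 1 / √(1 + t) :=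
  eq_div_of_mul_eq (Real.sqrt_pos.2 (by linarith)).ne' (rho_sq_mul_sqrt ht)

theorem measurable_rho : Measurable rho := by unfold rho; fun_prop

theorem continuousOn_rho : ContinuousOn rho (Set.Ici 0) := by
  unfold rho
  refine ContinuousOn.rpow_const (by fun_prop) fun t ht => Or.inl ?_
  have : (0 : ℝ) ≤ t := ht
  positivity

theorem lintegral_ofReal_deriv {F F' : ℝ → ℝ} {a b : ℝ} (hab : a ≤ b)
    (h : ∀ s ∈ Set.Icc a b, HasDerivAt F (F' s) s) (hc : ContinuousOn F' (Set.Icc a b))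
    (h0 : ∀ s ∈ Set.Icc a b, 0 ≤ F' s) :
    ∫⁻ s in Set.Ioc a b, ENNReal.ofReal (F' s) = ENNReal.ofReal (F b - F a) := by
  have hi : IntervalIntegrable F' volume a b :=
    ContinuousOn.intervalIntegrable (by rwa [Set.uIcc_of_le hab])
  rw [← intervalIntegral.integral_eq_sub_of_hasDerivAt (by rwa [Set.uIcc_of_le hab]) hi,
    intervalIntegral.integral_of_le hab, ofReal_integral_eq_lintegral_ofReal]
  · exact (intervalIntegrable_iff_integrableOn_Ioc_of_le hab).1 hi
  · filter_upwards [ae_restrict_mem measurableSet_Ioc] with s hs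
    exact h0 s ⟨hs.1.le, hs.2⟩

theorem hasDerivAt_two_sqrt {t : ℝ} (ht : 0 ≤ t) :
    HasDerivAt (fun s => 2 * √(1 + s)) (rho t ^ 2) t := by
  have h := (((hasDerivAt_id t).const_add 1).sqrt (by simp; linarith)).const_mul 2
  refine h.congr_deriv ?_
  rw [rho_sq ht]; simp; field_simp

theorem lintegral_rho_sq {a : ℝ} (ha : 0 ≤ a) :
    ∫⁻ s in Set.Ioc 0 a, ENNReal.ofReal (rho s ^ 2) ≤ ENNReal.ofReal (2 * √(1 + a)) := by
  rw [lintegral_ofReal_deriv (F := fun s => 2 * √(1 + s)) ha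
    (fun s hs => hasDerivAt_two_sqrt hs.1)
    ((continuousOn_rho.mono fun s hs => hs.1).pow 2) (fun s _ => sq_nonneg _)]
  exact ENNReal.ofReal_le_ofReal (by simp)

theorem setLIntegral_comp_sub_left (F : ℝ → ℝ≥0∞) (t : ℝ) :
    ∫⁻ s in Set.Ioc (t / 2) t, F (t - s) = ∫⁻ s in Set.Ioc 0 (t / 2), F s := by
  have h := (Measure.measurePreserving_sub_left volume t).setLIntegral_comp_preimage_emb
    (MeasurableEquiv.subLeft t).measurableEmbedding F (Set.Ico 0 (t / 2))
  rw [setLIntegral_congr (Ico_ae_eq_Ioc (μ := volume) (a := (0 : ℝ)) (b := t / 2))] at h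
  rw [← h]
  congr 2
  ext s
  simp only [Set.mem_Ioc, Set.mem_preimage, Set.mem_Ico]
  constructor <;> rintro ⟨h1, h2⟩ <;> constructor <;> linarith

theorem lintegral_rho_four {a : ℝ} (ha : 0 ≤ a) :
    ∫⁻ s in Set.Ioc 0 a, ENNReal.ofReal (rho s ^ 4) = ENNReal.ofReal (Real.log (1 + a)) := by
  rw [lintegral_ofReal_deriv (F := fun s => Real.log (1 + s)) (F' := fun s => rho s ^ 4) ha
    (fun s hs => ?_) ((continuousOn_rho.mono fun s hs => hs.1).pow 4)
    (fun s _ => by positivity)]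
  · simp
  · have h := ((hasDerivAt_id s).const_add 1).log (by simp; linarith [hs.1])
    refine h.congr_deriv ?_
    rw [rho_pow_four hs.1]; simp

theorem rho_half_le {t : ℝ} (ht : 0 ≤ t) {s : ℝ} (hs : t / 2 ≤ s) : rho s ≤ 2 * rho t := by
  refine rho_le_mul (by linarith) ht two_pos ?_
  linarith

/-- Convolution of the weight `(1 + t)^{-1/2}` with itself is bounded. -/
theorem lintegral_rho_sq_mul {t : ℝ} (ht : 0 ≤ t) :
    ∫⁻ s in Set.Ioc 0 t, ENNReal.ofReal (rho (t - s) ^ 2 * rho s ^ 2) ≤ ENNReal.ofReal 16 := by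
  have hr := rho_pos ht
  have h1 : ∫⁻ s in Set.Ioc 0 (t / 2), ENNReal.ofReal (rho (t - s) ^ 2 * rho s ^ 2)
      ≤ ENNReal.ofReal 8 := by
    calc _ ≤ ∫⁻ s in Set.Ioc 0 (t / 2), ENNReal.ofReal (4 * rho t ^ 2) *
          ENNReal.ofReal (rho s ^ 2) := by
          refine setLIntegral_mono' measurableSet_Ioc fun s hs => ?_
          rw [← ENNReal.ofReal_mul (by positivity)]
          refine ENNReal.ofReal_le_ofReal (mul_le_mul_of_nonneg_right ?_ (sq_nonneg _))
          have := rho_half_le ht (s := t - s) (by linarith [hs.2])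
          have h0 := rho_pos (t := t - s) (by linarith [hs.2])
          nlinarith
      _ ≤ ENNReal.ofReal (4 * rho t ^ 2) * ENNReal.ofReal (2 * √(1 + t)) := by
          rw [lintegral_const_mul' _ _ ENNReal.ofReal_ne_top]
          gcongr
          refine (lintegral_rho_sq (by linarith)).trans (ENNReal.ofReal_le_ofReal ?_)
          gcongr; linarith
      _ ≤ ENNReal.ofReal 8 := by
          rw [← ENNReal.ofReal_mul (by positivity)]
          refine ENNReal.ofReal_le_ofReal (le_of_eq ?_)
          linear_combination 8 * rho_sq_mul_sqrt ht
  have h2 : ∫⁻ s in Set.Ioc (t / 2) t, ENNReal.ofReal (rho (t - s) ^ 2 * rho s ^ 2)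
      ≤ ENNReal.ofReal 8 := by
    refine le_trans (le_of_eq ?_) h1
    rw [← setLIntegral_comp_sub_left]
    congr 1; ext s
    rw [sub_sub_cancel, mul_comm]
  rw [← Set.Ioc_union_Ioc_eq_Ioc (by linarith : (0 : ℝ) ≤ t / 2) (by linarith : t / 2 ≤ t)]
  refine (lintegral_union_le _ _ _).trans ((add_le_add h1 h2).trans ?_)
  rw [← ENNReal.ofReal_add (by norm_num) (by norm_num)]
  norm_num

/-- Exponential averages of a function with decaying integrals over unit intervals. -/
theorem lintegral_exp_mul_le : ∃ C : ℝ, 0 < C ∧ ∀ (G : ℝ → ℝ≥0∞) (A : ℝ≥0∞),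
    (∀ t, 0 ≤ t → ∫⁻ s in Set.Ioc t (t + 1), G s ≤ A * ENNReal.ofReal (rho t ^ 10)) →
    ∀ t, 0 ≤ t → ∫⁻ s in Set.Ioc 0 t, ENNReal.ofReal (Real.exp (-(t - s) / 6)) * G s
      ≤ ENNReal.ofReal C * A * ENNReal.ofReal (rho t ^ 10) := by
  refine ⟨20 * 3 ^ 10, by positivity, fun G A hG => ?_⟩
  set Φ : ℝ → ℝ≥0∞ := fun t =>
    ∫⁻ s in Set.Ioc 0 t, ENNReal.ofReal (Real.exp (-(t - s) / 6)) * G s with hΦ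
  have hstep : ∀ t, 0 ≤ t → rho (t / 30) ^ 10 ≤ (12 / 11) * rho ((t + 1) / 30) ^ 10 := by
    intro t ht
    have h1 : rho (t / 30) ≤ Real.exp (1 / 120) * rho ((t + 1) / 30) := by
      refine rho_le_mul (by positivity) (by positivity) (Real.exp_pos _) ?_
      rw [← Real.exp_nat_mul]
      have : (1 : ℝ) + 1 / 30 ≤ Real.exp ((4 : ℕ) * (1 / 120)) := by
        have := Real.add_one_le_exp ((4 : ℕ) * (1 / 120) : ℝ)
        norm_num at this ⊢; linarith
      nlinarith
    have h2 : Real.exp (1 / 120) ^ 10 ≤ 12 / 11 := by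
      rw [← Real.exp_nat_mul]
      have h3 := Real.add_one_le_exp (-(1 / 12) : ℝ)
      have h4 : Real.exp ((10 : ℕ) * (1 / 120)) * Real.exp (-(1 / 12)) = 1 := by
        rw [← Real.exp_add]; norm_num
      nlinarith [Real.exp_pos ((10 : ℕ) * (1 / 120) : ℝ)]
    calc _ ≤ (Real.exp (1 / 120) * rho ((t + 1) / 30)) ^ 10 :=
          pow_le_pow_left₀ (rho_pos (by positivity)).le h1 _
      _ ≤ _ := by rw [mul_pow]; gcongr
  have he : Real.exp (-1 / 6) ≤ (12 / 13) ^ 2 := by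
    have h3 := Real.add_one_le_exp (1 / 12 : ℝ)
    have h4 : Real.exp (-1 / 6) * Real.exp (1 / 12) ^ 2 = 1 := by
      rw [← Real.exp_nat_mul, ← Real.exp_add]; norm_num
    have h5 : (13 / 12 : ℝ) ^ 2 ≤ Real.exp (1 / 12) ^ 2 :=
      pow_le_pow_left₀ (by norm_num) (by linarith) 2
    nlinarith [Real.exp_pos (-1 / 6 : ℝ)]
  have key : ∀ n : ℕ, ∀ t : ℝ, 0 ≤ t → t ≤ n →
      Φ t ≤ ENNReal.ofReal (20 * rho (t / 30) ^ 10) * A := by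
    intro n
    induction n with
    | zero =>
      intro t ht htn
      have : t = 0 := le_antisymm (by simpa using htn) ht
      simp [hΦ, this]
    | succ n ih =>
      intro t ht htn
      have hexp : ∀ s ∈ Set.Ioc 0 t, ENNReal.ofReal (Real.exp (-(t - s) / 6)) ≤ 1 := by
        intro s hs
        rw [← ENNReal.ofReal_one]
        refine ENNReal.ofReal_le_ofReal (Real.exp_le_one_iff.2 ?_)
        linarith [hs.2]
      rcases le_total t 1 with h1 | h1
      · calc Φ t ≤ ∫⁻ s in Set.Ioc 0 t, G s := by
              refine setLIntegral_mono' measurableSet_Ioc fun s hs => ?_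
              exact (mul_le_mul_left (hexp s hs) _).trans (one_mul _).le
          _ ≤ ∫⁻ s in Set.Ioc 0 (0 + 1), G s :=
              lintegral_mono_set (Set.Ioc_subset_Ioc_right (by linarith))
          _ ≤ A * ENNReal.ofReal (rho 0 ^ 10) := hG 0 le_rfl
          _ = ENNReal.ofReal 1 * A := by simp [rho_zero]
          _ ≤ _ := by
              gcongr
              have h2 := hstep 0 le_rfl
              rw [zero_div, rho_zero] at h2
              have h3 : rho ((0 + 1) / 30) ^ 10 ≤ rho (t / 30) ^ 10 :=
                pow_le_pow_left₀ (rho_pos (by norm_num)).le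
                  (rho_anti (by positivity) (by linarith)) _
              linarith
      · have hI : ∀ t', t' = t - 1 → 0 ≤ t' →
            ∫⁻ s in Set.Ioc 0 t', ENNReal.ofReal (Real.exp (-(t - s) / 6)) * G s
              = ENNReal.ofReal (Real.exp (-1 / 6)) * Φ t' := by
          rintro t' rfl ht'
          rw [hΦ, ← lintegral_const_mul' _ _ ENNReal.ofReal_ne_top]
          congr 1; ext s
          rw [← mul_assoc, ← ENNReal.ofReal_mul (Real.exp_pos _).le, ← Real.exp_add]
          congr 3; ring
        have h0 : 0 ≤ t - 1 := by linarith
        have h2 : ∫⁻ s in Set.Ioc (t - 1) t, ENNReal.ofReal (Real.exp (-(t - s) / 6)) * G s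
            ≤ A * ENNReal.ofReal (rho (t - 1) ^ 10) := by
          refine le_trans ?_ (hG (t - 1) h0)
          rw [sub_add_cancel]
          refine setLIntegral_mono' measurableSet_Ioc fun s hs => ?_
          exact (mul_le_mul_left (hexp s ⟨by linarith [hs.1], hs.2⟩) _).trans (one_mul _).le
        have h3 : Φ t ≤ ENNReal.ofReal (Real.exp (-1 / 6)) * Φ (t - 1)
            + A * ENNReal.ofReal (rho (t - 1) ^ 10) := by
          rw [← hI _ rfl h0]
          refine le_trans (le_of_eq ?_) ((lintegral_union_le _ _ _).trans (add_le_add le_rfl h2))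
          rw [Set.Ioc_union_Ioc_eq_Ioc h0 (by linarith)]
        refine h3.trans ?_
        have h4 := ih (t - 1) h0 (by push_cast at htn; linarith)
        have hs := hstep (t - 1) h0
        rw [sub_add_cancel] at hs
        have h5 : rho (t - 1) ^ 10 ≤ rho ((t - 1) / 30) ^ 10 :=
          pow_le_pow_left₀ (rho_pos h0).le (rho_anti (by positivity) (by linarith)) _
        calc _ ≤ ENNReal.ofReal (Real.exp (-1 / 6)) *
              (ENNReal.ofReal (20 * rho ((t - 1) / 30) ^ 10) * A)
              + A * ENNReal.ofReal (rho (t - 1) ^ 10) := by gcongr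
          _ = ENNReal.ofReal (Real.exp (-1 / 6) * (20 * rho ((t - 1) / 30) ^ 10)
              + rho (t - 1) ^ 10) * A := by
              rw [ENNReal.ofReal_add (by positivity) (by positivity),
                ENNReal.ofReal_mul (Real.exp_pos _).le]
              ring
          _ ≤ _ := by
              gcongr
              have : 0 ≤ rho ((t - 1) / 30) ^ 10 := by positivity
              nlinarith
  intro t ht
  obtain ⟨n, hn⟩ := exists_nat_ge t
  refine (key n t ht hn).trans ?_
  rw [mul_right_comm, ← ENNReal.ofReal_mul (by positivity)]
  refine mul_le_mul' (ENNReal.ofReal_le_ofReal ?_) le_rfl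
  have h6 : rho (t / 30) ≤ 3 * rho t := rho_le_mul (by positivity) ht three_pos (by linarith)
  calc 20 * rho (t / 30) ^ 10 ≤ 20 * (3 * rho t) ^ 10 := by
        gcongr
        exact (rho_pos (by positivity)).le
    _ = _ := by ring

theorem exp_neg_le_rho : ∃ C : ℝ, 0 < C ∧ ∀ t, 0 ≤ t → Real.exp (-t / 6) ≤ C * rho t ^ 10 := by
  refine ⟨Real.exp (1 / 6) * (Nat.factorial 3 * 6 ^ 3), by positivity, fun t ht => ?_⟩
  have h1 := Real.pow_div_factorial_le_exp (x := (1 + t) / 6) (by positivity) 3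
  have hr := rho_pos ht
  have h2 : rho t ^ 12 = ((1 + t)⁻¹) ^ 3 := by rw [← rho_pow_four ht, ← pow_mul]
  have h3 : rho t ^ 12 ≤ rho t ^ 10 := pow_le_pow_of_le_one hr.le (rho_le_one ht) (by norm_num)
  have h4 : Real.exp (-t / 6) = Real.exp (1 / 6) * (Real.exp ((1 + t) / 6))⁻¹ := by
    rw [← Real.exp_neg, ← Real.exp_add]; congr 1; ring
  rw [h4, mul_assoc]
  gcongr
  refine le_trans ?_ (mul_le_mul_of_nonneg_left h3 (by positivity))
  rw [h2]
  have hT : 0 < 1 + t := by linarith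
  calc _ ≤ (((1 + t) / 6) ^ 3 / (Nat.factorial 3 : ℝ))⁻¹ := by
        gcongr
    _ = _ := by field_simp

/-! ### Gaussian bounds at low frequency -/

theorem pow_mul_exp_le (j : ℕ) : ∃ C : ℝ, 1 ≤ C ∧ ∀ x t : ℝ, 0 ≤ x → x ≤ 1 → 0 ≤ t →
    x ^ j * Real.exp (-(x * t) / 12) ≤ C * rho t ^ (4 * j) := by
  refine ⟨1 + Real.exp (1 / 12) * (Nat.factorial j * 12 ^ j), by
    have : 0 ≤ Real.exp (1 / 12) * (Nat.factorial j * 12 ^ j) := by positivity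
    linarith, fun x t hx hx1 ht => ?_⟩
  have h1 := Real.pow_div_factorial_le_exp (x := x * (1 + t) / 12) (by positivity) j
  have hT : 0 < 1 + t := by linarith
  have h4 : Real.exp (-(x * t) / 12) = Real.exp (x / 12) * (Real.exp (x * (1 + t) / 12))⁻¹ := by
    rw [← Real.exp_neg, ← Real.exp_add]; congr 1; ring
  have h5 : x ^ j * (Real.exp (x * (1 + t) / 12))⁻¹ ≤ Nat.factorial j * 12 ^ j * rho t ^ (4 * j) := by
    rw [← div_eq_mul_inv, div_le_iff₀ (Real.exp_pos _)]
    calc x ^ j = Nat.factorial j * 12 ^ j * rho t ^ (4 * j) *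
          ((x * (1 + t) / 12) ^ j / Nat.factorial j) := by
          rw [pow_mul, rho_pow_four ht, div_pow, mul_pow, inv_pow]
          field_simp
      _ ≤ _ := by
          have := rho_pos ht
          gcongr
  have hr : 0 ≤ rho t ^ (4 * j) := by have := rho_pos ht; positivity
  calc _ = Real.exp (x / 12) * (x ^ j * (Real.exp (x * (1 + t) / 12))⁻¹) := by rw [h4]; ring
    _ ≤ Real.exp (1 / 12) * (Nat.factorial j * 12 ^ j * rho t ^ (4 * j)) := by gcongr
    _ ≤ _ := by nlinarith

/-- The set of low frequencies `|k| ≤ 1`. -/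
def lowSet : Set ℝ := {ξ | |2 * Real.pi * ξ| ≤ 1}

theorem measurableSet_lowSet : MeasurableSet lowSet :=
  (isClosed_le (by fun_prop) continuous_const).measurableSet

theorem lintegral_low_gaussian (j : ℕ) : ∃ C : ℝ, 0 < C ∧ ∀ t, 0 ≤ t →
    ∫⁻ ξ in lowSet, ENNReal.ofReal (((2 * Real.pi * ξ) ^ 2) ^ j *
      Real.exp (-((2 * Real.pi * ξ) ^ 2 * t) / 6)) ≤ ENNReal.ofReal (C * rho t ^ (4 * j + 2)) := by
  obtain ⟨C, hC1, hC⟩ := pow_mul_exp_le j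
  refine ⟨C * Real.exp (1 / 12), by positivity, fun t ht => ?_⟩
  have hT : 0 < 1 + t := by linarith
  have hr := rho_pos ht
  set b : ℝ := Real.pi ^ 2 * (1 + t) / 3 with hb
  have hbpos : 0 < b := by positivity
  have hg := integrable_exp_neg_mul_sq hbpos
  calc _ ≤ ∫⁻ ξ in lowSet, ENNReal.ofReal (C * Real.exp (1 / 12) * rho t ^ (4 * j) *
        Real.exp (-b * ξ ^ 2)) := by
        refine setLIntegral_mono' measurableSet_lowSet fun ξ hξ => ENNReal.ofReal_le_ofReal ?_
        have hx : (2 * Real.pi * ξ) ^ 2 ≤ 1 := by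
          rw [← sq_abs]; exact pow_le_one₀ (abs_nonneg _) hξ
        have h1 := hC _ t (sq_nonneg (2 * Real.pi * ξ)) hx ht
        have h2 : Real.exp (-((2 * Real.pi * ξ) ^ 2 * t) / 6)
            = Real.exp (-((2 * Real.pi * ξ) ^ 2 * t) / 12) *
              (Real.exp ((2 * Real.pi * ξ) ^ 2 / 12) * Real.exp (-b * ξ ^ 2)) := by
          rw [← Real.exp_add, ← Real.exp_add, hb]; congr 1; ring
        rw [h2, ← mul_assoc]
        calc _ ≤ C * rho t ^ (4 * j) * (Real.exp (1 / 12) * Real.exp (-b * ξ ^ 2)) := by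
              gcongr
          _ = _ := by ring
    _ ≤ ∫⁻ ξ, ENNReal.ofReal (C * Real.exp (1 / 12) * rho t ^ (4 * j) *
        Real.exp (-b * ξ ^ 2)) := setLIntegral_le_lintegral _ _
    _ = ENNReal.ofReal (C * Real.exp (1 / 12) * rho t ^ (4 * j) * √(Real.pi / b)) := by
        rw [← ofReal_integral_eq_lintegral_ofReal (hg.const_mul _)
          (ae_of_all _ fun ξ => by positivity), integral_const_mul, integral_gaussian]
    _ ≤ _ := by
        refine ENNReal.ofReal_le_ofReal ?_
        rw [pow_add, ← mul_assoc]
        gcongr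
        have h1 : (1 : ℝ) / √(1 + t) = √(1 / (1 + t)) := by
          rw [Real.sqrt_div zero_le_one, Real.sqrt_one]
        rw [rho_sq ht, h1]
        refine Real.sqrt_le_sqrt ?_
        rw [div_le_div_iff₀ hbpos hT, hb]
        have := Real.pi_gt_three
        have : Real.pi * 3 ≤ Real.pi ^ 2 := by nlinarith
        have : Real.pi * (1 + t) * 3 ≤ Real.pi ^ 2 * (1 + t) := by nlinarith
        linarith

theorem low_weight_le (j : ℕ) : ∃ C : ℝ, 1 ≤ C ∧ ∀ k t : ℝ, |k| ≤ 1 → 0 ≤ t →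
    |k| ^ j * Real.exp (-(k ^ 2 * t) / 6) ≤ C * rho t ^ (2 * j) := by
  obtain ⟨C, hC1, hC⟩ := pow_mul_exp_le j
  refine ⟨C, hC1, fun k t hk ht => ?_⟩
  have hr := rho_pos ht
  have hx : k ^ 2 ≤ 1 := by rw [← sq_abs]; exact pow_le_one₀ (abs_nonneg _) hk
  refine (pow_le_pow_iff_left₀ (by positivity) (by positivity) two_ne_zero).1 ?_
  calc _ = (k ^ 2) ^ j * Real.exp (-(k ^ 2 * t) / 3) := by
        rw [mul_pow, ← Real.exp_nat_mul, ← pow_mul, mul_comm j 2, pow_mul, sq_abs]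
        congr 2; push_cast; ring
    _ ≤ (k ^ 2) ^ j * Real.exp (-(k ^ 2 * t) / 12) := by
        have : 0 ≤ k ^ 2 * t := by positivity
        refine mul_le_mul_of_nonneg_left (Real.exp_le_exp.2 ?_) (by positivity)
        linarith
    _ ≤ C * rho t ^ (4 * j) := hC _ _ (sq_nonneg _) hx ht
    _ ≤ C ^ 2 * rho t ^ (4 * j) := by gcongr; nlinarith
    _ = _ := by rw [mul_pow, ← pow_mul]; congr 2; ring

end PSystem

namespace PSystem

/-! ### Integral inequalities in `ℝ≥0∞` -/

theorem ennreal_add_sq_le (a b : ℝ≥0∞) : (a + b) ^ 2 ≤ 4 * (a ^ 2 + b ^ 2) := by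
  rcases le_total a b with h | h
  · calc (a + b) ^ 2 ≤ (b + b) ^ 2 := by gcongr
      _ = 4 * b ^ 2 := by ring
      _ ≤ _ := by gcongr; exact le_add_self
  · calc (a + b) ^ 2 ≤ (a + a) ^ 2 := by gcongr
      _ = 4 * a ^ 2 := by ring
      _ ≤ _ := by gcongr; exact le_self_add

theorem ofReal_norm_sq {E : Type} [NormedAddCommGroup E] (x : E) :
    ENNReal.ofReal (‖x‖ ^ 2) = ‖x‖ₑ ^ 2 := by
  rw [ENNReal.ofReal_pow (norm_nonneg _), ofReal_norm]

theorem ofReal_intervalIntegral {φ : ℝ → ℝ} (hc : Continuous φ) {a b : ℝ} (hab : a ≤ b)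
    (h0 : ∀ s, 0 ≤ φ s) :
    ENNReal.ofReal (∫ s in a..b, φ s) = ∫⁻ s in Set.Ioc a b, ENNReal.ofReal (φ s) := by
  rw [intervalIntegral.integral_of_le hab, ofReal_integral_eq_lintegral_ofReal]
  · exact (intervalIntegrable_iff_integrableOn_Ioc_of_le hab).1 (hc.intervalIntegrable _ _)
  · exact ae_of_all _ h0

theorem lintegral_weight_mul_sq_le {α : Type} [MeasurableSpace α] {μ : Measure α}
    {w G : α → ℝ≥0∞} (hw : AEMeasurable w μ) (hG : AEMeasurable G μ) :
    (∫⁻ s, w s * G s ∂μ) ^ 2 ≤ (∫⁻ s, w s ∂μ) * ∫⁻ s, w s * G s ^ 2 ∂μ := by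
  have hsq : ∀ a : ℝ≥0∞, (a ^ (1 / 2 : ℝ)) ^ 2 = a := fun a => by
    rw [← ENNReal.rpow_natCast, ← ENNReal.rpow_mul]; norm_num
  have h := lintegral_mul_sq_le (hw.pow_const (1 / 2 : ℝ)) ((hw.pow_const (1 / 2 : ℝ)).mul hG)
  simp only [Pi.mul_apply, mul_pow, hsq] at h
  refine le_trans (le_of_eq ?_) h
  congr 2
  ext s
  rw [← mul_assoc, ← pow_two, hsq]

theorem lintegral_lintegral_mul_sq_le {μ : Measure ℝ} [SFinite μ] {w : ℝ → ℝ≥0∞}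
    {G : ℝ → ℝ → ℝ≥0∞} (hw : Measurable w) (hG : Measurable (Function.uncurry G)) {S : Set ℝ}
    (hS : MeasurableSet S) {B : ℝ≥0∞} (h : ∀ s ∈ S, ∫⁻ ξ, G s ξ ^ 2 ∂μ ≤ B) :
    ∫⁻ ξ, (∫⁻ s in S, w s * G s ξ) ^ 2 ∂μ ≤ (∫⁻ s in S, w s) ^ 2 * B := by
  have hm : Measurable fun p : ℝ × ℝ => w p.2 * G p.2 p.1 ^ 2 :=
    (hw.comp measurable_snd).mul ((hG.comp measurable_swap).pow_const 2)
  calc _ ≤ ∫⁻ ξ, ((∫⁻ s in S, w s) * ∫⁻ s in S, w s * G s ξ ^ 2) ∂μ := by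
        refine lintegral_mono fun ξ => lintegral_weight_mul_sq_le hw.aemeasurable ?_
        exact (hG.comp (measurable_prodMk_right (y := ξ))).aemeasurable
    _ = (∫⁻ s in S, w s) * ∫⁻ ξ, (∫⁻ s in S, w s * G s ξ ^ 2) ∂μ := by
        rw [lintegral_const_mul]
        exact hm.lintegral_prod_right'
    _ = (∫⁻ s in S, w s) * ∫⁻ s in S, (w s * ∫⁻ ξ, G s ξ ^ 2 ∂μ) := by
        rw [lintegral_lintegral_swap hm.aemeasurable]
        congr 2; ext s
        rw [lintegral_const_mul]
        exact (hG.comp (measurable_prodMk_left (x := s))).pow_const 2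
    _ ≤ (∫⁻ s in S, w s) * ∫⁻ s in S, w s * B := by
        refine mul_le_mul_right ?_ _
        refine setLIntegral_mono' hS fun s hs => ?_
        exact mul_le_mul_right (h s hs) _
    _ = _ := by
        rw [lintegral_mul_const _ hw, pow_two, mul_assoc]

/-- The absolute value of the wave number `k = 2πξ`. -/
def kn (ξ : ℝ) : ℝ≥0∞ := ‖2 * Real.pi * ξ‖ₑ

theorem measurable_kn : Measurable kn := by unfold kn; fun_prop

theorem kn_ne_top (ξ : ℝ) : kn ξ ≠ ⊤ := enorm_ne_top

theorem kn_eq (ξ : ℝ) : kn ξ = ENNReal.ofReal |2 * Real.pi * ξ| := by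
  rw [kn, Real.enorm_eq_ofReal_abs]

theorem one_le_kn {ξ : ℝ} (h : 1 ≤ |2 * Real.pi * ξ|) : 1 ≤ kn ξ := by
  rw [kn_eq, ← ENNReal.ofReal_one]; exact ENNReal.ofReal_le_ofReal h

theorem abs_of_mem_compl_lowSet {ξ : ℝ} (h : ξ ∈ lowSetᶜ) : 1 ≤ |2 * Real.pi * ξ| :=
  (not_le.1 fun h' : |2 * Real.pi * ξ| ≤ 1 => h h').le

/-! ### Forcing and initial data -/

/-- Bounds for the Fourier transform `η s` of the flux at time `s`. -/
structure Forcing (M : ℝ) (η : ℝ → ℝ → ℂ) : Prop where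
  cont : Continuous (Function.uncurry η)
  sup : ∀ s, 0 ≤ s → ∀ ξ, ‖η s ξ‖ ≤ M * rho s ^ 2
  deriv : ∀ s, 0 ≤ s → ∫⁻ ξ, (kn ξ * ‖η s ξ‖ₑ) ^ 2 ≤ ENNReal.ofReal ((M * rho s ^ 5) ^ 2)
  diff : ∀ δ, 0 < δ → δ ≤ 1 → ∀ t, 0 ≤ t →
    ∫⁻ s in Set.Ioc t (t + 1), ∫⁻ ξ, ‖η (s + δ) ξ - η s ξ‖ₑ ^ 2
      ≤ ENNReal.ofReal ((M * δ * rho t ^ 5) ^ 2)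

/-- Bounds for the Fourier transform of the initial data. -/
structure DataBound (M : ℝ) (Z₀ : ℝ → VC) : Prop where
  meas : Measurable Z₀
  sup : ∀ᵐ ξ, ‖Z₀ ξ‖ ≤ M
  one : ∫⁻ ξ, (kn ξ * ‖Z₀ ξ‖ₑ) ^ 2 ≤ ENNReal.ofReal (M ^ 2)
  two : ∫⁻ ξ, (kn ξ ^ 2 * ‖Z₀ ξ 1‖ₑ) ^ 2 ≤ ENNReal.ofReal (M ^ 2)

variable {M : ℝ} {Z₀ : ℝ → VC} {η : ℝ → ℝ → ℂ}

theorem Forcing.cont_time (h : Forcing M η) (ξ : ℝ) : Continuous fun s => η s ξ :=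
  h.cont.comp (by fun_prop : Continuous fun s : ℝ => (s, ξ))

theorem Forcing.measurable_kn_mul (h : Forcing M η) :
    Measurable (Function.uncurry fun s ξ => kn ξ * ‖η s ξ‖ₑ) :=
  (measurable_kn.comp measurable_snd).mul h.cont.measurable.enorm

/-! ### Low frequencies -/

theorem enorm_duhamel_le_low (h : Forcing M η) {ξ : ℝ} (hξ : ξ ∈ lowSet)
    (hZ : ‖Z₀ ξ‖ ≤ M) {t : ℝ} (ht : 0 ≤ t) :
    ‖duhamel Z₀ η t ξ‖ₑ ≤ ENNReal.ofReal (2 * Real.exp (-((2 * Real.pi * ξ) ^ 2 * t) / 6) * M)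
      + ∫⁻ s in Set.Ioc 0 t, ENNReal.ofReal
        (2 * Real.exp (-((2 * Real.pi * ξ) ^ 2 * (t - s)) / 6)) * (kn ξ * ‖η s ξ‖ₑ) := by
  have hc := h.cont_time ξ
  have h1 := norm_duhamel_le_low Z₀ h.cont hξ ht
  rw [← ofReal_norm]
  refine (ENNReal.ofReal_le_ofReal h1).trans (ENNReal.ofReal_add_le.trans (add_le_add ?_ ?_))
  · exact ENNReal.ofReal_le_ofReal (by gcongr)
  · rw [ofReal_intervalIntegral (by fun_prop) ht (fun s => by positivity)]
    refine le_of_eq (lintegral_congr fun s => ?_)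
    rw [ENNReal.ofReal_mul (by positivity), ENNReal.ofReal_mul (abs_nonneg _), ← kn_eq, ofReal_norm]

theorem duhamel_sup_low : ∃ C : ℝ, 0 < C ∧ ∀ {M : ℝ} {Z₀ : ℝ → VC} {η : ℝ → ℝ → ℂ},
    Forcing M η → ∀ ξ ∈ lowSet, ‖Z₀ ξ‖ ≤ M → ∀ t, 0 ≤ t → ‖duhamel Z₀ η t ξ‖ ≤ C * M := by
  obtain ⟨C, hC1, hC⟩ := low_weight_le 1
  refine ⟨2 + 2 * C * 16, by positivity, fun {M Z₀ η} h ξ hξ hZ t ht => ?_⟩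
  have hM : 0 ≤ M := (norm_nonneg _).trans hZ
  have h1 := enorm_duhamel_le_low h hξ hZ ht
  have h2 : ∫⁻ s in Set.Ioc 0 t, ENNReal.ofReal
        (2 * Real.exp (-((2 * Real.pi * ξ) ^ 2 * (t - s)) / 6)) * (kn ξ * ‖η s ξ‖ₑ)
      ≤ ENNReal.ofReal (2 * C * M) * ENNReal.ofReal 16 := by
    refine le_trans ?_ (mul_le_mul_right (lintegral_rho_sq_mul ht) _)
    rw [← lintegral_const_mul' _ _ ENNReal.ofReal_ne_top]
    refine setLIntegral_mono' measurableSet_Ioc fun s hs => ?_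
    rw [kn_eq, ← ofReal_norm, ← ENNReal.ofReal_mul (abs_nonneg _),
      ← ENNReal.ofReal_mul (by positivity), ← ENNReal.ofReal_mul (by positivity)]
    refine ENNReal.ofReal_le_ofReal ?_
    have h3 := hC (2 * Real.pi * ξ) (t - s) hξ (by linarith [hs.2])
    have h4 := h.sup s hs.1.le ξ
    rw [pow_one, mul_one] at h3
    calc _ = 2 * (|2 * Real.pi * ξ| * Real.exp (-((2 * Real.pi * ξ) ^ 2 * (t - s)) / 6))
          * ‖η s ξ‖ := by ring
      _ ≤ 2 * (C * rho (t - s) ^ 2) * (M * rho s ^ 2) := by gcongr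
      _ = _ := by ring
  have h3 : ENNReal.ofReal (2 * Real.exp (-((2 * Real.pi * ξ) ^ 2 * t) / 6) * M)
      ≤ ENNReal.ofReal (2 * M) := by
    refine ENNReal.ofReal_le_ofReal ?_
    have : Real.exp (-((2 * Real.pi * ξ) ^ 2 * t) / 6) ≤ 1 := by
      rw [Real.exp_le_one_iff]
      have : 0 ≤ (2 * Real.pi * ξ) ^ 2 * t := by positivity
      linarith
    nlinarith
  have h4 := h1.trans (add_le_add h3 h2)
  rw [← ENNReal.ofReal_mul (by positivity), ← ENNReal.ofReal_add (by positivity) (by positivity),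
    ← ofReal_norm, ENNReal.ofReal_le_ofReal_iff (by positivity)] at h4
  linarith

theorem duhamel_low (j : ℕ) : ∃ C : ℝ, 0 < C ∧ ∀ {M : ℝ} {Z₀ : ℝ → VC} {η : ℝ → ℝ → ℂ},
    0 ≤ M → Forcing M η → (∀ᵐ ξ, ‖Z₀ ξ‖ ≤ M) → ∀ t, 0 ≤ t → ∀ V : ℝ, 0 ≤ V →
    ∫⁻ s in Set.Ioc 0 (t / 2), ENNReal.ofReal (rho s ^ (2 * j)) ≤ ENNReal.ofReal V →
    ∫⁻ ξ in lowSet, (kn ξ ^ j * ‖duhamel Z₀ η t ξ‖ₑ) ^ 2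
      ≤ ENNReal.ofReal (C * M ^ 2 * (rho t ^ (4 * j + 2) + rho t ^ 10 * V ^ 2)) := by
  obtain ⟨C₀, hC₀, hG₀⟩ := lintegral_low_gaussian j
  obtain ⟨C₁, hC₁, hG₁⟩ := lintegral_low_gaussian (j + 1)
  obtain ⟨C₂, hC₂, hW⟩ := low_weight_le j
  refine ⟨4 * (8 * C₀ + 512 * C₁) + 4 * (4 * C₂ ^ 2 * 4 ^ 5), by positivity,
    fun {M Z₀ η} hM h hZ t ht V hV0 hV => ?_⟩
  have hr := rho_pos ht
  set A : ℝ → ℝ := fun ξ => M * Real.exp (-((2 * Real.pi * ξ) ^ 2 * t) / 12) *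
    (2 + 16 * |2 * Real.pi * ξ| / rho t ^ 2) with hA
  set B : ℝ → ℝ≥0∞ := fun ξ => ∫⁻ s in Set.Ioc (t / 2) t,
    ENNReal.ofReal (2 * C₂ * rho (t - s) ^ (2 * j)) * (kn ξ * ‖η s ξ‖ₑ) with hB
  have hpt : ∀ᵐ ξ ∂volume.restrict lowSet, (kn ξ ^ j * ‖duhamel Z₀ η t ξ‖ₑ) ^ 2
      ≤ 4 * ((kn ξ ^ j * ENNReal.ofReal (A ξ)) ^ 2 + B ξ ^ 2) := by
    filter_upwards [ae_restrict_mem measurableSet_lowSet, ae_restrict_of_ae hZ] with ξ hξ hZξ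
    refine le_trans ?_ (ennreal_add_sq_le _ _)
    have hab := abs_nonneg (2 * Real.pi * ξ)
    have h1 := enorm_duhamel_le_low h hξ hZξ ht
    rw [← Set.Ioc_union_Ioc_eq_Ioc (by linarith : (0 : ℝ) ≤ t / 2) (by linarith : t / 2 ≤ t)] at h1
    have h2 := h1.trans (add_le_add le_rfl (lintegral_union_le _ _ _))
    rw [← add_assoc] at h2
    have h3 : ∫⁻ s in Set.Ioc 0 (t / 2), ENNReal.ofReal
        (2 * Real.exp (-((2 * Real.pi * ξ) ^ 2 * (t - s)) / 6)) * (kn ξ * ‖η s ξ‖ₑ)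
        ≤ ENNReal.ofReal (2 * Real.exp (-((2 * Real.pi * ξ) ^ 2 * t) / 12) *
          |2 * Real.pi * ξ| * M) * ENNReal.ofReal (2 * √(1 + t)) := by
      have h4 : ∫⁻ s in Set.Ioc 0 (t / 2), ENNReal.ofReal (rho s ^ 2)
          ≤ ENNReal.ofReal (2 * √(1 + t)) :=
        (lintegral_rho_sq (by linarith)).trans (ENNReal.ofReal_le_ofReal (by gcongr; linarith))
      refine le_trans ?_ (mul_le_mul_right h4 _)
      rw [← lintegral_const_mul' _ _ ENNReal.ofReal_ne_top]
      refine setLIntegral_mono' measurableSet_Ioc fun s hs => ?_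
      rw [kn_eq, ← ofReal_norm, ← ENNReal.ofReal_mul (abs_nonneg _),
        ← ENNReal.ofReal_mul (by positivity), ← ENNReal.ofReal_mul (by positivity)]
      refine ENNReal.ofReal_le_ofReal ?_
      have h5 := h.sup s hs.1.le ξ
      have h6 : Real.exp (-((2 * Real.pi * ξ) ^ 2 * (t - s)) / 6)
          ≤ Real.exp (-((2 * Real.pi * ξ) ^ 2 * t) / 12) := by
        refine Real.exp_le_exp.2 ?_
        have : (2 * Real.pi * ξ) ^ 2 * (t / 2) ≤ (2 * Real.pi * ξ) ^ 2 * (t - s) :=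
          mul_le_mul_of_nonneg_left (by linarith [hs.2]) (sq_nonneg _)
        linarith
      calc _ ≤ 2 * Real.exp (-((2 * Real.pi * ξ) ^ 2 * t) / 12) *
            (|2 * Real.pi * ξ| * (M * rho s ^ 2)) := by gcongr
        _ = _ := by ring
    have h7 : ENNReal.ofReal (2 * Real.exp (-((2 * Real.pi * ξ) ^ 2 * t) / 6) * M)
        + ENNReal.ofReal (2 * Real.exp (-((2 * Real.pi * ξ) ^ 2 * t) / 12) *
          |2 * Real.pi * ξ| * M) * ENNReal.ofReal (2 * √(1 + t)) ≤ ENNReal.ofReal (A ξ) := by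
      rw [← ENNReal.ofReal_mul (by positivity),
        ← ENNReal.ofReal_add (by positivity) (by positivity)]
      refine ENNReal.ofReal_le_ofReal ?_
      have h8 : √(1 + t) = 1 / rho t ^ 2 :=
        eq_div_of_mul_eq (by positivity) (by linarith [rho_sq_mul_sqrt ht])
      have h9 : Real.exp (-((2 * Real.pi * ξ) ^ 2 * t) / 6)
          ≤ Real.exp (-((2 * Real.pi * ξ) ^ 2 * t) / 12) := by
        refine Real.exp_le_exp.2 ?_
        have : 0 ≤ (2 * Real.pi * ξ) ^ 2 * t := by positivity
        linarith
      rw [h8, hA]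
      calc _ ≤ 2 * Real.exp (-((2 * Real.pi * ξ) ^ 2 * t) / 12) * M +
            2 * Real.exp (-((2 * Real.pi * ξ) ^ 2 * t) / 12) * |2 * Real.pi * ξ| * M *
              (8 * (1 / rho t ^ 2)) := by gcongr; norm_num
        _ = _ := by ring
    have h8 : kn ξ ^ j * ∫⁻ s in Set.Ioc (t / 2) t, ENNReal.ofReal
        (2 * Real.exp (-((2 * Real.pi * ξ) ^ 2 * (t - s)) / 6)) * (kn ξ * ‖η s ξ‖ₑ) ≤ B ξ := by
      rw [← lintegral_const_mul' _ _ (ENNReal.pow_ne_top (kn_ne_top ξ))]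
      refine setLIntegral_mono' measurableSet_Ioc fun s hs => ?_
      rw [← mul_assoc]
      refine mul_le_mul' ?_ le_rfl
      rw [kn_eq, ← ENNReal.ofReal_pow (abs_nonneg _), ← ENNReal.ofReal_mul (by positivity)]
      refine ENNReal.ofReal_le_ofReal ?_
      have := hW (2 * Real.pi * ξ) (t - s) hξ (by linarith [hs.2])
      linarith
    have h9 : kn ξ ^ j * ‖duhamel Z₀ η t ξ‖ₑ ≤ kn ξ ^ j * ENNReal.ofReal (A ξ) + B ξ := by
      refine (mul_le_mul_right h2 _).trans ?_
      rw [mul_add]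
      exact add_le_add (mul_le_mul_right ((add_le_add le_rfl h3).trans h7) _) h8
    gcongr
  have hAint : ∫⁻ ξ in lowSet, (kn ξ ^ j * ENNReal.ofReal (A ξ)) ^ 2
      ≤ ENNReal.ofReal ((8 * C₀ + 512 * C₁) * M ^ 2 * rho t ^ (4 * j + 2)) := by
    calc _ ≤ ∫⁻ ξ in lowSet, (ENNReal.ofReal (8 * M ^ 2) *
          ENNReal.ofReal (((2 * Real.pi * ξ) ^ 2) ^ j *
            Real.exp (-((2 * Real.pi * ξ) ^ 2 * t) / 6)) +
          ENNReal.ofReal (512 * M ^ 2 / rho t ^ 4) *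
          ENNReal.ofReal (((2 * Real.pi * ξ) ^ 2) ^ (j + 1) *
            Real.exp (-((2 * Real.pi * ξ) ^ 2 * t) / 6))) := by
          refine lintegral_mono fun ξ => ?_
          rw [kn_eq, ← ENNReal.ofReal_pow (abs_nonneg _), ← ENNReal.ofReal_mul (by positivity),
            ← ENNReal.ofReal_pow (by positivity), ← ENNReal.ofReal_mul (by positivity),
            ← ENNReal.ofReal_mul (by positivity),
            ← ENNReal.ofReal_add (by positivity) (by positivity)]
          refine ENNReal.ofReal_le_ofReal ?_
          have e1 : Real.exp (-((2 * Real.pi * ξ) ^ 2 * t) / 6)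
              = Real.exp (-((2 * Real.pi * ξ) ^ 2 * t) / 12) ^ 2 := by
            rw [← Real.exp_nat_mul]; congr 1; push_cast; ring
          have e2 : ((2 * Real.pi * ξ) ^ 2) ^ j = (|2 * Real.pi * ξ| ^ j) ^ 2 := by
            rw [← sq_abs, ← pow_mul, ← pow_mul, mul_comm 2 j]
          have e3 : ((2 * Real.pi * ξ) ^ 2) ^ (j + 1)
              = (|2 * Real.pi * ξ| ^ j) ^ 2 * |2 * Real.pi * ξ| ^ 2 := by
            rw [pow_succ, e2, sq_abs]
          rw [e3, e1, e2, hA]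
          dsimp only
          generalize Real.exp (-((2 * Real.pi * ξ) ^ 2 * t) / 12) = E
          generalize |2 * Real.pi * ξ| = x
          have e4 : 512 * M ^ 2 / rho t ^ 4 * ((x ^ j) ^ 2 * x ^ 2 * E ^ 2)
              = 512 * M ^ 2 * ((x ^ j) ^ 2 * E ^ 2) * (x / rho t ^ 2) ^ 2 := by ring
          have e5 : 16 * x / rho t ^ 2 = 16 * (x / rho t ^ 2) := by ring
          rw [e4, e5]
          have : 0 ≤ M ^ 2 * ((x ^ j) ^ 2 * E ^ 2) * (2 - 16 * (x / rho t ^ 2)) ^ 2 := by positivity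
          nlinarith
      _ ≤ ENNReal.ofReal (8 * M ^ 2) * ENNReal.ofReal (C₀ * rho t ^ (4 * j + 2)) +
          ENNReal.ofReal (512 * M ^ 2 / rho t ^ 4) *
            ENNReal.ofReal (C₁ * rho t ^ (4 * (j + 1) + 2)) := by
          rw [lintegral_add_left (by fun_prop), lintegral_const_mul' _ _ ENNReal.ofReal_ne_top,
            lintegral_const_mul' _ _ ENNReal.ofReal_ne_top]
          exact add_le_add (mul_le_mul_right (hG₀ t ht) _) (mul_le_mul_right (hG₁ t ht) _)
      _ = _ := by
          rw [← ENNReal.ofReal_mul (by positivity), ← ENNReal.ofReal_mul (by positivity),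
            ← ENNReal.ofReal_add (by positivity) (by positivity)]
          congr 1
          have : rho t ^ (4 * (j + 1) + 2) = rho t ^ 4 * rho t ^ (4 * j + 2) := by ring
          rw [this]
          field_simp
  have hBint : ∫⁻ ξ in lowSet, B ξ ^ 2
      ≤ ENNReal.ofReal (4 * C₂ ^ 2 * 4 ^ 5 * M ^ 2 * (rho t ^ 10 * V ^ 2)) := by
    have hwm : Measurable fun s => ENNReal.ofReal (2 * C₂ * rho (t - s) ^ (2 * j)) := by
      have : Measurable fun s => rho (t - s) := measurable_rho.comp (by fun_prop)
      fun_prop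
    have h1 := lintegral_lintegral_mul_sq_le (μ := volume.restrict lowSet)
      (w := fun s => ENNReal.ofReal (2 * C₂ * rho (t - s) ^ (2 * j)))
      (G := fun s ξ => kn ξ * ‖η s ξ‖ₑ) hwm h.measurable_kn_mul
      (measurableSet_Ioc (a := t / 2) (b := t)) (B := ENNReal.ofReal ((M * (2 * rho t) ^ 5) ^ 2))
      (fun s hs => (setLIntegral_le_lintegral _ _).trans
        ((h.deriv s (by linarith [hs.1])).trans (ENNReal.ofReal_le_ofReal (by
          have h2 := rho_half_le ht hs.1.le
          have h3 := rho_pos (t := s) (by linarith [hs.1])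
          gcongr))))
    refine h1.trans ?_
    have h2 : ∫⁻ s in Set.Ioc (t / 2) t, ENNReal.ofReal (2 * C₂ * rho (t - s) ^ (2 * j))
        ≤ ENNReal.ofReal (2 * C₂ * V) := by
      rw [setLIntegral_comp_sub_left (fun s => ENNReal.ofReal (2 * C₂ * rho s ^ (2 * j)))]
      simp only [ENNReal.ofReal_mul (show 0 ≤ 2 * C₂ by positivity)]
      rw [lintegral_const_mul' _ _ ENNReal.ofReal_ne_top]
      exact mul_le_mul_right hV _
    refine (mul_le_mul' (pow_le_pow_left' h2 2) le_rfl).trans (le_of_eq ?_)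
    rw [← ENNReal.ofReal_pow (by positivity), ← ENNReal.ofReal_mul (by positivity)]
    congr 1
    ring
  calc _ ≤ ∫⁻ ξ in lowSet, 4 * ((kn ξ ^ j * ENNReal.ofReal (A ξ)) ^ 2 + B ξ ^ 2) :=
        lintegral_mono_ae hpt
    _ ≤ 4 * (ENNReal.ofReal ((8 * C₀ + 512 * C₁) * M ^ 2 * rho t ^ (4 * j + 2)) +
        ENNReal.ofReal (4 * C₂ ^ 2 * 4 ^ 5 * M ^ 2 * (rho t ^ 10 * V ^ 2))) := by
        rw [lintegral_const_mul' _ _ (by norm_num), lintegral_add_left]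
        · gcongr
        · have := measurable_kn
          fun_prop
    _ ≤ _ := by
        rw [← ENNReal.ofReal_add (by positivity) (by positivity),
          show (4 : ℝ≥0∞) = ENNReal.ofReal 4 by norm_num, ← ENNReal.ofReal_mul (by norm_num)]
        refine ENNReal.ofReal_le_ofReal ?_
        have e1 : 0 ≤ (8 * C₀ + 512 * C₁) * M ^ 2 * (rho t ^ 10 * V ^ 2) := by positivity
        have e2 : 0 ≤ C₂ ^ 2 * M ^ 2 * rho t ^ (4 * j + 2) := by positivity
        nlinarith

end PSystem

namespace PSystem

/-! ### High frequencies -/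

namespace IsFlow

variable {k : ℝ} {η α β : ℝ → ℂ}

theorem const_mul (c : ℂ) (h : IsFlow k η α β) :
    IsFlow k (fun t => c * η t) (fun t => c * α t) (fun t => c * β t) where
  left t := ((h.left t).const_mul c).congr_deriv (by ring)
  right t := ((h.right t).const_mul c).congr_deriv (by ring)

theorem continuous_right (h : IsFlow k η α β) : Continuous β :=
  continuous_iff_continuousAt.2 fun t => (h.right t).continuousAt

theorem continuous_left (h : IsFlow k η α β) : Continuous α :=
  continuous_iff_continuousAt.2 fun t => (h.left t).continuousAt

theorem ofReal_norm_sq_add (a b : ℂ) :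
    ENNReal.ofReal (‖a‖ ^ 2 + ‖b‖ ^ 2) = ‖a‖ₑ ^ 2 + ‖b‖ₑ ^ 2 := by
  rw [ENNReal.ofReal_add (by positivity) (by positivity), ofReal_norm_sq, ofReal_norm_sq]

theorem enorm_decay_high (h : IsFlow k η α β) (hη : Continuous η) (hk : 1 ≤ |k|) {t : ℝ}
    (ht : 0 ≤ t) :
    ‖α t‖ₑ ^ 2 + ‖β t‖ₑ ^ 2 ≤ ENNReal.ofReal (3 * Real.exp (-t / 6)) * (‖α 0‖ₑ ^ 2 + ‖β 0‖ₑ ^ 2)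
      + ∫⁻ s in Set.Ioc 0 t, ENNReal.ofReal (6 * Real.exp (-(t - s) / 6)) * ‖η s‖ₑ ^ 2 := by
  have h1 := h.decay_high hη hk ht
  rw [sub_zero] at h1
  have h2 := ENNReal.ofReal_le_ofReal h1
  rw [ofReal_norm_sq_add] at h2
  refine h2.trans (ENNReal.ofReal_add_le.trans (add_le_add (le_of_eq ?_) (le_of_eq ?_)))
  · rw [ENNReal.ofReal_mul (by positivity), ofReal_norm_sq_add]
  · rw [← intervalIntegral.integral_const_mul, ofReal_intervalIntegral (by fun_prop) ht
      (fun s => by positivity)]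
    refine lintegral_congr fun s => ?_
    rw [← mul_assoc, ENNReal.ofReal_mul (by positivity), ofReal_norm_sq]

theorem enorm_energy_le (h : IsFlow k η α β) (hη : Continuous η) {t₀ t : ℝ} (ht : t₀ ≤ t) :
    ‖α t‖ₑ ^ 2 + ‖β t‖ₑ ^ 2 + ∫⁻ s in Set.Ioc t₀ t, (‖k‖ₑ * ‖β s‖ₑ) ^ 2
      ≤ ‖α t₀‖ₑ ^ 2 + ‖β t₀‖ₑ ^ 2 + ∫⁻ s in Set.Ioc t₀ t, ‖η s‖ₑ ^ 2 := by
  have hβ := h.continuous_right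
  have h2 := ENNReal.ofReal_le_ofReal (h.energy_le hη hβ ht)
  have hn : ∀ φ : ℝ → ℝ, (∀ s, 0 ≤ φ s) → 0 ≤ ∫ s in t₀..t, φ s := fun φ hφ =>
    intervalIntegral.integral_nonneg ht fun s _ => hφ s
  rw [ENNReal.ofReal_add (by positivity) (hn _ fun s => by positivity),
    ENNReal.ofReal_add (by positivity) (hn _ fun s => by positivity), ofReal_norm_sq_add,
    ofReal_norm_sq_add, ofReal_intervalIntegral (by fun_prop) ht (fun s => by positivity),
    ofReal_intervalIntegral (by fun_prop) ht (fun s => by positivity)] at h2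
  refine le_trans (le_of_eq ?_) (h2.trans (le_of_eq ?_))
  · congr 1
    refine lintegral_congr fun s => ?_
    rw [ENNReal.ofReal_mul (by positivity), mul_pow, ofReal_norm_sq, ← sq_abs k,
      ← Real.norm_eq_abs, ofReal_norm_sq]
  · simp only [ofReal_norm_sq]

theorem enorm_sq_le (h : IsFlow k η α β) (hη : Continuous η) {t : ℝ} (ht : 0 ≤ t) :
    ‖α t‖ₑ ^ 2 + ‖β t‖ₑ ^ 2 ≤ ENNReal.ofReal 1 * (‖α 0‖ₑ ^ 2 + ‖β 0‖ₑ ^ 2)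
      + ∫⁻ s in Set.Ioc 0 t, ENNReal.ofReal 1 * ‖η s‖ₑ ^ 2 := by
  simpa using le_self_add.trans (h.enorm_energy_le hη ht)

/-- An estimate of flows by data and forcing passes to the time derivative. -/
theorem enorm_deriv_le (h : IsFlow k η α β) (hη : Continuous η) {t a : ℝ} {e : ℝ → ℝ}
    (H : ∀ {η α β : ℝ → ℂ}, IsFlow k η α β → Continuous η →
      ‖α t‖ₑ ^ 2 + ‖β t‖ₑ ^ 2 ≤ ENNReal.ofReal a * (‖α 0‖ₑ ^ 2 + ‖β 0‖ₑ ^ 2)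
        + ∫⁻ s in Set.Ioc 0 t, ENNReal.ofReal (e s) * ‖η s‖ₑ ^ 2) :
    ‖deriv α t‖ₑ ^ 2 + ‖deriv β t‖ₑ ^ 2
      ≤ ENNReal.ofReal a * (‖deriv α 0‖ₑ ^ 2 + ‖deriv β 0‖ₑ ^ 2)
        + liminf (fun n : ℕ => ∫⁻ s in Set.Ioc 0 t, ENNReal.ofReal (e s) *
          (ENNReal.ofReal ((n : ℝ) + 1) * ‖η (s + ((n : ℝ) + 1)⁻¹) - η s‖ₑ) ^ 2) atTop := by
  set δ : ℕ → ℝ := fun n => ((n : ℝ) + 1)⁻¹ with hδ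
  have hδ0 : ∀ n, 0 < δ n := fun n => by positivity
  have hδt : Tendsto δ atTop (𝓝[≠] 0) := by
    refine tendsto_nhdsWithin_iff.2 ⟨?_, .of_forall fun n => (hδ0 n).ne'⟩
    simpa [hδ, one_div] using tendsto_one_div_add_atTop_nhds_zero_nat (𝕜 := ℝ)
  have hq : ∀ {γ : ℝ → ℂ}, Differentiable ℝ γ → ∀ s, Tendsto
      (fun n => (((δ n)⁻¹ : ℝ) : ℂ) * (γ (s + δ n) - γ s)) atTop (𝓝 (deriv γ s)) := by
    intro γ hγ s
    have h1 := (hasDerivAt_iff_tendsto_slope_zero.1 (hγ s).hasDerivAt).comp hδt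
    refine h1.congr fun n => ?_
    simp [Complex.real_smul]
  have hdα : Differentiable ℝ α := fun t => (h.left t).differentiableAt
  have hdβ : Differentiable ℝ β := fun t => (h.right t).differentiableAt
  have hN : ∀ s, Tendsto (fun n => ‖(((δ n)⁻¹ : ℝ) : ℂ) * (α (s + δ n) - α s)‖ₑ ^ 2
      + ‖(((δ n)⁻¹ : ℝ) : ℂ) * (β (s + δ n) - β s)‖ₑ ^ 2) atTop
      (𝓝 (‖deriv α s‖ₑ ^ 2 + ‖deriv β s‖ₑ ^ 2)) := fun s =>
    (((ENNReal.continuous_pow 2).tendsto _).comp (hq hdα s).enorm).add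
      (((ENNReal.continuous_pow 2).tendsto _).comp (hq hdβ s).enorm)
  have hflow : ∀ n, IsFlow k (fun s => (((δ n)⁻¹ : ℝ) : ℂ) * (η (s + δ n) - η s))
      (fun s => (((δ n)⁻¹ : ℝ) : ℂ) * (α (s + δ n) - α s))
      (fun s => (((δ n)⁻¹ : ℝ) : ℂ) * (β (s + δ n) - β s)) := fun n =>
    ((h.shift (δ n)).sub h).const_mul _
  set I : ℕ → ℝ≥0∞ := fun n => ∫⁻ s in Set.Ioc 0 t, ENNReal.ofReal (e s) *
          (ENNReal.ofReal ((n : ℝ) + 1) * ‖η (s + ((n : ℝ) + 1)⁻¹) - η s‖ₑ) ^ 2 with hI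
  have hle : ∀ n, _ := fun n => H (hflow n) (by fun_prop)
  have hIn : ∀ n, ∫⁻ s in Set.Ioc 0 t, ENNReal.ofReal (e s) *
      ‖(((δ n)⁻¹ : ℝ) : ℂ) * (η (s + δ n) - η s)‖ₑ ^ 2 = I n := by
    intro n
    refine lintegral_congr fun s => ?_
    rw [enorm_mul, ← ofReal_norm ((((δ n)⁻¹ : ℝ) : ℂ)), Complex.norm_real, Real.norm_eq_abs,
      abs_of_pos (inv_pos.2 (hδ0 n))]
    simp [hδ]
  refine ENNReal.le_of_forall_pos_le_add fun ε hε _ => ?_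
  have hR : Tendsto (fun n => ENNReal.ofReal a *
      (‖(((δ n)⁻¹ : ℝ) : ℂ) * (α (0 + δ n) - α 0)‖ₑ ^ 2
      + ‖(((δ n)⁻¹ : ℝ) : ℂ) * (β (0 + δ n) - β 0)‖ₑ ^ 2)) atTop
      (𝓝 (ENNReal.ofReal a * (‖deriv α 0‖ₑ ^ 2 + ‖deriv β 0‖ₑ ^ 2))) :=
    ENNReal.Tendsto.const_mul (hN 0) (Or.inr ENNReal.ofReal_ne_top)
  have hfin : ENNReal.ofReal a * (‖deriv α 0‖ₑ ^ 2 + ‖deriv β 0‖ₑ ^ 2) ≠ ⊤ :=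
    ENNReal.mul_ne_top ENNReal.ofReal_ne_top (ENNReal.add_ne_top.2
      ⟨ENNReal.pow_ne_top enorm_ne_top, ENNReal.pow_ne_top enorm_ne_top⟩)
  have hev := hR.eventually (eventually_le_nhds
    (ENNReal.lt_add_right hfin (ENNReal.coe_ne_zero.2 hε.ne')))
  rw [← (hN t).liminf_eq, add_right_comm]
  refine (liminf_le_liminf (v := fun n => (ENNReal.ofReal a *
    (‖deriv α 0‖ₑ ^ 2 + ‖deriv β 0‖ₑ ^ 2) + ε) + I n) ?_).trans (le_of_eq ?_)
  · filter_upwards [hev] with n hn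
    exact (hle n).trans (add_le_add hn (hIn n).le)
  · exact liminf_const_add atTop I _ (by isBoundedDefault) (by isBoundedDefault)

end IsFlow

variable {M : ℝ} {Z₀ : ℝ → VC} {η : ℝ → ℝ → ℂ}

theorem enormVC_sq (v : VC) : ‖v‖ₑ ^ 2 = ‖v 0‖ₑ ^ 2 + ‖v 1‖ₑ ^ 2 := by
  rw [← ofReal_norm_sq, normVC_sq, IsFlow.ofReal_norm_sq_add]

theorem enormVC_apply_le (v : VC) (i : Fin 2) : ‖v i‖ₑ ≤ ‖v‖ₑ := by
  refine (ENNReal.pow_le_pow_left_iff two_ne_zero).1 ?_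
  rw [enormVC_sq]
  fin_cases i
  · exact le_self_add
  · exact le_add_self

theorem Forcing.nonneg (h : Forcing M η) : 0 ≤ M := by
  have := (norm_nonneg _).trans (h.sup 0 le_rfl 0)
  simpa [rho_zero] using this

/-- Squares of time increments of the forcing, divided by the square of the step. -/
theorem Forcing.lintegral_quotient (h : Forcing M η) (n : ℕ) {t : ℝ} (ht : 0 ≤ t) :
    ∫⁻ s in Set.Ioc t (t + 1), ∫⁻ ξ, (ENNReal.ofReal ((n : ℝ) + 1) *
      ‖η (s + ((n : ℝ) + 1)⁻¹) ξ - η s ξ‖ₑ) ^ 2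
      ≤ ENNReal.ofReal (M ^ 2) * ENNReal.ofReal (rho t ^ 10) := by
  have hn : (0 : ℝ) < (n : ℝ) + 1 := by positivity
  have h1 := h.diff ((n : ℝ) + 1)⁻¹ (by positivity) (inv_le_one_of_one_le₀ (by simp)) t ht
  simp only [mul_pow]
  have hne : ENNReal.ofReal ((n : ℝ) + 1) ^ 2 ≠ ⊤ := ENNReal.pow_ne_top ENNReal.ofReal_ne_top
  simp only [lintegral_const_mul' _ _ hne]
  refine (mul_le_mul_right h1 _).trans (le_of_eq ?_)
  rw [← ENNReal.ofReal_pow hn.le, ← ENNReal.ofReal_mul (by positivity),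
    ← ENNReal.ofReal_mul (by positivity)]
  congr 1
  field_simp

theorem Forcing.measurable_quotient (h : Forcing M η) (n : ℕ) :
    Measurable fun p : ℝ × ℝ => (ENNReal.ofReal ((n : ℝ) + 1) *
      ‖η (p.1 + ((n : ℝ) + 1)⁻¹) p.2 - η p.1 p.2‖ₑ) ^ 2 := by
  have h1 : Continuous fun p : ℝ × ℝ => η (p.1 + ((n : ℝ) + 1)⁻¹) p.2 :=
    h.cont.comp (by fun_prop : Continuous fun p : ℝ × ℝ => ((p.1 + ((n : ℝ) + 1)⁻¹, p.2) : ℝ × ℝ))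
  have h2 : Continuous fun p : ℝ × ℝ => η p.1 p.2 := h.cont
  exact ((h1.sub h2).measurable.enorm.const_mul _).pow_const 2

/-- The exponential average of a forcing, integrated over the frequencies. -/
theorem lintegral_conv_le : ∃ C : ℝ, 0 < C ∧ ∀ (G : ℝ → ℝ → ℝ≥0∞) (A : ℝ≥0∞),
    Measurable (Function.uncurry G) →
    (∀ t, 0 ≤ t → ∫⁻ s in Set.Ioc t (t + 1), ∫⁻ ξ, G s ξ ≤ A * ENNReal.ofReal (rho t ^ 10)) →
    ∀ t, 0 ≤ t → ∫⁻ ξ, ∫⁻ s in Set.Ioc 0 t, ENNReal.ofReal (6 * Real.exp (-(t - s) / 6)) * G s ξ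
      ≤ ENNReal.ofReal C * A * ENNReal.ofReal (rho t ^ 10) := by
  obtain ⟨C, hC, hconv⟩ := lintegral_exp_mul_le
  refine ⟨6 * C, by positivity, fun G A hm hG t ht => ?_⟩
  have h1 := hconv (fun s => ∫⁻ ξ, G s ξ) A hG t ht
  rw [lintegral_lintegral_swap]
  · calc _ = ∫⁻ s in Set.Ioc 0 t, ENNReal.ofReal 6 *
          (ENNReal.ofReal (Real.exp (-(t - s) / 6)) * ∫⁻ ξ, G s ξ) := by
          refine lintegral_congr fun s => ?_
          rw [lintegral_const_mul' _ _ ENNReal.ofReal_ne_top,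
            ENNReal.ofReal_mul (by norm_num), mul_assoc]
      _ ≤ _ := by
          rw [lintegral_const_mul' _ _ ENNReal.ofReal_ne_top, ENNReal.ofReal_mul (by norm_num),
            mul_assoc, mul_assoc]
          rw [mul_assoc] at h1
          exact mul_le_mul_right h1 _
  · refine Measurable.aemeasurable ?_
    have : Measurable fun p : ℝ × ℝ => G p.2 p.1 := hm.comp measurable_swap
    exact Measurable.mul (by fun_prop) this

theorem duhamel_high_one : ∃ C : ℝ, 0 < C ∧ ∀ {M : ℝ} {Z₀ : ℝ → VC} {η : ℝ → ℝ → ℂ},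
    Forcing M η → DataBound M Z₀ → ∀ t, 0 ≤ t →
    ∫⁻ ξ in lowSetᶜ, (kn ξ * ‖duhamel Z₀ η t ξ‖ₑ) ^ 2
      ≤ ENNReal.ofReal (C * M ^ 2 * rho t ^ 10) := by
  obtain ⟨C₁, hC₁, hexp⟩ := exp_neg_le_rho
  obtain ⟨C₂, hC₂, hconv⟩ := lintegral_conv_le
  refine ⟨3 * C₁ + C₂, by positivity, fun {M Z₀ η} h hZ t ht => ?_⟩
  have hr := rho_pos ht
  have h1 := hconv (fun s ξ => (kn ξ * ‖η s ξ‖ₑ) ^ 2) (ENNReal.ofReal (M ^ 2))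
    (h.measurable_kn_mul.pow_const 2) (fun s hs => by
      calc _ ≤ ∫⁻ u in Set.Ioc s (s + 1), ENNReal.ofReal ((M * rho s ^ 5) ^ 2) := by
            refine setLIntegral_mono' measurableSet_Ioc fun u hu => ?_
            have hu0 : 0 ≤ u := hs.trans hu.1.le
            have h2 := rho_pos hu0
            have h3 := rho_anti hs hu.1.le
            have := h.nonneg
            exact (h.deriv u hu0).trans (ENNReal.ofReal_le_ofReal (by gcongr))
        _ = _ := by
            rw [setLIntegral_const, Real.volume_Ioc, add_sub_cancel_left, ENNReal.ofReal_one,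
              mul_one, ← ENNReal.ofReal_mul (by positivity)]
            congr 1; ring) t ht
  calc _ ≤ ∫⁻ ξ in lowSetᶜ, (ENNReal.ofReal (3 * Real.exp (-t / 6)) * (kn ξ * ‖Z₀ ξ‖ₑ) ^ 2 +
        ∫⁻ s in Set.Ioc 0 t, ENNReal.ofReal (6 * Real.exp (-(t - s) / 6)) *
          (kn ξ * ‖η s ξ‖ₑ) ^ 2) := by
        refine setLIntegral_mono' measurableSet_lowSet.compl fun ξ hξ => ?_
        have h2 := (isFlow_duhamel Z₀ h.cont ξ).enorm_decay_high (h.cont_time ξ)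
          (abs_of_mem_compl_lowSet hξ) ht
        rw [← enormVC_sq, ← enormVC_sq, duhamel_zero] at h2
        rw [mul_pow, mul_pow]
        refine (mul_le_mul_right h2 _).trans (le_of_eq ?_)
        rw [mul_add, ← lintegral_const_mul' _ _ (ENNReal.pow_ne_top (kn_ne_top ξ))]
        congr 1
        · ring
        · refine lintegral_congr fun s => ?_
          ring
    _ ≤ ∫⁻ ξ, (ENNReal.ofReal (3 * Real.exp (-t / 6)) * (kn ξ * ‖Z₀ ξ‖ₑ) ^ 2 +
        ∫⁻ s in Set.Ioc 0 t, ENNReal.ofReal (6 * Real.exp (-(t - s) / 6)) *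
          (kn ξ * ‖η s ξ‖ₑ) ^ 2) := setLIntegral_le_lintegral _ _
    _ ≤ ENNReal.ofReal (3 * Real.exp (-t / 6)) * ENNReal.ofReal (M ^ 2) +
        ENNReal.ofReal C₂ * ENNReal.ofReal (M ^ 2) * ENNReal.ofReal (rho t ^ 10) := by
        rw [lintegral_add_left, lintegral_const_mul' _ _ ENNReal.ofReal_ne_top]
        · exact add_le_add (mul_le_mul_right hZ.one _) h1
        · have := measurable_kn
          have := hZ.meas
          fun_prop
    _ ≤ _ := by
        rw [← ENNReal.ofReal_mul (by positivity), ← ENNReal.ofReal_mul (by positivity),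
          ← ENNReal.ofReal_mul (by positivity), ← ENNReal.ofReal_add (by positivity) (by positivity)]
        refine ENNReal.ofReal_le_ofReal ?_
        nlinarith [mul_le_mul_of_nonneg_right (hexp t ht) (sq_nonneg M)]

theorem measurable_duhamel_right (hZ : Measurable Z₀) (hη : Continuous (Function.uncurry η))
    (t : ℝ) : Measurable fun ξ => duhamel Z₀ η t ξ :=
  Measurable.comp (g := fun p : ℝ × ℝ => duhamel Z₀ η p.1 p.2) (f := fun ξ : ℝ => (t, ξ))
    (measurable_duhamel hZ hη) (by fun_prop)

/-- The components of the time derivative of Duhamel's formula. -/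
theorem deriv_duhamel_zero (hη : Continuous (Function.uncurry η)) (t ξ : ℝ) :
    deriv (fun s => duhamel Z₀ η s ξ 0) t
      = Complex.I * ((2 * Real.pi * ξ : ℝ) : ℂ) * duhamel Z₀ η t ξ 1 :=
  ((isFlow_duhamel Z₀ hη ξ).left t).deriv

theorem deriv_duhamel_one (hη : Continuous (Function.uncurry η)) (t ξ : ℝ) :
    deriv (fun s => duhamel Z₀ η s ξ 1) t
      = Complex.I * ((2 * Real.pi * ξ : ℝ) : ℂ) * duhamel Z₀ η t ξ 0
        - 2 * ((2 * Real.pi * ξ : ℝ) : ℂ) ^ 2 * duhamel Z₀ η t ξ 1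
        + Complex.I * ((2 * Real.pi * ξ : ℝ) : ℂ) * η t ξ :=
  ((isFlow_duhamel Z₀ hη ξ).right t).deriv

theorem enorm_ofReal_k (ξ : ℝ) : ‖((2 * Real.pi * ξ : ℝ) : ℂ)‖ₑ = kn ξ := by
  rw [kn, ← ofReal_norm, Complex.norm_real, ofReal_norm]

theorem enorm_deriv_duhamel_zero (hη : Continuous (Function.uncurry η)) (t ξ : ℝ) :
    ‖deriv (fun s => duhamel Z₀ η s ξ 0) t‖ₑ = kn ξ * ‖duhamel Z₀ η t ξ 1‖ₑ := by
  have hI : ‖Complex.I‖ₑ = 1 := by rw [← ofReal_norm]; simp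
  rw [deriv_duhamel_zero hη, enorm_mul, enorm_mul, enorm_ofReal_k, hI, one_mul]

theorem enorm_deriv_duhamel_one_le (hη : Continuous (Function.uncurry η)) (t ξ : ℝ) :
    ‖deriv (fun s => duhamel Z₀ η s ξ 1) t‖ₑ ≤ kn ξ * ‖duhamel Z₀ η t ξ 0‖ₑ
      + 2 * (kn ξ ^ 2 * ‖duhamel Z₀ η t ξ 1‖ₑ) + kn ξ * ‖η t ξ‖ₑ := by
  have hI : ‖Complex.I‖ₑ = 1 := by rw [← ofReal_norm]; simp
  have h2 : ‖(2 : ℂ)‖ₑ = 2 := by rw [← ofReal_norm]; simp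
  rw [deriv_duhamel_one hη]
  refine (enorm_add_le _ _).trans (add_le_add (enorm_sub_le.trans (add_le_add ?_ ?_)) ?_) <;>
  simp only [enorm_mul, enorm_pow, enorm_ofReal_k, hI, h2, one_mul] <;> simp [mul_assoc]

theorem kn_sq_mul_enorm_le (ξ : ℝ) {a b e w : ℂ}
    (hw : w = Complex.I * ((2 * Real.pi * ξ : ℝ) : ℂ) * a - 2 * ((2 * Real.pi * ξ : ℝ) : ℂ) ^ 2 * b
      + Complex.I * ((2 * Real.pi * ξ : ℝ) : ℂ) * e) :
    kn ξ ^ 2 * ‖b‖ₑ ≤ ‖w‖ₑ + (kn ξ * ‖a‖ₑ + kn ξ * ‖e‖ₑ) := by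
  have hI : ‖Complex.I‖ₑ = 1 := by rw [← ofReal_norm]; simp
  have h2 : ‖(2 : ℂ)‖ₑ = 2 := by rw [← ofReal_norm]; simp
  have h3 := congrArg (fun z : ℂ => ‖z‖ₑ) (show 2 * ((2 * Real.pi * ξ : ℝ) : ℂ) ^ 2 * b
      = (Complex.I * ((2 * Real.pi * ξ : ℝ) : ℂ) * a + Complex.I * ((2 * Real.pi * ξ : ℝ) : ℂ) * e)
        - w by rw [hw]; ring)
  simp only [enorm_mul, enorm_pow, enorm_ofReal_k, h2] at h3
  calc _ ≤ 2 * kn ξ ^ 2 * ‖b‖ₑ := by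
        rw [mul_assoc]
        exact le_mul_of_one_le_left' (by norm_num)
    _ ≤ _ := by
        rw [h3]
        refine enorm_sub_le.trans ?_
        rw [add_comm]
        refine add_le_add le_rfl ((enorm_add_le _ _).trans (le_of_eq ?_))
        simp only [enorm_mul, enorm_ofReal_k, hI, one_mul]

theorem DataBound.lintegral_deriv_le (hZ : DataBound M Z₀) (h : Forcing M η) :
    ∫⁻ ξ, (‖deriv (fun s => duhamel Z₀ η s ξ 0) 0‖ₑ ^ 2
      + ‖deriv (fun s => duhamel Z₀ η s ξ 1) 0‖ₑ ^ 2) ≤ 100 * ENNReal.ofReal (M ^ 2) := by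
  have hk := measurable_kn
  have hm := hZ.meas
  have hη := h.cont
  have hη0 : Measurable fun ξ => η 0 ξ := (hη.comp (by fun_prop : Continuous fun ξ : ℝ =>
    ((0, ξ) : ℝ × ℝ))).measurable
  have h0 := h.deriv 0 le_rfl
  rw [rho_zero] at h0
  simp only [one_pow, mul_one] at h0
  calc _ ≤ ∫⁻ ξ, (17 * (kn ξ * ‖Z₀ ξ‖ₑ) ^ 2 + (64 * (kn ξ ^ 2 * ‖Z₀ ξ 1‖ₑ) ^ 2
        + 4 * (kn ξ * ‖η 0 ξ‖ₑ) ^ 2)) := by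
        refine lintegral_mono fun ξ => ?_
        have h1 := enorm_deriv_duhamel_one_le (Z₀ := Z₀) hη 0 ξ
        rw [enorm_deriv_duhamel_zero hη, duhamel_zero]
        rw [duhamel_zero] at h1
        have ha := enormVC_apply_le (Z₀ ξ) 0
        have hb := enormVC_apply_le (Z₀ ξ) 1
        calc _ ≤ (kn ξ * ‖Z₀ ξ‖ₑ) ^ 2 + (kn ξ * ‖Z₀ ξ‖ₑ
              + 2 * (kn ξ ^ 2 * ‖Z₀ ξ 1‖ₑ) + kn ξ * ‖η 0 ξ‖ₑ) ^ 2 := by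
              refine add_le_add (by gcongr) (pow_le_pow_left' (h1.trans ?_) 2)
              gcongr
          _ ≤ (kn ξ * ‖Z₀ ξ‖ₑ) ^ 2 + 4 * (4 * ((kn ξ * ‖Z₀ ξ‖ₑ) ^ 2
              + (2 * (kn ξ ^ 2 * ‖Z₀ ξ 1‖ₑ)) ^ 2) + (kn ξ * ‖η 0 ξ‖ₑ) ^ 2) := by
              refine add_le_add le_rfl ((ennreal_add_sq_le _ _).trans ?_)
              gcongr
              exact ennreal_add_sq_le _ _
          _ = _ := by ring
    _ ≤ 17 * ENNReal.ofReal (M ^ 2) + (64 * ENNReal.ofReal (M ^ 2)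
        + 4 * ENNReal.ofReal (M ^ 2)) := by
        rw [lintegral_add_left (by fun_prop), lintegral_add_left (by fun_prop),
          lintegral_const_mul' _ _ (by norm_num), lintegral_const_mul' _ _ (by norm_num),
          lintegral_const_mul' _ _ (by norm_num)]
        gcongr
        · exact hZ.one
        · exact hZ.two
    _ ≤ _ := by
        rw [← add_mul, ← add_mul]
        gcongr
        norm_num

theorem duhamel_high_two : ∃ C : ℝ, 0 < C ∧ ∀ {M : ℝ} {Z₀ : ℝ → VC} {η : ℝ → ℝ → ℂ},
    Forcing M η → DataBound M Z₀ → ∀ t, 0 ≤ t →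
    ∫⁻ ξ in lowSetᶜ, (kn ξ ^ 2 * ‖duhamel Z₀ η t ξ 1‖ₑ) ^ 2
      ≤ ENNReal.ofReal (C * M ^ 2 * rho t ^ 10) := by
  obtain ⟨C₁, hC₁, hexp⟩ := exp_neg_le_rho
  obtain ⟨C₂, hC₂, hconv⟩ := lintegral_conv_le
  obtain ⟨C₃, hC₃, hone⟩ := duhamel_high_one
  refine ⟨4 * ((300 * C₁ + C₂) + 4 * (C₃ + 1)), by positivity, fun {M Z₀ η} h hZ t ht => ?_⟩
  have hr := rho_pos ht
  have hk := measurable_kn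
  set I : ℕ → ℝ → ℝ≥0∞ := fun n ξ => ∫⁻ s in Set.Ioc 0 t,
    ENNReal.ofReal (6 * Real.exp (-(t - s) / 6)) *
      (ENNReal.ofReal ((n : ℝ) + 1) * ‖η (s + ((n : ℝ) + 1)⁻¹) ξ - η s ξ‖ₑ) ^ 2 with hI
  have hIm : ∀ n, Measurable (I n) := fun n => by
    have : Measurable fun p : ℝ × ℝ => ENNReal.ofReal (6 * Real.exp (-(t - p.2) / 6)) *
      (ENNReal.ofReal ((n : ℝ) + 1) * ‖η (p.2 + ((n : ℝ) + 1)⁻¹) p.1 - η p.2 p.1‖ₑ) ^ 2 :=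
      Measurable.mul (by fun_prop) ((h.measurable_quotient n).comp measurable_swap)
    exact this.lintegral_prod_right'
  have hIle : ∀ n, ∫⁻ ξ, I n ξ ≤ ENNReal.ofReal C₂ * ENNReal.ofReal (M ^ 2) *
      ENNReal.ofReal (rho t ^ 10) := fun n =>
    hconv (fun s ξ => (ENNReal.ofReal ((n : ℝ) + 1) *
      ‖η (s + ((n : ℝ) + 1)⁻¹) ξ - η s ξ‖ₑ) ^ 2) _ (h.measurable_quotient n)
      (fun s hs => h.lintegral_quotient n hs) t ht
  have hw : ∫⁻ ξ in lowSetᶜ, ‖deriv (fun s => duhamel Z₀ η s ξ 1) t‖ₑ ^ 2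
      ≤ ENNReal.ofReal ((300 * C₁ + C₂) * M ^ 2 * rho t ^ 10) := by
    calc _ ≤ ∫⁻ ξ in lowSetᶜ, (liminf (fun n => I n ξ) atTop +
          ENNReal.ofReal (3 * Real.exp (-t / 6)) * (‖deriv (fun s => duhamel Z₀ η s ξ 0) 0‖ₑ ^ 2
          + ‖deriv (fun s => duhamel Z₀ η s ξ 1) 0‖ₑ ^ 2)) := by
          refine setLIntegral_mono' measurableSet_lowSet.compl fun ξ hξ => ?_
          have h2 := (isFlow_duhamel Z₀ h.cont ξ).enorm_deriv_le (h.cont_time ξ) (t := t)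
            fun hf hc => hf.enorm_decay_high hc (abs_of_mem_compl_lowSet hξ) ht
          rw [add_comm] at h2
          exact le_self_add.trans (h2.trans (add_comm _ _).le)
      _ ≤ ∫⁻ ξ, (liminf (fun n => I n ξ) atTop +
          ENNReal.ofReal (3 * Real.exp (-t / 6)) * (‖deriv (fun s => duhamel Z₀ η s ξ 0) 0‖ₑ ^ 2
          + ‖deriv (fun s => duhamel Z₀ η s ξ 1) 0‖ₑ ^ 2)) := setLIntegral_le_lintegral _ _
      _ ≤ ENNReal.ofReal C₂ * ENNReal.ofReal (M ^ 2) * ENNReal.ofReal (rho t ^ 10) +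
          ENNReal.ofReal (3 * Real.exp (-t / 6)) * (100 * ENNReal.ofReal (M ^ 2)) := by
          rw [lintegral_add_left (Measurable.liminf hIm),
            lintegral_const_mul' _ _ ENNReal.ofReal_ne_top]
          refine add_le_add ?_ (mul_le_mul_right (hZ.lintegral_deriv_le h) _)
          refine (lintegral_liminf_le hIm).trans ?_
          exact (liminf_le_liminf (.of_forall hIle)).trans (liminf_const _).le
      _ ≤ _ := by
          rw [show (100 : ℝ≥0∞) = ENNReal.ofReal 100 by norm_num]
          rw [← ENNReal.ofReal_mul (by positivity), ← ENNReal.ofReal_mul (by positivity),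
            ← ENNReal.ofReal_mul (by positivity), ← ENNReal.ofReal_mul (by positivity),
            ← ENNReal.ofReal_add (by positivity) (by positivity)]
          refine ENNReal.ofReal_le_ofReal ?_
          nlinarith [mul_le_mul_of_nonneg_right (hexp t ht) (sq_nonneg M)]
  have hη : Measurable fun ξ => kn ξ * ‖η t ξ‖ₑ := by
    have : Continuous fun ξ => η t ξ := h.cont.comp (by fun_prop :
      Continuous fun ξ : ℝ => ((t, ξ) : ℝ × ℝ))
    fun_prop
  have hd : ∫⁻ ξ in lowSetᶜ, (kn ξ * ‖η t ξ‖ₑ) ^ 2 ≤ ENNReal.ofReal (M ^ 2 * rho t ^ 10) :=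
    (setLIntegral_le_lintegral _ _).trans ((h.deriv t ht).trans (le_of_eq (by congr 1; ring)))
  calc _ ≤ ∫⁻ ξ in lowSetᶜ, 4 * (4 * ((kn ξ * ‖η t ξ‖ₑ) ^ 2 + (kn ξ * ‖duhamel Z₀ η t ξ‖ₑ) ^ 2)
        + ‖deriv (fun s => duhamel Z₀ η s ξ 1) t‖ₑ ^ 2) := by
        refine lintegral_mono fun ξ => ?_
        have h1 := kn_sq_mul_enorm_le ξ (deriv_duhamel_one (Z₀ := Z₀) h.cont t ξ)
        have h2 : kn ξ ^ 2 * ‖duhamel Z₀ η t ξ 1‖ₑ ≤ (kn ξ * ‖η t ξ‖ₑ +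
            kn ξ * ‖duhamel Z₀ η t ξ‖ₑ) + ‖deriv (fun s => duhamel Z₀ η s ξ 1) t‖ₑ := by
          refine h1.trans ?_
          rw [add_comm, add_comm (kn ξ * ‖η t ξ‖ₑ)]
          gcongr
          exact enormVC_apply_le _ 0
        refine (pow_le_pow_left' h2 2).trans ((ennreal_add_sq_le _ _).trans ?_)
        gcongr
        exact ennreal_add_sq_le _ _
    _ ≤ 4 * (4 * (ENNReal.ofReal (M ^ 2 * rho t ^ 10) + ENNReal.ofReal (C₃ * M ^ 2 * rho t ^ 10)) +
        ENNReal.ofReal ((300 * C₁ + C₂) * M ^ 2 * rho t ^ 10)) := by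
        have hdm : Measurable fun ξ => duhamel Z₀ η t ξ :=
          measurable_duhamel_right hZ.meas h.cont t
        rw [lintegral_const_mul' _ _ (by norm_num), lintegral_add_left (by fun_prop),
          lintegral_const_mul' _ _ (by norm_num), lintegral_add_left (by fun_prop)]
        gcongr
        exact hone h hZ t ht
    _ ≤ _ := by
        rw [show (4 : ℝ≥0∞) = ENNReal.ofReal 4 by norm_num]
        rw [← ENNReal.ofReal_add (by positivity) (by positivity),
          ← ENNReal.ofReal_mul (by positivity), ← ENNReal.ofReal_add (by positivity) (by positivity),
          ← ENNReal.ofReal_mul (by positivity)]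
        exact ENNReal.ofReal_le_ofReal (le_of_eq (by ring))

end PSystem

namespace PSystem

/-! ### The linear estimate -/

/-- Decay of the Fourier transform `Z t` of a space-time function, with bounds for its
increments in time. -/
structure Decay (M : ℝ) (Z : ℝ → ℝ → VC) : Prop where
  sup : ∀ t, 0 ≤ t → ∀ᵐ ξ, ‖Z t ξ‖ ≤ M
  zero : ∀ t, 0 ≤ t → ∫⁻ ξ, ‖Z t ξ‖ₑ ^ 2 ≤ ENNReal.ofReal ((M * rho t) ^ 2)
  one : ∀ t, 0 ≤ t → ∫⁻ ξ, (kn ξ * ‖Z t ξ‖ₑ) ^ 2 ≤ ENNReal.ofReal ((M * rho t ^ 3) ^ 2)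
  two : ∀ t, 0 ≤ t → ∫⁻ ξ, (kn ξ ^ 2 * ‖Z t ξ 1‖ₑ) ^ 2
    ≤ ENNReal.ofReal ((M * (rho t ^ 5 * Real.log (2 + t))) ^ 2)
  diff : ∀ δ, 0 < δ → δ ≤ 1 → ∀ t, 0 ≤ t →
    ∫⁻ ξ, ‖Z (t + δ) ξ - Z t ξ‖ₑ ^ 2 ≤ ENNReal.ofReal ((M * δ * rho t ^ 3) ^ 2)
  diffB : ∀ δ, 0 < δ → δ ≤ 1 → ∀ t, 0 ≤ t →
    ∫⁻ s in Set.Ioc t (t + 1), ∫⁻ ξ, (kn ξ * ‖Z (s + δ) ξ 1 - Z s ξ 1‖ₑ) ^ 2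
      ≤ ENNReal.ofReal ((M * δ * rho t ^ 3) ^ 2)

theorem half_le_log {t : ℝ} (ht : 0 ≤ t) : 1 / 2 ≤ Real.log (2 + t) := by
  have h1 : Real.log 2 ≤ Real.log (2 + t) := Real.log_le_log two_pos (by linarith)
  have := Real.log_two_gt_d9
  linarith

theorem rho_sq_mul_log_le {t : ℝ} (ht : 0 ≤ t) : rho t ^ 2 * Real.log (2 + t) ≤ 4 := by
  have h2 : 0 < 2 + t := by linarith
  have h1 : Real.log (2 + t) ≤ 4 * √(1 + t) := by
    have h3 : Real.log (2 + t) = 2 * Real.log √(2 + t) := by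
      rw [Real.log_sqrt h2.le]; ring
    have h4 := Real.log_le_sub_one_of_pos (Real.sqrt_pos.2 h2)
    have h5 : √(2 + t) ≤ 2 * √(1 + t) := by
      rw [Real.sqrt_le_left (by positivity), mul_pow, Real.sq_sqrt (by linarith)]
      linarith
    linarith
  have := rho_sq_mul_sqrt ht
  have hr := rho_pos ht
  nlinarith [mul_le_mul_of_nonneg_left h1 (sq_nonneg (rho t))]

theorem enorm_sub_le_lintegral_deriv {f : ℝ → ℂ} (hf : Differentiable ℝ f)
    (hc : Continuous (deriv f)) {a b : ℝ} (hab : a ≤ b) :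
    ‖f b - f a‖ₑ ≤ ∫⁻ s in Set.Ioc a b, ‖deriv f s‖ₑ := by
  rw [← intervalIntegral.integral_deriv_eq_sub (fun x _ => hf x) (hc.intervalIntegrable _ _),
    intervalIntegral.integral_of_le hab]
  exact enorm_integral_le_lintegral_enorm _

theorem IsFlow.continuous_deriv_left {k : ℝ} {η α β : ℝ → ℂ} (h : IsFlow k η α β) :
    Continuous (deriv α) := by
  have := h.continuous_right
  rw [show deriv α = fun t => Complex.I * k * β t from funext fun t => (h.left t).deriv]
  fun_prop

theorem IsFlow.continuous_deriv_right {k : ℝ} {η α β : ℝ → ℂ} (h : IsFlow k η α β)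
    (hη : Continuous η) : Continuous (deriv β) := by
  have := h.continuous_right
  have := h.continuous_left
  rw [show deriv β = fun t => Complex.I * k * α t - 2 * (k : ℂ) ^ 2 * β t + Complex.I * k * η t
    from funext fun t => (h.right t).deriv]
  fun_prop

theorem measurable_applyVC {α : Type} [MeasurableSpace α] {f : α → VC} (hf : Measurable f)
    (i : Fin 2) : Measurable fun a => f a i := by
  fun_prop

theorem enormVC_le_add (v : VC) : ‖v‖ₑ ≤ ‖v 0‖ₑ + ‖v 1‖ₑ := by
  refine (ENNReal.pow_le_pow_left_iff two_ne_zero).1 ?_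
  rw [enormVC_sq, add_sq]
  exact add_le_add le_self_add le_rfl

theorem duhamel_sup_high {M : ℝ} {Z₀ : ℝ → VC} {η : ℝ → ℝ → ℂ} (h : Forcing M η) {ξ : ℝ}
    (hξ : 1 ≤ |2 * Real.pi * ξ|) (hZ : ‖Z₀ ξ‖ ≤ M) {t : ℝ} (ht : 0 ≤ t) :
    ‖duhamel Z₀ η t ξ‖ ≤ 7 * M := by
  have hM := h.nonneg
  have hc := h.cont_time ξ
  have h1 := (isFlow_duhamel Z₀ h.cont ξ).decay_high hc hξ ht
  rw [← normVC_sq, ← normVC_sq, duhamel_zero, sub_zero] at h1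
  have h2 : ∫ s in (0 : ℝ)..t, Real.exp (-(t - s) / 6) * ‖η s ξ‖ ^ 2 ≤ 6 * M ^ 2 := by
    calc _ ≤ ∫ s in (0 : ℝ)..t, Real.exp (-(t - s) / 6) * M ^ 2 := by
          refine intervalIntegral.integral_mono_on ht
            (Continuous.intervalIntegrable (by fun_prop) _ _)
            (Continuous.intervalIntegrable (by fun_prop) _ _) fun s hs => ?_
          have h3 := h.sup s hs.1 ξ
          have h4 : rho s ^ 2 ≤ 1 := pow_le_one₀ (rho_pos hs.1).le (rho_le_one hs.1)
          have h5 : ‖η s ξ‖ ≤ M := h3.trans (mul_le_of_le_one_right hM h4)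
          gcongr
      _ = 6 * M ^ 2 * (1 - Real.exp (-t / 6)) := by
          rw [intervalIntegral.integral_eq_sub_of_hasDerivAt
            (f := fun s => 6 * M ^ 2 * Real.exp (-(t - s) / 6)) (fun s _ => ?_)
            (Continuous.intervalIntegrable (by fun_prop) _ _)]
          · simp; ring
          · have := ((((hasDerivAt_id s).const_sub t).neg.div_const 6).exp).const_mul (6 * M ^ 2)
            refine this.congr_deriv ?_
            simp; ring
      _ ≤ _ := by
          have := Real.exp_pos (-t / 6)
          nlinarith [sq_nonneg M]
  have h3 : Real.exp (-t / 6) ≤ 1 := Real.exp_le_one_iff.2 (by linarith)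
  have h4 : ‖Z₀ ξ‖ ^ 2 ≤ M ^ 2 := by gcongr
  refine (pow_le_pow_iff_left₀ (norm_nonneg _) (by positivity) two_ne_zero).1 ?_
  have h5 : 3 * Real.exp (-t / 6) * ‖Z₀ ξ‖ ^ 2 ≤ 3 * 1 * M ^ 2 := by gcongr
  nlinarith

theorem lintegral_low_add_high (F : ℝ → ℝ≥0∞) {A B X : ℝ} (hA : 0 ≤ A) (hB : 0 ≤ B)
    (h1 : ∫⁻ ξ in lowSet, F ξ ≤ ENNReal.ofReal A) (h2 : ∫⁻ ξ in lowSetᶜ, F ξ ≤ ENNReal.ofReal B)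
    (h : A + B ≤ X) : ∫⁻ ξ, F ξ ≤ ENNReal.ofReal X := by
  rw [← lintegral_add_compl F measurableSet_lowSet]
  refine (add_le_add h1 h2).trans ?_
  rw [← ENNReal.ofReal_add hA hB]
  exact ENNReal.ofReal_le_ofReal h

set_option maxHeartbeats 1000000 in
/-- Duhamel's formula maps data and forcings to decaying functions. -/
theorem decay_duhamel : ∃ C : ℝ, 1 ≤ C ∧ ∀ {M : ℝ} {Z₀ : ℝ → VC} {η : ℝ → ℝ → ℂ},
    Forcing M η → DataBound M Z₀ → Decay (C * M) (duhamel Z₀ η) := by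
  obtain ⟨Cs, hCs, hs⟩ := duhamel_sup_low
  obtain ⟨C₀, hC₀, h₀⟩ := duhamel_low 0
  obtain ⟨C₁, hC₁, h₁⟩ := duhamel_low 1
  obtain ⟨C₂, hC₂, h₂⟩ := duhamel_low 2
  obtain ⟨C₃, hC₃, h₃⟩ := duhamel_high_one
  obtain ⟨C₄, hC₄, h₄⟩ := duhamel_high_two
  set K : ℝ := 7 + Cs + 2 * C₀ + 5 * C₁ + 5 * C₂ + C₃ + 4 * C₄ with hK
  have hK1 : 1 ≤ K := by rw [hK]; linarith
  have hKK : K ≤ K ^ 2 := by nlinarith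
  refine ⟨50 * K, by linarith, fun {M Z₀ η} h hZ => ?_⟩
  have hM := h.nonneg
  have hkm := measurable_kn
  have hdm := measurable_duhamel hZ.meas h.cont
  have hzero : ∀ t, 0 ≤ t → ∫⁻ ξ, ‖duhamel Z₀ η t ξ‖ₑ ^ 2
      ≤ ENNReal.ofReal ((K * M * rho t) ^ 2) := by
    intro t ht
    have hr := rho_pos ht
    have hr1 := rho_le_one ht
    have a1 := h₀ hM h hZ.sup t ht (t / 2) (by linarith) (by simp)
    have a2 := h₃ h hZ t ht
    simp only [pow_zero, one_mul] at a1
    refine lintegral_low_add_high _ (by positivity) (by positivity) a1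
      (le_trans (setLIntegral_mono' measurableSet_lowSet.compl fun ξ hξ => ?_) a2) ?_
    · exact pow_le_pow_left' (le_mul_of_one_le_left' (one_le_kn (abs_of_mem_compl_lowSet hξ))) 2
    · have e0 : rho t ^ 8 = ((1 + t)⁻¹) ^ 2 := by rw [← rho_pow_four ht]; ring
      have hT : 0 < 1 + t := by linarith
      have e1 : rho t ^ 8 * (t / 2) ^ 2 ≤ 1 := by
        rw [e0, inv_pow, inv_mul_le_iff₀ (by positivity)]
        nlinarith
      have e2 : rho t ^ 10 * (t / 2) ^ 2 ≤ rho t ^ 2 := by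
        calc _ = rho t ^ 2 * (rho t ^ 8 * (t / 2) ^ 2) := by ring
          _ ≤ rho t ^ 2 * 1 := by gcongr
          _ = _ := mul_one _
      have e3 : rho t ^ 10 ≤ rho t ^ 2 := pow_le_pow_of_le_one hr.le hr1 (by norm_num)
      calc _ ≤ C₀ * M ^ 2 * (rho t ^ 2 + rho t ^ 2) + C₃ * M ^ 2 * rho t ^ 2 := by
            simp only [mul_zero, zero_add]
            gcongr
        _ = (2 * C₀ + C₃) * (M ^ 2 * rho t ^ 2) := by ring
        _ ≤ K ^ 2 * (M ^ 2 * rho t ^ 2) := by gcongr; rw [hK] at hKK ⊢; linarith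
        _ = _ := by ring
  have hone : ∀ t, 0 ≤ t → ∫⁻ ξ, (kn ξ * ‖duhamel Z₀ η t ξ‖ₑ) ^ 2
      ≤ ENNReal.ofReal ((K * M * rho t ^ 3) ^ 2) := by
    intro t ht
    have hr := rho_pos ht
    have hr1 := rho_le_one ht
    have a1 := h₁ hM h hZ.sup t ht (2 * √(1 + t)) (by positivity)
      ((lintegral_rho_sq (by linarith)).trans
        (ENNReal.ofReal_le_ofReal (by gcongr; linarith)))
    have a2 := h₃ h hZ t ht
    simp only [pow_one] at a1
    refine lintegral_low_add_high _ (by positivity) (by positivity) a1 a2 ?_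
    have e2 : rho t ^ 10 * (2 * √(1 + t)) ^ 2 = 4 * rho t ^ 6 := by
      have := rho_sq_mul_sqrt ht
      calc _ = 4 * rho t ^ 6 * (rho t ^ 2 * √(1 + t)) ^ 2 := by ring
        _ = _ := by rw [this]; ring
    have e3 : rho t ^ 10 ≤ rho t ^ 6 := pow_le_pow_of_le_one hr.le hr1 (by norm_num)
    rw [e2]
    calc _ ≤ C₁ * M ^ 2 * (rho t ^ 6 + 4 * rho t ^ 6) + C₃ * M ^ 2 * rho t ^ 6 := by
          gcongr
      _ = (5 * C₁ + C₃) * (M ^ 2 * rho t ^ 6) := by ring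
      _ ≤ K ^ 2 * (M ^ 2 * rho t ^ 6) := by gcongr; rw [hK] at hKK ⊢; linarith
      _ = _ := by ring
  have htwo : ∀ t, 0 ≤ t → ∫⁻ ξ, (kn ξ ^ 2 * ‖duhamel Z₀ η t ξ 1‖ₑ) ^ 2
      ≤ ENNReal.ofReal ((K * M * (rho t ^ 5 * Real.log (2 + t))) ^ 2) := by
    intro t ht
    have hr := rho_pos ht
    have hr1 := rho_le_one ht
    have hl := half_le_log ht
    have a1 := h₂ hM h hZ.sup t ht (Real.log (2 + t)) (by linarith)
      ((lintegral_rho_four (by linarith)).le.trans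
        (ENNReal.ofReal_le_ofReal (Real.log_le_log (by linarith) (by linarith))))
    have a2 := h₄ h hZ t ht
    refine lintegral_low_add_high _ (by positivity) (by positivity)
      (le_trans (lintegral_mono fun ξ => ?_) a1) a2 ?_
    · have := enormVC_apply_le (duhamel Z₀ η t ξ) 1
      dsimp only
      gcongr
    set L := Real.log (2 + t)
    have e3 : rho t ^ 10 ≤ 4 * (rho t ^ 10 * L ^ 2) := by
      have : 1 ≤ 4 * L ^ 2 := by nlinarith
      nlinarith [pow_pos hr 10]
    calc _ ≤ C₂ * M ^ 2 * (4 * (rho t ^ 10 * L ^ 2) + rho t ^ 10 * L ^ 2)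
          + C₄ * M ^ 2 * (4 * (rho t ^ 10 * L ^ 2)) := by
          gcongr
      _ = (5 * C₂ + 4 * C₄) * (M ^ 2 * (rho t ^ 10 * L ^ 2)) := by ring
      _ ≤ K ^ 2 * (M ^ 2 * (rho t ^ 10 * L ^ 2)) := by gcongr; rw [hK] at hKK ⊢; linarith
      _ = _ := by ring
  have hdiff : ∀ δ, 0 < δ → δ ≤ 1 → ∀ t, 0 ≤ t →
      ∫⁻ ξ, ‖duhamel Z₀ η (t + δ) ξ - duhamel Z₀ η t ξ‖ₑ ^ 2
        ≤ ENNReal.ofReal ((40 * K * M * δ * rho t ^ 3) ^ 2) := by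
    intro δ hδ hδ1 t ht
    have hr := rho_pos ht
    set W : ℝ → ℝ → ℝ≥0∞ := fun s ξ => 2 * (kn ξ * ‖duhamel Z₀ η s ξ‖ₑ
      + kn ξ ^ 2 * ‖duhamel Z₀ η s ξ 1‖ₑ) + kn ξ * ‖η s ξ‖ₑ with hW
    have hWm : Measurable (Function.uncurry W) := by
      have a1 : Measurable fun p : ℝ × ℝ => duhamel Z₀ η p.1 p.2 := hdm
      have a2 : Measurable fun p : ℝ × ℝ => kn p.2 * ‖η p.1 p.2‖ₑ := h.measurable_kn_mul
      have a3 : Measurable fun p : ℝ × ℝ => kn p.2 := hkm.comp measurable_snd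
      have a4 := measurable_applyVC a1 1
      refine Measurable.add ?_ a2
      fun_prop
    have hpt : ∀ ξ, ‖duhamel Z₀ η (t + δ) ξ - duhamel Z₀ η t ξ‖ₑ
        ≤ ∫⁻ s in Set.Ioc t (t + δ), 1 * W s ξ := by
      intro ξ
      have hflow := isFlow_duhamel Z₀ h.cont ξ
      have hc := h.cont_time ξ
      have c0 := hflow.continuous_left
      have c1 := hflow.continuous_right
      have b0 := enorm_sub_le_lintegral_deriv (fun s => (hflow.left s).differentiableAt)
        hflow.continuous_deriv_left
        (by linarith : t ≤ t + δ)
      have b1 := enorm_sub_le_lintegral_deriv (fun s => (hflow.right s).differentiableAt)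
        (hflow.continuous_deriv_right hc)
        (by linarith : t ≤ t + δ)
      refine (enormVC_le_add _).trans ?_
      rw [PiLp.sub_apply, PiLp.sub_apply]
      refine (add_le_add b0 b1).trans ?_
      rw [← lintegral_add_left hflow.continuous_deriv_left.measurable.enorm]
      refine lintegral_mono fun s => ?_
      have d1 := enorm_deriv_duhamel_one_le (Z₀ := Z₀) h.cont s ξ
      have x0 := enormVC_apply_le (duhamel Z₀ η s ξ) 0
      have x1 := enormVC_apply_le (duhamel Z₀ η s ξ) 1
      rw [enorm_deriv_duhamel_zero h.cont, one_mul, hW]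
      refine (add_le_add le_rfl d1).trans ?_
      calc _ ≤ kn ξ * ‖duhamel Z₀ η s ξ‖ₑ + (kn ξ * ‖duhamel Z₀ η s ξ‖ₑ
            + 2 * (kn ξ ^ 2 * ‖duhamel Z₀ η s ξ 1‖ₑ) + kn ξ * ‖η s ξ‖ₑ) := by gcongr
        _ = _ := by ring
    have hWint : ∀ s ∈ Set.Ioc t (t + δ), ∫⁻ ξ, W s ξ ^ 2
        ≤ ENNReal.ofReal ((40 * K * M * rho t ^ 3) ^ 2) := by
      intro s hs
      have hs0 : 0 ≤ s := ht.trans hs.1.le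
      have hrs := rho_pos hs0
      have hrs1 := rho_le_one hs0
      have hrt := rho_anti ht hs.1.le
      have hl := half_le_log hs0
      have hl2 := rho_sq_mul_log_le hs0
      have m1 : Measurable fun ξ => duhamel Z₀ η s ξ := measurable_duhamel_right hZ.meas h.cont s
      have m2 := measurable_applyVC m1 1
      calc _ ≤ ∫⁻ ξ, (64 * (kn ξ * ‖duhamel Z₀ η s ξ‖ₑ) ^ 2
            + (64 * (kn ξ ^ 2 * ‖duhamel Z₀ η s ξ 1‖ₑ) ^ 2 + 4 * (kn ξ * ‖η s ξ‖ₑ) ^ 2)) := by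
            refine lintegral_mono fun ξ => ?_
            refine (ennreal_add_sq_le _ _).trans ?_
            rw [mul_pow]
            refine (mul_le_mul_right (add_le_add (mul_le_mul_right (ennreal_add_sq_le _ _) _)
              le_rfl) _).trans (le_of_eq ?_)
            ring
        _ ≤ 64 * ENNReal.ofReal ((K * M * rho s ^ 3) ^ 2) +
            (64 * ENNReal.ofReal ((K * M * (rho s ^ 5 * Real.log (2 + s))) ^ 2) +
              4 * ENNReal.ofReal ((M * rho s ^ 5) ^ 2)) := by
            rw [lintegral_add_left (by fun_prop), lintegral_add_left (by fun_prop),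
              lintegral_const_mul' _ _ (by norm_num), lintegral_const_mul' _ _ (by norm_num),
              lintegral_const_mul' _ _ (by norm_num)]
            exact add_le_add (mul_le_mul_right (hone s hs0) _) (add_le_add
              (mul_le_mul_right (htwo s hs0) _) (mul_le_mul_right (h.deriv s hs0) _))
        _ ≤ _ := by
            rw [show (64 : ℝ≥0∞) = ENNReal.ofReal 64 by norm_num,
              show (4 : ℝ≥0∞) = ENNReal.ofReal 4 by norm_num,
              ← ENNReal.ofReal_mul (by norm_num), ← ENNReal.ofReal_mul (by norm_num),
              ← ENNReal.ofReal_mul (by norm_num), ← ENNReal.ofReal_add (by positivity)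
              (by positivity), ← ENNReal.ofReal_add (by positivity) (by positivity)]
            refine ENNReal.ofReal_le_ofReal ?_
            have f1 : rho s ^ 5 * Real.log (2 + s) ≤ 4 * rho s ^ 3 := by
              calc _ = rho s ^ 3 * (rho s ^ 2 * Real.log (2 + s)) := by ring
                _ ≤ rho s ^ 3 * 4 := by gcongr
                _ = _ := by ring
            have f2 : rho s ^ 5 ≤ rho s ^ 3 := pow_le_pow_of_le_one hrs.le hrs1 (by norm_num)
            calc _ ≤ 64 * (K * M * rho s ^ 3) ^ 2 + (64 * (K * M * (4 * rho s ^ 3)) ^ 2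
                  + 4 * (K * M * rho s ^ 3) ^ 2) := by
                  gcongr
                  exact le_mul_of_one_le_left hM hK1
              _ = 1092 * (K * M * rho s ^ 3) ^ 2 := by ring
              _ ≤ 1600 * (K * M * rho t ^ 3) ^ 2 := by gcongr; norm_num
              _ = _ := by ring
    calc _ ≤ ∫⁻ ξ, (∫⁻ s in Set.Ioc t (t + δ), 1 * W s ξ) ^ 2 :=
          lintegral_mono fun ξ => pow_le_pow_left' (hpt ξ) 2
      _ ≤ _ := lintegral_lintegral_mul_sq_le measurable_const hWm measurableSet_Ioc hWint
      _ = _ := by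
          rw [setLIntegral_const, Real.volume_Ioc, add_sub_cancel_left, one_mul,
            ← ENNReal.ofReal_pow hδ.le, ← ENNReal.ofReal_mul (by positivity)]
          congr 1; ring
  refine ⟨fun t ht => ?_, fun t ht => (hzero t ht).trans (ENNReal.ofReal_le_ofReal ?_),
    fun t ht => (hone t ht).trans (ENNReal.ofReal_le_ofReal ?_),
    fun t ht => (htwo t ht).trans (ENNReal.ofReal_le_ofReal ?_),
    fun δ hδ hδ1 t ht => (hdiff δ hδ hδ1 t ht).trans (ENNReal.ofReal_le_ofReal ?_),
    fun δ hδ hδ1 t ht => ?_⟩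
  · filter_upwards [hZ.sup] with ξ hξ
    rcases le_total |2 * Real.pi * ξ| 1 with hl | hl
    · refine (hs h ξ hl hξ t ht).trans ?_
      gcongr
      rw [hK]; linarith
    · refine (duhamel_sup_high h hl hξ ht).trans ?_
      gcongr
      rw [hK]; linarith
  · have := rho_pos ht
    gcongr; linarith
  · have := rho_pos ht
    gcongr; linarith
  · have := rho_pos ht
    have := half_le_log ht
    gcongr; linarith
  · have := rho_pos ht
    gcongr; linarith
  · have hr := rho_pos ht
    have hr1 := rho_le_one ht
    have mη : Measurable fun p : ℝ × ℝ => ‖η (p.1 + δ) p.2 - η p.1 p.2‖ₑ ^ 2 := by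
      have h1 : Continuous fun p : ℝ × ℝ => η (p.1 + δ) p.2 :=
        h.cont.comp (by fun_prop : Continuous fun p : ℝ × ℝ => ((p.1 + δ, p.2) : ℝ × ℝ))
      have h2 : Continuous fun p : ℝ × ℝ => η p.1 p.2 := h.cont
      exact (h1.sub h2).measurable.enorm.pow_const 2
    have mZ : Measurable fun p : ℝ × ℝ =>
        (kn p.2 * ‖duhamel Z₀ η (p.1 + δ) p.2 1 - duhamel Z₀ η p.1 p.2 1‖ₑ) ^ 2 := by
      have h1 : Measurable fun p : ℝ × ℝ => duhamel Z₀ η (p.1 + δ) p.2 :=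
        Measurable.comp (g := fun p : ℝ × ℝ => duhamel Z₀ η p.1 p.2)
          (f := fun p : ℝ × ℝ => (p.1 + δ, p.2)) hdm (by fun_prop)
      have h2 : Measurable fun p : ℝ × ℝ => duhamel Z₀ η p.1 p.2 := hdm
      have a3 : Measurable fun p : ℝ × ℝ => kn p.2 := hkm.comp measurable_snd
      exact (a3.mul ((measurable_applyVC h1 1).sub (measurable_applyVC h2 1)).enorm).pow_const 2
    rw [lintegral_lintegral_swap mZ.aemeasurable]
    have hpt : ∀ ξ, ∫⁻ s in Set.Ioc t (t + 1),
        (kn ξ * ‖duhamel Z₀ η (s + δ) ξ 1 - duhamel Z₀ η s ξ 1‖ₑ) ^ 2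
        ≤ ‖duhamel Z₀ η (t + δ) ξ - duhamel Z₀ η t ξ‖ₑ ^ 2
          + ∫⁻ s in Set.Ioc t (t + 1), ‖η (s + δ) ξ - η s ξ‖ₑ ^ 2 := by
      intro ξ
      have hc := h.cont_time ξ
      have hflow := isFlow_duhamel Z₀ h.cont ξ
      have := ((hflow.shift δ).sub hflow).enorm_energy_le (by fun_prop)
        (by linarith : t ≤ t + 1)
      rw [enormVC_sq, PiLp.sub_apply, PiLp.sub_apply]
      exact le_add_self.trans this
    have md : Measurable fun ξ => ‖duhamel Z₀ η (t + δ) ξ - duhamel Z₀ η t ξ‖ₑ ^ 2 := by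
      have h1 : Measurable fun ξ => duhamel Z₀ η (t + δ) ξ :=
        measurable_duhamel_right hZ.meas h.cont (t + δ)
      have h2 : Measurable fun ξ => duhamel Z₀ η t ξ := measurable_duhamel_right hZ.meas h.cont t
      fun_prop
    refine (lintegral_mono hpt).trans ?_
    rw [lintegral_add_left md, lintegral_lintegral_swap
      (f := fun ξ s => ‖η (s + δ) ξ - η s ξ‖ₑ ^ 2) (mη.comp measurable_swap).aemeasurable]
    refine (add_le_add (hdiff δ hδ hδ1 t ht) (h.diff δ hδ hδ1 t ht)).trans ?_
    rw [← ENNReal.ofReal_add (by positivity) (by positivity)]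
    refine ENNReal.ofReal_le_ofReal ?_
    have f2 : rho t ^ 5 ≤ rho t ^ 3 := pow_le_pow_of_le_one hr.le hr1 (by norm_num)
    calc _ ≤ (40 * K * M * δ * rho t ^ 3) ^ 2 + (K * M * δ * rho t ^ 3) ^ 2 := by
          gcongr
          exact le_mul_of_one_le_left hM hK1
      _ = 1601 * (K * M * δ * rho t ^ 3) ^ 2 := by ring
      _ ≤ 2500 * (K * M * δ * rho t ^ 3) ^ 2 := by gcongr; norm_num
      _ = _ := by ring

end PSystem

namespace PSystem

/-! ### The nonlinearity -/

/-- The flux as a function of the state and of `∂ₓb`. -/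
def fluxFn (f g : V → ℝ) (v : V) (p : ℝ) : ℝ := g v + 2 * f v * p

theorem flux_eq (f g : V → ℝ) (z : L2 V) (x : ℝ) :
    flux f g z x = fluxFn f g (z x) (derivB z x) := rfl

/-- The part of admissibility that the estimates use. -/
structure FluxBound (f g : V → ℝ) (C r : ℝ) : Prop where
  one_le : 1 ≤ C
  pos : 0 < r
  g_zero : g 0 = 0
  g_sub : ∀ v w : V, ‖v‖ < r → ‖w‖ < r → |g v - g w| ≤ C * (‖v - w‖ * (‖v‖ + ‖w‖))
  f_le : ∀ v : V, ‖v‖ < r → |f v| ≤ C * ‖v‖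
  f_sub : ∀ v w : V, ‖v‖ < r → ‖w‖ < r → |f v - f w| ≤ C * ‖v - w‖

theorem Admissible.exists_fluxBound {f g : V → ℝ} (h : Admissible f g) :
    ∃ C r : ℝ, FluxBound f g C r := by
  obtain ⟨g₀, C, r, hr, h⟩ := h
  have hle : C ≤ max C 1 := le_max_left _ _
  refine ⟨max C 1, r, le_max_right _ _, hr, ?_, fun v w hv hw => ?_, fun v hv => ?_,
    fun v w hv hw => ?_⟩
  · have := (h 0 0 0 (by simpa using hr) (by simpa using hr) (by simpa using hr)).1
    simpa using this
  · exact (h v v w hv hv hw).2.1.trans (by gcongr)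
  · exact (h v v v hv hv hv).2.2.2.2.1.trans (by gcongr)
  · exact (h v v w hv hv hw).2.2.2.2.2.trans (by gcongr)

namespace FluxBound

variable {f g : V → ℝ} {C r : ℝ}

theorem fluxFn_zero (h : FluxBound f g C r) : fluxFn f g 0 0 = 0 := by
  simp [fluxFn, h.g_zero]

theorem sub_le (h : FluxBound f g C r) {v w : V} (hv : ‖v‖ < r) (hw : ‖w‖ < r) (p q : ℝ) :
    |fluxFn f g v p - fluxFn f g w q|
      ≤ C * ((‖v‖ + ‖w‖ + 2 * |p|) * ‖v - w‖ + 2 * ‖w‖ * |p - q|) := by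
  have e : fluxFn f g v p - fluxFn f g w q
      = (g v - g w) + 2 * ((f v - f w) * p) + 2 * (f w * (p - q)) := by
    simp only [fluxFn]; ring
  have h1 := h.g_sub v w hv hw
  have h2 : |(f v - f w) * p| ≤ C * ‖v - w‖ * |p| := by
    rw [abs_mul]; exact mul_le_mul_of_nonneg_right (h.f_sub v w hv hw) (abs_nonneg _)
  have h3 : |f w * (p - q)| ≤ C * ‖w‖ * |p - q| := by
    rw [abs_mul]; exact mul_le_mul_of_nonneg_right (h.f_le w hw) (abs_nonneg _)
  rw [e]
  refine (abs_add_le _ _).trans ((add_le_add (abs_add_le _ _) le_rfl).trans ?_)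
  rw [abs_mul 2 ((f v - f w) * p), abs_mul 2 (f w * (p - q)), abs_two]
  linarith

theorem aestronglyMeasurable (h : FluxBound f g C r) {z : L2 V} (hz : ∀ᵐ x, ‖z x‖ < r) :
    AEStronglyMeasurable (flux f g z) volume := by
  have hC : 0 ≤ C := zero_le_one.trans h.one_le
  have hg : LipschitzOnWith (C * (r + r)).toNNReal g {v | ‖v‖ < r} := by
    refine LipschitzOnWith.of_dist_le_mul fun v hv w hw => ?_
    rw [Real.coe_toNNReal _ (by have := h.pos; positivity), Real.dist_eq, dist_eq_norm]
    refine (h.g_sub v w hv hw).trans ?_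
    have h1 : ‖v‖ + ‖w‖ ≤ r + r := add_le_add (le_of_lt hv) (le_of_lt hw)
    calc _ ≤ C * (‖v - w‖ * (r + r)) := by gcongr
      _ = _ := by ring
  have hf : LipschitzOnWith C.toNNReal f {v | ‖v‖ < r} := by
    refine LipschitzOnWith.of_dist_le_mul fun v hv w hw => ?_
    rw [Real.coe_toNNReal _ hC, Real.dist_eq, dist_eq_norm]
    exact h.f_sub v w hv hw
  obtain ⟨g', hg', heg⟩ := hg.extend_real
  obtain ⟨f', hf', hef⟩ := hf.extend_real
  have hzm := (Lp.stronglyMeasurable z)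
  have hpm := (Lp.stronglyMeasurable (derivB z))
  have hm : StronglyMeasurable fun x => fluxFn f' g' (z x) (derivB z x) :=
    (hg'.continuous.comp_stronglyMeasurable hzm).add
      (((hf'.continuous.comp_stronglyMeasurable hzm).const_mul 2).mul hpm)
  refine ⟨_, hm, ?_⟩
  filter_upwards [hz] with x hx
  rw [flux_eq, fluxFn, fluxFn, heg hx, hef hx]

end FluxBound

/-- The second difference of the flux is bounded as for a function of class `C²`,
for comparison states in the set `T`. -/
def SecondDiff (f g : V → ℝ) (K r : ℝ) (T : Set (V × ℝ)) : Prop :=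
  ∀ (A B : ℝ) (v₁ v₂ v₁' v₂' : V) (p₁ p₂ p₁' p₂' : ℝ), A < r → A ≤ 1 →
    (v₁', p₁') ∈ T → (v₂', p₂') ∈ T →
    ‖v₁‖ ≤ A → ‖v₂‖ ≤ A → ‖v₁'‖ ≤ A → ‖v₂'‖ ≤ A → |p₁| ≤ A → |p₂| ≤ A → |p₁'| ≤ A → |p₂'| ≤ A →
    ‖v₁ - v₁'‖ ≤ B → ‖v₂ - v₂'‖ ≤ B → |p₁ - p₁'| ≤ B → |p₂ - p₂'| ≤ B →
    |(fluxFn f g v₁ p₁ - fluxFn f g v₁' p₁') - (fluxFn f g v₂ p₂ - fluxFn f g v₂' p₂')|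
      ≤ K * (A * (‖(v₁ - v₁') - (v₂ - v₂')‖ + |(p₁ - p₁') - (p₂ - p₂')|)
        + B * (‖v₁' - v₂'‖ + |p₁ - p₂|))

theorem FluxBound.secondDiff_zero {f g : V → ℝ} {C r : ℝ} (h : FluxBound f g C r) :
    SecondDiff f g (4 * C) r {0} := by
  intro A B v₁ v₂ v₁' v₂' p₁ p₂ p₁' p₂' hA _ h1 h2 hv₁ hv₂ _ _ hp₁ _ _ _ hB _ _ _
  simp only [Set.mem_singleton_iff, Prod.mk_eq_zero] at h1 h2
  obtain ⟨rfl, rfl⟩ := h1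
  obtain ⟨rfl, rfl⟩ := h2
  have hC := h.one_le
  have hB0 : 0 ≤ B := (norm_nonneg _).trans hB
  have hA0 : 0 ≤ A := (norm_nonneg _).trans hv₁
  rw [h.fluxFn_zero]
  simp only [sub_zero]
  have key := h.sub_le (hv₁.trans_lt hA) (hv₂.trans_lt hA) p₁ p₂
  calc _ ≤ C * ((A + A + 2 * A) * ‖v₁ - v₂‖ + 2 * A * |p₁ - p₂|) := by
        refine key.trans ?_
        gcongr
    _ ≤ 4 * C * (A * (‖v₁ - v₂‖ + |p₁ - p₂|)) := by
        have : 0 ≤ C * A * |p₁ - p₂| := by positivity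
        linarith
    _ ≤ _ := by
        gcongr
        have : 0 ≤ B * (‖(0 : V)‖ + |p₁ - p₂|) := by positivity
        linarith

/-- A function whose derivative is Lipschitz near the origin: the bound for second differences. -/
theorem abs_second_diff_le {F : V → ℝ} {r L : ℝ} (hL : 0 ≤ L)
    (hF : ∀ v : V, ‖v‖ < r → DifferentiableAt ℝ F v)
    (hlip : ∀ v w : V, ‖v‖ < r → ‖w‖ < r → ‖fderiv ℝ F v - fderiv ℝ F w‖ ≤ L * ‖v - w‖)
    {A N : ℝ} (hA : A < r) (hN : ∀ v : V, ‖v‖ ≤ A → ‖fderiv ℝ F v‖ ≤ N)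
    {v₁ v₂ w₁ w₂ : V} (hv₁ : ‖v₁‖ ≤ A) (hv₂ : ‖v₂‖ ≤ A) (hw₁ : ‖w₁‖ ≤ A) (hw₂ : ‖w₂‖ ≤ A)
    {B : ℝ} (h1 : ‖v₁ - w₁‖ ≤ B) (h2 : ‖v₂ - w₂‖ ≤ B) :
    |(F v₁ - F w₁) - (F v₂ - F w₂)| ≤ N * ‖(v₁ - w₁) - (v₂ - w₂)‖ + L * B * ‖w₁ - w₂‖ := by
  have hseg : ∀ {a b : V}, ‖a‖ ≤ A → ‖b‖ ≤ A → ∀ θ ∈ Set.Icc (0 : ℝ) 1, ‖b + θ • (a - b)‖ ≤ A := by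
    intro a b ha hb θ hθ
    have e : b + θ • (a - b) = (1 - θ) • b + θ • a := by module
    rw [e]
    calc _ ≤ (1 - θ) * ‖b‖ + θ * ‖a‖ := by
          refine (norm_add_le _ _).trans ?_
          rw [norm_smul, norm_smul, Real.norm_of_nonneg hθ.1,
            Real.norm_of_nonneg (by linarith [hθ.2])]
      _ ≤ (1 - θ) * A + θ * A := by
          have h0 := hθ.1
          have h1 : 0 ≤ 1 - θ := by linarith [hθ.2]
          gcongr
      _ = A := by ring
  set φ : ℝ → ℝ := fun θ => F (v₂ + θ • (v₁ - v₂)) - F (w₂ + θ • (w₁ - w₂)) with hφ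
  have hline : ∀ (a b : V) (θ : ℝ), HasDerivAt (fun θ : ℝ => b + θ • (a - b)) (a - b) θ := by
    intro a b θ
    simpa using ((hasDerivAt_id θ).smul_const (a - b)).const_add b
  have hd : ∀ θ ∈ Set.Icc (0 : ℝ) 1, HasDerivWithinAt φ
      (fderiv ℝ F (v₂ + θ • (v₁ - v₂)) (v₁ - v₂) - fderiv ℝ F (w₂ + θ • (w₁ - w₂)) (w₁ - w₂))
      (Set.Icc 0 1) θ := fun θ hθ =>
    ((((hF _ ((hseg hv₁ hv₂ θ hθ).trans_lt hA)).hasFDerivAt.comp_hasDerivAt θ (hline v₁ v₂ θ)).sub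
      ((hF _ ((hseg hw₁ hw₂ θ hθ).trans_lt hA)).hasFDerivAt.comp_hasDerivAt θ
        (hline w₁ w₂ θ)))).hasDerivWithinAt
  have hb := norm_image_sub_le_of_norm_deriv_le_segment_01'
    (C := N * ‖(v₁ - w₁) - (v₂ - w₂)‖ + L * B * ‖w₁ - w₂‖) hd (fun θ hθ' => by
      have hθ : θ ∈ Set.Icc (0 : ℝ) 1 := ⟨hθ'.1, hθ'.2.le⟩
      set a := v₂ + θ • (v₁ - v₂) with ha
      set b := w₂ + θ • (w₁ - w₂) with hbdef
      have ha' := hseg hv₁ hv₂ θ hθ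
      have hb' := hseg hw₁ hw₂ θ hθ
      have e : fderiv ℝ F a (v₁ - v₂) - fderiv ℝ F b (w₁ - w₂)
          = fderiv ℝ F a ((v₁ - w₁) - (v₂ - w₂)) + (fderiv ℝ F a - fderiv ℝ F b) (w₁ - w₂) := by
        simp only [map_sub, sub_apply]
        ring
      have hab : ‖a - b‖ ≤ B := by
        have e2 : a - b = (1 - θ) • (v₂ - w₂) + θ • (v₁ - w₁) := by
          rw [ha, hbdef]; module
        rw [e2]
        calc _ ≤ (1 - θ) * ‖v₂ - w₂‖ + θ * ‖v₁ - w₁‖ := by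
              refine (norm_add_le _ _).trans ?_
              rw [norm_smul, norm_smul, Real.norm_of_nonneg hθ.1,
                Real.norm_of_nonneg (by linarith [hθ.2])]
          _ ≤ (1 - θ) * B + θ * B := by
              have h0 := hθ.1
              have h1 : 0 ≤ 1 - θ := by linarith [hθ.2]
              gcongr
          _ = B := by ring
      rw [e]
      refine (norm_add_le _ _).trans (add_le_add ?_ ?_)
      · exact ((fderiv ℝ F a).le_opNorm _).trans (by gcongr; exact hN a ha')
      · refine ((fderiv ℝ F a - fderiv ℝ F b).le_opNorm _).trans ?_
        gcongr
        refine (hlip a b (ha'.trans_lt hA) (hb'.trans_lt hA)).trans ?_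
        gcongr)
  simp only [hφ, Real.norm_eq_abs, one_smul, zero_smul, add_zero, add_sub_cancel] at hb
  exact hb

theorem exists_lipschitz_fderiv {F : V → ℝ} (hF : ContDiffAt ℝ 2 F 0) :
    ∃ L r : ℝ, 0 ≤ L ∧ 0 < r ∧ (∀ v : V, ‖v‖ < r → DifferentiableAt ℝ F v) ∧
      ∀ v w : V, ‖v‖ < r → ‖w‖ < r → ‖fderiv ℝ F v - fderiv ℝ F w‖ ≤ L * ‖v - w‖ := by
  have h1 : ContDiffAt ℝ 1 (fderiv ℝ F) 0 := hF.fderiv_right (by norm_num)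
  obtain ⟨L, s, hs, hL⟩ := h1.exists_lipschitzOnWith
  have h2 : ∀ᶠ v in 𝓝 (0 : V), DifferentiableAt ℝ F v := by
    have := hF.eventually (by simp)
    filter_upwards [this] with v hv using hv.differentiableAt (by norm_num)
  obtain ⟨r, hr, hball⟩ := Metric.eventually_nhds_iff.1 (h2.and hs)
  refine ⟨L, r, L.coe_nonneg, hr, fun v hv => (hball (by simpa using hv)).1, fun v w hv hw => ?_⟩
  have := hL.dist_le_mul v (hball (by simpa using hv)).2 w (hball (by simpa using hw)).2
  rwa [dist_eq_norm, dist_eq_norm] at this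

theorem FluxBound.exists_secondDiff {f g : V → ℝ} {C r : ℝ} (h : FluxBound f g C r)
    (hf : ContDiffAt ℝ 2 f 0) (hg : ContDiffAt ℝ 2 g 0) :
    ∃ K r' : ℝ, 0 < r' ∧ 0 ≤ K ∧ SecondDiff f g K r' Set.univ := by
  obtain ⟨Lf, rf, hLf, hrf, hdf, hlf⟩ := exists_lipschitz_fderiv hf
  obtain ⟨Lg, rg, hLg, hrg, hdg, hlg⟩ := exists_lipschitz_fderiv hg
  have hC := h.one_le
  have hgd : fderiv ℝ g 0 = 0 := by
    refine HasFDerivAt.fderiv ?_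
    refine HasFDerivAt.of_isLittleO ?_
    have hO : (fun v : V => g v - g 0 - (0 : V →L[ℝ] ℝ) (v - 0)) =O[𝓝 0]
        fun v => ‖v‖ ^ 2 := by
      refine Asymptotics.IsBigO.of_bound C ?_
      filter_upwards [Metric.ball_mem_nhds (0 : V) h.pos] with v hv
      have := h.g_sub v 0 (by simpa using hv) (by simpa using h.pos)
      simp only [sub_zero, norm_zero, add_zero] at this
      simp only [zero_apply, sub_zero, norm_pow, norm_norm]
      rw [Real.norm_eq_abs, pow_two]; exact this
    refine hO.trans_isLittleO ?_
    simpa using Asymptotics.isLittleO_norm_pow_id (E' := V) one_lt_two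
  set L := max (max Lf Lg) (max C ‖fderiv ℝ f 0‖) with hL
  have hLf' : Lf ≤ L := (le_max_left _ _).trans (le_max_left _ _)
  have hLg' : Lg ≤ L := (le_max_right _ _).trans (le_max_left _ _)
  have hLC : C ≤ L := (le_max_left _ _).trans (le_max_right _ _)
  have hLn : ‖fderiv ℝ f 0‖ ≤ L := (le_max_right _ _).trans (le_max_right _ _)
  have hL0 : 0 ≤ L := by linarith
  refine ⟨12 * L, min r (min rf rg), lt_min h.pos (lt_min hrf hrg), by positivity, ?_⟩
  intro A B v₁ v₂ w₁ w₂ p₁ p₂ q₁ q₂ hA hA1 _ _ hv₁ hv₂ hw₁ hw₂ hp₁ hp₂ hq₁ hq₂ hB₁ hB₂ hb₁ hb₂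
  have hAr : A < r := hA.trans_le (min_le_left _ _)
  have hArf : A < rf := hA.trans_le ((min_le_right _ _).trans (min_le_left _ _))
  have hArg : A < rg := hA.trans_le ((min_le_right _ _).trans (min_le_right _ _))
  have hA0 : 0 ≤ A := (norm_nonneg _).trans hv₁
  have hB0 : 0 ≤ B := (norm_nonneg _).trans hB₁
  have hG := abs_second_diff_le hLg hdg hlg hArg (N := L * A) (fun v hv => by
    have := hlg v 0 (hv.trans_lt hArg) (by simpa using hrg)
    rw [hgd, sub_zero, sub_zero] at this
    exact this.trans (by gcongr)) hv₁ hv₂ hw₁ hw₂ hB₁ hB₂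
  have hF := abs_second_diff_le hLf hdf hlf hArf (N := 2 * L) (fun v hv => by
    have h1 := hlf v 0 (hv.trans_lt hArf) (by simpa using hrf)
    have h2 := norm_sub_norm_le (fderiv ℝ f v) (fderiv ℝ f 0)
    rw [sub_zero] at h1
    have h3 : Lf * ‖v‖ ≤ L * 1 := by gcongr; linarith
    linarith) hv₁ hv₂ hw₁ hw₂ hB₁ hB₂
  set X := ‖(v₁ - w₁) - (v₂ - w₂)‖
  set Y := |(p₁ - q₁) - (p₂ - q₂)|
  set W := ‖w₁ - w₂‖
  set P := |p₁ - p₂|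
  have hX : 0 ≤ X := norm_nonneg _
  have hY : 0 ≤ Y := abs_nonneg _
  have hW : 0 ≤ W := norm_nonneg _
  have hP : 0 ≤ P := abs_nonneg _
  have e : (fluxFn f g v₁ p₁ - fluxFn f g w₁ q₁) - (fluxFn f g v₂ p₂ - fluxFn f g w₂ q₂)
      = ((g v₁ - g w₁) - (g v₂ - g w₂)) + 2 * (((f v₁ - f w₁) - (f v₂ - f w₂)) * p₁
        + (f v₂ - f w₂) * (p₁ - p₂) + f w₁ * ((p₁ - q₁) - (p₂ - q₂))
        + (f w₁ - f w₂) * (p₂ - q₂)) := by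
    simp only [fluxFn]; ring
  have t0 : |(g v₁ - g w₁) - (g v₂ - g w₂)| ≤ L * A * X + L * B * W :=
    hG.trans (by gcongr)
  have t1 : |((f v₁ - f w₁) - (f v₂ - f w₂)) * p₁| ≤ (2 * L * X + L * B * W) * A := by
    rw [abs_mul]
    refine mul_le_mul (hF.trans (by gcongr)) hp₁ (abs_nonneg _) (by positivity)
  have t2 : |(f v₂ - f w₂) * (p₁ - p₂)| ≤ L * B * P := by
    rw [abs_mul]
    refine mul_le_mul_of_nonneg_right ((h.f_sub _ _ (hv₂.trans_lt hAr) (hw₂.trans_lt hAr)).trans ?_)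
      (abs_nonneg _)
    gcongr
  have t3 : |f w₁ * ((p₁ - q₁) - (p₂ - q₂))| ≤ L * A * Y := by
    rw [abs_mul]
    refine mul_le_mul_of_nonneg_right ((h.f_le _ (hw₁.trans_lt hAr)).trans ?_) (abs_nonneg _)
    gcongr
  have t4 : |(f w₁ - f w₂) * (p₂ - q₂)| ≤ L * W * B := by
    rw [abs_mul]
    refine mul_le_mul ((h.f_sub _ _ (hw₁.trans_lt hAr) (hw₂.trans_lt hAr)).trans ?_) hb₂
      (abs_nonneg _) (by positivity)
    gcongr
  rw [e]
  refine (abs_add_le _ _).trans ?_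
  rw [abs_mul, abs_two]
  have t5 := abs_add_le (((f v₁ - f w₁) - (f v₂ - f w₂)) * p₁
        + (f v₂ - f w₂) * (p₁ - p₂) + f w₁ * ((p₁ - q₁) - (p₂ - q₂))) ((f w₁ - f w₂) * (p₂ - q₂))
  have t6 := abs_add_le (((f v₁ - f w₁) - (f v₂ - f w₂)) * p₁
        + (f v₂ - f w₂) * (p₁ - p₂)) (f w₁ * ((p₁ - q₁) - (p₂ - q₂)))
  have t7 := abs_add_le (((f v₁ - f w₁) - (f v₂ - f w₂)) * p₁) ((f v₂ - f w₂) * (p₁ - p₂))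
  have s1 : L * B * W * A ≤ L * B * W := mul_le_of_le_one_right (by positivity) hA1
  have s2 : 0 ≤ L * A * X := by positivity
  have s3 : 0 ≤ L * A * Y := by positivity
  have s4 : 0 ≤ L * B * W := by positivity
  have s5 : 0 ≤ L * B * P := by positivity
  linarith

/-! ### Estimates of the flux in `L¹` and `L²` -/

theorem lintegral_enorm_mul_le {E F : Type} [NormedAddCommGroup E] [NormedAddCommGroup F]
    (u : L2 E) (v : L2 F) : ∫⁻ x, ‖u x‖ₑ * ‖v x‖ₑ ≤ ‖u‖ₑ * ‖v‖ₑ := by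
  have h := lintegral_mul_sq_le (μ := (volume : Measure ℝ))
    (Lp.aestronglyMeasurable u).enorm (Lp.aestronglyMeasurable v).enorm
  rw [← eLpNorm_two_sq, ← eLpNorm_two_sq, ← mul_pow] at h
  rw [Lp.enorm_def, Lp.enorm_def]
  exact (ENNReal.pow_le_pow_left_iff two_ne_zero).1 h

theorem ofReal_add_mul_expand {a b c d e : ℝ} (ha : 0 ≤ a) (hb : 0 ≤ b) (hc : 0 ≤ c) (hd : 0 ≤ d)
    (he : 0 ≤ e) : ENNReal.ofReal ((a + b + 2 * c) * d + 2 * b * e)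
      = ENNReal.ofReal a * ENNReal.ofReal d + (ENNReal.ofReal b * ENNReal.ofReal d
        + (2 * (ENNReal.ofReal c * ENNReal.ofReal d) + 2 * (ENNReal.ofReal b * ENNReal.ofReal e))) := by
  rw [show (2 : ℝ≥0∞) = ENNReal.ofReal 2 by norm_num]
  rw [← ENNReal.ofReal_mul ha, ← ENNReal.ofReal_mul hb, ← ENNReal.ofReal_mul hb,
    ← ENNReal.ofReal_mul hc, ← ENNReal.ofReal_mul zero_le_two, ← ENNReal.ofReal_mul zero_le_two,
    ← ENNReal.ofReal_add (by positivity) (by positivity),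
    ← ENNReal.ofReal_add (by positivity) (by positivity),
    ← ENNReal.ofReal_add (by positivity) (by positivity)]
  congr 1; ring

theorem eLpNorm_le_of_ae_le_four {F n₁ n₂ n₃ n₄ : ℝ → ℝ} {a b : ℝ} (ha : 0 ≤ a) (hb : 0 ≤ b)
    (h₁ : AEStronglyMeasurable n₁ volume) (h₂ : AEStronglyMeasurable n₂ volume)
    (h₃ : AEStronglyMeasurable n₃ volume) (h₄ : AEStronglyMeasurable n₄ volume)
    (h : ∀ᵐ x, |F x| ≤ a * (n₁ x + n₂ x) + b * (n₃ x + n₄ x)) :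
    eLpNorm F 2 volume ≤ ENNReal.ofReal a * (eLpNorm n₁ 2 volume + eLpNorm n₂ 2 volume)
      + ENNReal.ofReal b * (eLpNorm n₃ 2 volume + eLpNorm n₄ 2 volume) := by
  have hc : ∀ {c : ℝ} (_ : 0 ≤ c) (u : ℝ → ℝ), eLpNorm (fun x => c * u x) 2 volume
      = ENNReal.ofReal c * eLpNorm u 2 volume := by
    intro c hc u
    have := eLpNorm_const_smul c u 2 volume
    rw [Real.enorm_eq_ofReal hc] at this
    exact this
  refine (eLpNorm_mono_ae_real h).trans ?_
  refine (eLpNorm_add_le ((h₁.add h₂).const_mul a) ((h₃.add h₄).const_mul b) one_le_two).trans ?_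
  refine add_le_add ((hc ha _).le.trans ?_) ((hc hb _).le.trans ?_)
  · exact mul_le_mul_right (eLpNorm_add_le h₁ h₂ one_le_two) _
  · exact mul_le_mul_right (eLpNorm_add_le h₃ h₄ one_le_two) _

namespace FluxBound

variable {f g : V → ℝ} {C r : ℝ}

theorem lintegral_flux_sub_le (h : FluxBound f g C r) {z w : L2 V} (hz : ∀ᵐ x, ‖z x‖ < r)
    (hw : ∀ᵐ x, ‖w x‖ < r) :
    ∫⁻ x, ‖flux f g z x - flux f g w x‖ₑ
      ≤ ENNReal.ofReal C * ((‖z‖ₑ + ‖w‖ₑ + 2 * ‖derivB z‖ₑ) * ‖z - w‖ₑ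
        + 2 * (‖w‖ₑ * ‖derivB z - derivB w‖ₑ)) := by
  have hC : 0 ≤ C := zero_le_one.trans h.one_le
  set D : L2 V := z - w with hD
  set q : L2 ℝ := derivB z - derivB w with hq
  have hpt : ∀ᵐ x, ‖flux f g z x - flux f g w x‖ₑ ≤ ENNReal.ofReal C *
      (‖z x‖ₑ * ‖D x‖ₑ + (‖w x‖ₑ * ‖D x‖ₑ + (2 * (‖derivB z x‖ₑ * ‖D x‖ₑ)
        + 2 * (‖w x‖ₑ * ‖q x‖ₑ)))) := by
    filter_upwards [hz, hw, Lp.coeFn_sub z w, Lp.coeFn_sub (derivB z) (derivB w)] with x h1 h2 h3 h4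
    rw [← hD] at h3
    rw [← hq] at h4
    have key := h.sub_le h1 h2 (derivB z x) (derivB w x)
    rw [h3, h4, Pi.sub_apply, Pi.sub_apply, flux_eq, flux_eq, ← ofReal_norm, Real.norm_eq_abs]
    refine (ENNReal.ofReal_le_ofReal key).trans (le_of_eq ?_)
    rw [ENNReal.ofReal_mul hC]
    congr 1
    simp only [← ofReal_norm, Real.norm_eq_abs]
    exact ofReal_add_mul_expand (norm_nonneg _) (norm_nonneg _) (abs_nonneg _) (norm_nonneg _)
      (abs_nonneg _)
  refine (lintegral_mono_ae hpt).trans ?_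
  have mz := (Lp.stronglyMeasurable z).measurable
  have mw := (Lp.stronglyMeasurable w).measurable
  have mD := (Lp.stronglyMeasurable D).measurable
  have mp := (Lp.stronglyMeasurable (derivB z)).measurable
  rw [lintegral_const_mul' _ _ ENNReal.ofReal_ne_top, lintegral_add_left (by fun_prop),
    lintegral_add_left (by fun_prop), lintegral_add_left (by fun_prop),
    lintegral_const_mul' _ _ (by norm_num), lintegral_const_mul' _ _ (by norm_num)]
  refine mul_le_mul_right ?_ _
  calc _ ≤ ‖z‖ₑ * ‖D‖ₑ + (‖w‖ₑ * ‖D‖ₑ + (2 * (‖derivB z‖ₑ * ‖D‖ₑ) + 2 * (‖w‖ₑ * ‖q‖ₑ))) := by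
        gcongr <;> exact lintegral_enorm_mul_le _ _
    _ = _ := by ring

/-- The Lipschitz bound of the flux in `L²`. -/
theorem eLpNorm_flux_sub_le (h : FluxBound f g C r) {z w : L2 V} {A : ℝ} (hA : A < r)
    (hz : ∀ᵐ x, ‖z x‖ ≤ A) (hw : ∀ᵐ x, ‖w x‖ ≤ A) (hp : ∀ᵐ x, |derivB z x| ≤ A) :
    eLpNorm (fun x => flux f g z x - flux f g w x) 2 volume
      ≤ ENNReal.ofReal (4 * C * A) * (‖z - w‖ₑ + ‖derivB z - derivB w‖ₑ) := by
  have hC : 0 ≤ C := zero_le_one.trans h.one_le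
  obtain ⟨x₀, hx₀⟩ := hz.exists
  have hA0 : 0 ≤ A := (norm_nonneg _).trans hx₀
  have := eLpNorm_le_of_ae_le_four (F := fun x => flux f g z x - flux f g w x)
    (n₁ := fun x => ‖(z - w : L2 V) x‖) (n₂ := fun x => ‖(derivB z - derivB w : L2 ℝ) x‖)
    (n₃ := fun _ => 0) (n₄ := fun _ => 0) (a := 4 * C * A) (b := 0) (by positivity) le_rfl
    (Lp.aestronglyMeasurable _).norm (Lp.aestronglyMeasurable _).norm
    aestronglyMeasurable_const aestronglyMeasurable_const (by
      filter_upwards [hz, hw, hp, Lp.coeFn_sub z w, Lp.coeFn_sub (derivB z) (derivB w)]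
        with x h1 h2 h3 h4 h5
      rw [h4, h5, Pi.sub_apply, Pi.sub_apply, flux_eq, flux_eq, Real.norm_eq_abs]
      refine (h.sub_le (h1.trans_lt hA) (h2.trans_lt hA) (derivB z x) (derivB w x)).trans ?_
      calc _ ≤ C * ((A + A + 2 * A) * ‖z x - w x‖ + 2 * A * |derivB z x - derivB w x|) := by
            gcongr
        _ ≤ _ := by
            have : 0 ≤ C * A * |derivB z x - derivB w x| := by positivity
            linarith)
  rw [eLpNorm_norm, eLpNorm_norm] at this
  simpa [Lp.enorm_def] using this

end FluxBound

end PSystem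

namespace PSystem

/-! ### Difference quotients and the Fourier transform -/

theorem fourier_comp_add_right (u : ℝ → ℂ) (a ξ : ℝ) :
    𝓕 (fun x => u (x + a)) ξ = (Real.fourierChar (a * ξ) : ℂ) * 𝓕 u ξ := by
  rw [Real.fourier_real_eq, Real.fourier_real_eq,
    ← integral_add_right_eq_self (fun y => Real.fourierChar (-(y * ξ)) • u y) a,
    ← integral_const_mul]
  congr 1
  ext x
  rw [Circle.smul_def, Circle.smul_def, smul_eq_mul, smul_eq_mul, ← mul_assoc, ← Circle.coe_mul,
    ← AddChar.map_add_eq_mul]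
  congr 3
  ring

theorem fourier_sub {u v : ℝ → ℂ} (hu : Integrable u) (hv : Integrable v) (ξ : ℝ) :
    𝓕 (fun x => u x - v x) ξ = 𝓕 u ξ - 𝓕 v ξ := by
  rw [Real.fourier_real_eq, Real.fourier_real_eq, Real.fourier_real_eq, ← integral_sub]
  · simp only [smul_sub]
  · simpa [mul_comm] using (Real.fourierIntegral_convergent_iff (μ := volume) (f := u) ξ).2 hu
  · simpa [mul_comm] using (Real.fourierIntegral_convergent_iff (μ := volume) (f := v) ξ).2 hv

theorem enorm_fourier_le (u : ℝ → ℂ) (ξ : ℝ) : ‖𝓕 u ξ‖ₑ ≤ ∫⁻ x, ‖u x‖ₑ := by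
  rw [Real.fourier_real_eq]
  refine (enorm_integral_le_lintegral_enorm _).trans (le_of_eq (lintegral_congr fun x => ?_))
  rw [← ofReal_norm, ← ofReal_norm, Circle.norm_smul]

/-- A bound for difference quotients in `L²` bounds the derivative on the Fourier side. -/
theorem lintegral_kn_fourier_le {u : ℝ → ℂ} (hu : Integrable u) (hu2 : MemLp u 2) {B : ℝ≥0∞}
    (hB : ∀ a : ℝ, eLpNorm (fun x => u (x + a) - u x) 2 volume ≤ ‖a‖ₑ * B) :
    ∫⁻ ξ, (kn ξ * ‖𝓕 u ξ‖ₑ) ^ 2 ≤ B ^ 2 := by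
  have hc := continuous_fourier_of_integrable hu
  set a : ℕ → ℝ := fun n => ((n : ℝ) + 1)⁻¹ with ha
  have ha0 : ∀ n, 0 < a n := fun n => by positivity
  set F : ℕ → ℝ → ℝ≥0∞ := fun n ξ =>
    (‖((a n)⁻¹ : ℂ) * ((Real.fourierChar (a n * ξ) : ℂ) - 1)‖ₑ * ‖𝓕 u ξ‖ₑ) ^ 2 with hF
  have hFm : ∀ n, Measurable (F n) := fun n => by
    have h1 : Continuous fun ξ : ℝ => ((a n)⁻¹ : ℂ) * ((Real.fourierChar (a n * ξ) : ℂ) - 1) := by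
      fun_prop
    exact (h1.measurable.enorm.mul hc.measurable.enorm).pow_const 2
  have hlim : ∀ ξ, Tendsto (fun n => F n ξ) atTop (𝓝 ((kn ξ * ‖𝓕 u ξ‖ₑ) ^ 2)) := by
    intro ξ
    have hd : HasDerivAt (fun s : ℝ => (Real.fourierChar (s * ξ) : ℂ))
        (2 * Real.pi * Complex.I * ξ) 0 := by
      have h1 : HasDerivAt (fun s : ℝ => Complex.exp ((2 * Real.pi * Complex.I * ξ) * (s : ℂ)))
          (Complex.exp ((2 * Real.pi * Complex.I * ξ) * ((0 : ℝ) : ℂ)) *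
            ((2 * Real.pi * Complex.I * ξ) * 1)) 0 :=
        ((Complex.ofRealCLM.hasDerivAt (x := (0 : ℝ))).const_mul
          (2 * Real.pi * Complex.I * ξ : ℂ)).cexp
      simp only [Complex.ofReal_zero, mul_zero, Complex.exp_zero, one_mul, mul_one] at h1
      refine h1.congr_of_eventuallyEq (.of_forall fun s => ?_)
      simp only [Real.fourierChar_apply]
      congr 1; push_cast; ring
    have hat : Tendsto a atTop (𝓝[≠] 0) := by
      refine tendsto_nhdsWithin_iff.2 ⟨?_, .of_forall fun n => (ha0 n).ne'⟩
      simpa [ha, one_div] using tendsto_one_div_add_atTop_nhds_zero_nat (𝕜 := ℝ)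
    have h2 := (hasDerivAt_iff_tendsto_slope_zero.1 hd).comp hat
    have h3 : Tendsto (fun n => ((a n)⁻¹ : ℂ) * ((Real.fourierChar (a n * ξ) : ℂ) - 1)) atTop
        (𝓝 (2 * Real.pi * Complex.I * ξ)) := by
      refine h2.congr fun n => ?_
      simp [Complex.real_smul]
    have h4 : ‖(2 * Real.pi * Complex.I * ξ : ℂ)‖ₑ = kn ξ := by
      rw [← ofReal_norm, norm_two_pi_I_mul, kn_eq]
    have h5 := h3.enorm
    rw [h4] at h5
    exact ((ENNReal.continuous_pow 2).tendsto _).comp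
      (ENNReal.Tendsto.mul_const h5 (Or.inr enorm_ne_top))
  have hle : ∀ n, ∫⁻ ξ, F n ξ ≤ B ^ 2 := by
    intro n
    have hi : Integrable fun x => u (x + a n) := hu.comp_add_right (a n)
    have hi2 : MemLp (fun x => u (x + a n)) 2 :=
      hu2.comp_measurePreserving (measurePreserving_add_right volume (a n))
    have h1 := eLpNorm_fourier_eq (hi.sub hu) (hi2.sub hu2)
    have h2 : eLpNorm (𝓕 (fun x => u (x + a n) - u x)) 2 volume ≤ ‖a n‖ₑ * B :=
      h1.le.trans (hB (a n))
    have h3 : ∀ ξ, 𝓕 (fun x => u (x + a n) - u x) ξ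
        = ((Real.fourierChar (a n * ξ) : ℂ) - 1) * 𝓕 u ξ := by
      intro ξ
      rw [fourier_sub hi hu, fourier_comp_add_right]; ring
    have hane : ‖((a n)⁻¹ : ℂ)‖ₑ * ‖a n‖ₑ = 1 := by
      rw [← ofReal_norm, ← ofReal_norm, ← ENNReal.ofReal_mul (norm_nonneg _), norm_inv,
        Complex.norm_real, inv_mul_cancel₀ (norm_ne_zero_iff.2 (ha0 n).ne'), ENNReal.ofReal_one]
    calc ∫⁻ ξ, F n ξ = ‖((a n)⁻¹ : ℂ)‖ₑ ^ 2 *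
          eLpNorm (𝓕 (fun x => u (x + a n) - u x)) 2 volume ^ 2 := by
          rw [eLpNorm_two_sq, ← lintegral_const_mul' _ _ (ENNReal.pow_ne_top enorm_ne_top)]
          refine lintegral_congr fun ξ => ?_
          rw [h3, hF]
          dsimp only
          rw [enorm_mul, enorm_mul]; ring
      _ ≤ ‖((a n)⁻¹ : ℂ)‖ₑ ^ 2 * (‖a n‖ₑ * B) ^ 2 := by gcongr
      _ = B ^ 2 := by rw [← mul_pow, ← mul_assoc, hane, one_mul]
  calc _ = ∫⁻ ξ, liminf (fun n => F n ξ) atTop :=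
        lintegral_congr fun ξ => (hlim ξ).liminf_eq.symm
    _ ≤ liminf (fun n => ∫⁻ ξ, F n ξ) atTop := lintegral_liminf_le hFm
    _ ≤ B ^ 2 := (liminf_le_liminf (.of_forall hle)).trans (liminf_const _).le

/-! ### States -/

theorem ae_comp_add {P : ℝ → Prop} (h : ∀ᵐ x, P x) (a : ℝ) : ∀ᵐ x, P (x + a) :=
  (measurePreserving_add_right volume a).quasiMeasurePreserving.ae h

theorem eLpNorm_translate_le (z : L2 V) (a : ℝ) :
    eLpNorm (fun x => z (x + a) - z x) 2 volume ≤ ‖a‖ₑ * fourierNormOne z := by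
  rcases eq_or_ne a 0 with rfl | ha
  · simp
  by_cases h1 : fourierNormOne z < ⊤
  · have h := eLpNorm_translate_sub_le (u := complexify.compLp z) (m := fourierL2 z)
      (by rfl) h1 a
    refine le_trans (le_of_eq (eLpNorm_congr_norm_ae ?_)) h
    have hc := complexify.coeFn_compLp z
    filter_upwards [hc, ae_comp_add hc a] with x h2 h3
    rw [h2, h3, ← map_sub, norm_complexify]
  · rw [not_lt_top_iff.1 h1, ENNReal.mul_top (by simpa using ha)]
    exact le_top

theorem fourierNormTwo_eq (z : L2 V) :
    eLpNorm (fun ξ => (2 * Real.pi * ξ) • ((2 * Real.pi * Complex.I * ξ) • fourierL2 z ξ 1)) 2 volume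
      = fourierNormTwo z := by
  refine eLpNorm_congr_norm_ae (.of_forall fun ξ => ?_)
  rw [norm_smul, norm_smul, norm_smul, norm_two_pi_I_mul, Real.norm_eq_abs, norm_pow,
    Real.norm_eq_abs]
  ring

theorem eLpNorm_translate_derivB_le {z : L2 V} (h : fourierNormOne z < ⊤) (a : ℝ) :
    eLpNorm (fun x => derivB z (x + a) - derivB z x) 2 volume ≤ ‖a‖ₑ * fourierNormTwo z := by
  rcases eq_or_ne a 0 with rfl | ha
  · simp
  by_cases h1 : fourierNormTwo z < ⊤
  · have h' := eLpNorm_translate_sub_le (fourier_derivB h)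
      (by rw [fourierNormTwo_eq z]; exact h1) a
    rw [fourierNormTwo_eq z] at h'
    refine le_trans (le_of_eq (eLpNorm_congr_norm_ae ?_)) h'
    have hc := Complex.ofRealCLM.coeFn_compLp (derivB z)
    filter_upwards [hc, ae_comp_add hc a] with x h2 h3
    rw [h2, h3, ← map_sub, Complex.ofRealCLM_apply, Complex.norm_real]
  · rw [not_lt_top_iff.1 h1, ENNReal.mul_top (by simpa using ha)]
    exact le_top

theorem ae_norm_le {z : L2 V} {a₀ a₁ l : ℝ} (ha₀ : 0 ≤ a₀) (ha₁ : 0 ≤ a₁) (hl : 0 < l)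
    (h0 : ‖z‖ₑ ≤ ENNReal.ofReal a₀) (h1 : fourierNormOne z ≤ ENNReal.ofReal a₁) :
    ∀ᵐ x, ‖z x‖ ≤ √((l ^ 2 * a₀ ^ 2 + a₁ ^ 2) / (2 * l)) := by
  have h := ae_norm_le_of_fourier (u := complexify.compLp z) (m := fourierL2 z) (by rfl)
    ha₀ ha₁ hl (by rw [eLpNorm_fourierL2]; exact h0) h1
  filter_upwards [h, complexify.coeFn_compLp z] with x h2 h3
  rwa [h3, norm_complexify] at h2

theorem ae_abs_derivB_le {z : L2 V} (h : fourierNormOne z < ⊤) {a₀ a₁ l : ℝ} (ha₀ : 0 ≤ a₀)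
    (ha₁ : 0 ≤ a₁) (hl : 0 < l) (h0 : ‖derivB z‖ₑ ≤ ENNReal.ofReal a₀)
    (h1 : fourierNormTwo z ≤ ENNReal.ofReal a₁) :
    ∀ᵐ x, |derivB z x| ≤ √((l ^ 2 * a₀ ^ 2 + a₁ ^ 2) / (2 * l)) := by
  have e : eLpNorm (fun ξ : ℝ => (2 * Real.pi * Complex.I * ξ) • fourierL2 z ξ 1) 2 volume
      = ‖derivB z‖ₑ := by
    rw [enorm_derivB h]
    refine eLpNorm_congr_norm_ae (.of_forall fun ξ => ?_)
    rw [norm_smul, norm_smul, norm_two_pi_I_mul, Real.norm_eq_abs]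
  have h' := ae_norm_le_of_fourier (fourier_derivB h) ha₀ ha₁ hl (by rw [e]; exact h0)
    (by rw [fourierNormTwo_eq z]; exact h1)
  filter_upwards [h', Complex.ofRealCLM.coeFn_compLp (derivB z)] with x h2 h3
  rwa [h3, Complex.ofRealCLM_apply, Complex.norm_real] at h2

theorem enorm_derivB_le {z : L2 V} (h : fourierNormOne z < ⊤) : ‖derivB z‖ₑ ≤ fourierNormOne z := by
  rw [enorm_derivB h]; exact eLpNorm_smul_apply_le z

theorem fourierNormOne_sq (z : L2 V) :
    fourierNormOne z ^ 2 = ∫⁻ ξ, (kn ξ * ‖fourierL2 z ξ‖ₑ) ^ 2 := by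
  rw [fourierNormOne, eLpNorm_two_sq]
  simp only [enorm_smul, kn]

theorem fourierNormTwo_sq (z : L2 V) :
    fourierNormTwo z ^ 2 = ∫⁻ ξ, (kn ξ ^ 2 * ‖fourierL2 z ξ 1‖ₑ) ^ 2 := by
  rw [fourierNormTwo, eLpNorm_two_sq]
  simp only [enorm_smul, kn, enorm_pow]

theorem enorm_derivB_sq {z : L2 V} (h : fourierNormOne z < ⊤) :
    ‖derivB z‖ₑ ^ 2 = ∫⁻ ξ, (kn ξ * ‖fourierL2 z ξ 1‖ₑ) ^ 2 := by
  rw [enorm_derivB h, eLpNorm_two_sq]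
  simp only [enorm_smul, kn]

theorem enorm_sq_eq (z : L2 V) : ‖z‖ₑ ^ 2 = ∫⁻ ξ, ‖fourierL2 z ξ‖ₑ ^ 2 := by
  rw [← eLpNorm_fourierL2, eLpNorm_two_sq]

theorem ennreal_le_ofReal_of_sq {x : ℝ≥0∞} {A : ℝ} (hA : 0 ≤ A)
    (h : x ^ 2 ≤ ENNReal.ofReal (A ^ 2)) : x ≤ ENNReal.ofReal A := by
  rw [ENNReal.ofReal_pow hA] at h
  exact (ENNReal.pow_le_pow_left_iff two_ne_zero).1 h

/-- Interpolation: `‖∂ₓb‖² ≤ ‖b‖ ‖∂ₓ²b‖`. -/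
theorem enorm_derivB_sq_le {z : L2 V} (h : fourierNormOne z < ⊤) :
    ‖derivB z‖ₑ ^ 2 ≤ ‖z‖ₑ * fourierNormTwo z := by
  have hm : AEMeasurable (fun ξ => ‖fourierL2 z ξ 1‖ₑ) volume :=
    (measurable_applyVC (Lp.stronglyMeasurable (fourierL2 z)).measurable 1).enorm.aemeasurable
  have h1 := lintegral_mul_sq_le hm (((measurable_kn.pow_const 2).aemeasurable).mul hm)
  simp only [Pi.mul_apply] at h1
  refine (ENNReal.pow_le_pow_left_iff two_ne_zero).1 ?_
  rw [enorm_derivB_sq h, mul_pow, fourierNormTwo_sq, enorm_sq_eq]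
  refine le_trans (le_of_eq ?_) (h1.trans (mul_le_mul_left ?_ _))
  · congr 1
    refine lintegral_congr fun ξ => ?_
    ring
  · refine lintegral_mono fun ξ => ?_
    have := enormVC_apply_le (fourierL2 z ξ) 1
    dsimp only
    gcongr

/-- A state with finite norms, bounded by `A` together with `∂ₓb`. -/
structure SupBound (A : ℝ) (z : L2 V) : Prop where
  one : fourierNormOne z < ⊤
  two : fourierNormTwo z < ⊤
  v : ∀ᵐ x, ‖z x‖ ≤ A
  p : ∀ᵐ x, |derivB z x| ≤ A

theorem SupBound.nonneg {A : ℝ} {z : L2 V} (h : SupBound A z) : 0 ≤ A := by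
  obtain ⟨x, hx⟩ := h.v.exists
  exact (norm_nonneg _).trans hx

theorem SupBound.mono {A B : ℝ} {z : L2 V} (h : SupBound A z) (hAB : A ≤ B) : SupBound B z :=
  ⟨h.one, h.two, h.v.mono fun _ hx => hx.trans hAB, h.p.mono fun _ hx => hx.trans hAB⟩

theorem fourierL2_zero : fourierL2 (0 : L2 V) =ᵐ[volume] 0 := by
  have h := fourierL2_sub (0 : L2 V) 0
  rw [sub_zero, sub_self] at h
  rw [h]
  exact Lp.coeFn_zero _ _ _

theorem fourierNormOne_zero : fourierNormOne (0 : L2 V) = 0 := by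
  rw [fourierNormOne, eLpNorm_congr_ae (g := 0), eLpNorm_zero]
  filter_upwards [fourierL2_zero] with ξ h
  rw [h]; simp

theorem fourierNormTwo_zero : fourierNormTwo (0 : L2 V) = 0 := by
  rw [fourierNormTwo, eLpNorm_congr_ae (g := 0), eLpNorm_zero]
  filter_upwards [fourierL2_zero] with ξ h
  rw [h]; simp

theorem derivB_zero : derivB (0 : L2 V) = 0 := by
  have h := enorm_derivB_le (z := 0) (by rw [fourierNormOne_zero]; exact ENNReal.zero_lt_top)
  rw [fourierNormOne_zero] at h
  simpa using h

theorem supBound_zero {A : ℝ} (hA : 0 ≤ A) : SupBound A (0 : L2 V) := by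
  refine ⟨by simp [fourierNormOne_zero], by simp [fourierNormTwo_zero], ?_, ?_⟩
  · filter_upwards [Lp.coeFn_zero V 2 (volume : Measure ℝ)] with x hx
    rw [hx]; simpa using hA
  · rw [derivB_zero]
    filter_upwards [Lp.coeFn_zero ℝ 2 (volume : Measure ℝ)] with x hx
    rw [hx]; simpa using hA

/-! ### The Fourier transform of the flux -/

/-- The Fourier transform of the flux. -/
def fluxHat (f g : V → ℝ) (z : L2 V) (ξ : ℝ) : ℂ :=
  𝓕 (fun x : ℝ => ((flux f g z x : ℝ) : ℂ)) ξ

theorem fluxHat_neg (f g : V → ℝ) (z : L2 V) (ξ : ℝ) :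
    fluxHat f g z (-ξ) = (starRingEnd ℂ) (fluxHat f g z ξ) := by
  rw [fluxHat, fluxHat, conj_fourier]
  simp only [Complex.conj_ofReal]

namespace FluxBound

variable {f g : V → ℝ} {C r A : ℝ} {z w : L2 V}

theorem flux_zero (h : FluxBound f g C r) : flux f g (0 : L2 V) =ᵐ[volume] 0 := by
  filter_upwards [Lp.coeFn_zero V 2 (volume : Measure ℝ), Lp.coeFn_zero ℝ 2 (volume : Measure ℝ)]
    with x h1 h2
  rw [flux_eq, derivB_zero, h1, h2]
  exact h.fluxFn_zero

theorem fluxHat_zero (h : FluxBound f g C r) (ξ : ℝ) : fluxHat f g (0 : L2 V) ξ = 0 := by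
  rw [fluxHat, Real.fourier_real_eq, integral_eq_zero_of_ae]
  filter_upwards [h.flux_zero] with x hx
  simp [hx]

theorem integrable_flux_sub (h : FluxBound f g C r) (hA : A < r) (hz : SupBound A z)
    (hw : SupBound A w) : Integrable fun x => flux f g z x - flux f g w x := by
  have hz' := hz.v.mono fun _ hx => hx.trans_lt hA
  have hw' := hw.v.mono fun _ hx => hx.trans_lt hA
  refine ⟨(h.aestronglyMeasurable hz').sub (h.aestronglyMeasurable hw'), ?_⟩
  refine (h.lintegral_flux_sub_le hz' hw').trans_lt ?_
  refine ENNReal.mul_lt_top ENNReal.ofReal_lt_top (ENNReal.add_lt_top.2 ⟨?_, ?_⟩)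
  · exact ENNReal.mul_lt_top (by simp [ENNReal.mul_lt_top]) enorm_lt_top
  · exact ENNReal.mul_lt_top (by simp) (ENNReal.mul_lt_top enorm_lt_top enorm_lt_top)

theorem integrable_flux (h : FluxBound f g C r) (hA : A < r) (hz : SupBound A z) :
    Integrable (flux f g z) := by
  refine (h.integrable_flux_sub hA hz (supBound_zero hz.nonneg)).congr ?_
  filter_upwards [h.flux_zero] with x hx
  rw [hx]; simp

theorem memLp_flux_sub (h : FluxBound f g C r) (hA : A < r) (hz : SupBound A z)
    (hw : SupBound A w) : MemLp (fun x => flux f g z x - flux f g w x) 2 := by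
  refine ⟨(h.integrable_flux_sub hA hz hw).1, ?_⟩
  refine (h.eLpNorm_flux_sub_le hA hz.v hw.v hz.p).trans_lt ?_
  exact ENNReal.mul_lt_top ENNReal.ofReal_lt_top (by simp)

theorem fluxHat_sub (h : FluxBound f g C r) (hA : A < r) (hz : SupBound A z)
    (hw : SupBound A w) (ξ : ℝ) : fluxHat f g z ξ - fluxHat f g w ξ
      = 𝓕 (fun x : ℝ => ((flux f g z x - flux f g w x : ℝ) : ℂ)) ξ := by
  have := fourier_sub (u := fun x : ℝ => ((flux f g z x : ℝ) : ℂ))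
    (v := fun x : ℝ => ((flux f g w x : ℝ) : ℂ)) (h.integrable_flux hA hz).ofReal
    (h.integrable_flux hA hw).ofReal ξ
  rw [fluxHat, fluxHat, ← this]
  simp only [Complex.ofReal_sub]

theorem continuous_fluxHat (h : FluxBound f g C r) (hA : A < r) (hz : SupBound A z) :
    Continuous (fluxHat f g z) :=
  continuous_fourier_of_integrable (h.integrable_flux hA hz).ofReal

theorem enorm_ofReal_complex (x : ℝ) : ‖(x : ℂ)‖ₑ = ‖x‖ₑ := by
  rw [← ofReal_norm, Complex.norm_real, ofReal_norm]

theorem enorm_fluxHat_sub_le (h : FluxBound f g C r) (hA : A < r) (hz : SupBound A z)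
    (hw : SupBound A w) (ξ : ℝ) : ‖fluxHat f g z ξ - fluxHat f g w ξ‖ₑ
      ≤ ENNReal.ofReal C * ((‖z‖ₑ + ‖w‖ₑ + 2 * ‖derivB z‖ₑ) * ‖z - w‖ₑ
        + 2 * (‖w‖ₑ * ‖derivB z - derivB w‖ₑ)) := by
  rw [h.fluxHat_sub hA hz hw]
  refine (enorm_fourier_le _ _).trans ?_
  simp only [enorm_ofReal_complex]
  exact h.lintegral_flux_sub_le (hz.v.mono fun _ hx => hx.trans_lt hA)
    (hw.v.mono fun _ hx => hx.trans_lt hA)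

theorem eLpNorm_ofReal (u : ℝ → ℝ) : eLpNorm (fun x => (u x : ℂ)) 2 volume = eLpNorm u 2 volume :=
  eLpNorm_congr_norm_ae (.of_forall fun x => by simp)

theorem eLpNorm_fluxHat_sub (h : FluxBound f g C r) (hA : A < r) (hz : SupBound A z)
    (hw : SupBound A w) : eLpNorm (fun ξ => fluxHat f g z ξ - fluxHat f g w ξ) 2 volume
      = eLpNorm (fun x => flux f g z x - flux f g w x) 2 volume := by
  simp only [h.fluxHat_sub hA hz hw]
  rw [← eLpNorm_ofReal]
  exact eLpNorm_fourier_eq (h.integrable_flux_sub hA hz hw).ofReal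
    (h.memLp_flux_sub hA hz hw).ofReal

theorem lintegral_fluxHat_sub_le (h : FluxBound f g C r) (hA : A < r) (hz : SupBound A z)
    (hw : SupBound A w) : ∫⁻ ξ, ‖fluxHat f g z ξ - fluxHat f g w ξ‖ₑ ^ 2
      ≤ (ENNReal.ofReal (4 * C * A) * (‖z - w‖ₑ + ‖derivB z - derivB w‖ₑ)) ^ 2 := by
  rw [← eLpNorm_two_sq, h.eLpNorm_fluxHat_sub hA hz hw]
  exact pow_le_pow_left' (h.eLpNorm_flux_sub_le hA hz.v hw.v hz.p) 2

end FluxBound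

/-- The bound for second differences of the flux in `L²`. -/
theorem SecondDiff.eLpNorm_le {f g : V → ℝ} {K r : ℝ} {T : Set (V × ℝ)}
    (h : SecondDiff f g K r T) (hK : 0 ≤ K) {A B : ℝ} (hA : A < r) (hA1 : A ≤ 1) (hB : 0 ≤ B)
    {v₁ v₂ w₁ w₂ : ℝ → V} {p₁ p₂ q₁ q₂ : ℝ → ℝ}
    (mv₁ : AEStronglyMeasurable v₁ volume) (mv₂ : AEStronglyMeasurable v₂ volume)
    (mw₁ : AEStronglyMeasurable w₁ volume) (mw₂ : AEStronglyMeasurable w₂ volume)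
    (mp₁ : AEStronglyMeasurable p₁ volume) (mp₂ : AEStronglyMeasurable p₂ volume)
    (mq₁ : AEStronglyMeasurable q₁ volume) (mq₂ : AEStronglyMeasurable q₂ volume)
    (hT₁ : ∀ᵐ x, (w₁ x, q₁ x) ∈ T) (hT₂ : ∀ᵐ x, (w₂ x, q₂ x) ∈ T)
    (hv₁ : ∀ᵐ x, ‖v₁ x‖ ≤ A ∧ |p₁ x| ≤ A) (hv₂ : ∀ᵐ x, ‖v₂ x‖ ≤ A ∧ |p₂ x| ≤ A)
    (hw₁ : ∀ᵐ x, ‖w₁ x‖ ≤ A ∧ |q₁ x| ≤ A) (hw₂ : ∀ᵐ x, ‖w₂ x‖ ≤ A ∧ |q₂ x| ≤ A)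
    (hB₁ : ∀ᵐ x, ‖v₁ x - w₁ x‖ ≤ B ∧ |p₁ x - q₁ x| ≤ B)
    (hB₂ : ∀ᵐ x, ‖v₂ x - w₂ x‖ ≤ B ∧ |p₂ x - q₂ x| ≤ B) :
    eLpNorm (fun x => (fluxFn f g (v₁ x) (p₁ x) - fluxFn f g (w₁ x) (q₁ x))
        - (fluxFn f g (v₂ x) (p₂ x) - fluxFn f g (w₂ x) (q₂ x))) 2 volume
      ≤ ENNReal.ofReal (K * A) * (eLpNorm (fun x => (v₁ x - w₁ x) - (v₂ x - w₂ x)) 2 volume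
          + eLpNorm (fun x => (p₁ x - q₁ x) - (p₂ x - q₂ x)) 2 volume)
        + ENNReal.ofReal (K * B) * (eLpNorm (fun x => w₁ x - w₂ x) 2 volume
          + eLpNorm (fun x => p₁ x - p₂ x) 2 volume) := by
  obtain ⟨x₀, hx₀⟩ := hv₁.exists
  have hA0 : 0 ≤ A := (norm_nonneg _).trans hx₀.1
  have := eLpNorm_le_of_ae_le_four (a := K * A) (b := K * B) (by positivity) (by positivity)
    ((mv₁.sub mw₁).sub (mv₂.sub mw₂)).norm ((mp₁.sub mq₁).sub (mp₂.sub mq₂)).norm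
    (mw₁.sub mw₂).norm (mp₁.sub mp₂).norm (F := fun x =>
      (fluxFn f g (v₁ x) (p₁ x) - fluxFn f g (w₁ x) (q₁ x))
        - (fluxFn f g (v₂ x) (p₂ x) - fluxFn f g (w₂ x) (q₂ x))) (by
      filter_upwards [hT₁, hT₂, hv₁, hv₂, hw₁, hw₂, hB₁, hB₂] with x t1 t2 a1 a2 a3 a4 b1 b2
      refine (h A B _ _ _ _ _ _ _ _ hA hA1 t1 t2 a1.1 a2.1 a3.1 a4.1 a1.2 a2.2 a3.2 a4.2
        b1.1 b2.1 b1.2 b2.2).trans (le_of_eq ?_)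
      simp only [Pi.sub_apply, Real.norm_eq_abs]
      ring)
  simp only [eLpNorm_norm] at this
  exact this

end PSystem

namespace PSystem

/-! ### Consequences of decay -/

theorem fourierNormOne_sub_le (z w : L2 V) :
    fourierNormOne (z - w) ≤ fourierNormOne z + fourierNormOne w := by
  have hk : Measurable fun ξ : ℝ => 2 * Real.pi * ξ := by fun_prop
  have e : fourierNormOne (z - w) = eLpNorm ((fun ξ : ℝ => (2 * Real.pi * ξ) • fourierL2 z ξ) -
      fun ξ => (2 * Real.pi * ξ) • fourierL2 w ξ) 2 volume := by
    refine eLpNorm_congr_ae ?_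
    filter_upwards [fourierL2_sub_ae z w] with ξ h
    rw [h, Pi.sub_apply, smul_sub]
  rw [e]
  exact eLpNorm_sub_le (hk.aestronglyMeasurable.smul (Lp.aestronglyMeasurable _))
    (hk.aestronglyMeasurable.smul (Lp.aestronglyMeasurable _)) one_le_two

theorem fourierNormTwo_sub_le (z w : L2 V) :
    fourierNormTwo (z - w) ≤ fourierNormTwo z + fourierNormTwo w := by
  have hk : Measurable fun ξ : ℝ => (2 * Real.pi * ξ) ^ 2 := by fun_prop
  have hm : ∀ z : L2 V, AEStronglyMeasurable (fun ξ => fourierL2 z ξ 1) volume := fun z =>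
    (measurable_applyVC (Lp.stronglyMeasurable (fourierL2 z)).measurable 1).aestronglyMeasurable
  have e : fourierNormTwo (z - w) = eLpNorm ((fun ξ : ℝ => (2 * Real.pi * ξ) ^ 2 • fourierL2 z ξ 1)
      - fun ξ => (2 * Real.pi * ξ) ^ 2 • fourierL2 w ξ 1) 2 volume := by
    refine eLpNorm_congr_ae ?_
    filter_upwards [fourierL2_sub_ae z w] with ξ h
    rw [h, Pi.sub_apply, PiLp.sub_apply, smul_sub]
  rw [e]
  exact eLpNorm_sub_le (hk.aestronglyMeasurable.smul (hm z))
    (hk.aestronglyMeasurable.smul (hm w)) one_le_two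

theorem derivB_sub' {z w : L2 V} (hz : fourierNormOne z < ⊤) (hw : fourierNormOne w < ⊤) :
    derivB (z - w) = derivB z - derivB w :=
  derivB_sub hz hw ((fourierNormOne_sub_le z w).trans_lt (ENNReal.add_lt_top.2 ⟨hz, hw⟩))

theorem tendsto_zero_of_sq {ι : Type} {l : Filter ι} {u : ι → ℝ≥0∞}
    (h : Tendsto (fun i => u i ^ 2) l (𝓝 0)) : Tendsto u l (𝓝 0) := by
  have h2 := h.ennrpow_const (1 / 2 : ℝ)
  rw [ENNReal.zero_rpow_of_pos (by norm_num)] at h2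
  refine h2.congr fun i => ?_
  rw [← ENNReal.rpow_natCast, ← ENNReal.rpow_mul]
  norm_num

theorem continuousWithinAt_of_enorm {X : Type} [SeminormedAddCommGroup X] {u : ℝ → X} {S : Set ℝ}
    {t : ℝ} (hu : Tendsto (fun s => ‖u s - u t‖ₑ) (𝓝[S] t) (𝓝 0)) : ContinuousWithinAt u S t := by
  rw [ContinuousWithinAt, tendsto_iff_norm_sub_tendsto_zero]
  have h2 := (ENNReal.tendsto_toReal ENNReal.zero_ne_top).comp hu
  simpa [Function.comp_def] using h2

theorem enorm_derivB_sub_sq_le {z w : L2 V} (hz : fourierNormOne z < ⊤)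
    (hw : fourierNormOne w < ⊤) : ‖derivB z - derivB w‖ₑ ^ 2
      ≤ ‖z - w‖ₑ * (fourierNormTwo z + fourierNormTwo w) := by
  rw [← derivB_sub' hz hw]
  refine (enorm_derivB_sq_le ((fourierNormOne_sub_le z w).trans_lt
    (ENNReal.add_lt_top.2 ⟨hz, hw⟩))).trans ?_
  gcongr
  exact fourierNormTwo_sub_le z w

theorem continuousOn_derivB_of_continuousOn {z : ℝ → L2 V} (hc : ContinuousOn z (Set.Ici 0))
    (h1 : ∀ t, 0 ≤ t → fourierNormOne (z t) < ⊤) {B : ℝ}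
    (h2 : ∀ t, 0 ≤ t → fourierNormTwo (z t) ≤ ENNReal.ofReal B) :
    ContinuousOn (fun t => derivB (z t)) (Set.Ici 0) := by
  intro t ht
  refine continuousWithinAt_of_enorm (tendsto_zero_of_sq ?_)
  have h3 : Tendsto (fun s => z s - z t) (𝓝[Set.Ici 0] t) (𝓝 (z t - z t)) :=
    (hc t ht).tendsto.sub tendsto_const_nhds
  have h4 := ENNReal.Tendsto.mul_const h3.enorm (b := ENNReal.ofReal B + ENNReal.ofReal B)
    (.inr (by simp))
  rw [sub_self, enorm_zero, zero_mul] at h4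
  refine tendsto_of_tendsto_of_tendsto_of_le_of_le' tendsto_const_nhds h4
    (.of_forall fun _ => zero_le) ?_
  filter_upwards [self_mem_nhdsWithin] with s hs
  refine (enorm_derivB_sub_sq_le (h1 s hs) (h1 t ht)).trans ?_
  gcongr
  · exact h2 s hs
  · exact h2 t ht

theorem Decay.nonneg {R : ℝ} {Z : ℝ → ℝ → VC} (h : Decay R Z) : 0 ≤ R := by
  obtain ⟨ξ, hξ⟩ := (h.sup 0 le_rfl).exists
  exact (norm_nonneg _).trans hξ

namespace Decay

variable {R : ℝ} {z : ℝ → L2 V} {t : ℝ}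

theorem norm_le (h : Decay R fun t => fourierL2 (z t)) (ht : 0 ≤ t) :
    ‖z t‖ₑ ≤ ENNReal.ofReal (R * rho t) := by
  have := h.nonneg
  have hr := rho_pos ht
  exact ennreal_le_ofReal_of_sq (by positivity) ((enorm_sq_eq _).le.trans (h.zero t ht))

theorem one_le (h : Decay R fun t => fourierL2 (z t)) (ht : 0 ≤ t) :
    fourierNormOne (z t) ≤ ENNReal.ofReal (R * rho t ^ 3) := by
  have := h.nonneg
  have hr := rho_pos ht
  exact ennreal_le_ofReal_of_sq (by positivity) ((fourierNormOne_sq _).le.trans (h.one t ht))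

theorem two_le_log (h : Decay R fun t => fourierL2 (z t)) (ht : 0 ≤ t) :
    fourierNormTwo (z t) ≤ ENNReal.ofReal (R * (rho t ^ 5 * Real.log (2 + t))) := by
  have := h.nonneg
  have hr := rho_pos ht
  have hl := half_le_log ht
  exact ennreal_le_ofReal_of_sq (by positivity) ((fourierNormTwo_sq _).le.trans (h.two t ht))

theorem two_le (h : Decay R fun t => fourierL2 (z t)) (ht : 0 ≤ t) :
    fourierNormTwo (z t) ≤ ENNReal.ofReal (4 * R * rho t ^ 3) := by
  refine (h.two_le_log ht).trans (ENNReal.ofReal_le_ofReal ?_)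
  have hR := h.nonneg
  have hr := rho_pos ht
  have h1 := rho_sq_mul_log_le ht
  calc _ = R * rho t ^ 3 * (rho t ^ 2 * Real.log (2 + t)) := by ring
    _ ≤ R * rho t ^ 3 * 4 := by gcongr
    _ = _ := by ring

theorem one_lt_top (h : Decay R fun t => fourierL2 (z t)) (ht : 0 ≤ t) :
    fourierNormOne (z t) < ⊤ := (h.one_le ht).trans_lt ENNReal.ofReal_lt_top

theorem derivB_le (h : Decay R fun t => fourierL2 (z t)) (ht : 0 ≤ t) :
    ‖derivB (z t)‖ₑ ≤ ENNReal.ofReal (R * rho t ^ 3) :=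
  (enorm_derivB_le (h.one_lt_top ht)).trans (h.one_le ht)

end Decay

/-- Pointwise bounds of a state from the norms of the space `𝓑` at one time. -/
theorem supBound_of_norms {R ρ : ℝ} {z : L2 V} (hR : 0 ≤ R) (hρ : 0 < ρ) (hρ1 : ρ ≤ 1)
    (h0 : ‖z‖ₑ ≤ ENNReal.ofReal (R * ρ)) (h1 : fourierNormOne z ≤ ENNReal.ofReal (R * ρ ^ 3))
    (h2 : fourierNormTwo z ≤ ENNReal.ofReal (4 * R * ρ ^ 3)) : SupBound (3 * R * ρ ^ 2) z := by
  have hlt := h1.trans_lt ENNReal.ofReal_lt_top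
  refine ⟨hlt, h2.trans_lt ENNReal.ofReal_lt_top, ?_, ?_⟩
  · have := ae_norm_le (by positivity) (by positivity) (pow_pos hρ 2) h0 h1
    filter_upwards [this] with x hx
    refine hx.trans (Real.sqrt_le_iff.2 ⟨by positivity, ?_⟩)
    rw [div_le_iff₀ (by positivity)]
    have : 0 ≤ R ^ 2 * ρ ^ 6 := by positivity
    nlinarith
  · have := ae_abs_derivB_le hlt (by positivity) (by positivity) one_pos
      ((enorm_derivB_le hlt).trans h1) h2
    filter_upwards [this] with x hx
    refine hx.trans (Real.sqrt_le_iff.2 ⟨by positivity, ?_⟩)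
    rw [div_le_iff₀ (by positivity)]
    have h6 : ρ ^ 6 ≤ ρ ^ 4 := pow_le_pow_of_le_one hρ.le hρ1 (by norm_num)
    have : R ^ 2 * ρ ^ 6 ≤ R ^ 2 * ρ ^ 4 := by gcongr
    nlinarith [sq_nonneg (R * ρ ^ 2)]

namespace Decay

variable {R : ℝ} {z : ℝ → L2 V} {t : ℝ}

theorem supBound (h : Decay R fun t => fourierL2 (z t)) (ht : 0 ≤ t) :
    SupBound (3 * R * rho t ^ 2) (z t) :=
  supBound_of_norms h.nonneg (rho_pos ht) (rho_le_one ht) (h.norm_le ht) (h.one_le ht) (h.two_le ht)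

theorem supBound_const (h : Decay R fun t => fourierL2 (z t)) (ht : 0 ≤ t) :
    SupBound (3 * R) (z t) := by
  refine (h.supBound ht).mono ?_
  have := h.nonneg
  exact mul_le_of_le_one_right (by positivity) (pow_le_one₀ (rho_pos ht).le (rho_le_one ht))

theorem diff_le (h : Decay R fun t => fourierL2 (z t)) (ht : 0 ≤ t) {δ : ℝ} (hδ : 0 < δ)
    (hδ1 : δ ≤ 1) : ‖z (t + δ) - z t‖ₑ ≤ ENNReal.ofReal (R * δ * rho t ^ 3) := by
  have := h.nonneg
  have hr := rho_pos ht
  refine ennreal_le_ofReal_of_sq (by positivity) (le_trans (le_of_eq ?_) (h.diff δ hδ hδ1 t ht))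
  rw [enorm_sq_eq]
  refine lintegral_congr_ae ?_
  filter_upwards [fourierL2_sub_ae (z (t + δ)) (z t)] with ξ hξ
  rw [hξ]

theorem derivB_diff_sq (h : Decay R fun t => fourierL2 (z t)) {s : ℝ} (hs : 0 ≤ s) (ht : 0 ≤ t) :
    ‖derivB (z s) - derivB (z t)‖ₑ ^ 2
      = ∫⁻ ξ, (kn ξ * ‖fourierL2 (z s) ξ 1 - fourierL2 (z t) ξ 1‖ₑ) ^ 2 := by
  have h1 := h.one_lt_top hs
  have h2 := h.one_lt_top ht
  rw [← derivB_sub' h1 h2, enorm_derivB_sq ((fourierNormOne_sub_le _ _).trans_lt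
    (ENNReal.add_lt_top.2 ⟨h1, h2⟩))]
  refine lintegral_congr_ae ?_
  filter_upwards [fourierL2_sub_ae (z s) (z t)] with ξ hξ
  rw [hξ, PiLp.sub_apply]

theorem derivB_diff_le (h : Decay R fun t => fourierL2 (z t)) (ht : 0 ≤ t) {δ : ℝ} (hδ : 0 < δ)
    (hδ1 : δ ≤ 1) : ∫⁻ s in Set.Ioc t (t + 1), ‖derivB (z (s + δ)) - derivB (z s)‖ₑ ^ 2
      ≤ ENNReal.ofReal ((R * δ * rho t ^ 3) ^ 2) := by
  refine le_trans (le_of_eq ?_) (h.diffB δ hδ hδ1 t ht)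
  refine setLIntegral_congr_fun measurableSet_Ioc fun s hs => ?_
  have hs0 : 0 ≤ s := ht.trans hs.1.le
  exact h.derivB_diff_sq (by linarith) hs0

theorem norm_sub_le (h : Decay R fun t => fourierL2 (z t)) {s : ℝ} (hs : 0 ≤ s) (ht : 0 ≤ t)
    (hst : |s - t| ≤ 1) : ‖z s - z t‖ ≤ R * |s - t| := by
  have hR := h.nonneg
  have key : ∀ a b : ℝ, 0 ≤ a → a < b → b - a ≤ 1 → ‖z b - z a‖ ≤ R * (b - a) := by
    intro a b ha hab h1
    have h2 := h.diff_le ha (sub_pos.2 hab) h1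
    rw [add_sub_cancel, ← ofReal_norm, ENNReal.ofReal_le_ofReal_iff (by
      have := rho_pos ha
      have := sub_pos.2 hab
      positivity)] at h2
    refine h2.trans (mul_le_of_le_one_right (mul_nonneg hR (sub_pos.2 hab).le)
      (pow_le_one₀ (rho_pos ha).le (rho_le_one ha)))
  rcases lt_trichotomy s t with hlt | rfl | hlt
  · rw [norm_sub_rev, abs_sub_comm, abs_of_pos (sub_pos.2 hlt)] at *
    exact key s t hs hlt hst
  · simp
  · rw [abs_of_pos (sub_pos.2 hlt)] at *
    exact key t s ht hlt hst

theorem continuousOn (h : Decay R fun t => fourierL2 (z t)) : ContinuousOn z (Set.Ici 0) := by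
  intro t ht
  rw [ContinuousWithinAt, tendsto_iff_norm_sub_tendsto_zero]
  have hlim : Tendsto (fun s => R * |s - t|) (𝓝[Set.Ici 0] t) (𝓝 0) := by
    have : Continuous fun s => R * |s - t| := by fun_prop
    simpa using (this.tendsto t).mono_left nhdsWithin_le_nhds
  refine tendsto_of_tendsto_of_tendsto_of_le_of_le' tendsto_const_nhds hlim
    (.of_forall fun s => norm_nonneg _) ?_
  filter_upwards [self_mem_nhdsWithin, mem_nhdsWithin_of_mem_nhds (Metric.closedBall_mem_nhds t
    one_pos)] with s hs hs1
  exact h.norm_sub_le hs ht (by simpa [Real.dist_eq] using hs1)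

theorem continuousOn_derivB (h : Decay R fun t => fourierL2 (z t)) :
    ContinuousOn (fun t => derivB (z t)) (Set.Ici 0) :=
  continuousOn_derivB_of_continuousOn h.continuousOn (fun _ ht => h.one_lt_top ht) fun _ hu =>
    (h.two_le hu).trans (ENNReal.ofReal_le_ofReal (mul_le_of_le_one_right
      (mul_nonneg zero_le_four h.nonneg) (pow_le_one₀ (rho_pos hu).le (rho_le_one hu))))

end Decay

/-! ### The forcing generated by decaying functions -/

theorem FluxBound.norm_fluxHat_sub_le {f g : V → ℝ} {C r A : ℝ} {z w : L2 V}
    (h : FluxBound f g C r) (hA : A < r) (hz : SupBound A z) (hw : SupBound A w) (ξ : ℝ) :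
    ‖fluxHat f g z ξ - fluxHat f g w ξ‖ ≤ C * ((‖z‖ + ‖w‖ + 2 * ‖derivB z‖) * ‖z - w‖
        + 2 * (‖w‖ * ‖derivB z - derivB w‖)) := by
  have hC : 0 ≤ C := zero_le_one.trans h.one_le
  have h1 := h.enorm_fluxHat_sub_le hA hz hw ξ
  have e := ofReal_add_mul_expand (norm_nonneg z) (norm_nonneg w) (norm_nonneg (derivB z))
    (norm_nonneg (z - w)) (norm_nonneg (derivB z - derivB w))
  simp only [ofReal_norm] at e
  have e2 : (‖z‖ₑ + ‖w‖ₑ + 2 * ‖derivB z‖ₑ) * ‖z - w‖ₑ + 2 * (‖w‖ₑ * ‖derivB z - derivB w‖ₑ)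
      = ENNReal.ofReal ((‖z‖ + ‖w‖ + 2 * ‖derivB z‖) * ‖z - w‖
        + 2 * ‖w‖ * ‖derivB z - derivB w‖) := by rw [e]; ring
  rw [e2, ← ENNReal.ofReal_mul hC, ← ofReal_norm, ENNReal.ofReal_le_ofReal_iff (by positivity)]
    at h1
  linarith

theorem FluxBound.continuous_fluxHat_uncurry {f g : V → ℝ} {C r A : ℝ} (h : FluxBound f g C r)
    (hA : A < r) {ζ : ℝ → L2 V} (hζ : Continuous ζ) (hp : Continuous fun s => derivB (ζ s))
    (hs : ∀ s, SupBound A (ζ s)) :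
    Continuous (Function.uncurry fun s ξ => fluxHat f g (ζ s) ξ) := by
  rw [continuous_iff_continuousAt]
  rintro ⟨s₀, ξ₀⟩
  rw [ContinuousAt, tendsto_iff_norm_sub_tendsto_zero]
  have hc := h.continuous_fluxHat hA (hs s₀)
  set b : ℝ × ℝ → ℝ := fun p => C * ((‖ζ p.1‖ + ‖ζ s₀‖ + 2 * ‖derivB (ζ p.1)‖) * ‖ζ p.1 - ζ s₀‖
        + 2 * (‖ζ s₀‖ * ‖derivB (ζ p.1) - derivB (ζ s₀)‖))
        + ‖fluxHat f g (ζ s₀) p.2 - fluxHat f g (ζ s₀) ξ₀‖ with hb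
  have hbc : Continuous b := by
    have h1 : Continuous fun p : ℝ × ℝ => ζ p.1 := hζ.comp continuous_fst
    have h2 : Continuous fun p : ℝ × ℝ => derivB (ζ p.1) := hp.comp continuous_fst
    have h3 : Continuous fun p : ℝ × ℝ => fluxHat f g (ζ s₀) p.2 := hc.comp continuous_snd
    rw [hb]
    fun_prop
  have hlim : Tendsto b (𝓝 (s₀, ξ₀)) (𝓝 0) := by
    have := hbc.tendsto (s₀, ξ₀)
    simpa [hb] using this
  refine tendsto_of_tendsto_of_tendsto_of_le_of_le tendsto_const_nhds hlim
    (fun p => norm_nonneg _) fun p => ?_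
  simp only [Function.uncurry]
  calc _ ≤ ‖fluxHat f g (ζ p.1) p.2 - fluxHat f g (ζ s₀) p.2‖
        + ‖fluxHat f g (ζ s₀) p.2 - fluxHat f g (ζ s₀) ξ₀‖ := norm_sub_le_norm_sub_add_norm_sub _ _ _
    _ ≤ _ := by
        exact add_le_add (h.norm_fluxHat_sub_le hA (hs _) (hs _) _) le_rfl

theorem continuous_comp_max {X : Type} [TopologicalSpace X] {ζ : ℝ → X}
    (h : ContinuousOn ζ (Set.Ici 0)) : Continuous fun s => ζ (max s 0) :=
  h.comp_continuous (by fun_prop) fun s => le_max_right s 0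

section Pair

variable {f g : V → ℝ} {C K r A B : ℝ} {T : Set (V × ℝ)}

theorem eLpNorm_lp_sub {E : Type} [NormedAddCommGroup E] (u v : L2 E) :
    eLpNorm (fun x => u x - v x) 2 volume = ‖u - v‖ₑ := by
  rw [Lp.enorm_def]
  exact eLpNorm_congr_ae (Lp.coeFn_sub u v).symm

theorem SupBound.ae_sub {z w : L2 V} (hz : SupBound A z) (hw : SupBound A w)
    (hB : SupBound B (z - w)) : ∀ᵐ x, ‖z x - w x‖ ≤ B ∧ |derivB z x - derivB w x| ≤ B := by
  have h1 := hB.p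
  rw [derivB_sub' hz.one hw.one] at h1
  filter_upwards [hB.v, h1, Lp.coeFn_sub z w, Lp.coeFn_sub (derivB z) (derivB w)] with x a b c d
  rw [c] at a
  rw [d] at b
  exact ⟨a, b⟩

/-- The spatial derivative of the difference of two fluxes. -/
theorem SecondDiff.lintegral_kn_fluxHat_sub_le (h : FluxBound f g C r) (h2 : SecondDiff f g K r T)
    (hK : 0 ≤ K) (hA : A < r) (hA1 : A ≤ 1) {z w : L2 V} (hz : SupBound A z) (hw : SupBound A w)
    (hB : SupBound B (z - w)) (hT : ∀ᵐ x, (w x, derivB w x) ∈ T) :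
    ∫⁻ ξ, (kn ξ * ‖fluxHat f g z ξ - fluxHat f g w ξ‖ₑ) ^ 2
      ≤ (ENNReal.ofReal (K * A) * (fourierNormOne (z - w) + fourierNormTwo (z - w))
        + ENNReal.ofReal (K * B) * (fourierNormOne w + fourierNormTwo z)) ^ 2 := by
  simp only [h.fluxHat_sub hA hz hw]
  refine lintegral_kn_fourier_le (h.integrable_flux_sub hA hz hw).ofReal
    (h.memLp_flux_sub hA hz hw).ofReal fun a => ?_
  have mz := Lp.aestronglyMeasurable z
  have mw := Lp.aestronglyMeasurable w
  have mp := Lp.aestronglyMeasurable (derivB z)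
  have mq := Lp.aestronglyMeasurable (derivB w)
  have ht : ∀ {E : Type} [NormedAddCommGroup E] {u : ℝ → E}, AEStronglyMeasurable u volume →
      AEStronglyMeasurable (fun x => u (x + a)) volume := fun hu =>
    hu.comp_quasiMeasurePreserving (measurePreserving_add_right volume a).quasiMeasurePreserving
  have key := h2.eLpNorm_le hK hA hA1 hB.nonneg (ht mz) mz (ht mw) mw (ht mp) mp (ht mq) mq
    (ae_comp_add hT a) hT (ae_comp_add (hz.v.and hz.p) a) (hz.v.and hz.p)
    (ae_comp_add (hw.v.and hw.p) a) (hw.v.and hw.p) (ae_comp_add (hz.ae_sub hw hB) a)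
    (hz.ae_sub hw hB)
  have e1 : eLpNorm (fun x => (z (x + a) - w (x + a)) - (z x - w x)) 2 volume
      ≤ ‖a‖ₑ * fourierNormOne (z - w) := by
    refine le_trans (le_of_eq (eLpNorm_congr_ae ?_)) (eLpNorm_translate_le (z - w) a)
    have hc := Lp.coeFn_sub z w
    filter_upwards [hc, ae_comp_add hc a] with x a1 a2
    rw [a1, a2]; rfl
  have e2 : eLpNorm (fun x => (derivB z (x + a) - derivB w (x + a)) - (derivB z x - derivB w x)) 2
      volume ≤ ‖a‖ₑ * fourierNormTwo (z - w) := by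
    refine le_trans (le_of_eq (eLpNorm_congr_ae ?_)) (eLpNorm_translate_derivB_le hB.one a)
    rw [derivB_sub' hz.one hw.one]
    have hc := Lp.coeFn_sub (derivB z) (derivB w)
    filter_upwards [hc, ae_comp_add hc a] with x a1 a2
    rw [a1, a2]; rfl
  have e3 := eLpNorm_translate_le w a
  have e4 := eLpNorm_translate_derivB_le hz.one a
  calc _ = eLpNorm (fun x => (fluxFn f g (z (x + a)) (derivB z (x + a))
          - fluxFn f g (w (x + a)) (derivB w (x + a)))
          - (fluxFn f g (z x) (derivB z x) - fluxFn f g (w x) (derivB w x))) 2 volume := by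
        rw [← FluxBound.eLpNorm_ofReal]
        refine eLpNorm_congr_ae (.of_forall fun x => ?_)
        simp only [flux_eq]
        push_cast
        rfl
    _ ≤ _ := key
    _ ≤ ENNReal.ofReal (K * A) * (‖a‖ₑ * fourierNormOne (z - w) + ‖a‖ₑ * fourierNormTwo (z - w))
        + ENNReal.ofReal (K * B) * (‖a‖ₑ * fourierNormOne w + ‖a‖ₑ * fourierNormTwo z) := by
        gcongr
    _ = _ := by ring

/-- Increments of the difference of two fluxes. -/
theorem SecondDiff.lintegral_fluxHat_sub_sub_le (h : FluxBound f g C r)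
    (h2 : SecondDiff f g K r T) (hK : 0 ≤ K) (hA : A < r) (hA1 : A ≤ 1) {z₁ z₂ w₁ w₂ : L2 V}
    (hz₁ : SupBound A z₁) (hw₁ : SupBound A w₁) (hz₂ : SupBound A z₂) (hw₂ : SupBound A w₂)
    (hB₁ : SupBound B (z₁ - w₁)) (hB₂ : SupBound B (z₂ - w₂))
    (hT₁ : ∀ᵐ x, (w₁ x, derivB w₁ x) ∈ T) (hT₂ : ∀ᵐ x, (w₂ x, derivB w₂ x) ∈ T) :
    ∫⁻ ξ, ‖(fluxHat f g z₁ ξ - fluxHat f g w₁ ξ) - (fluxHat f g z₂ ξ - fluxHat f g w₂ ξ)‖ₑ ^ 2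
      ≤ (ENNReal.ofReal (K * A) * (‖(z₁ - w₁) - (z₂ - w₂)‖ₑ
          + ‖derivB (z₁ - w₁) - derivB (z₂ - w₂)‖ₑ)
        + ENNReal.ofReal (K * B) * (‖w₁ - w₂‖ₑ + ‖derivB z₁ - derivB z₂‖ₑ)) ^ 2 := by
  have hm : ∀ u : L2 V, AEStronglyMeasurable u volume := fun u => Lp.aestronglyMeasurable u
  have hm' : ∀ u : L2 ℝ, AEStronglyMeasurable u volume := fun u => Lp.aestronglyMeasurable u
  have key := h2.eLpNorm_le hK hA hA1 hB₁.nonneg (hm z₁) (hm z₂) (hm w₁) (hm w₂)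
    (hm' (derivB z₁)) (hm' (derivB z₂)) (hm' (derivB w₁)) (hm' (derivB w₂)) hT₁ hT₂
    (hz₁.v.and hz₁.p) (hz₂.v.and hz₂.p) (hw₁.v.and hw₁.p) (hw₂.v.and hw₂.p)
    (hz₁.ae_sub hw₁ hB₁) (hz₂.ae_sub hw₂ hB₂)
  have e1 : eLpNorm (fun x => (z₁ x - w₁ x) - (z₂ x - w₂ x)) 2 volume
      = ‖(z₁ - w₁) - (z₂ - w₂)‖ₑ := by
    rw [← eLpNorm_lp_sub]
    refine eLpNorm_congr_ae ?_
    filter_upwards [Lp.coeFn_sub z₁ w₁, Lp.coeFn_sub z₂ w₂] with x a1 a2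
    rw [a1, a2]; rfl
  have e2 : eLpNorm (fun x => (derivB z₁ x - derivB w₁ x) - (derivB z₂ x - derivB w₂ x)) 2 volume
      = ‖derivB (z₁ - w₁) - derivB (z₂ - w₂)‖ₑ := by
    rw [derivB_sub' hz₁.one hw₁.one, derivB_sub' hz₂.one hw₂.one, ← eLpNorm_lp_sub]
    refine eLpNorm_congr_ae ?_
    filter_upwards [Lp.coeFn_sub (derivB z₁) (derivB w₁), Lp.coeFn_sub (derivB z₂) (derivB w₂)]
      with x a1 a2
    rw [a1, a2]; rfl
  rw [e1, e2, eLpNorm_lp_sub, eLpNorm_lp_sub] at key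
  rw [← eLpNorm_two_sq]
  refine pow_le_pow_left' (le_trans (le_of_eq ?_) key) 2
  have hi₁ := h.integrable_flux_sub hA hz₁ hw₁
  have hi₂ := h.integrable_flux_sub hA hz₂ hw₂
  have hF := eLpNorm_fourier_eq (u := fun x : ℝ =>
      ((flux f g z₁ x - flux f g w₁ x : ℝ) : ℂ) - ((flux f g z₂ x - flux f g w₂ x : ℝ) : ℂ))
    (hi₁.ofReal.sub hi₂.ofReal)
    ((h.memLp_flux_sub hA hz₁ hw₁).ofReal.sub (h.memLp_flux_sub hA hz₂ hw₂).ofReal)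
  have e3 : (fun ξ => (fluxHat f g z₁ ξ - fluxHat f g w₁ ξ) - (fluxHat f g z₂ ξ - fluxHat f g w₂ ξ))
      = 𝓕 (fun x : ℝ => ((flux f g z₁ x - flux f g w₁ x : ℝ) : ℂ)
        - ((flux f g z₂ x - flux f g w₂ x : ℝ) : ℂ)) := by
    ext ξ
    rw [h.fluxHat_sub hA hz₁ hw₁, h.fluxHat_sub hA hz₂ hw₂]
    exact (fourier_sub hi₁.ofReal hi₂.ofReal ξ).symm
  rw [e3, hF, ← FluxBound.eLpNorm_ofReal]
  refine eLpNorm_congr_ae (.of_forall fun x => ?_)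
  simp only [flux_eq]
  push_cast
  rfl

set_option maxHeartbeats 1000000 in
/-- The difference of the fluxes of two decaying functions is a forcing. -/
theorem SecondDiff.forcing (h : FluxBound f g C r) (h2 : SecondDiff f g K r T) (hK : 0 ≤ K)
    {R S : ℝ} (hR : 3 * R < r) (hR1 : 3 * R ≤ 1) {z w : ℝ → L2 V}
    (hz : Decay R fun t => fourierL2 (z t)) (hw : Decay R fun t => fourierL2 (w t))
    (hS : Decay S fun t => fourierL2 (z t - w t))
    (hT : ∀ t, 0 ≤ t → ∀ᵐ x, (w t x, derivB (w t) x) ∈ T) :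
    Forcing (30 * (C + K) * R * S)
      fun s ξ => fluxHat f g (z (max s 0)) ξ - fluxHat f g (w (max s 0)) ξ := by
  have hC : 0 ≤ C := zero_le_one.trans h.one_le
  have hR0 := hz.nonneg
  have hS0 := hS.nonneg
  have mx : ∀ {s : ℝ}, 0 ≤ s → max s 0 = s := fun hs => max_eq_left hs
  have sb : ∀ {t u : ℝ}, 0 ≤ t → t ≤ u → 3 * R * rho u ^ 2 ≤ 3 * R * rho t ^ 2 := by
    intro t u ht htu
    have h1 := rho_anti ht htu
    have h2 := rho_pos (ht.trans htu)
    gcongr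
  have sbS : ∀ {t u : ℝ}, 0 ≤ t → t ≤ u → 3 * S * rho u ^ 2 ≤ 3 * S * rho t ^ 2 := by
    intro t u ht htu
    have h1 := rho_anti ht htu
    have h2 := rho_pos (ht.trans htu)
    gcongr
  have hAr : ∀ {t : ℝ}, 0 ≤ t → 3 * R * rho t ^ 2 ≤ 3 * R := fun ht =>
    mul_le_of_le_one_right (by positivity) (pow_le_one₀ (rho_pos ht).le (rho_le_one ht))
  refine ⟨?_, fun s hs ξ => ?_, fun s hs => ?_, fun δ hδ hδ1 t ht => ?_⟩
  · have c1 := h.continuous_fluxHat_uncurry hR (continuous_comp_max hz.continuousOn)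
      (continuous_comp_max hz.continuousOn_derivB) fun s => hz.supBound_const (le_max_right s 0)
    have c2 := h.continuous_fluxHat_uncurry hR (continuous_comp_max hw.continuousOn)
      (continuous_comp_max hw.continuousOn_derivB) fun s => hw.supBound_const (le_max_right s 0)
    exact c1.sub c2
  · rw [mx hs]
    have hr := rho_pos hs
    have hr1 := rho_le_one hs
    have b := h.norm_fluxHat_sub_le hR (hz.supBound_const hs) (hw.supBound_const hs) ξ
    have toR : ∀ {E : Type} [NormedAddCommGroup E] {x : E} {a : ℝ}, 0 ≤ a →
        ‖x‖ₑ ≤ ENNReal.ofReal a → ‖x‖ ≤ a := by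
      intro E _ x a ha hx
      rwa [← ofReal_norm, ENNReal.ofReal_le_ofReal_iff ha] at hx
    have n1 := toR (by positivity) (hz.norm_le hs)
    have n2 := toR (by positivity) (hw.norm_le hs)
    have n3 := toR (by positivity) (hz.derivB_le hs)
    have n4 := toR (by positivity) (hS.norm_le hs)
    have n5 : ‖derivB (z s) - derivB (w s)‖ ≤ S * rho s ^ 3 := by
      rw [← derivB_sub' (hz.one_lt_top hs) (hw.one_lt_top hs)]
      exact toR (by positivity) (hS.derivB_le hs)
    have p3 : rho s ^ 3 ≤ rho s := by
      calc rho s ^ 3 ≤ rho s ^ 1 := pow_le_pow_of_le_one hr.le hr1 (by norm_num)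
        _ = _ := pow_one _
    calc _ ≤ C * ((R * rho s + R * rho s + 2 * (R * rho s)) * (S * rho s)
          + 2 * (R * rho s * (S * rho s))) := by
          refine b.trans ?_
          gcongr
          · exact n3.trans (by gcongr)
          · exact n5.trans (by gcongr)
      _ = 6 * C * R * S * rho s ^ 2 := by ring
      _ ≤ _ := by gcongr <;> linarith
  · rw [mx hs]
    have hr := rho_pos hs
    have b := SecondDiff.lintegral_kn_fluxHat_sub_le h h2 hK ((hAr hs).trans_lt hR)
      ((hAr hs).trans hR1) (hz.supBound hs) (hw.supBound hs) (hS.supBound hs) (hT s hs)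
    refine b.trans ?_
    rw [ENNReal.ofReal_pow (by positivity)]
    refine pow_le_pow_left' ?_ 2
    calc _ ≤ ENNReal.ofReal (K * (3 * R * rho s ^ 2)) *
          (ENNReal.ofReal (S * rho s ^ 3) + ENNReal.ofReal (4 * S * rho s ^ 3))
          + ENNReal.ofReal (K * (3 * S * rho s ^ 2)) *
          (ENNReal.ofReal (R * rho s ^ 3) + ENNReal.ofReal (4 * R * rho s ^ 3)) := by
          gcongr
          · exact hS.one_le hs
          · exact hS.two_le hs
          · exact hw.one_le hs
          · exact hz.two_le hs
      _ ≤ _ := by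
          rw [← ENNReal.ofReal_add (by positivity) (by positivity),
            ← ENNReal.ofReal_add (by positivity) (by positivity),
            ← ENNReal.ofReal_mul (by positivity), ← ENNReal.ofReal_mul (by positivity),
            ← ENNReal.ofReal_add (by positivity) (by positivity)]
          refine ENNReal.ofReal_le_ofReal ?_
          have : 0 ≤ C * (R * S * rho s ^ 5) := by positivity
          nlinarith
  · have hr := rho_pos ht
    set X : ℝ≥0∞ := ENNReal.ofReal (6 * K * R * S * δ * rho t ^ 5) with hX
    set a : ℝ≥0∞ := ENNReal.ofReal (3 * K * R * rho t ^ 2) with ha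
    set b : ℝ≥0∞ := ENNReal.ofReal (3 * K * S * rho t ^ 2) with hb
    set Q : ℝ → ℝ≥0∞ := fun s => ‖derivB (z (s + δ) - w (s + δ)) - derivB (z s - w s)‖ₑ ^ 2 with hQ
    set P : ℝ → ℝ≥0∞ := fun s => ‖derivB (z (s + δ)) - derivB (z s)‖ₑ ^ 2 with hP
    have hpt : ∀ s ∈ Set.Ioc t (t + 1), ∫⁻ ξ,
        ‖(fluxHat f g (z (max (s + δ) 0)) ξ - fluxHat f g (w (max (s + δ) 0)) ξ)
          - (fluxHat f g (z (max s 0)) ξ - fluxHat f g (w (max s 0)) ξ)‖ₑ ^ 2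
        ≤ 4 * X ^ 2 + (16 * a ^ 2 * Q s + 16 * b ^ 2 * P s) := by
      intro s hs
      have hs0 : 0 ≤ s := ht.trans hs.1.le
      have hsd : 0 ≤ s + δ := by linarith
      have hst : t ≤ s := hs.1.le
      have hstd : t ≤ s + δ := by linarith
      have hrs := rho_anti ht hst
      have hrs0 := rho_pos hs0
      rw [mx hs0, mx hsd]
      have key := SecondDiff.lintegral_fluxHat_sub_sub_le h h2 hK ((hAr ht).trans_lt hR)
        ((hAr ht).trans hR1) ((hz.supBound hsd).mono (sb ht hstd))
        ((hw.supBound hsd).mono (sb ht hstd)) ((hz.supBound hs0).mono (sb ht hst))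
        ((hw.supBound hs0).mono (sb ht hst)) ((hS.supBound hsd).mono (sbS ht hstd))
        ((hS.supBound hs0).mono (sbS ht hst)) (hT _ hsd) (hT _ hs0)
      refine key.trans ?_
      have g1 : ‖(z (s + δ) - w (s + δ)) - (z s - w s)‖ₑ ≤ ENNReal.ofReal (S * δ * rho t ^ 3) :=
        (hS.diff_le hs0 hδ hδ1).trans (ENNReal.ofReal_le_ofReal (by gcongr))
      have g2 : ‖w (s + δ) - w s‖ₑ ≤ ENNReal.ofReal (R * δ * rho t ^ 3) :=
        (hw.diff_le hs0 hδ hδ1).trans (ENNReal.ofReal_le_ofReal (by gcongr))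
      set q := ‖derivB (z (s + δ) - w (s + δ)) - derivB (z s - w s)‖ₑ
      set p := ‖derivB (z (s + δ)) - derivB (z s)‖ₑ
      calc _ ≤ (ENNReal.ofReal (K * (3 * R * rho t ^ 2)) * (ENNReal.ofReal (S * δ * rho t ^ 3) + q)
            + ENNReal.ofReal (K * (3 * S * rho t ^ 2)) *
              (ENNReal.ofReal (R * δ * rho t ^ 3) + p)) ^ 2 := by gcongr
        _ = (X + (a * q + b * p)) ^ 2 := by
            congr 1
            rw [mul_add, mul_add, ← ENNReal.ofReal_mul (by positivity),
              ← ENNReal.ofReal_mul (by positivity), hX, ha, hb]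
            rw [show K * (3 * R * rho t ^ 2) * (S * δ * rho t ^ 3)
                = 3 * K * R * S * δ * rho t ^ 5 by ring,
              show K * (3 * S * rho t ^ 2) * (R * δ * rho t ^ 3)
                = 3 * K * R * S * δ * rho t ^ 5 by ring,
              show 6 * K * R * S * δ * rho t ^ 5 = 3 * K * R * S * δ * rho t ^ 5
                + 3 * K * R * S * δ * rho t ^ 5 by ring,
              ENNReal.ofReal_add (by positivity) (by positivity),
              show K * (3 * R * rho t ^ 2) = 3 * K * R * rho t ^ 2 by ring,
              show K * (3 * S * rho t ^ 2) = 3 * K * S * rho t ^ 2 by ring]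
            ring
        _ ≤ 4 * (X ^ 2 + 4 * ((a * q) ^ 2 + (b * p) ^ 2)) := by
            refine (ennreal_add_sq_le _ _).trans ?_
            gcongr
            exact ennreal_add_sq_le _ _
        _ = _ := by rw [hQ, hP]; ring
    have hQm : AEMeasurable Q (volume.restrict (Set.Ioc t (t + 1))) := by
      have c := continuous_comp_max hS.continuousOn_derivB
      have c' : Continuous fun s : ℝ => ‖derivB (z (max (s + δ) 0) - w (max (s + δ) 0))
          - derivB (z (max s 0) - w (max s 0))‖ₑ ^ 2 := by
        have c1 : Continuous fun s : ℝ => derivB (z (max (s + δ) 0) - w (max (s + δ) 0)) :=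
          c.comp (continuous_add_const δ)
        exact (ENNReal.continuous_pow 2).comp (c1.sub c).enorm
      refine c'.measurable.aemeasurable.congr ?_
      filter_upwards [ae_restrict_mem measurableSet_Ioc] with s hs
      have hs0 : 0 ≤ s := ht.trans hs.1.le
      rw [mx hs0, mx (by linarith)]
    have hI : ∫⁻ s in Set.Ioc t (t + 1), (4 * X ^ 2 + (16 * a ^ 2 * Q s + 16 * b ^ 2 * P s))
        ≤ 4 * X ^ 2 + (16 * a ^ 2 * ENNReal.ofReal ((S * δ * rho t ^ 3) ^ 2)
          + 16 * b ^ 2 * ENNReal.ofReal ((R * δ * rho t ^ 3) ^ 2)) := by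
      have t1 : (16 * a ^ 2) ≠ ⊤ := ENNReal.mul_ne_top (by norm_num)
        (ENNReal.pow_ne_top ENNReal.ofReal_ne_top)
      have t2 : (16 * b ^ 2) ≠ ⊤ := ENNReal.mul_ne_top (by norm_num)
        (ENNReal.pow_ne_top ENNReal.ofReal_ne_top)
      rw [lintegral_add_left measurable_const, lintegral_add_left' (hQm.const_mul _),
        lintegral_const_mul' _ _ t1, lintegral_const_mul' _ _ t2, setLIntegral_const,
        Real.volume_Ioc, add_sub_cancel_left, ENNReal.ofReal_one, mul_one]
      gcongr
      · exact hS.derivB_diff_le ht hδ hδ1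
      · exact hz.derivB_diff_le ht hδ hδ1
    refine (setLIntegral_mono' measurableSet_Ioc hpt).trans (hI.trans ?_)
    rw [hX, ha, hb, show (4 : ℝ≥0∞) = ENNReal.ofReal 4 by norm_num,
      show (16 : ℝ≥0∞) = ENNReal.ofReal 16 by norm_num, ← ENNReal.ofReal_pow (by positivity),
      ← ENNReal.ofReal_pow (by positivity), ← ENNReal.ofReal_pow (by positivity),
      ← ENNReal.ofReal_mul (by positivity), ← ENNReal.ofReal_mul (by positivity),
      ← ENNReal.ofReal_mul (by positivity), ← ENNReal.ofReal_mul (by positivity),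
      ← ENNReal.ofReal_mul (by positivity), ← ENNReal.ofReal_add (by positivity) (by positivity),
      ← ENNReal.ofReal_add (by positivity) (by positivity)]
    refine ENNReal.ofReal_le_ofReal ?_
    calc _ = 432 * (K * R * S * δ * rho t ^ 5) ^ 2 := by ring
      _ ≤ 900 * ((C + K) * R * S * δ * rho t ^ 5) ^ 2 := by
          gcongr <;> linarith
      _ = _ := by ring

end Pair

end PSystem

namespace PSystem

/-! ### The space `𝓑₀` on the Fourier side -/

open SchwartzMap in
theorem integral_iterDerivSchwartz_smul {E : Type} [NormedAddCommGroup E] [NormedSpace ℝ E]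
    [CompleteSpace E] (n : ℕ) (φ : 𝓢(ℝ, ℝ)) (u : 𝓢(ℝ, E)) :
    ∫ x, iterDerivSchwartz n φ x • u x = (-1 : ℝ) ^ n • ∫ x, φ x • iterDerivSchwartz n u x := by
  induction n generalizing φ with
  | zero => simp [iterDerivSchwartz]
  | succ n ih =>
    have e1 : iterDerivSchwartz (n + 1) φ = iterDerivSchwartz n (SchwartzMap.derivCLM ℝ ℝ φ) :=
      Function.iterate_succ_apply _ _ _
    have e2 : iterDerivSchwartz (n + 1) u = SchwartzMap.derivCLM ℝ E (iterDerivSchwartz n u) :=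
      Function.iterate_succ_apply' _ _ _
    have h := SchwartzMap.integral_smul_deriv_right_eq_neg_left φ (iterDerivSchwartz n u)
    rw [e1, ih, e2, pow_succ, mul_neg_one, neg_smul, ← smul_neg]
    congr 1
    simp only [SchwartzMap.derivCLM_apply]
    rw [h, neg_neg]

open SchwartzMap in
theorem derivNorm_le_schwartz {E : Type} [NormedAddCommGroup E] [NormedSpace ℝ E]
    [CompleteSpace E] (n : ℕ) {u : L2 E} {φ : 𝓢(ℝ, E)} (h : u =ᵐ[volume] φ) :
    derivNorm n u ≤ eLpNorm (iteratedDeriv n φ) 2 volume := by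
  have hcoe := (iterDerivSchwartz n φ).coeFn_toLp 2 (μ := volume)
  have hw : HasWeakDeriv n u ((iterDerivSchwartz n φ).toLp 2 volume) := by
    intro ψ hψ hψc
    have h1 := integral_iterDerivSchwartz_smul n (hψc.toSchwartzMap hψ) φ
    rw [coe_iterDerivSchwartz] at h1
    calc _ = ∫ x, iteratedDeriv n ψ x • φ x := integral_congr_ae (by
          filter_upwards [h] with x hx
          rw [hx])
      _ = _ := h1
      _ = _ := by
          congr 1
          refine integral_congr_ae ?_
          filter_upwards [hcoe] with x hx
          rw [hx]
          rfl
  calc derivNorm n u ≤ ‖(iterDerivSchwartz n φ).toLp 2 volume‖ₑ := iInf₂_le _ hw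
    _ = _ := by rw [Lp.enorm_def, eLpNorm_congr_ae hcoe, coe_iterDerivSchwartz]

/-- The norm of `𝓑₀` of a function with the Fourier transform `m`. -/
def fourierNorm (m : ℝ → VC) : ℝ≥0∞ :=
  eLpNorm m ⊤ volume + eLpNorm m 2 volume + eLpNorm (fun ξ => (2 * Real.pi * ξ) • m ξ) 2 volume
    + eLpNorm (fun ξ => (2 * Real.pi * ξ) ^ 2 • m ξ 1) 2 volume

theorem fourierNorm_congr {m m' : ℝ → VC} (h : m =ᵐ[volume] m') :
    fourierNorm m = fourierNorm m' := by
  unfold fourierNorm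
  rw [eLpNorm_congr_ae h, eLpNorm_congr_ae h, eLpNorm_congr_ae
    (f := fun ξ : ℝ => (2 * Real.pi * ξ) • m ξ) (g := fun ξ => (2 * Real.pi * ξ) • m' ξ),
    eLpNorm_congr_ae (f := fun ξ : ℝ => (2 * Real.pi * ξ) ^ 2 • m ξ 1)
      (g := fun ξ => (2 * Real.pi * ξ) ^ 2 • m' ξ 1)]
  · filter_upwards [h] with ξ hξ
    rw [hξ]
  · filter_upwards [h] with ξ hξ
    rw [hξ]

theorem normB0_eq (z : L2 V) : normB0 z = fourierNorm (fourierL2 z) := by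
  rw [normB0, normLow, derivNorm_one_eq, derivNorm_two_compB_eq, fourierNorm, eLpNorm_fourierL2]
  rfl

theorem fourierNorm_add_le {m m' : ℝ → VC} (hm : AEStronglyMeasurable m volume)
    (hm' : AEStronglyMeasurable m' volume) :
    fourierNorm (fun ξ => m ξ + m' ξ) ≤ fourierNorm m + fourierNorm m' := by
  have hk : Measurable fun ξ : ℝ => 2 * Real.pi * ξ := by fun_prop
  have hp : ∀ {m : ℝ → VC}, AEStronglyMeasurable m volume →
      AEStronglyMeasurable (fun ξ => m ξ 1) volume := fun h =>
    (EuclideanSpace.proj (𝕜 := ℂ) (1 : Fin 2)).continuous.comp_aestronglyMeasurable h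
  have h0 := eLpNorm_add_le hm hm' (p := ⊤) le_top
  have h1 := eLpNorm_add_le hm hm' (p := 2) one_le_two
  have h2 := eLpNorm_add_le (hk.aestronglyMeasurable.smul hm) (hk.aestronglyMeasurable.smul hm')
    (p := 2) one_le_two
  have h3 := eLpNorm_add_le ((hk.pow_const 2).aestronglyMeasurable.smul (hp hm))
    ((hk.pow_const 2).aestronglyMeasurable.smul (hp hm')) (p := 2) one_le_two
  have e2 : (fun ξ : ℝ => (2 * Real.pi * ξ) • (m ξ + m' ξ))
      = (fun ξ : ℝ => 2 * Real.pi * ξ) • m + (fun ξ : ℝ => 2 * Real.pi * ξ) • m' := by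
    ext1 ξ; simp
  have e3 : (fun ξ : ℝ => (2 * Real.pi * ξ) ^ 2 • (m ξ + m' ξ) 1)
      = (fun ξ : ℝ => (2 * Real.pi * ξ) ^ 2) • (fun ξ => m ξ 1)
        + (fun ξ : ℝ => (2 * Real.pi * ξ) ^ 2) • fun ξ => m' ξ 1 := by
    ext1 ξ; simp
  unfold fourierNorm
  rw [e2, e3]
  refine (add_le_add (add_le_add (add_le_add h0 h1) h2) h3).trans (le_of_eq ?_)
  simp only [Pi.smul_def']
  ring

theorem normB0_sub_le (z y w : L2 V) : normB0 (z - w) ≤ normB0 (z - y) + normB0 (y - w) := by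
  rw [normB0_eq, normB0_eq, normB0_eq]
  refine le_trans (le_of_eq (fourierNorm_congr ?_)) (fourierNorm_add_le
    (Lp.aestronglyMeasurable (fourierL2 (z - y))) (Lp.aestronglyMeasurable (fourierL2 (y - w))))
  filter_upwards [fourierL2_sub_ae z w, fourierL2_sub_ae z y, fourierL2_sub_ae y w] with ξ h1 h2 h3
  rw [h1, h2, h3]; abel

theorem fourierL2_eq_integral (z : L2 V) (hz : Integrable z) :
    fourierL2 z =ᵐ[volume] 𝓕 fun x => complexify (z x) := by
  have hc := complexify.coeFn_compLp z
  have h1 := fourier_L2_eq_integral (complexify.compLp z : L2 VC)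
    ((complexify.integrable_comp hz).congr (hc.mono fun x hx => hx.symm))
  refine h1.trans (Eq.eventuallyEq ?_)
  ext1 ξ
  exact Real.fourier_congr_ae hc ξ

/-- The Fourier transform of an element of `𝓑₀` is continuous and vanishes at infinity. -/
theorem MemB0.exists_fourier {z : L2 V} (h : MemB0 z) : ∃ m : ℝ → VC, Continuous m ∧
    Tendsto m (cocompact ℝ) (𝓝 0) ∧ fourierL2 z =ᵐ[volume] m := by
  have hpos : ∀ n : ℕ, (0 : ℝ≥0∞) < ENNReal.ofReal ((n : ℝ) + 1)⁻¹ := fun n =>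
    ENNReal.ofReal_pos.2 (by positivity)
  choose w hw hlt using fun n : ℕ => h _ (hpos n)
  choose φ hφ hφc hwφ using hw
  have hinteg : ∀ n, Integrable (fun x => complexify (φ n x)) := fun n =>
    complexify.integrable_comp ((hφ n).continuous.integrable_of_hasCompactSupport (hφc n))
  let F : ℕ → ZeroAtInftyContinuousMap ℝ VC := fun n =>
    ⟨⟨𝓕 fun x => complexify (φ n x), continuous_fourier_of_integrable (hinteg n)⟩,
      Real.zero_at_infty_fourier _⟩
  have hF : ∀ n, fourierL2 (w n) =ᵐ[volume] F n := by
    intro n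
    have hwi : Integrable (w n) :=
      ((hφ n).continuous.integrable_of_hasCompactSupport (hφc n)).congr (hwφ n).symm
    refine (fourierL2_eq_integral (w n) hwi).trans (Eq.eventuallyEq ?_)
    ext1 ξ
    exact Real.fourier_congr_ae ((hwφ n).mono fun x hx => by rw [hx]) ξ
  have hd : ∀ n, ∀ᵐ ξ, ‖fourierL2 z ξ - F n ξ‖ ≤ ((n : ℝ) + 1)⁻¹ := by
    intro n
    have h1 : eLpNorm (fourierL2 (z - w n)) ⊤ volume ≤ ENNReal.ofReal ((n : ℝ) + 1)⁻¹ := by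
      refine le_trans ?_ (hlt n).le
      rw [normB0, normLow, add_assoc, add_assoc]
      exact le_self_add
    rw [eLpNorm_exponent_top] at h1
    filter_upwards [ae_le_eLpNormEssSup (f := fourierL2 (z - w n)) (μ := volume),
      fourierL2_sub_ae z (w n), hF n] with ξ a b c
    have := a.trans h1
    rw [b, c, ← ofReal_norm, ENNReal.ofReal_le_ofReal_iff (by positivity)] at this
    exact this
  have hdd : ∀ n k ξ, ‖F n ξ - F k ξ‖ ≤ ((n : ℝ) + 1)⁻¹ + ((k : ℝ) + 1)⁻¹ := by
    intro n k
    have hcont : Continuous fun ξ => ‖F n ξ - F k ξ‖ :=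
      ((F n).continuous.sub (F k).continuous).norm
    have hae : ∀ᵐ ξ, ‖F n ξ - F k ξ‖ ≤ ((n : ℝ) + 1)⁻¹ + ((k : ℝ) + 1)⁻¹ := by
      filter_upwards [hd n, hd k] with ξ a b
      rw [norm_sub_rev] at a
      exact (norm_sub_le_norm_sub_add_norm_sub _ _ _).trans (add_le_add a b)
    have hcl : IsClosed {ξ | ‖F n ξ - F k ξ‖ ≤ ((n : ℝ) + 1)⁻¹ + ((k : ℝ) + 1)⁻¹} :=
      isClosed_le hcont continuous_const
    intro ξ
    have hden := Measure.dense_of_ae hae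
    have := hcl.closure_eq ▸ hden ξ
    exact this
  have hlim : Tendsto (fun n : ℕ => ((n : ℝ) + 1)⁻¹) atTop (𝓝 0) := by
    simpa [one_div] using tendsto_one_div_add_atTop_nhds_zero_nat (𝕜 := ℝ)
  have hcauchy : CauchySeq F := by
    rw [Metric.cauchySeq_iff']
    intro ε hε
    obtain ⟨N, hN⟩ := (hlim.eventually (gt_mem_nhds (by positivity : (0 : ℝ) < ε / 3))).exists_forall_of_atTop
    refine ⟨N, fun n hn => ?_⟩
    rw [← ZeroAtInftyContinuousMap.dist_toBCF_eq_dist]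
    refine lt_of_le_of_lt ((BoundedContinuousFunction.dist_le (by positivity :
      (0 : ℝ) ≤ ε / 3 + ε / 3)).2 fun ξ => ?_) (by linarith : ε / 3 + ε / 3 < ε)
    rw [dist_eq_norm]
    exact (hdd n N ξ).trans (add_le_add (hN n hn).le (hN N le_rfl).le)
  obtain ⟨G, hG⟩ := cauchySeq_tendsto_of_complete hcauchy
  have hGu := ZeroAtInftyContinuousMap.tendsto_iff_tendstoUniformly.1 hG
  refine ⟨G, G.continuous, G.zero_at_infty', ?_⟩
  filter_upwards [ae_all_iff.2 hd] with ξ hξ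
  refine tendsto_nhds_unique ?_ (hGu.tendsto_at ξ)
  rw [tendsto_iff_norm_sub_tendsto_zero]
  refine tendsto_of_tendsto_of_tendsto_of_le_of_le tendsto_const_nhds hlim
    (fun n => norm_nonneg _) fun n => ?_
  rw [norm_sub_rev]
  exact hξ n

end PSystem

namespace PSystem

/-! ### Approximation by test functions -/

theorem eLpNorm_top_fourierL2_le (z : L2 V) (hz : Integrable z) :
    eLpNorm (fourierL2 z) ⊤ volume ≤ ∫⁻ x, ‖z x‖ₑ := by
  rw [eLpNorm_congr_ae (fourierL2_eq_integral z hz), eLpNorm_exponent_top]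
  refine essSup_le_of_ae_le _ (.of_forall fun ξ => ?_)
  change ‖𝓕 (fun x => complexify (z x)) ξ‖ₑ ≤ _
  rw [Real.fourier_real_eq]
  refine (enorm_integral_le_lintegral_enorm _).trans (le_of_eq (lintegral_congr fun x => ?_))
  rw [← ofReal_norm, ← ofReal_norm, Circle.norm_smul, norm_complexify]

open SchwartzMap in
theorem normB0_le_schwartz {z : L2 V} {φ : 𝓢(ℝ, V)} (h : z =ᵐ[volume] φ) :
    normB0 z ≤ (∫⁻ x, ‖φ x‖ₑ) + eLpNorm φ 2 volume + eLpNorm (iteratedDeriv 1 φ) 2 volume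
      + eLpNorm (iteratedDeriv 2 φ) 2 volume := by
  have hi : Integrable z := φ.integrable.congr h.symm
  let P : V →L[ℝ] ℝ := EuclideanSpace.proj (1 : Fin 2)
  have hb : compB z =ᵐ[volume] (SchwartzMap.postcompCLM (𝕜 := ℝ) P φ) := by
    filter_upwards [P.coeFn_compLp z, h] with x h1 h2
    rw [compB, h1, h2]
    rfl
  unfold normB0 normLow
  gcongr ?_ + ?_ + ?_ + ?_
  · refine (eLpNorm_top_fourierL2_le z hi).trans (le_of_eq (lintegral_congr_ae ?_))
    filter_upwards [h] with x hx
    rw [hx]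
  · rw [Lp.enorm_def, eLpNorm_congr_ae h]
  · exact derivNorm_le_schwartz 1 h
  · refine (derivNorm_le_schwartz 2 hb).trans (eLpNorm_mono fun x => ?_)
    have e := iteratedDeriv_clm_comp P (φ.smooth ⊤) 2 x
    change ‖iteratedDeriv 2 (fun y => P (φ y)) x‖ ≤ _
    rw [e]
    exact PiLp.norm_apply_le _ _

open SchwartzMap in
/-- Schwartz functions belong to `𝓑₀`. -/
theorem memB0_schwartz {z : L2 V} {φ : 𝓢(ℝ, V)} (h : z =ᵐ[volume] φ) : MemB0 z := by
  obtain ⟨χ, hχ, hχc, hcut⟩ := exists_cutoff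
  have hs : ∀ N, ContDiff ℝ ∞ (fun y => χ N y • φ y) := fun N => (hχ N).smul (φ.smooth ⊤)
  have hsc : ∀ N, HasCompactSupport (fun y => χ N y • φ y) := fun N => (hχc N).smul_right
  let w : ℕ → 𝓢(ℝ, V) := fun N => (hsc N).toSchwartzMap (hs N)
  have hlim : ∀ n q : ℕ, 1 ≤ q →
      Tendsto (fun N => ∫⁻ x, ‖iteratedDeriv n (φ - w N) x‖ₑ ^ q) atTop (𝓝 0) := by
    intro n q hq
    obtain ⟨hl, B, hB, hbound⟩ := hcut V φ n
    have e : ∀ N x, iteratedDeriv n (φ - w N) x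
        = iteratedDeriv n φ x - iteratedDeriv n (fun y => χ N y • φ y) x := by
      intro N x
      exact iteratedDeriv_sub ((φ.smooth ⊤).contDiffAt.of_le (by exact_mod_cast le_top))
        ((hs N).contDiffAt.of_le (by exact_mod_cast le_top))
    have hmem : ∀ p, MemLp (fun x => ‖iteratedDeriv n φ x‖ + B x) p volume := by
      intro p
      rw [← coe_iterDerivSchwartz]
      exact ((iterDerivSchwartz n φ).memLp p volume).norm.add (hB p)
    have h0 : Tendsto (fun N => ∫⁻ x, ‖iteratedDeriv n (φ - w N) x‖ₑ ^ q) atTop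
        (𝓝 (∫⁻ _ : ℝ, 0)) := by
      refine tendsto_lintegral_of_dominated_convergence
        (fun x => ‖‖iteratedDeriv n φ x‖ + B x‖ₑ ^ q) (fun N => ?_) (fun N => ?_) ?_ ?_
      · have : Continuous (iteratedDeriv n (φ - w N)) := by
          rw [← coe_iterDerivSchwartz]
          exact SchwartzMap.continuous _
        exact this.measurable.enorm.pow_const q
      · filter_upwards with x
        gcongr
        rw [e]
        rw [← ofReal_norm, ← ofReal_norm]
        refine ENNReal.ofReal_le_ofReal ?_
        have hb := hbound N x
        rw [Real.norm_eq_abs, abs_of_nonneg (add_nonneg (norm_nonneg _) ((norm_nonneg _).trans hb))]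
        exact (norm_sub_le _ _).trans (by gcongr)
      · have h1 := (hmem q).eLpNorm_lt_top
        have hq0 : (q : ℝ≥0) ≠ 0 := by exact_mod_cast (by omega : q ≠ 0)
        have h2 := eLpNorm_nnreal_pow_eq_lintegral (μ := volume)
          (f := fun x => ‖iteratedDeriv n φ x‖ + B x) hq0
        simp only [NNReal.coe_natCast, ENNReal.rpow_natCast] at h2
        rw [← h2]
        exact ENNReal.pow_ne_top (by exact_mod_cast h1.ne)
      · filter_upwards with x
        refine tendsto_const_nhds.congr' ?_
        filter_upwards [hl x] with N hN
        rw [e, hN, sub_self]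
        rw [enorm_zero, zero_pow (by omega)]
    simpa using h0
  have hsq : ∀ n : ℕ, Tendsto (fun N => eLpNorm (iteratedDeriv n (φ - w N)) 2 volume) atTop
      (𝓝 0) := by
    intro n
    have h1 := (hlim n 2 one_le_two).ennrpow_const (1 / 2 : ℝ)
    rw [ENNReal.zero_rpow_of_pos (by norm_num)] at h1
    refine h1.congr fun N => ?_
    rw [← eLpNorm_two_sq, ← ENNReal.rpow_natCast, ← ENNReal.rpow_mul]
    norm_num
  have htot : Tendsto (fun N => (∫⁻ x, ‖(φ - w N) x‖ₑ) + eLpNorm (φ - w N) 2 volume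
      + eLpNorm (iteratedDeriv 1 (φ - w N)) 2 volume
      + eLpNorm (iteratedDeriv 2 (φ - w N)) 2 volume) atTop (𝓝 0) := by
    have h1 := hlim 0 1 le_rfl
    have h2 := hsq 0
    simp only [iteratedDeriv_zero, pow_one] at h1 h2
    simpa using ((h1.add h2).add (hsq 1)).add (hsq 2)
  intro ε hε
  obtain ⟨N, hN⟩ := (htot.eventually (gt_mem_nhds hε)).exists
  refine ⟨(w N).toLp 2 volume, ⟨_, hs N, hsc N, (w N).coeFn_toLp 2 volume⟩, ?_⟩
  refine lt_of_le_of_lt (normB0_le_schwartz (φ := φ - w N) ?_) hN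
  filter_upwards [Lp.coeFn_sub z ((w N).toLp 2 volume), (w N).coeFn_toLp 2 volume, h] with x a b c
  rw [a, Pi.sub_apply, b, c]
  rfl

theorem tendsto_eLpNorm_cutoff {F : Type} [NormedAddCommGroup F] [NormedSpace ℝ F]
    {χ : ℕ → ℝ → ℝ} (hχ : ∀ N, Measurable (χ N)) (h1 : ∀ N ξ, |1 - χ N ξ| ≤ 1)
    (hlim : ∀ ξ, ∀ᶠ N in atTop, χ N ξ = 1) {u : ℝ → F} (hu : AEStronglyMeasurable u volume)
    (hu2 : eLpNorm u 2 volume < ⊤) :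
    Tendsto (fun N => eLpNorm (fun ξ => (1 - χ N ξ) • u ξ) 2 volume) atTop (𝓝 0) := by
  have h0 : Tendsto (fun N => ∫⁻ ξ, ‖(1 - χ N ξ) • u ξ‖ₑ ^ 2) atTop (𝓝 (∫⁻ _ : ℝ, 0)) := by
    refine tendsto_lintegral_of_dominated_convergence' (fun ξ => ‖u ξ‖ₑ ^ 2) (fun N => ?_)
      (fun N => ?_) ?_ ?_
    · exact ((((hχ N).const_sub 1).aestronglyMeasurable.smul hu).enorm).pow_const 2
    · filter_upwards with ξ
      gcongr
      rw [enorm_smul]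
      refine mul_le_of_le_one_left' ?_
      rw [← ofReal_norm, Real.norm_eq_abs, ENNReal.ofReal_le_one]
      exact h1 N ξ
    · rw [← eLpNorm_two_sq]
      exact ENNReal.pow_ne_top hu2.ne
    · filter_upwards with ξ
      refine tendsto_const_nhds.congr' ?_
      filter_upwards [hlim ξ] with N hN
      simp [hN]
  rw [lintegral_zero] at h0
  have h2 := h0.ennrpow_const (1 / 2 : ℝ)
  rw [ENNReal.zero_rpow_of_pos (by norm_num)] at h2
  refine h2.congr fun N => ?_
  rw [← eLpNorm_two_sq, ← ENNReal.rpow_natCast, ← ENNReal.rpow_mul]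
  norm_num

/-- A small function with support in a fixed compact set has small norm. -/
theorem fourierNorm_le_of_support {D : ℝ → VC} {ε L : ℝ} (hL : 0 ≤ L)
    (hD : ∀ ξ, ‖D ξ‖ ≤ ε) (hS : ∀ ξ, L < |ξ| → D ξ = 0) :
    fourierNorm D ≤ ENNReal.ofReal ε + 3 * (ENNReal.ofReal (ε * (1 + 2 * Real.pi * L) ^ 2) *
      eLpNorm (Set.indicator (Set.Icc (-L) L) fun _ => (1 : ℝ)) 2 volume) := by
  have hε : 0 ≤ ε := (norm_nonneg _).trans (hD 0)
  have hpi := Real.pi_pos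
  set B := (1 + 2 * Real.pi * L) ^ 2 with hB
  have hB1 : 1 ≤ 1 + 2 * Real.pi * L := by
    have : 0 ≤ 2 * Real.pi * L := by positivity
    linarith
  have hB0 : 0 ≤ B := by positivity
  have key : ∀ {F : Type} [NormedAddCommGroup F] (u : ℝ → F) (_ : ∀ ξ, |ξ| ≤ L → ‖u ξ‖ ≤ ε * B)
      (_ : ∀ ξ, L < |ξ| → u ξ = 0), eLpNorm u 2 volume ≤ ENNReal.ofReal (ε * B) *
        eLpNorm (Set.indicator (Set.Icc (-L) L) fun _ => (1 : ℝ)) 2 volume := by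
    intro F _ u h1 h2
    refine eLpNorm_le_mul_eLpNorm_of_ae_le_mul (.of_forall fun ξ => ?_) 2
    by_cases h : |ξ| ≤ L
    · rw [Set.indicator_of_mem (by exact Set.mem_Icc.2 (abs_le.1 h))]
      simpa using h1 ξ h
    · rw [h2 ξ (not_le.1 h), norm_zero]
      positivity
  have hk : ∀ ξ : ℝ, |ξ| ≤ L → |2 * Real.pi * ξ| ≤ 1 + 2 * Real.pi * L := by
    intro ξ h
    rw [abs_mul, abs_of_pos (by positivity : 0 < 2 * Real.pi)]
    have := mul_le_mul_of_nonneg_left h (by positivity : 0 ≤ 2 * Real.pi)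
    linarith
  have k0 := key D (fun ξ _ => (hD ξ).trans (le_mul_of_one_le_right hε (one_le_pow₀ hB1))) hS
  have k1 := key (fun ξ => (2 * Real.pi * ξ) • D ξ) (fun ξ h => by
      rw [norm_smul, Real.norm_eq_abs, mul_comm]
      refine mul_le_mul (hD ξ) ((hk ξ h).trans (le_self_pow₀ hB1 two_ne_zero)) (abs_nonneg _) hε)
    fun ξ h => by rw [hS ξ h, smul_zero]
  have k2 := key (fun ξ => (2 * Real.pi * ξ) ^ 2 • D ξ 1) (fun ξ h => by
      rw [norm_smul, norm_pow, Real.norm_eq_abs, mul_comm]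
      exact mul_le_mul ((norm_apply_le _ _).trans (hD ξ))
        (pow_le_pow_left₀ (abs_nonneg _) (hk ξ h) 2) (by positivity) hε)
    fun ξ h => by rw [hS ξ h]; simp
  have kt : eLpNorm D ⊤ volume ≤ ENNReal.ofReal ε := by
    rw [eLpNorm_exponent_top]
    exact eLpNormEssSup_le_of_ae_bound (.of_forall hD)
  unfold fourierNorm
  refine (add_le_add (add_le_add (add_le_add kt k0) k1) k2).trans (le_of_eq ?_)
  ring

theorem exists_smooth_symm_approx {M : ℝ → VC} (hM : Continuous M) {L ε : ℝ}
    (hε : 0 < ε) (hsupp : ∀ ξ, L < |ξ| → M ξ = 0) (hsymm : ∀ ξ, M (-ξ) = conjVC (M ξ)) :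
    ∃ ψ : ℝ → VC, ContDiff ℝ ∞ ψ ∧ (∀ ξ, L + 1 < |ξ| → ψ ξ = 0) ∧ (∀ ξ, ‖M ξ - ψ ξ‖ ≤ ε) ∧
      ∀ ξ, ψ (-ξ) = conjVC (ψ ξ) := by
  have hMc : HasCompactSupport M := by
    refine HasCompactSupport.intro (isCompact_Icc (a := -L) (b := L)) fun ξ h => hsupp ξ ?_
    rw [Set.mem_Icc, ← abs_le, not_le] at h
    exact h
  have hu : UniformContinuous M := hMc.uniformContinuous_of_continuous hM
  obtain ⟨δ, hδ, hδM⟩ := Metric.uniformContinuous_iff.1 hu ε hε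
  obtain ⟨ψ, hψ, hψM⟩ := hM.exists_contDiff_dist_le_of_forall_mem_ball_dist_le
    (lt_min hδ one_pos)
  have hd : ∀ ξ, ‖M ξ - ψ ξ‖ ≤ ε := by
    intro ξ
    rw [← dist_eq_norm, dist_comm]
    exact hψM ξ ε fun x hx => (hδM (lt_of_lt_of_le hx (min_le_left _ _))).le
  have hz : ∀ ξ, L + 1 < |ξ| → ψ ξ = 0 := by
    intro ξ h
    have h1 := hψM ξ 0 fun x hx => by
      have hx1 : |x - ξ| < 1 := lt_of_lt_of_le hx (min_le_right _ _)
      have := abs_sub_abs_le_abs_sub ξ x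
      rw [abs_sub_comm] at this
      rw [hsupp x (by linarith), hsupp ξ (by linarith), dist_self]
    rw [hsupp ξ (by linarith)] at h1
    exact dist_le_zero.1 h1
  have hcc : ∀ v, conjVC (conjVC v) = v := fun v => by ext i; simp
  refine ⟨fun ξ => (1 / 2 : ℝ) • (ψ ξ + conjVC (ψ (-ξ))), ?_, ?_, ?_, ?_⟩
  · have : ContDiff ℝ ∞ fun ξ : ℝ => ψ (-ξ) := hψ.comp contDiff_neg
    fun_prop
  · intro ξ h
    simp only
    rw [hz ξ h, hz (-ξ) (by rwa [abs_neg]), map_zero, add_zero, smul_zero]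
  · intro ξ
    have e : M ξ - (1 / 2 : ℝ) • (ψ ξ + conjVC (ψ (-ξ)))
        = (1 / 2 : ℝ) • ((M ξ - ψ ξ) + conjVC (M (-ξ) - ψ (-ξ))) := by
      rw [map_sub, hsymm, hcc]
      module
    rw [e, norm_smul]
    have h2 : ‖conjVC (M (-ξ) - ψ (-ξ))‖ ≤ ε := by
      rw [norm_conjVC]
      exact hd (-ξ)
    have h3 := norm_add_le (M ξ - ψ ξ) (conjVC (M (-ξ) - ψ (-ξ)))
    have h4 := hd ξ
    rw [Real.norm_eq_abs, abs_of_pos (by norm_num)]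
    linarith
  · intro ξ
    simp only [map_smul, map_add, hcc, neg_neg]
    rw [add_comm]

/-- A function whose Fourier transform is continuous and vanishes at infinity belongs to `𝓑₀`
if its norm is finite. -/
theorem fourierL2_rep_neg {z : L2 V} {m : ℝ → VC} (hc : Continuous m)
    (hm : fourierL2 z =ᵐ[volume] m) : ∀ ξ, m (-ξ) = conjVC (m ξ) := by
  refine congrFun (Continuous.ae_eq_iff_eq volume (hc.comp continuous_neg)
    (conjVC.continuous.comp hc) |>.1 ?_)
  filter_upwards [fourierL2_neg z, hm, (Measure.measurePreserving_neg
    (volume : Measure ℝ)).quasiMeasurePreserving.ae hm] with ξ a b c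
  simp only [Function.comp_apply]
  rw [← c, ← b, a]

theorem memB0_of_fourier {z : L2 V} {m : ℝ → VC} (hc : Continuous m)
    (h0 : Tendsto m (cocompact ℝ) (𝓝 0)) (hm : fourierL2 z =ᵐ[volume] m)
    (h1 : fourierNormOne z < ⊤) (h2 : fourierNormTwo z < ⊤) : MemB0 z := by
  have hsymm := fourierL2_rep_neg hc hm
  let b : ℕ → ContDiffBump (0 : ℝ) := fun N => ⟨N + 1, N + 2, by positivity, by linarith⟩
  have hb1 : ∀ N ξ, |1 - b N ξ| ≤ 1 := fun N ξ => by
    rw [abs_of_nonneg (sub_nonneg.2 (b N).le_one)]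
    linarith [(b N).nonneg (x := ξ)]
  have hbin : ∀ (N : ℕ) (ξ : ℝ), |ξ| ≤ N + 1 → b N ξ = 1 := fun N ξ h =>
    (b N).one_of_mem_closedBall (by rw [mem_closedBall_zero_iff]; exact h)
  have hbout : ∀ (N : ℕ) (ξ : ℝ), (N : ℝ) + 2 < |ξ| → b N ξ = 0 := fun N ξ h =>
    (b N).zero_of_le_dist (by rw [dist_zero_right]; exact h.le)
  have hlim : ∀ ξ : ℝ, ∀ᶠ N in atTop, b N ξ = 1 := by
    intro ξ
    obtain ⟨N₀, hN₀⟩ := exists_nat_gt |ξ|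
    filter_upwards [eventually_ge_atTop N₀] with N hN
    refine hbin N ξ ?_
    have : (N₀ : ℝ) ≤ N := by exact_mod_cast hN
    linarith
  have hmeas : ∀ N, Measurable (b N) := fun N => (b N).continuous.measurable
  have hk : Measurable fun ξ : ℝ => 2 * Real.pi * ξ := by fun_prop
  have hcut : Tendsto (fun N => fourierNorm fun ξ => m ξ - b N ξ • m ξ) atTop (𝓝 0) := by
    have t0 : Tendsto (fun N => eLpNorm (fun ξ => (1 - b N ξ) • m ξ) ⊤ volume) atTop (𝓝 0) := by
      rw [ENNReal.tendsto_atTop_zero]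
      intro ε hε
      obtain ⟨r, hr0, hr⟩ := ENNReal.lt_iff_exists_real_btwn.1 hε
      have hr0' : 0 < r := ENNReal.ofReal_pos.1 (by simpa using hr.1)
      have hev := h0.norm.eventually (gt_mem_nhds (by simpa using hr0' : ‖(0 : VC)‖ < r))
      obtain ⟨K, hK, hKs⟩ := mem_cocompact.1 hev
      obtain ⟨A, hA⟩ := hK.isBounded.subset_closedBall 0
      obtain ⟨N₀, hN₀⟩ := exists_nat_gt A
      refine ⟨N₀, fun N hN => le_trans ?_ hr.2.le⟩
      rw [eLpNorm_exponent_top]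
      refine eLpNormEssSup_le_of_ae_bound (.of_forall fun ξ => ?_)
      by_cases h : |ξ| ≤ N + 1
      · rw [hbin N ξ h, sub_self, zero_smul, norm_zero]
        exact hr0'.le
      · have hξ : ξ ∈ Kᶜ := fun hξ => h (by
          have h3 : |ξ| ≤ A := by simpa using hA hξ
          have : (N₀ : ℝ) ≤ N := by exact_mod_cast hN
          linarith)
        rw [norm_smul, Real.norm_eq_abs]
        exact (mul_le_of_le_one_left (norm_nonneg _) (hb1 N ξ)).trans (hKs hξ).le
    have hm2 : eLpNorm m 2 volume < ⊤ := by
      rw [← eLpNorm_congr_ae hm]; exact Lp.eLpNorm_lt_top _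
    have hm1 : eLpNorm (fun ξ => (2 * Real.pi * ξ) • m ξ) 2 volume < ⊤ := by
      refine lt_of_le_of_lt (le_of_eq (eLpNorm_congr_ae ?_)) h1
      filter_upwards [hm] with ξ hξ
      rw [hξ]
    have hm3 : eLpNorm (fun ξ => (2 * Real.pi * ξ) ^ 2 • m ξ 1) 2 volume < ⊤ := by
      refine lt_of_le_of_lt (le_of_eq (eLpNorm_congr_ae ?_)) h2
      filter_upwards [hm] with ξ hξ
      rw [hξ]
    have hc1 : Continuous fun ξ => m ξ 1 := by fun_prop
    have t1 := tendsto_eLpNorm_cutoff hmeas hb1 hlim hc.aestronglyMeasurable hm2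
    have t2 := tendsto_eLpNorm_cutoff hmeas hb1 hlim
      (hk.aestronglyMeasurable.smul hc.aestronglyMeasurable) hm1
    have t3 := tendsto_eLpNorm_cutoff hmeas hb1 hlim
      ((hk.pow_const 2).aestronglyMeasurable.smul hc1.aestronglyMeasurable) hm3
    have ht := ((t0.add t1).add t2).add t3
    simp only [add_zero] at ht
    refine ht.congr fun N => ?_
    unfold fourierNorm
    have e : ∀ ξ, m ξ - b N ξ • m ξ = (1 - b N ξ) • m ξ := fun ξ => by rw [sub_smul, one_smul]
    simp only [e]
    have e2 : (fun ξ => (1 - b N ξ) • ((fun ξ : ℝ => 2 * Real.pi * ξ) • m) ξ)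
        = fun ξ => (2 * Real.pi * ξ) • (1 - b N ξ) • m ξ := by
      ext1 ξ
      exact smul_comm (1 - b N ξ) (2 * Real.pi * ξ) (m ξ)
    have e3 : (fun ξ => (1 - b N ξ) • ((fun ξ : ℝ => (2 * Real.pi * ξ) ^ 2) • fun ξ => m ξ 1) ξ)
        = fun ξ => (2 * Real.pi * ξ) ^ 2 • ((1 - b N ξ) • m ξ) 1 := by
      ext1 ξ
      exact smul_comm (1 - b N ξ) ((2 * Real.pi * ξ) ^ 2) (m ξ 1)
    rw [e2, e3]
  intro ε hε
  have hε3 : 0 < ε / 3 := ENNReal.div_pos hε.ne' (by norm_num)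
  obtain ⟨N, hN⟩ := (hcut.eventually (gt_mem_nhds hε3)).exists
  set L : ℝ := N + 2 with hL
  have hL0 : 0 ≤ L := by positivity
  set v := eLpNorm (Set.indicator (Set.Icc (-(L + 1)) (L + 1)) fun _ => (1 : ℝ)) 2 volume with hv
  have hvt : v ≠ ⊤ := by
    rw [hv, eLpNorm_indicator_const measurableSet_Icc (by norm_num) (by norm_num)]
    simp
  have hsmall : Tendsto (fun x : ℝ => ENNReal.ofReal x
      + 3 * (ENNReal.ofReal (x * (1 + 2 * Real.pi * (L + 1)) ^ 2) * v)) (𝓝[>] 0) (𝓝 0) := by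
    have c1 : Tendsto (fun x : ℝ => ENNReal.ofReal x) (𝓝[>] 0) (𝓝 0) := by
      have := (ENNReal.continuous_ofReal.tendsto 0).mono_left (nhdsWithin_le_nhds (s := Set.Ioi 0))
      simpa using this
    have c2 : Tendsto (fun x : ℝ => ENNReal.ofReal (x * (1 + 2 * Real.pi * (L + 1)) ^ 2)) (𝓝[>] 0)
        (𝓝 0) := by
      have h := (ENNReal.continuous_ofReal.comp (by fun_prop : Continuous fun x : ℝ =>
        x * (1 + 2 * Real.pi * (L + 1)) ^ 2)).tendsto 0
      have := h.mono_left (nhdsWithin_le_nhds (s := Set.Ioi 0))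
      simpa [Function.comp_def] using this
    have c3 := ENNReal.Tendsto.const_mul (a := 3)
      (ENNReal.Tendsto.mul_const c2 (b := v) (.inr hvt)) (.inr (by norm_num))
    simpa using c1.add c3
  obtain ⟨r, hr, hr0⟩ := ((hsmall.eventually (gt_mem_nhds hε3)).and
    (self_mem_nhdsWithin : Set.Ioi (0 : ℝ) ∈ 𝓝[>] 0)).exists
  have hMs : ∀ ξ, L < |ξ| → b N ξ • m ξ = 0 := fun ξ h => by rw [hbout N ξ h, zero_smul]
  have hMc : Continuous fun ξ => b N ξ • m ξ := (b N).continuous.smul hc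
  obtain ⟨ψ, hψ, hψs, hψd, hψn⟩ := exists_smooth_symm_approx hMc hr0 hMs fun ξ => by
    rw [hsymm, map_smul, (b N).neg]
  have hψc : HasCompactSupport ψ := by
    refine HasCompactSupport.intro (isCompact_Icc (a := -(L + 1)) (b := L + 1)) fun ξ h => hψs ξ ?_
    rw [Set.mem_Icc, ← abs_le, not_le] at h
    exact h
  have hψL : MemLp ψ 2 volume := hψ.continuous.memLp_of_hasCompactSupport hψc
  obtain ⟨w, hw⟩ := exists_fourierL2_eq hψL (.of_forall hψn)
  let Ψ : SchwartzMap ℝ VC := hψc.toSchwartzMap hψ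
  have hwS : w =ᵐ[volume] (SchwartzMap.postcompCLM (𝕜 := ℝ) reVC (𝓕⁻ Ψ)) := by
    have h3 := ae_eq_fourierInv_of_fourier_ae_eq (complexify.compLp w : L2 VC)
      (hψ.continuous.integrable_of_hasCompactSupport hψc) hw
    filter_upwards [h3, complexify.coeFn_compLp w] with x a c
    have e : (𝓕⁻ Ψ : SchwartzMap ℝ VC) x = 𝓕⁻ ψ x := by rw [SchwartzMap.fourierInv_coe]; rfl
    change _ = reVC ((𝓕⁻ Ψ : SchwartzMap ℝ VC) x)
    rw [e, ← a, c]
    ext i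
    simp
  obtain ⟨y, hy, hyw⟩ := memB0_schwartz hwS _ hε3
  refine ⟨y, hy, (normB0_sub_le z w y).trans_lt ?_⟩
  have hzw : normB0 (z - w) < ε / 3 + ε / 3 := by
    rw [normB0_eq, fourierNorm_congr (m' := fun ξ => (m ξ - b N ξ • m ξ) + (b N ξ • m ξ - ψ ξ))]
    · refine (fourierNorm_add_le (hc.sub hMc).aestronglyMeasurable
        (hMc.sub hψ.continuous).aestronglyMeasurable).trans_lt (ENNReal.add_lt_add hN ?_)
      refine lt_of_le_of_lt (fourierNorm_le_of_support (L := L + 1) (by positivity) hψd ?_) hr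
      intro ξ h
      rw [Pi.sub_apply, hMs ξ (by linarith), hψs ξ h, sub_zero]
    · filter_upwards [fourierL2_sub_ae z w, hm, hw] with ξ a b c
      rw [a, b, c]
      abel
  calc _ < ε / 3 + ε / 3 + ε / 3 := ENNReal.add_lt_add hzw hyw
    _ = ε := ENNReal.add_thirds ε

end PSystem

namespace PSystem

/-! ### Membership in `𝓑` of solutions of the linear problem -/

/-- The pointwise bound of Duhamel's formula on the time interval `[0, T]`. -/
def envelope (Z₀ : ℝ → VC) (η : ℝ → ℝ → ℂ) (T ξ : ℝ) : ℝ≥0∞ :=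
  ‖Z₀ ξ‖ₑ ^ 2 + ∫⁻ s in Set.Ioc 0 T, ‖η s ξ‖ₑ ^ 2

variable {M R : ℝ} {Z₀ : ℝ → VC} {η : ℝ → ℝ → ℂ} {z : ℝ → L2 V}

theorem enorm_duhamel_sq_le (hη : Continuous (Function.uncurry η)) {t T : ℝ} (ht : 0 ≤ t)
    (hT : t ≤ T) (ξ : ℝ) : ‖duhamel Z₀ η t ξ‖ₑ ^ 2 ≤ envelope Z₀ η T ξ := by
  have hc : Continuous fun s => η s ξ := hη.comp (by fun_prop : Continuous fun s : ℝ => (s, ξ))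
  have h := (isFlow_duhamel Z₀ hη ξ).enorm_energy_le hc ht
  rw [← enormVC_sq, ← enormVC_sq, duhamel_zero] at h
  exact (le_self_add.trans h).trans (add_le_add le_rfl
    (lintegral_mono_set (Set.Ioc_subset_Ioc_right hT)))

theorem measurable_envelope (hZ : Measurable Z₀) (hη : Continuous (Function.uncurry η)) (T : ℝ) :
    Measurable (envelope Z₀ η T) := by
  refine (hZ.enorm.pow_const 2).add ?_
  have : Measurable (Function.uncurry fun ξ s => ‖η s ξ‖ₑ ^ 2) :=
    ((hη.measurable.comp measurable_swap).enorm).pow_const 2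
  exact this.lintegral_prod_right

theorem Forcing.norm_le (h : Forcing M η) {s : ℝ} (hs : 0 ≤ s) (ξ : ℝ) : ‖η s ξ‖ ≤ M :=
  (h.sup s hs ξ).trans (mul_le_of_le_one_right h.nonneg
    (pow_le_one₀ (rho_pos hs).le (rho_le_one hs)))

theorem tendsto_envelope (h : Forcing M η) (hη0 : ∀ s, 0 ≤ s → Tendsto (η s) (cocompact ℝ) (𝓝 0))
    (hZ0 : Tendsto Z₀ (cocompact ℝ) (𝓝 0)) (T : ℝ) :
    Tendsto (envelope Z₀ η T) (cocompact ℝ) (𝓝 0) := by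
  have : (cocompact ℝ).IsCountablyGenerated := by
    rw [cocompact_eq_atBot_atTop]; infer_instance
  have h1 : Tendsto (fun ξ => ‖Z₀ ξ‖ₑ ^ 2) (cocompact ℝ) (𝓝 0) := by
    simpa using ENNReal.Tendsto.pow (n := 2) hZ0.enorm
  have h2 : Tendsto (fun ξ => ∫⁻ s in Set.Ioc 0 T, ‖η s ξ‖ₑ ^ 2) (cocompact ℝ)
      (𝓝 (∫⁻ _ in Set.Ioc 0 T, 0)) := by
    refine tendsto_lintegral_filter_of_dominated_convergence (fun _ => ENNReal.ofReal M ^ 2)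
      (.of_forall fun ξ => ((h.cont_time ξ).measurable.enorm).pow_const 2)
      (.of_forall fun ξ => ?_) ?_ ?_
    · filter_upwards [ae_restrict_mem measurableSet_Ioc] with s hs
      gcongr
      rw [← ofReal_norm]
      exact ENNReal.ofReal_le_ofReal (h.norm_le hs.1.le ξ)
    · rw [setLIntegral_const]
      exact ENNReal.mul_ne_top (ENNReal.pow_ne_top ENNReal.ofReal_ne_top) (by simp)
    · filter_upwards [ae_restrict_mem measurableSet_Ioc] with s hs
      simpa using ENNReal.Tendsto.pow (n := 2) (hη0 s hs.1.le).enorm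
  have h3 := h1.add h2
  simp only [lintegral_zero, add_zero] at h3
  exact h3

theorem lintegral_kn_envelope_lt_top (h : Forcing M η) (hZ : DataBound M Z₀) (T : ℝ) :
    ∫⁻ ξ, kn ξ ^ 2 * envelope Z₀ η T ξ < ⊤ := by
  have hk := measurable_kn
  have hm : Measurable fun p : ℝ × ℝ => (kn p.1 * ‖η p.2 p.1‖ₑ) ^ 2 :=
    ((hk.comp measurable_fst).mul (h.cont.measurable.comp measurable_swap).enorm).pow_const 2
  have e : ∀ ξ, kn ξ ^ 2 * envelope Z₀ η T ξ
      = (kn ξ * ‖Z₀ ξ‖ₑ) ^ 2 + ∫⁻ s in Set.Ioc 0 T, (kn ξ * ‖η s ξ‖ₑ) ^ 2 := by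
    intro ξ
    rw [envelope, mul_add, mul_pow]
    congr 1
    rw [← lintegral_const_mul _ (((h.cont_time ξ).measurable.enorm).pow_const 2)]
    simp only [mul_pow]
  simp only [e]
  have hm0 : Measurable fun ξ => (kn ξ * ‖Z₀ ξ‖ₑ) ^ 2 := (hk.mul hZ.meas.enorm).pow_const 2
  rw [lintegral_add_left hm0]
  refine ENNReal.add_lt_top.2 ⟨hZ.one.trans_lt ENNReal.ofReal_lt_top, ?_⟩
  rw [lintegral_lintegral_swap hm.aemeasurable]
  calc _ ≤ ∫⁻ _ in Set.Ioc 0 T, ENNReal.ofReal (M ^ 2) := by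
        refine setLIntegral_mono measurable_const fun s hs => (h.deriv s hs.1.le).trans
          (ENNReal.ofReal_le_ofReal (pow_le_pow_left₀ ?_ ?_ 2))
        · have := h.nonneg
          have := rho_pos hs.1.le
          positivity
        · exact mul_le_of_le_one_right h.nonneg
            (pow_le_one₀ (rho_pos hs.1.le).le (rho_le_one hs.1.le))
    _ < ⊤ := by
        rw [setLIntegral_const]
        exact ENNReal.mul_lt_top ENNReal.ofReal_lt_top (by simp)

theorem tendsto_duhamel_cocompact (h : Forcing M η)
    (hη0 : ∀ s, 0 ≤ s → Tendsto (η s) (cocompact ℝ) (𝓝 0))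
    (hZ0 : Tendsto Z₀ (cocompact ℝ) (𝓝 0)) {t : ℝ} (ht : 0 ≤ t) :
    Tendsto (duhamel Z₀ η t) (cocompact ℝ) (𝓝 0) := by
  have h1 : Tendsto (fun ξ => ‖duhamel Z₀ η t ξ‖ₑ) (cocompact ℝ) (𝓝 0) :=
    tendsto_zero_of_sq (tendsto_of_tendsto_of_tendsto_of_le_of_le tendsto_const_nhds
      (tendsto_envelope h hη0 hZ0 t) (fun _ => zero_le) fun ξ =>
        enorm_duhamel_sq_le h.cont ht le_rfl ξ)
  rw [tendsto_zero_iff_norm_tendsto_zero]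
  have h2 := (ENNReal.tendsto_toReal ENNReal.zero_ne_top).comp h1
  simpa [Function.comp_def] using h2

theorem eventually_norm_duhamel_sub_le (h : Forcing M η)
    (hη0 : ∀ s, 0 ≤ s → Tendsto (η s) (cocompact ℝ) (𝓝 0)) (hZc : Continuous Z₀)
    (hZ0 : Tendsto Z₀ (cocompact ℝ) (𝓝 0)) {t : ℝ} (ht : 0 ≤ t) {ε : ℝ≥0∞} (hε : 0 < ε) :
    ∀ᶠ s in 𝓝[Set.Ici 0] t, ∀ ξ, ‖duhamel Z₀ η s ξ - duhamel Z₀ η t ξ‖ₑ ≤ ε := by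
  have hε2 : 0 < (ε / 2) ^ 2 := ENNReal.pow_pos (ENNReal.div_pos hε.ne' (by norm_num)) 2
  obtain ⟨K, hK, hKs⟩ := mem_cocompact.1
    ((tendsto_envelope h hη0 hZ0 (t + 1)).eventually (gt_mem_nhds hε2))
  have hd := continuous_duhamel hZc h.cont
  have hcont : Continuous fun p : ℝ × ℝ => ‖duhamel Z₀ η p.1 p.2 - duhamel Z₀ η t p.2‖ₑ :=
    ((hd.comp (by fun_prop : Continuous fun p : ℝ × ℝ => (p.1, p.2))).sub
      (hd.comp (by fun_prop : Continuous fun p : ℝ × ℝ => (t, p.2)))).enorm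
  have h1 : ∀ᶠ s in 𝓝 t, ∀ ξ ∈ K, ‖duhamel Z₀ η s ξ - duhamel Z₀ η t ξ‖ₑ < ε := by
    refine hK.eventually_forall_of_forall_eventually fun ξ _ => ?_
    have := hcont.tendsto (t, ξ)
    simp only [sub_self, enorm_zero] at this
    exact this.eventually (gt_mem_nhds hε)
  have h2 : ∀ᶠ s in 𝓝 t, s < t + 1 := gt_mem_nhds (by linarith)
  filter_upwards [nhdsWithin_le_nhds h1, nhdsWithin_le_nhds h2, self_mem_nhdsWithin]
    with s a b (c : 0 ≤ s) ξ
  by_cases hξ : ξ ∈ K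
  · exact (a ξ hξ).le
  have hh : envelope Z₀ η (t + 1) ξ < (ε / 2) ^ 2 := hKs hξ
  have e : ∀ u, 0 ≤ u → u ≤ t + 1 → ‖duhamel Z₀ η u ξ‖ₑ ≤ ε / 2 := fun u h0 h1 =>
    (ENNReal.pow_le_pow_left_iff two_ne_zero).1 ((enorm_duhamel_sq_le h.cont h0 h1 ξ).trans hh.le)
  calc _ ≤ ‖duhamel Z₀ η s ξ‖ₑ + ‖duhamel Z₀ η t ξ‖ₑ := enorm_sub_le
    _ ≤ ε / 2 + ε / 2 := add_le_add (e s c b.le) (e t ht (by linarith))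
    _ = ε := ENNReal.add_halves ε

theorem tendsto_lintegral_kn_duhamel_sub (h : Forcing M η) (hZ : DataBound M Z₀) {t : ℝ}
    (ht : 0 ≤ t) : Tendsto (fun s => ∫⁻ ξ, (kn ξ * ‖duhamel Z₀ η s ξ - duhamel Z₀ η t ξ‖ₑ) ^ 2)
      (𝓝[Set.Ici 0] t) (𝓝 0) := by
  have hm := fun s => measurable_duhamel_right hZ.meas h.cont s
  have h2 : ∀ᶠ s in 𝓝[Set.Ici 0] t, s < t + 1 := nhdsWithin_le_nhds (gt_mem_nhds (by linarith))
  rw [← lintegral_zero (μ := (volume : Measure ℝ))]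
  refine tendsto_lintegral_filter_of_dominated_convergence
    (fun ξ => 8 * (kn ξ ^ 2 * envelope Z₀ η (t + 1) ξ))
    (.of_forall fun s => (measurable_kn.mul ((hm s).sub (hm t)).enorm).pow_const 2) ?_ ?_ ?_
  · filter_upwards [h2, self_mem_nhdsWithin] with s b (c : 0 ≤ s)
    filter_upwards with ξ
    calc _ ≤ kn ξ ^ 2 * (‖duhamel Z₀ η s ξ‖ₑ + ‖duhamel Z₀ η t ξ‖ₑ) ^ 2 := by
          rw [mul_pow]
          gcongr
          exact enorm_sub_le
      _ ≤ kn ξ ^ 2 * (4 * (envelope Z₀ η (t + 1) ξ + envelope Z₀ η (t + 1) ξ)) := by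
          gcongr
          exact (ennreal_add_sq_le _ _).trans (by
            gcongr
            · exact enorm_duhamel_sq_le h.cont c b.le ξ
            · exact enorm_duhamel_sq_le h.cont ht (by linarith) ξ)
      _ = _ := by ring
  · have hme : Measurable fun ξ => kn ξ ^ 2 * envelope Z₀ η (t + 1) ξ :=
      (measurable_kn.pow_const 2).mul (measurable_envelope hZ.meas h.cont _)
    rw [lintegral_const_mul _ hme]
    exact ENNReal.mul_ne_top (by norm_num) (lintegral_kn_envelope_lt_top h hZ _).ne
  · filter_upwards with ξ
    have hc : Continuous fun s => ‖duhamel Z₀ η s ξ - duhamel Z₀ η t ξ‖ₑ :=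
      ((continuous_duhamel_time Z₀ h.cont ξ).sub continuous_const).enorm
    have := ENNReal.Tendsto.pow (n := 2) (ENNReal.Tendsto.const_mul (a := kn ξ) (hc.tendsto t)
      (.inr (kn_ne_top ξ)))
    simp only [sub_self, enorm_zero, mul_zero, ne_eq, OfNat.ofNat_ne_zero, not_false_eq_true,
      zero_pow] at this
    exact this.mono_left nhdsWithin_le_nhds

theorem memB0_of_duhamel (h : Forcing M η)
    (hη0 : ∀ s, 0 ≤ s → Tendsto (η s) (cocompact ℝ) (𝓝 0)) (hZc : Continuous Z₀)
    (hZ0 : Tendsto Z₀ (cocompact ℝ) (𝓝 0)) (hd : Decay R fun t => fourierL2 (z t))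
    (hz : ∀ t, 0 ≤ t → fourierL2 (z t) =ᵐ[volume] duhamel Z₀ η t) {t : ℝ} (ht : 0 ≤ t) :
    MemB0 (z t) :=
  memB0_of_fourier ((continuous_duhamel hZc h.cont).comp (by fun_prop : Continuous fun ξ : ℝ =>
    (t, ξ))) (tendsto_duhamel_cocompact h hη0 hZ0 ht) (hz t ht) (hd.one_lt_top ht)
    ((hd.two_le ht).trans_lt ENNReal.ofReal_lt_top)

theorem continuousInTime_of_duhamel (h : Forcing M η)
    (hη0 : ∀ s, 0 ≤ s → Tendsto (η s) (cocompact ℝ) (𝓝 0)) (hZ : DataBound M Z₀)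
    (hZc : Continuous Z₀) (hZ0 : Tendsto Z₀ (cocompact ℝ) (𝓝 0))
    (hd : Decay R fun t => fourierL2 (z t))
    (hz : ∀ t, 0 ≤ t → fourierL2 (z t) =ᵐ[volume] duhamel Z₀ η t) :
    ContinuousInTime normLow z := by
  intro t ht
  have hsub : ∀ s, 0 ≤ s → fourierL2 (z s - z t) =ᵐ[volume]
      fun ξ => duhamel Z₀ η s ξ - duhamel Z₀ η t ξ := by
    intro s hs
    filter_upwards [fourierL2_sub_ae (z s) (z t), hz s hs, hz t ht] with ξ a b c
    rw [a, b, c]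
  have t0 : Tendsto (fun s => eLpNorm (fourierL2 (z s - z t)) ⊤ volume) (𝓝[Set.Ici 0] t)
      (𝓝 0) := by
    rw [ENNReal.tendsto_nhds_zero]
    intro ε hε
    filter_upwards [eventually_norm_duhamel_sub_le h hη0 hZc hZ0 ht hε, self_mem_nhdsWithin]
      with s a b
    rw [eLpNorm_congr_ae (hsub s b), eLpNorm_exponent_top]
    exact essSup_le_of_ae_le _ (.of_forall a)
  have t1 : Tendsto (fun s => ‖z s - z t‖ₑ) (𝓝[Set.Ici 0] t) (𝓝 0) := by
    have h1 : Tendsto (fun s => z s - z t) (𝓝[Set.Ici 0] t) (𝓝 (z t - z t)) :=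
      (hd.continuousOn t ht).tendsto.sub tendsto_const_nhds
    simpa using h1.enorm
  have t2 : Tendsto (fun s => derivNorm 1 (z s - z t)) (𝓝[Set.Ici 0] t) (𝓝 0) := by
    refine tendsto_zero_of_sq ((tendsto_lintegral_kn_duhamel_sub h hZ ht).congr' ?_)
    filter_upwards [self_mem_nhdsWithin] with s hs
    rw [derivNorm_one_eq, fourierNormOne_sq]
    refine lintegral_congr_ae ?_
    filter_upwards [hsub s hs] with ξ a
    rw [a]
  have h3 := (t0.add t1).add t2
  simp only [add_zero] at h3
  exact h3

end PSystem

namespace PSystem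

/-! ### The norm of `𝓑` and the decay of solutions -/

theorem rpow_mul_rho_pow {t : ℝ} (ht : 0 ≤ t) (n : ℕ) :
    (1 + t) ^ ((n : ℝ) / 4) * rho t ^ n = 1 := by
  rw [rho, ← Real.rpow_natCast, ← Real.rpow_mul (by linarith), ← Real.rpow_add (by linarith)]
  rw [show (n : ℝ) / 4 + -(1 / 4) * n = 0 by ring, Real.rpow_zero]

theorem ofReal_mul_le_iff {w x R : ℝ} (hx : 0 ≤ x) (h : w * x = 1) {N : ℝ≥0∞} :
    ENNReal.ofReal w * N ≤ ENNReal.ofReal R ↔ N ≤ ENNReal.ofReal (R * x) := by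
  have h1 : ENNReal.ofReal x * ENNReal.ofReal w = 1 := by
    rw [← ENNReal.ofReal_mul hx, mul_comm x, h, ENNReal.ofReal_one]
  rw [ENNReal.ofReal_mul' hx]
  constructor
  · intro hN
    calc N = ENNReal.ofReal x * (ENNReal.ofReal w * N) := by rw [← mul_assoc, h1, one_mul]
      _ ≤ ENNReal.ofReal x * ENNReal.ofReal R := by gcongr
      _ = _ := mul_comm _ _
  · intro hN
    calc _ ≤ ENNReal.ofReal w * (ENNReal.ofReal R * ENNReal.ofReal x) := by gcongr
      _ = ENNReal.ofReal R * (ENNReal.ofReal x * ENNReal.ofReal w) := by ring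
      _ = _ := by rw [h1, mul_one]

theorem weightedSup_le_iff {w x : ℝ → ℝ} {R : ℝ} {N : ℝ → ℝ≥0∞}
    (hx : ∀ t, 0 ≤ t → 0 ≤ x t) (h : ∀ t, 0 ≤ t → w t * x t = 1) :
    weightedSup w N ≤ ENNReal.ofReal R ↔ ∀ t, 0 ≤ t → N t ≤ ENNReal.ofReal (R * x t) := by
  rw [weightedSup, iSup₂_le_iff]
  exact forall₂_congr fun t ht => ofReal_mul_le_iff (hx t ht) (h t ht)

section Weights

variable {R : ℝ} {N : ℝ → ℝ≥0∞}

theorem weightedSup_one_le_iff :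
    weightedSup (fun _ => 1) N ≤ ENNReal.ofReal R ↔ ∀ t, 0 ≤ t → N t ≤ ENNReal.ofReal R := by
  have := weightedSup_le_iff (w := fun _ => 1) (x := fun _ => 1) (R := R) (N := N)
    (fun _ _ => zero_le_one) fun _ _ => one_mul 1
  simpa using this

theorem weightedSup_quarter_le_iff : weightedSup (fun t => (1 + t) ^ (1 / 4 : ℝ)) N
    ≤ ENNReal.ofReal R ↔ ∀ t, 0 ≤ t → N t ≤ ENNReal.ofReal (R * rho t) :=
  weightedSup_le_iff (fun t ht => (rho_pos ht).le)
    fun t ht => by simpa using rpow_mul_rho_pow ht 1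

theorem weightedSup_three_quarters_le_iff : weightedSup (fun t => (1 + t) ^ (3 / 4 : ℝ)) N
    ≤ ENNReal.ofReal R ↔ ∀ t, 0 ≤ t → N t ≤ ENNReal.ofReal (R * rho t ^ 3) :=
  weightedSup_le_iff
    (fun t ht => pow_nonneg (rho_pos ht).le 3) fun t ht => by simpa using rpow_mul_rho_pow ht 3

theorem weightedSup_log_le_iff :
    weightedSup (fun t => (1 + t) ^ (5 / 4 : ℝ) / Real.log (2 + t)) N ≤ ENNReal.ofReal R
      ↔ ∀ t, 0 ≤ t → N t ≤ ENNReal.ofReal (R * (rho t ^ 5 * Real.log (2 + t))) := by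
  have hl : ∀ t : ℝ, 0 ≤ t → 0 < Real.log (2 + t) := fun t ht => by linarith [half_le_log ht]
  refine weightedSup_le_iff (x := fun t => rho t ^ 5 * Real.log (2 + t))
    (fun t ht => mul_nonneg (pow_nonneg (rho_pos ht).le 5) (hl t ht).le) fun t ht => ?_
  have h1 := rpow_mul_rho_pow ht 5
  have := (hl t ht).ne'
  push_cast at h1
  field_simp
  exact h1

end Weights

theorem normB_le_of_decay {R : ℝ} {z : ℝ → L2 V} (h : Decay R fun t => fourierL2 (z t)) :
    normB z ≤ ENNReal.ofReal (4 * R) := by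
  have hR := h.nonneg
  have h0 : weightedSup (fun _ => 1) (fun t => eLpNorm (fourierL2 (z t)) ⊤ volume)
      ≤ ENNReal.ofReal R := weightedSup_one_le_iff.2 fun t ht => by
    rw [eLpNorm_exponent_top]
    exact eLpNormEssSup_le_of_ae_bound (h.sup t ht)
  have h1 : weightedSup (fun t => (1 + t) ^ (1 / 4 : ℝ)) (fun t => ‖z t‖ₑ) ≤ ENNReal.ofReal R :=
    weightedSup_quarter_le_iff.2 fun t ht => h.norm_le ht
  have h2 : weightedSup (fun t => (1 + t) ^ (3 / 4 : ℝ)) (fun t => derivNorm 1 (z t))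
      ≤ ENNReal.ofReal R := weightedSup_three_quarters_le_iff.2 fun t ht => by
    rw [derivNorm_one_eq]
    exact h.one_le ht
  have h3 : weightedSup (fun t => (1 + t) ^ (5 / 4 : ℝ) / Real.log (2 + t))
      (fun t => derivNorm 2 (compB (z t))) ≤ ENNReal.ofReal R :=
    weightedSup_log_le_iff.2 fun t ht => by
      rw [derivNorm_two_compB_eq]
      exact h.two_le_log ht
  refine (add_le_add (add_le_add (add_le_add h0 h1) h2) h3).trans (le_of_eq ?_)
  rw [← ENNReal.ofReal_add hR hR, ← ENNReal.ofReal_add (by positivity) hR,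
    ← ENNReal.ofReal_add (by positivity) hR]
  congr 1
  ring

/-- States with the bounds that make the flux continuous in time. -/
structure Regular (A : ℝ) (z : ℝ → L2 V) : Prop where
  cont : ContinuousOn z (Set.Ici 0)
  contB : ContinuousOn (fun t => derivB (z t)) (Set.Ici 0)
  sup : ∀ t, 0 ≤ t → SupBound A (z t)
  norm : ∀ t, 0 ≤ t → ‖z t‖ₑ ≤ ENNReal.ofReal A
  normB : ∀ t, 0 ≤ t → ‖derivB (z t)‖ₑ ≤ ENNReal.ofReal A

theorem ofReal_mul_rho_le {R t : ℝ} (hR : 0 ≤ R) (ht : 0 ≤ t) (n : ℕ) :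
    ENNReal.ofReal (R * rho t ^ n) ≤ ENNReal.ofReal (3 * R) := by
  refine ENNReal.ofReal_le_ofReal ?_
  have := mul_le_of_le_one_right hR (pow_le_one₀ (n := n) (rho_pos ht).le (rho_le_one ht))
  linarith

theorem Decay.regular {R : ℝ} {z : ℝ → L2 V} (h : Decay R fun t => fourierL2 (z t)) :
    Regular (3 * R) z :=
  ⟨h.continuousOn, h.continuousOn_derivB, fun _ ht => h.supBound_const ht,
    fun _ ht => (h.norm_le ht).trans (by simpa using ofReal_mul_rho_le h.nonneg ht 1),
    fun _ ht => (h.derivB_le ht).trans (ofReal_mul_rho_le h.nonneg ht 3)⟩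

theorem norm_le_of_normB {R : ℝ} {z : ℝ → L2 V} (h : normB z ≤ ENNReal.ofReal R) {t : ℝ}
    (ht : 0 ≤ t) : ‖z t‖ₑ ≤ ENNReal.ofReal (R * rho t) :=
  weightedSup_quarter_le_iff.1 ((le_add_self.trans (le_self_add.trans le_self_add)).trans h) t ht

theorem MemB.regular {R : ℝ} {z : ℝ → L2 V} (hR : 0 ≤ R) (hz : MemB z)
    (h : normB z ≤ ENNReal.ofReal R) : Regular (3 * R) z := by
  have h0 := fun t ht => norm_le_of_normB h (t := t) ht
  have h1 : ∀ t, 0 ≤ t → fourierNormOne (z t) ≤ ENNReal.ofReal (R * rho t ^ 3) := fun t ht => by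
    rw [← derivNorm_one_eq]
    exact weightedSup_three_quarters_le_iff.1 ((le_add_self.trans le_self_add).trans h) t ht
  have h2 : ∀ t, 0 ≤ t → fourierNormTwo (z t) ≤ ENNReal.ofReal (4 * R * rho t ^ 3) :=
    fun t ht => by
      rw [← derivNorm_two_compB_eq]
      refine (weightedSup_log_le_iff.1 (le_add_self.trans h) t ht).trans
        (ENNReal.ofReal_le_ofReal ?_)
      have hr := rho_pos ht
      have h1 := rho_sq_mul_log_le ht
      calc _ = R * rho t ^ 3 * (rho t ^ 2 * Real.log (2 + t)) := by ring
        _ ≤ R * rho t ^ 3 * 4 := by gcongr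
        _ = _ := by ring
  have hlt : ∀ t, 0 ≤ t → fourierNormOne (z t) < ⊤ := fun t ht =>
    (h1 t ht).trans_lt ENNReal.ofReal_lt_top
  have key : ∀ t, 0 ≤ t → Tendsto (fun s => ‖z s - z t‖ₑ) (𝓝[Set.Ici 0] t) (𝓝 0) ∧
      Tendsto (fun s => fourierNormOne (z s - z t)) (𝓝[Set.Ici 0] t) (𝓝 0) := by
    intro t ht
    have hc := hz.2.1 t ht
    constructor
    · exact tendsto_of_tendsto_of_tendsto_of_le_of_le tendsto_const_nhds hc (fun _ => zero_le)
        fun s => le_add_self.trans le_self_add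
    · refine tendsto_of_tendsto_of_tendsto_of_le_of_le tendsto_const_nhds hc (fun _ => zero_le)
        fun s => ?_
      rw [← derivNorm_one_eq]
      exact le_add_self
  refine ⟨fun t ht => continuousWithinAt_of_enorm (key t ht).1,
    fun t ht => continuousWithinAt_of_enorm ?_, fun t ht => ?_, fun t ht => ?_, fun t ht => ?_⟩
  · refine tendsto_of_tendsto_of_tendsto_of_le_of_le' tendsto_const_nhds (key t ht).2
      (.of_forall fun _ => zero_le) ?_
    filter_upwards [self_mem_nhdsWithin] with s hs
    rw [← derivB_sub' (hlt s hs) (hlt t ht)]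
    exact enorm_derivB_le ((fourierNormOne_sub_le _ _).trans_lt
      (ENNReal.add_lt_top.2 ⟨hlt s hs, hlt t ht⟩))
  · refine (supBound_of_norms hR (rho_pos ht) (rho_le_one ht) (h0 t ht) (h1 t ht) (h2 t ht)).mono ?_
    exact mul_le_of_le_one_right (by positivity) (pow_le_one₀ (rho_pos ht).le (rho_le_one ht))
  · exact (h0 t ht).trans (by simpa using ofReal_mul_rho_le hR ht 1)
  · exact (enorm_derivB_le (hlt t ht)).trans ((h1 t ht).trans (ofReal_mul_rho_le hR ht 3))

/-! ### Mild solutions -/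

/-- The Fourier transform of the flux along a path. -/
def fluxPath (f g : V → ℝ) (z : ℝ → L2 V) (s ξ : ℝ) : ℂ := fluxHat f g (z (max s 0)) ξ

variable {f g : V → ℝ} {C r A : ℝ} {z z' w w' : ℝ → L2 V} {Z₀ Z₀' : ℝ → VC}

theorem isMildSolution_iff {z₀ : L2 V} (hZ : fourierL2 z₀ =ᵐ[volume] Z₀) :
    IsMildSolution f g z₀ z
      ↔ ∀ t, 0 ≤ t → fourierL2 (z t) =ᵐ[volume] duhamel Z₀ (fluxPath f g z) t := by
  refine forall₂_congr fun t ht => ?_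
  have e : ∀ᵐ ξ, (∀ i : Fin 2, fourierL2 (z t) ξ i =
      (semigroup (2 * Real.pi * ξ) t).mulVec (fun j => fourierL2 z₀ ξ j) i +
      ∫ s in (0 : ℝ)..t, (semigroup (2 * Real.pi * ξ) (t - s)).mulVec
        ![0, Complex.I * ((2 * Real.pi * ξ : ℝ) : ℂ) *
          𝓕 (fun x : ℝ => ((flux f g (z s) x : ℝ) : ℂ)) ξ] i)
      ↔ fourierL2 (z t) ξ = duhamel Z₀ (fluxPath f g z) t ξ := by
    filter_upwards [hZ] with ξ h
    rw [h]
    have hi : ∀ i : Fin 2, ∫ s in (0 : ℝ)..t, (semigroup (2 * Real.pi * ξ) (t - s)).mulVec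
        ![0, Complex.I * ((2 * Real.pi * ξ : ℝ) : ℂ) *
          𝓕 (fun x : ℝ => ((flux f g (z s) x : ℝ) : ℂ)) ξ] i
        = ∫ s in (0 : ℝ)..t, (semigroup (2 * Real.pi * ξ) (t - s)).mulVec
        ![0, Complex.I * ((2 * Real.pi * ξ : ℝ) : ℂ) * fluxPath f g z s ξ] i := by
      intro i
      refine intervalIntegral.integral_congr fun s hs => ?_
      rw [Set.uIcc_of_le ht] at hs
      simp only [fluxPath, max_eq_left hs.1, fluxHat]
    simp only [hi]
    constructor
    · intro h
      ext i
      exact h i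
    · intro h i
      rw [h]
      rfl
  constructor
  · intro h
    filter_upwards [h, e] with ξ a b using b.1 a
  · intro h
    filter_upwards [h, e] with ξ a b using b.2 a

theorem Regular.continuous_fluxPath (hz : Regular A z) (h : FluxBound f g C r) (hA : A < r) :
    Continuous (Function.uncurry (fluxPath f g z)) :=
  h.continuous_fluxHat_uncurry hA (continuous_comp_max hz.cont)
    (continuous_comp_max (ζ := fun t => derivB (z t)) hz.contB) fun _ => hz.sup _ (le_max_right _ _)

theorem tendsto_fluxPath (f g : V → ℝ) (z : ℝ → L2 V) (s : ℝ) :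
    Tendsto (fluxPath f g z s) (cocompact ℝ) (𝓝 0) :=
  Real.zero_at_infty_fourier _

theorem fluxPath_neg (f g : V → ℝ) (z : ℝ → L2 V) (s ξ : ℝ) :
    fluxPath f g z s (-ξ) = (starRingEnd ℂ) (fluxPath f g z s ξ) := fluxHat_neg f g _ ξ

theorem decay_zero {R : ℝ} (hR : 0 ≤ R) : Decay R fun _ => fourierL2 (0 : L2 V) := by
  have h0 : ∀ᵐ ξ, fourierL2 (0 : L2 V) ξ = 0 := fourierL2_zero
  refine ⟨fun t _ => ?_, fun t _ => ?_, fun t _ => ?_, fun t _ => ?_, fun δ _ _ t _ => ?_,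
    fun δ _ _ t _ => ?_⟩
  · filter_upwards [h0] with ξ h
    rw [h, norm_zero]; exact hR
  · rw [lintegral_congr_ae (g := 0)]
    · simp
    · filter_upwards [h0] with ξ h
      simp [h]
  · rw [lintegral_congr_ae (g := 0)]
    · simp
    · filter_upwards [h0] with ξ h
      simp [h]
  · rw [lintegral_congr_ae (g := 0)]
    · simp
    · filter_upwards [h0] with ξ h
      simp [h]
  · simp
  · simp

theorem FluxBound.forcing (h : FluxBound f g C r) {R : ℝ} (hR : 3 * R < r) (hR1 : 3 * R ≤ 1)
    (hz : Decay R fun t => fourierL2 (z t)) : Forcing (150 * C * R * R) (fluxPath f g z) := by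
  have hC : 0 ≤ C := zero_le_one.trans h.one_le
  have hF := h.secondDiff_zero.forcing h (by positivity) hR hR1 hz (decay_zero hz.nonneg)
    (by simpa using hz) (fun t _ => by
      rw [derivB_zero]
      filter_upwards [Lp.coeFn_zero V 2 (volume : Measure ℝ),
        Lp.coeFn_zero ℝ 2 (volume : Measure ℝ)] with x a b
      rw [a, b]
      rfl)
  simp only [h.fluxHat_zero, sub_zero] at hF
  rw [show 30 * (C + 4 * C) * R * R = 150 * C * R * R by ring] at hF
  exact hF

/-! ### The energy of a difference -/

/-- `‖z(t) - z'(t)‖² + ∫₀ᵗ ‖∂ₓb - ∂ₓb'‖²`. -/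
def energy (z z' : ℝ → L2 V) (t : ℝ) : ℝ≥0∞ :=
  ‖z t - z' t‖ₑ ^ 2 + ∫⁻ s in Set.Ioc 0 t, ‖derivB (z s) - derivB (z' s)‖ₑ ^ 2

theorem lintegral_duhamel_sub_le {η η' : ℝ → ℝ → ℂ} (hZ : Measurable Z₀) (hZ' : Measurable Z₀')
    (hη : Continuous (Function.uncurry η)) (hη' : Continuous (Function.uncurry η')) {t : ℝ}
    (ht : 0 ≤ t) :
    (∫⁻ ξ, ‖duhamel Z₀ η t ξ - duhamel Z₀' η' t ξ‖ₑ ^ 2)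
      + ∫⁻ s in Set.Ioc 0 t, ∫⁻ ξ, (kn ξ * ‖duhamel Z₀ η s ξ 1 - duhamel Z₀' η' s ξ 1‖ₑ) ^ 2
      ≤ (∫⁻ ξ, ‖Z₀ ξ - Z₀' ξ‖ₑ ^ 2) + ∫⁻ s in Set.Ioc 0 t, ∫⁻ ξ, ‖η s ξ - η' s ξ‖ₑ ^ 2 := by
  have m1 := measurable_duhamel hZ hη
  have m2 := measurable_duhamel hZ' hη'
  have mP : Measurable fun p : ℝ × ℝ =>
      (kn p.2 * ‖duhamel Z₀ η p.1 p.2 1 - duhamel Z₀' η' p.1 p.2 1‖ₑ) ^ 2 :=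
    ((measurable_kn.comp measurable_snd).mul
      ((measurable_applyVC m1 1).sub (measurable_applyVC m2 1)).enorm).pow_const 2
  have mH : Measurable fun p : ℝ × ℝ => ‖η p.1 p.2 - η' p.1 p.2‖ₑ ^ 2 :=
    ((hη.sub hη').measurable.enorm).pow_const 2
  have m0 : Measurable fun ξ => ‖Z₀ ξ - Z₀' ξ‖ₑ ^ 2 := ((hZ.sub hZ').enorm).pow_const 2
  have mF : Measurable fun ξ => ‖duhamel Z₀ η t ξ - duhamel Z₀' η' t ξ‖ₑ ^ 2 :=
    (((measurable_duhamel_right hZ hη t).sub (measurable_duhamel_right hZ' hη' t)).enorm).pow_const 2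
  have sP := lintegral_lintegral_swap (μ := volume.restrict (Set.Ioc 0 t)) (ν := volume)
    (f := fun s ξ => (kn ξ * ‖duhamel Z₀ η s ξ 1 - duhamel Z₀' η' s ξ 1‖ₑ) ^ 2) mP.aemeasurable
  have sH := lintegral_lintegral_swap (μ := volume.restrict (Set.Ioc 0 t)) (ν := volume)
    (f := fun s ξ => ‖η s ξ - η' s ξ‖ₑ ^ 2) mH.aemeasurable
  rw [sP, sH, ← lintegral_add_left mF, ← lintegral_add_left m0]
  refine lintegral_mono fun ξ => ?_
  have hs := (isFlow_duhamel Z₀ hη ξ).sub (isFlow_duhamel Z₀' hη' ξ)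
  have hc : Continuous fun s => η s ξ - η' s ξ :=
    (hη.comp (by fun_prop : Continuous fun s : ℝ => (s, ξ))).sub
      (hη'.comp (by fun_prop : Continuous fun s : ℝ => (s, ξ)))
  have h1 := hs.enorm_energy_le hc ht
  simp only [duhamel_zero] at h1
  rw [enormVC_sq, enormVC_sq]
  exact h1

/-- The energy of a difference after one step of the iteration. -/
theorem energy_le (h : FluxBound f g C r) (hA : A < r) (hz : Regular A z) (hz' : Regular A z')
    (hZ : Measurable Z₀) (hZ' : Measurable Z₀')
    (hw : ∀ t, 0 ≤ t → fourierL2 (w t) =ᵐ[volume] duhamel Z₀ (fluxPath f g z) t)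
    (hw' : ∀ t, 0 ≤ t → fourierL2 (w' t) =ᵐ[volume] duhamel Z₀' (fluxPath f g z') t)
    (h1 : ∀ t, 0 ≤ t → fourierNormOne (w t) < ⊤) (h1' : ∀ t, 0 ≤ t → fourierNormOne (w' t) < ⊤)
    {t : ℝ} (ht : 0 ≤ t) :
    energy w w' t ≤ (∫⁻ ξ, ‖Z₀ ξ - Z₀' ξ‖ₑ ^ 2)
      + ENNReal.ofReal (64 * (C * A) ^ 2) * ∫⁻ s in Set.Ioc 0 t,
        (‖z s - z' s‖ₑ ^ 2 + ‖derivB (z s) - derivB (z' s)‖ₑ ^ 2) := by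
  have hη := hz.continuous_fluxPath h hA
  have hη' := hz'.continuous_fluxPath h hA
  have key := lintegral_duhamel_sub_le hZ hZ' hη hη' ht
  have hsub : ∀ s, 0 ≤ s → fourierL2 (w s - w' s) =ᵐ[volume] fun ξ =>
      duhamel Z₀ (fluxPath f g z) s ξ - duhamel Z₀' (fluxPath f g z') s ξ := by
    intro s hs
    filter_upwards [fourierL2_sub_ae (w s) (w' s), hw s hs, hw' s hs] with ξ a b c
    rw [a, b, c]
  have e1 : energy w w' t = (∫⁻ ξ, ‖duhamel Z₀ (fluxPath f g z) t ξ
      - duhamel Z₀' (fluxPath f g z') t ξ‖ₑ ^ 2)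
      + ∫⁻ s in Set.Ioc 0 t, ∫⁻ ξ, (kn ξ * ‖duhamel Z₀ (fluxPath f g z) s ξ 1
        - duhamel Z₀' (fluxPath f g z') s ξ 1‖ₑ) ^ 2 := by
    unfold energy
    congr 1
    · rw [enorm_sq_eq]
      refine lintegral_congr_ae ?_
      filter_upwards [hsub t ht] with ξ a
      rw [a]
    · refine setLIntegral_congr_fun measurableSet_Ioc fun s hs => ?_
      have hs0 := hs.1.le
      simp only
      rw [← derivB_sub' (h1 s hs0) (h1' s hs0), enorm_derivB_sq ((fourierNormOne_sub_le _ _).trans_lt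
        (ENNReal.add_lt_top.2 ⟨h1 s hs0, h1' s hs0⟩))]
      refine lintegral_congr_ae ?_
      filter_upwards [hsub s hs0] with ξ a
      rw [a]
      rfl
  rw [e1]
  refine key.trans (add_le_add le_rfl ?_)
  rw [← lintegral_const_mul' _ _ ENNReal.ofReal_ne_top]
  refine setLIntegral_mono' measurableSet_Ioc fun s hs => ?_
  have hs0 := hs.1.le
  simp only [fluxPath, max_eq_left hs0]
  refine (h.lintegral_fluxHat_sub_le hA (hz.sup s hs0) (hz'.sup s hs0)).trans ?_
  rw [mul_pow]
  refine (mul_le_mul_right (ennreal_add_sq_le _ _) _).trans (le_of_eq ?_)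
  rw [← ENNReal.ofReal_pow (by
    have := (hz.sup 0 le_rfl).nonneg
    have := h.one_le
    positivity), show (64 * (C * A) ^ 2 : ℝ) = (4 * C * A) ^ 2 * 4 by ring,
    ENNReal.ofReal_mul (by positivity)]
  rw [show ENNReal.ofReal 4 = 4 by norm_num]
  ring

theorem energy_step (h : FluxBound f g C r) (hA : A < r) (hCA : C * A ≤ 1 / 32)
    (hz : Regular A z) (hz' : Regular A z')
    (hZ : Measurable Z₀) (hZ' : Measurable Z₀')
    (hw : ∀ t, 0 ≤ t → fourierL2 (w t) =ᵐ[volume] duhamel Z₀ (fluxPath f g z) t)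
    (hw' : ∀ t, 0 ≤ t → fourierL2 (w' t) =ᵐ[volume] duhamel Z₀' (fluxPath f g z') t)
    (h1 : ∀ t, 0 ≤ t → fourierNormOne (w t) < ⊤) (h1' : ∀ t, 0 ≤ t → fourierNormOne (w' t) < ⊤)
    {q : ℝ≥0∞} (hq : ∀ t, 0 ≤ t → energy z z' t ≤ q * ENNReal.ofReal (Real.exp t))
    {t : ℝ} (ht : 0 ≤ t) :
    energy w w' t ≤ ((∫⁻ ξ, ‖Z₀ ξ - Z₀' ξ‖ₑ ^ 2) + q / 8) * ENNReal.ofReal (Real.exp t) := by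
  have hA0 := (hz.sup 0 le_rfl).nonneg
  have hC0 : 0 ≤ C := zero_le_one.trans h.one_le
  have e1 : (1 : ℝ≥0∞) ≤ ENNReal.ofReal (Real.exp t) := by
    rw [← ENNReal.ofReal_one]
    exact ENNReal.ofReal_le_ofReal (Real.one_le_exp ht)
  have hm : AEMeasurable (fun s => ‖z s - z' s‖ₑ ^ 2) (volume.restrict (Set.Ioc 0 t)) := by
    have hc : Continuous fun s => ‖z (max s 0) - z' (max s 0)‖ₑ :=
      ((continuous_comp_max hz.cont).sub (continuous_comp_max hz'.cont)).enorm
    refine (hc.measurable.pow_const 2).aemeasurable.congr ?_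
    filter_upwards [ae_restrict_mem measurableSet_Ioc] with s hs
    rw [max_eq_left hs.1.le]
  have hF : ∫⁻ s in Set.Ioc 0 t, ‖z s - z' s‖ₑ ^ 2 ≤ q * ENNReal.ofReal (Real.exp t) := by
    calc _ ≤ ∫⁻ s in Set.Ioc 0 t, q * ENNReal.ofReal (Real.exp s) := by
          refine setLIntegral_mono' measurableSet_Ioc fun s hs => ?_
          exact le_self_add.trans (hq s hs.1.le)
      _ = q * ∫⁻ s in Set.Ioc 0 t, ENNReal.ofReal (Real.exp s) :=
          lintegral_const_mul _ (by fun_prop)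
      _ ≤ _ := by
          gcongr
          rw [lintegral_ofReal_deriv (F := Real.exp) ht (fun s _ => Real.hasDerivAt_exp s)
            (by fun_prop) fun s _ => (Real.exp_pos s).le]
          refine ENNReal.ofReal_le_ofReal ?_
          simp
  have hP : ∫⁻ s in Set.Ioc 0 t, ‖derivB (z s) - derivB (z' s)‖ₑ ^ 2
      ≤ q * ENNReal.ofReal (Real.exp t) := le_add_self.trans (hq t ht)
  have hκ : ENNReal.ofReal (64 * (C * A) ^ 2) * 2 ≤ 8⁻¹ := by
    rw [show (2 : ℝ≥0∞) = ENNReal.ofReal 2 by norm_num, ← ENNReal.ofReal_mul (by positivity),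
      show (8⁻¹ : ℝ≥0∞) = ENNReal.ofReal (8⁻¹) by
        rw [ENNReal.ofReal_inv_of_pos (by norm_num)]; norm_num]
    refine ENNReal.ofReal_le_ofReal ?_
    have := pow_le_pow_left₀ (mul_nonneg hC0 hA0) hCA 2
    norm_num at this ⊢
    linarith
  refine (energy_le h hA hz hz' hZ hZ' hw hw' h1 h1' ht).trans ?_
  rw [lintegral_add_left' hm, add_mul]
  refine add_le_add (le_mul_of_one_le_right' e1) ?_
  calc _ ≤ ENNReal.ofReal (64 * (C * A) ^ 2) *
        (q * ENNReal.ofReal (Real.exp t) + q * ENNReal.ofReal (Real.exp t)) := by gcongr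
    _ = (ENNReal.ofReal (64 * (C * A) ^ 2) * 2) * (q * ENNReal.ofReal (Real.exp t)) := by ring
    _ ≤ 8⁻¹ * (q * ENNReal.ofReal (Real.exp t)) := by gcongr
    _ = _ := by rw [ENNReal.div_eq_inv_mul]; ring

end PSystem

namespace PSystem

/-! ### Existence by iteration -/

theorem Forcing.mono {M M' : ℝ} {η : ℝ → ℝ → ℂ} (h : Forcing M η) (hM : M ≤ M') :
    Forcing M' η := by
  have h0 := h.nonneg
  refine ⟨h.cont, fun s hs ξ => (h.sup s hs ξ).trans ?_, fun s hs => (h.deriv s hs).trans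
    (ENNReal.ofReal_le_ofReal ?_), fun δ hδ hδ1 t ht => (h.diff δ hδ hδ1 t ht).trans
    (ENNReal.ofReal_le_ofReal ?_)⟩
  · gcongr
  · have := rho_pos hs
    gcongr
  · have := rho_pos ht
    gcongr

theorem Forcing.of_tendsto {M : ℝ} {η : ℝ → ℝ → ℂ} {ηn : ℕ → ℝ → ℝ → ℂ}
    (h : ∀ n, Forcing M (ηn n)) (hc : Continuous (Function.uncurry η))
    (hlim : ∀ s ξ, Tendsto (fun n => ηn n s ξ) atTop (𝓝 (η s ξ))) : Forcing M η := by
  refine ⟨hc, fun s hs ξ => ?_, fun s hs => ?_, fun δ hδ hδ1 t ht => ?_⟩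
  · exact le_of_tendsto (hlim s ξ).norm (.of_forall fun n => (h n).sup s hs ξ)
  · have hm : ∀ n, Measurable fun ξ => (kn ξ * ‖ηn n s ξ‖ₑ) ^ 2 := fun n =>
      (measurable_kn.mul (((h n).cont.comp (by fun_prop : Continuous fun ξ : ℝ =>
        (s, ξ))).measurable.enorm)).pow_const 2
    have e : ∀ ξ, (kn ξ * ‖η s ξ‖ₑ) ^ 2 = liminf (fun n => (kn ξ * ‖ηn n s ξ‖ₑ) ^ 2) atTop :=
      fun ξ => (ENNReal.Tendsto.pow (n := 2) (ENNReal.Tendsto.const_mul (hlim s ξ).enorm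
        (.inr (kn_ne_top ξ)))).liminf_eq.symm
    simp only [e]
    refine (lintegral_liminf_le hm).trans ?_
    exact liminf_le_of_frequently_le' (.of_forall fun n => (h n).deriv s hs)
  · have hm : ∀ n, Measurable fun p : ℝ × ℝ => ‖ηn n (p.1 + δ) p.2 - ηn n p.1 p.2‖ₑ ^ 2 :=
      fun n => ((((h n).cont.comp (by fun_prop : Continuous fun p : ℝ × ℝ =>
        (p.1 + δ, p.2))).sub (h n).cont).measurable.enorm).pow_const 2
    have e : ∀ s ξ, ‖η (s + δ) ξ - η s ξ‖ₑ ^ 2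
        = liminf (fun n => ‖ηn n (s + δ) ξ - ηn n s ξ‖ₑ ^ 2) atTop := fun s ξ =>
      (ENNReal.Tendsto.pow (n := 2) ((hlim (s + δ) ξ).sub (hlim s ξ)).enorm).liminf_eq.symm
    simp only [e]
    calc _ ≤ ∫⁻ s in Set.Ioc t (t + 1), liminf (fun n =>
          ∫⁻ ξ, ‖ηn n (s + δ) ξ - ηn n s ξ‖ₑ ^ 2) atTop :=
          lintegral_mono fun s => lintegral_liminf_le fun n =>
            (hm n).comp (by fun_prop : Measurable fun ξ : ℝ => (s, ξ))
      _ ≤ liminf (fun n => ∫⁻ s in Set.Ioc t (t + 1),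
          ∫⁻ ξ, ‖ηn n (s + δ) ξ - ηn n s ξ‖ₑ ^ 2) atTop :=
          lintegral_liminf_le fun n => (hm n).lintegral_prod_right'
      _ ≤ _ := liminf_le_of_frequently_le' (.of_forall fun n => (h n).diff δ hδ hδ1 t ht)

theorem Decay.congr {R : ℝ} {Z Z' : ℝ → ℝ → VC} (h : Decay R Z)
    (hZ : ∀ t, 0 ≤ t → Z' t =ᵐ[volume] Z t) : Decay R Z' := by
  refine ⟨fun t ht => ?_, fun t ht => ?_, fun t ht => ?_, fun t ht => ?_, fun δ hδ hδ1 t ht => ?_,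
    fun δ hδ hδ1 t ht => ?_⟩
  · filter_upwards [h.sup t ht, hZ t ht] with ξ a b
    rw [b]; exact a
  · refine le_trans (le_of_eq (lintegral_congr_ae ?_)) (h.zero t ht)
    filter_upwards [hZ t ht] with ξ b
    rw [b]
  · refine le_trans (le_of_eq (lintegral_congr_ae ?_)) (h.one t ht)
    filter_upwards [hZ t ht] with ξ b
    rw [b]
  · refine le_trans (le_of_eq (lintegral_congr_ae ?_)) (h.two t ht)
    filter_upwards [hZ t ht] with ξ b
    rw [b]
  · refine le_trans (le_of_eq (lintegral_congr_ae ?_)) (h.diff δ hδ hδ1 t ht)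
    filter_upwards [hZ t ht, hZ (t + δ) (by linarith)] with ξ b c
    rw [b, c]
  · refine le_trans (le_of_eq (setLIntegral_congr_fun measurableSet_Ioc fun s hs => ?_))
      (h.diffB δ hδ hδ1 t ht)
    have hs0 : 0 ≤ s := ht.trans hs.1.le
    refine lintegral_congr_ae ?_
    filter_upwards [hZ s hs0, hZ (s + δ) (by linarith)] with ξ b c
    rw [b, c]

theorem dataBound_of_fourierNorm {Z₀ : ℝ → VC} {ε : ℝ} (hε : 0 ≤ ε) (hm : Measurable Z₀)
    (h : fourierNorm Z₀ ≤ ENNReal.ofReal ε) : DataBound ε Z₀ := by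
  have h0 : eLpNorm Z₀ ⊤ volume ≤ ENNReal.ofReal ε :=
    (le_self_add.trans (le_self_add.trans le_self_add)).trans h
  have h1 := ((le_add_self.trans le_self_add).trans h)
  have h2 := (le_add_self.trans h)
  rw [eLpNorm_two_le_iff _ hε] at h1 h2
  simp only [enorm_smul, enorm_pow] at h1 h2
  refine ⟨hm, ?_, h1, h2⟩
  rw [eLpNorm_exponent_top] at h0
  filter_upwards [ae_le_eLpNormEssSup (f := Z₀) (μ := volume)] with ξ hξ
  have := hξ.trans h0
  rwa [← ofReal_norm, ENNReal.ofReal_le_ofReal_iff hε] at this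

variable {f g : V → ℝ} {C r A R ε : ℝ} {z z' : ℝ → L2 V} {Z₀ Z₀' : ℝ → VC}

theorem exists_L2_of_decay {η : ℝ → ℝ → ℂ} (hη : Continuous (Function.uncurry η))
    (hs : ∀ s ξ, η s (-ξ) = (starRingEnd ℂ) (η s ξ)) (hZ : Measurable Z₀)
    (hsymm : ∀ ξ, Z₀ (-ξ) = conjVC (Z₀ ξ)) (hd : Decay R (duhamel Z₀ η)) :
    ∃ w : ℝ → L2 V, ∀ t, 0 ≤ t → fourierL2 (w t) =ᵐ[volume] duhamel Z₀ η t := by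
  have h : ∀ t : ℝ, ∃ w : L2 V, 0 ≤ t → fourierL2 w =ᵐ[volume] duhamel Z₀ η t := by
    intro t
    by_cases ht : 0 ≤ t
    · have hm : MemLp (duhamel Z₀ η t) 2 := by
        refine ⟨(measurable_duhamel_right hZ hη t).aestronglyMeasurable, ?_⟩
        have := (eLpNorm_two_sq (duhamel Z₀ η t) (μ := volume)).le.trans (hd.zero t ht)
        exact lt_top_iff_ne_top.2 fun h => by simp [h] at this
      obtain ⟨w, hw⟩ := exists_fourierL2_eq hm (.of_forall fun ξ =>
        duhamel_neg hη (hsymm ξ) (fun s => hs s ξ) t)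
      exact ⟨w, fun _ => hw⟩
    · exact ⟨0, fun h => absurd h ht⟩
  choose w hw using h
  exact ⟨w, hw⟩

theorem Regular.energy_le (hz : Regular A z) (hz' : Regular A z') {t : ℝ} (ht : 0 ≤ t) :
    energy z z' t ≤ ENNReal.ofReal (8 * A ^ 2) * ENNReal.ofReal (Real.exp t) := by
  have hA := (hz.sup 0 le_rfl).nonneg
  have key : ∀ {X : Type} [SeminormedAddCommGroup X] (u v : X), ‖u‖ₑ ≤ ENNReal.ofReal A →
      ‖v‖ₑ ≤ ENNReal.ofReal A → ‖u - v‖ₑ ^ 2 ≤ ENNReal.ofReal (4 * A ^ 2) := by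
    intro X _ u v hu hv
    have h1 : ‖u - v‖ₑ ≤ ENNReal.ofReal (2 * A) := by
      refine enorm_sub_le.trans ((add_le_add hu hv).trans (le_of_eq ?_))
      rw [← ENNReal.ofReal_add hA hA]
      congr 1
      ring
    refine (pow_le_pow_left' h1 2).trans (le_of_eq ?_)
    rw [← ENNReal.ofReal_pow (by positivity)]
    congr 1
    ring
  have e1 := Real.add_one_le_exp t
  calc energy z z' t ≤ ENNReal.ofReal (4 * A ^ 2)
        + ∫⁻ s in Set.Ioc 0 t, ENNReal.ofReal (4 * A ^ 2) := by
        refine add_le_add (key _ _ (hz.norm t ht) (hz'.norm t ht)) ?_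
        exact setLIntegral_mono' measurableSet_Ioc fun s hs =>
          key _ _ (hz.normB s hs.1.le) (hz'.normB s hs.1.le)
    _ = ENNReal.ofReal (4 * A ^ 2 + 4 * A ^ 2 * t) := by
        rw [setLIntegral_const, Real.volume_Ioc, sub_zero, ← ENNReal.ofReal_mul (by positivity),
          ← ENNReal.ofReal_add (by positivity) (by positivity)]
    _ ≤ _ := by
        rw [← ENNReal.ofReal_mul (by positivity)]
        refine ENNReal.ofReal_le_ofReal ?_
        nlinarith [sq_nonneg A, mul_nonneg (sq_nonneg A) ht]

theorem exists_subseq_fourierL2_tendsto {u : ℕ → L2 V} {v : L2 V}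
    (h : Tendsto u atTop (𝓝 v)) : ∃ ns : ℕ → ℕ, StrictMono ns ∧
      ∀ᵐ ξ, Tendsto (fun n => fourierL2 (u (ns n)) ξ) atTop (𝓝 (fourierL2 v ξ)) := by
  have h1 : Tendsto (fun n => fourierL2 (u n)) atTop (𝓝 (fourierL2 v)) := by
    rw [tendsto_iff_norm_sub_tendsto_zero] at h ⊢
    refine h.congr fun n => ?_
    rw [← fourierL2_sub, norm_fourierL2]
  exact (tendstoInMeasure_of_tendsto_Lp h1).exists_seq_tendsto_ae

/-- Fourier multiplier norms are lower semicontinuous. -/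
theorem lintegral_le_of_tendsto {u : ℕ → L2 V} {v : L2 V} (h : Tendsto u atTop (𝓝 v))
    {Φ : ℝ → VC → ℝ≥0∞} (hm : ∀ w : L2 V, Measurable fun ξ => Φ ξ (fourierL2 w ξ))
    (hc : ∀ ξ, Continuous (Φ ξ)) {B : ℝ≥0∞} (hB : ∀ n, ∫⁻ ξ, Φ ξ (fourierL2 (u n) ξ) ≤ B) :
    ∫⁻ ξ, Φ ξ (fourierL2 v ξ) ≤ B := by
  obtain ⟨ns, _, hlim⟩ := exists_subseq_fourierL2_tendsto h
  calc _ = ∫⁻ ξ, liminf (fun n => Φ ξ (fourierL2 (u (ns n)) ξ)) atTop := by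
        refine lintegral_congr_ae ?_
        filter_upwards [hlim] with ξ hξ
        exact (((hc ξ).tendsto _).comp hξ).liminf_eq.symm
    _ ≤ liminf (fun n => ∫⁻ ξ, Φ ξ (fourierL2 (u (ns n)) ξ)) atTop :=
        lintegral_liminf_le fun n => hm _
    _ ≤ B := liminf_le_of_frequently_le' (.of_forall fun n => hB _)

theorem measurable_fourierL2 (w : L2 V) : Measurable (fourierL2 w) :=
  (Lp.stronglyMeasurable (fourierL2 w)).measurable

theorem fourierNormOne_le_of_tendsto {u : ℕ → L2 V} {v : L2 V} (h : Tendsto u atTop (𝓝 v)) {B : ℝ}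
    (hB0 : 0 ≤ B) (hB : ∀ n, fourierNormOne (u n) ≤ ENNReal.ofReal B) :
    fourierNormOne v ≤ ENNReal.ofReal B := by
  refine ennreal_le_ofReal_of_sq hB0 ?_
  rw [fourierNormOne_sq]
  refine lintegral_le_of_tendsto h (Φ := fun ξ v => (kn ξ * ‖v‖ₑ) ^ 2) (fun w =>
    (measurable_kn.mul (measurable_fourierL2 w).enorm).pow_const 2) (fun ξ => ?_) fun n => ?_
  · exact (ENNReal.continuous_pow 2).comp ((ENNReal.continuous_const_mul (kn_ne_top ξ)).comp
      continuous_enorm)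
  · rw [← fourierNormOne_sq, ENNReal.ofReal_pow hB0]
    exact pow_le_pow_left' (hB n) 2

theorem fourierNormTwo_le_of_tendsto {u : ℕ → L2 V} {v : L2 V} (h : Tendsto u atTop (𝓝 v)) {B : ℝ}
    (hB0 : 0 ≤ B) (hB : ∀ n, fourierNormTwo (u n) ≤ ENNReal.ofReal B) :
    fourierNormTwo v ≤ ENNReal.ofReal B := by
  refine ennreal_le_ofReal_of_sq hB0 ?_
  rw [fourierNormTwo_sq]
  refine lintegral_le_of_tendsto h (Φ := fun ξ v => (kn ξ ^ 2 * ‖v 1‖ₑ) ^ 2) (fun w =>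
    ((measurable_kn.pow_const 2).mul (measurable_applyVC (measurable_fourierL2 w) 1).enorm).pow_const
      2) (fun ξ => ?_) fun n => ?_
  · exact (ENNReal.continuous_pow 2).comp ((ENNReal.continuous_const_mul
      (ENNReal.pow_ne_top (kn_ne_top ξ))).comp (continuous_enorm.comp (by fun_prop)))
  · rw [← fourierNormTwo_sq, ENNReal.ofReal_pow hB0]
    exact pow_le_pow_left' (hB n) 2

theorem tendsto_duhamel {M : ℝ} {η : ℝ → ℝ → ℂ} {ηn : ℕ → ℝ → ℝ → ℂ} (h : ∀ n, Forcing M (ηn n))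
    (hη : Forcing M η) (hlim : ∀ s ξ, Tendsto (fun n => ηn n s ξ) atTop (𝓝 (η s ξ))) {t : ℝ}
    (ht : 0 ≤ t) (ξ : ℝ) :
    Tendsto (fun n => duhamel Z₀ (ηn n) t ξ) atTop (𝓝 (duhamel Z₀ η t ξ)) := by
  have hM := hη.nonneg
  have h1 : Tendsto (fun n => ∫⁻ s in Set.Ioc 0 t, ‖ηn n s ξ - η s ξ‖ₑ ^ 2) atTop
      (𝓝 (∫⁻ _ in Set.Ioc 0 t, 0)) := by
    refine tendsto_lintegral_of_dominated_convergence (fun _ => ENNReal.ofReal (M + M) ^ 2)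
      (fun n => ((((h n).cont_time ξ).sub (hη.cont_time ξ)).measurable.enorm).pow_const 2)
      (fun n => ?_) ?_ ?_
    · filter_upwards [ae_restrict_mem measurableSet_Ioc] with s hs
      gcongr
      rw [← ofReal_norm]
      exact ENNReal.ofReal_le_ofReal ((norm_sub_le _ _).trans (add_le_add
        ((h n).norm_le hs.1.le ξ) (hη.norm_le hs.1.le ξ)))
    · rw [setLIntegral_const]
      exact ENNReal.mul_ne_top (ENNReal.pow_ne_top ENNReal.ofReal_ne_top) (by simp)
    · filter_upwards with s
      have := ENNReal.Tendsto.pow (n := 2) ((hlim s ξ).sub_const (η s ξ)).enorm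
      simpa using this
  rw [lintegral_zero] at h1
  have h2 : Tendsto (fun n => ‖duhamel Z₀ (ηn n) t ξ - duhamel Z₀ η t ξ‖ₑ) atTop (𝓝 0) := by
    refine tendsto_zero_of_sq (tendsto_of_tendsto_of_tendsto_of_le_of_le tendsto_const_nhds h1
      (fun _ => zero_le) fun n => ?_)
    have hs := (isFlow_duhamel Z₀ (h n).cont ξ).sub (isFlow_duhamel Z₀ hη.cont ξ)
    have := le_self_add.trans (hs.enorm_energy_le
      (((h n).cont_time ξ).sub (hη.cont_time ξ)) ht)
    simp only [duhamel_zero, sub_self, enorm_zero, ne_eq, OfNat.ofNat_ne_zero, not_false_eq_true,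
      zero_pow, zero_add] at this
    rw [enormVC_sq]
    exact this
  rw [tendsto_iff_norm_sub_tendsto_zero]
  have h3 := (ENNReal.tendsto_toReal ENNReal.zero_ne_top).comp h2
  simpa [Function.comp_def] using h3

end PSystem

namespace PSystem

variable {f g : V → ℝ} {C r A R ε : ℝ} {z z' : ℝ → L2 V} {Z₀ Z₀' : ℝ → VC}

theorem tendsto_fluxHat (h : FluxBound f g C r) (hA : A < r) {u : ℕ → L2 V} {v : L2 V}
    (hu : ∀ n, SupBound A (u n)) (hv : SupBound A v) {B : ℝ}
    (h2 : ∀ n, fourierNormTwo (u n) ≤ ENNReal.ofReal B) (hlim : Tendsto u atTop (𝓝 v)) (ξ : ℝ) :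
    Tendsto (fun n => fluxHat f g (u n) ξ) atTop (𝓝 (fluxHat f g v ξ)) := by
  have h1 : Tendsto (fun n => ‖u n - v‖) atTop (𝓝 0) := tendsto_iff_norm_sub_tendsto_zero.1 hlim
  have hp : Tendsto (fun n => ‖derivB v - derivB (u n)‖) atTop (𝓝 0) := by
    have h3 : Tendsto (fun n => ‖derivB v - derivB (u n)‖ₑ) atTop (𝓝 0) := by
      refine tendsto_zero_of_sq ?_
      have h4 := ENNReal.Tendsto.mul_const (hlim.const_sub v).enorm
        (b := fourierNormTwo v + ENNReal.ofReal B) (.inr (by simp [hv.two.ne]))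
      rw [sub_self, enorm_zero, zero_mul] at h4
      refine tendsto_of_tendsto_of_tendsto_of_le_of_le tendsto_const_nhds h4 (fun _ => zero_le)
        fun n => (enorm_derivB_sub_sq_le hv.one (hu n).one).trans ?_
      gcongr
      exact h2 n
    have h5 := (ENNReal.tendsto_toReal ENNReal.zero_ne_top).comp h3
    simpa [Function.comp_def] using h5
  have h1' : Tendsto (fun n => ‖v - u n‖) atTop (𝓝 0) := h1.congr fun n => norm_sub_rev _ _
  rw [tendsto_iff_norm_sub_tendsto_zero]
  have hb : Tendsto (fun n => C * ((‖v‖ + ‖u n‖ + 2 * ‖derivB v‖) * ‖v - u n‖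
      + 2 * (‖u n‖ * ‖derivB v - derivB (u n)‖))) atTop (𝓝 0) := by
    have := (((((hlim.norm.const_add ‖v‖).add_const (2 * ‖derivB v‖)).mul h1').add
      ((hlim.norm.mul hp).const_mul 2)).const_mul C)
    simpa using this
  refine tendsto_of_tendsto_of_tendsto_of_le_of_le tendsto_const_nhds hb
    (fun _ => norm_nonneg _) fun n => ?_
  rw [norm_sub_rev]
  exact h.norm_fluxHat_sub_le hA hv (hu n) ξ

/-- The iterates of the solution operator of the linear problem. -/
theorem exists_iterates (h : FluxBound f g C r) {C₁ : ℝ}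
    (hlin : ∀ {M : ℝ} {Z₀ : ℝ → VC} {η : ℝ → ℝ → ℂ}, Forcing M η → DataBound M Z₀ →
      Decay (C₁ * M) (duhamel Z₀ η)) (hR0 : 0 ≤ C₁ * ε)
    (hR : 3 * (C₁ * ε) < r) (hR1 : 3 * (C₁ * ε) ≤ 1)
    (hε : 150 * C * (C₁ * ε) * (C₁ * ε) ≤ ε) (hZ : DataBound ε Z₀)
    (hsymm : ∀ ξ, Z₀ (-ξ) = conjVC (Z₀ ξ)) :
    ∃ ζ : ℕ → ℝ → L2 V, (∀ n, Decay (C₁ * ε) fun t => fourierL2 (ζ n t)) ∧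
      ∀ n t, 0 ≤ t → fourierL2 (ζ (n + 1) t) =ᵐ[volume] duhamel Z₀ (fluxPath f g (ζ n)) t := by
  set R := C₁ * ε with hRdef
  have next : ∀ z : {z : ℝ → L2 V // Decay R fun t => fourierL2 (z t)},
      ∃ w : {z : ℝ → L2 V // Decay R fun t => fourierL2 (z t)}, ∀ t, 0 ≤ t →
        fourierL2 (w.1 t) =ᵐ[volume] duhamel Z₀ (fluxPath f g z.1) t := by
    rintro ⟨z, hz⟩
    have hF := (h.forcing hR hR1 hz).mono hε
    have hd := hlin hF hZ
    obtain ⟨w, hw⟩ := exists_L2_of_decay hF.cont (fluxPath_neg f g z) hZ.meas hsymm hd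
    exact ⟨⟨w, hd.congr hw⟩, hw⟩
  choose T hT using next
  let ζ : ℕ → {z : ℝ → L2 V // Decay R fun t => fourierL2 (z t)} := fun n =>
    Nat.rec ⟨fun _ => 0, decay_zero hR0⟩ (fun _ z => T z) n
  exact ⟨fun n => (ζ n).1, fun n => (ζ n).2, fun n => hT (ζ n)⟩

theorem dist_iterates_le (h : FluxBound f g C r) (hR0 : 0 ≤ R) (hR : 3 * R < r)
    (hCR : C * (3 * R) ≤ 1 / 32) (hZ : Measurable Z₀) {ζ : ℕ → ℝ → L2 V}
    (hreg : ∀ n, Regular (3 * R) (ζ n))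
    (hζ : ∀ n t, 0 ≤ t →
      fourierL2 (ζ (n + 1) t) =ᵐ[volume] duhamel Z₀ (fluxPath f g (ζ n)) t) (n : ℕ) {t : ℝ}
    (ht : 0 ≤ t) : dist (ζ n t) (ζ (n + 1) t) ≤ (9 * R * Real.exp t) * (1 / 2) ^ n := by
  have hen : ∀ n t, 0 ≤ t → energy (ζ (n + 1)) (ζ n) t
      ≤ ENNReal.ofReal (8 * (3 * R) ^ 2 * (1 / 8) ^ n) * ENNReal.ofReal (Real.exp t) := by
    intro n
    induction n with
    | zero =>
      intro t ht
      rw [pow_zero, mul_one]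
      exact (hreg 1).energy_le (hreg 0) ht
    | succ n ih =>
      intro t ht
      refine (energy_step h hR hCR (hreg (n + 1)) (hreg n) hZ hZ (hζ (n + 1)) (hζ n)
        (fun t ht => ((hreg _).sup t ht).one) (fun t ht => ((hreg _).sup t ht).one) ih ht).trans
        (le_of_eq ?_)
      congr 1
      simp only [sub_self, enorm_zero, ne_eq, OfNat.ofNat_ne_zero, not_false_eq_true, zero_pow,
        lintegral_zero, zero_add]
      rw [show (8 : ℝ≥0∞) = ENNReal.ofReal 8 by norm_num,
        ← ENNReal.ofReal_div_of_pos (by norm_num)]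
      congr 1
      ring
  have h1 := le_self_add.trans (hen n t ht)
  rw [← ofReal_norm_sq, ← ENNReal.ofReal_mul (by positivity),
    ENNReal.ofReal_le_ofReal_iff (by positivity)] at h1
  rw [dist_comm, dist_eq_norm]
  refine (pow_le_pow_iff_left₀ (norm_nonneg _) (by positivity) two_ne_zero).1 (h1.trans ?_)
  have e1 : Real.exp t ≤ Real.exp t ^ 2 := le_self_pow₀ (Real.one_le_exp ht) two_ne_zero
  have e2 : ((1 / 8 : ℝ)) ^ n ≤ ((1 / 2 : ℝ) ^ n) ^ 2 := by
    rw [← pow_mul, mul_comm, pow_mul]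
    exact pow_le_pow_left₀ (by norm_num) (by norm_num) n
  calc 8 * (3 * R) ^ 2 * (1 / 8) ^ n * Real.exp t
      ≤ 8 * (3 * R) ^ 2 * ((1 / 2 : ℝ) ^ n) ^ 2 * Real.exp t ^ 2 := by gcongr
    _ ≤ 81 * R ^ 2 * ((1 / 2 : ℝ) ^ n) ^ 2 * Real.exp t ^ 2 := by
        refine mul_le_mul_of_nonneg_right (mul_le_mul_of_nonneg_right ?_ (by positivity))
          (by positivity)
        nlinarith [sq_nonneg R]
    _ = _ := by ring

/-- Existence of a solution with the decay of the linear problem. -/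
theorem exists_solution (h : FluxBound f g C r) {C₁ : ℝ}
    (hlin : ∀ {M : ℝ} {Z₀ : ℝ → VC} {η : ℝ → ℝ → ℂ}, Forcing M η → DataBound M Z₀ →
      Decay (C₁ * M) (duhamel Z₀ η)) (hR0 : 0 ≤ C₁ * ε)
    (hR : 3 * (C₁ * ε) < r) (hR1 : 3 * (C₁ * ε) ≤ 1) (hCR : C * (3 * (C₁ * ε)) ≤ 1 / 32)
    (hε : 150 * C * (C₁ * ε) * (C₁ * ε) ≤ ε) (hZ : DataBound ε Z₀)
    (hsymm : ∀ ξ, Z₀ (-ξ) = conjVC (Z₀ ξ)) :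
    ∃ z : ℝ → L2 V, Decay (C₁ * ε) (fun t => fourierL2 (z t)) ∧ Forcing ε (fluxPath f g z) ∧
      ∀ t, 0 ≤ t → fourierL2 (z t) =ᵐ[volume] duhamel Z₀ (fluxPath f g z) t := by
  set R := C₁ * ε with hRdef
  have hforce : ∀ z : ℝ → L2 V, Decay R (fun t => fourierL2 (z t)) → Forcing ε (fluxPath f g z) :=
    fun z hz => (h.forcing hR hR1 hz).mono hε
  obtain ⟨ζ, hζd, hζ⟩ := exists_iterates h hlin hR0 hR hR1 hε hZ hsymm
  have hreg : ∀ n, Regular (3 * R) (ζ n) := fun n => (hζd n).regular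
  have hdist := fun n t ht => dist_iterates_le h hR0 hR hCR hZ.meas hreg hζ n (t := t) ht
  have hex : ∀ t, ∃ y : L2 V, 0 ≤ t → Tendsto (fun n => ζ n t) atTop (𝓝 y) := by
    intro t
    by_cases ht : 0 ≤ t
    · obtain ⟨y, hy⟩ := cauchySeq_tendsto_of_complete
        (cauchySeq_of_le_geometric _ _ (by norm_num) fun n => hdist n t ht)
      exact ⟨y, fun _ => hy⟩
    · exact ⟨0, fun h => absurd h ht⟩
  choose z hz using hex
  have hn0 : ∀ t, 0 ≤ t → ‖z t‖ₑ ≤ ENNReal.ofReal (R * rho t) := fun t ht =>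
    le_of_tendsto (hz t ht).enorm (.of_forall fun n => (hζd n).norm_le ht)
  have hn1 : ∀ t, 0 ≤ t → fourierNormOne (z t) ≤ ENNReal.ofReal (R * rho t ^ 3) := fun t ht =>
    fourierNormOne_le_of_tendsto (hz t ht) (by have := rho_pos ht; positivity)
      fun n => (hζd n).one_le ht
  have hn2 : ∀ t, 0 ≤ t → fourierNormTwo (z t) ≤ ENNReal.ofReal (4 * R * rho t ^ 3) :=
    fun t ht => fourierNormTwo_le_of_tendsto (hz t ht) (by have := rho_pos ht; positivity)
      fun n => (hζd n).two_le ht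
  have hlt : ∀ t, 0 ≤ t → fourierNormOne (z t) < ⊤ := fun t ht =>
    (hn1 t ht).trans_lt ENNReal.ofReal_lt_top
  have hcont : ContinuousOn z (Set.Ici 0) := by
    intro t ht
    rw [ContinuousWithinAt, tendsto_iff_norm_sub_tendsto_zero]
    have hlim : Tendsto (fun s => R * |s - t|) (𝓝[Set.Ici 0] t) (𝓝 0) := by
      have : Continuous fun s => R * |s - t| := by fun_prop
      simpa using (this.tendsto t).mono_left nhdsWithin_le_nhds
    refine tendsto_of_tendsto_of_tendsto_of_le_of_le' tendsto_const_nhds hlim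
      (.of_forall fun s => norm_nonneg _) ?_
    filter_upwards [self_mem_nhdsWithin, mem_nhdsWithin_of_mem_nhds (Metric.closedBall_mem_nhds t
      one_pos)] with s hs hs1
    exact le_of_tendsto ((hz s hs).sub (hz t ht)).norm (.of_forall fun n =>
      (hζd n).norm_sub_le hs ht (by simpa [Real.dist_eq] using hs1))
  have hzreg : Regular (3 * R) z := by
    refine ⟨hcont, continuousOn_derivB_of_continuousOn hcont hlt (B := 4 * R) fun t ht =>
      (hn2 t ht).trans (ENNReal.ofReal_le_ofReal (mul_le_of_le_one_right (by positivity)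
      (pow_le_one₀ (rho_pos ht).le (rho_le_one ht)))), fun t ht => ?_, fun t ht => ?_,
      fun t ht => ?_⟩
    · refine (supBound_of_norms hR0 (rho_pos ht) (rho_le_one ht) (hn0 t ht) (hn1 t ht)
        (hn2 t ht)).mono ?_
      exact mul_le_of_le_one_right (by positivity) (pow_le_one₀ (rho_pos ht).le (rho_le_one ht))
    · exact (hn0 t ht).trans (by simpa using ofReal_mul_rho_le hR0 ht 1)
    · exact (enorm_derivB_le (hlt t ht)).trans ((hn1 t ht).trans (ofReal_mul_rho_le hR0 ht 3))
  have hflim : ∀ s ξ, Tendsto (fun n => fluxPath f g (ζ n) s ξ) atTop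
      (𝓝 (fluxPath f g z s ξ)) := by
    intro s ξ
    have hs : 0 ≤ max s 0 := le_max_right _ _
    exact tendsto_fluxHat h hR (fun n => (hreg n).sup _ hs) (hzreg.sup _ hs)
      (fun n => (hζd n).two_le hs) (hz _ hs) ξ
  have hF : Forcing ε (fluxPath f g z) :=
    .of_tendsto (fun n => hforce _ (hζd n)) (hzreg.continuous_fluxPath h hR) hflim
  have hsol : ∀ t, 0 ≤ t → fourierL2 (z t) =ᵐ[volume] duhamel Z₀ (fluxPath f g z) t := by
    intro t ht
    obtain ⟨ns, hns, hlim⟩ := exists_subseq_fourierL2_tendsto ((tendsto_add_atTop_iff_nat 1).2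
      (hz t ht))
    filter_upwards [hlim, ae_all_iff.2 fun n => hζ n t ht] with ξ a b
    refine tendsto_nhds_unique a ?_
    simp only [b]
    exact (tendsto_duhamel (fun n => hforce _ (hζd n)) hF hflim ht ξ).comp hns.tendsto_atTop
  exact ⟨z, (hlin hF hZ).congr hsol, hF, hsol⟩

/-- Continuous dependence of regular solutions on the data, and uniqueness. -/
theorem energy_le_of_solutions (h : FluxBound f g C r) (hA : A < r) (hCA : C * A ≤ 1 / 32)
    (hz : Regular A z) (hz' : Regular A z') (hZ : Measurable Z₀) (hZ' : Measurable Z₀')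
    (hs : ∀ t, 0 ≤ t → fourierL2 (z t) =ᵐ[volume] duhamel Z₀ (fluxPath f g z) t)
    (hs' : ∀ t, 0 ≤ t → fourierL2 (z' t) =ᵐ[volume] duhamel Z₀' (fluxPath f g z') t)
    {t : ℝ} (ht : 0 ≤ t) :
    energy z z' t ≤ 2 * (∫⁻ ξ, ‖Z₀ ξ - Z₀' ξ‖ₑ ^ 2) * ENNReal.ofReal (Real.exp t) := by
  set D := ∫⁻ ξ, ‖Z₀ ξ - Z₀' ξ‖ₑ ^ 2 with hD
  have key : ∀ n : ℕ, ∀ t, 0 ≤ t → energy z z' t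
      ≤ (2 * D + ENNReal.ofReal (8 * A ^ 2 * (1 / 8) ^ n)) * ENNReal.ofReal (Real.exp t) := by
    intro n
    induction n with
    | zero =>
      intro t ht
      refine (hz.energy_le hz' ht).trans ?_
      gcongr
      simp
    | succ n ih =>
      intro t ht
      refine (energy_step h hA hCA hz hz' hZ hZ' hs hs' (fun t ht => (hz.sup t ht).one)
        (fun t ht => (hz'.sup t ht).one) ih ht).trans (mul_le_mul' ?_ le_rfl)
      rw [← hD, ENNReal.add_div, ← add_assoc]
      refine add_le_add ?_ (le_of_eq ?_)
      · rw [two_mul]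
        refine add_le_add le_rfl ?_
        refine ENNReal.div_le_of_le_mul ?_
        rw [show (8 : ℝ≥0∞) = 1 + 1 + 6 by norm_num, mul_add, mul_add, mul_one]
        exact le_self_add
      · rw [show (8 : ℝ≥0∞) = ENNReal.ofReal 8 by norm_num,
          ← ENNReal.ofReal_div_of_pos (by norm_num)]
        congr 1
        rw [pow_succ]
        norm_num
        ring
  have hlim : Tendsto (fun n : ℕ => (2 * D + ENNReal.ofReal (8 * A ^ 2 * (1 / 8) ^ n)) *
      ENNReal.ofReal (Real.exp t)) atTop (𝓝 (2 * D * ENNReal.ofReal (Real.exp t))) := by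
    have h1 : Tendsto (fun n : ℕ => 8 * A ^ 2 * (1 / 8 : ℝ) ^ n) atTop (𝓝 0) := by
      simpa using (tendsto_pow_atTop_nhds_zero_of_lt_one (by norm_num : (0 : ℝ) ≤ 1 / 8)
        (by norm_num)).const_mul (8 * A ^ 2)
    have h2 := ENNReal.tendsto_ofReal h1
    have h3 := ENNReal.Tendsto.mul_const (b := ENNReal.ofReal (Real.exp t)) (h2.const_add (2 * D))
      (.inr ENNReal.ofReal_ne_top)
    simpa using h3
  exact ge_of_tendsto' hlim fun n => key n t ht

end PSystem

namespace PSystem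

/-! ### Well-posedness -/

theorem FluxBound.of_le {f g : V → ℝ} {C r r' : ℝ} (h : FluxBound f g C r) (hr' : 0 < r')
    (hr : r' ≤ r) : FluxBound f g C r' :=
  ⟨h.one_le, hr', h.g_zero, fun v w hv hw => h.g_sub v w (hv.trans_le hr) (hw.trans_le hr),
    fun v hv => h.f_le v (hv.trans_le hr),
    fun v w hv hw => h.f_sub v w (hv.trans_le hr) (hw.trans_le hr)⟩

/-- The constants for which the fixed point argument closes for data of size `ε`. -/
structure Small (f g : V → ℝ) (C r C₁ ε : ℝ) : Prop where
  flux : FluxBound f g C r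
  one_le : 1 ≤ C₁
  pos : 0 < ε
  lin : ∀ {M : ℝ} {Z₀ : ℝ → VC} {η : ℝ → ℝ → ℂ}, Forcing M η → DataBound M Z₀ →
    Decay (C₁ * M) (duhamel Z₀ η)
  lt : 12 * (C₁ * ε) < r
  le_one : 12 * (C₁ * ε) ≤ 1
  contr : C * (12 * (C₁ * ε)) ≤ 1 / 32
  quad : 150 * C * (C₁ * ε) * (C₁ * ε) ≤ ε

/-- `Z₀` is the continuous representative of the Fourier transform of data of size `ε`. -/
structure IsDatum (ε : ℝ) (z₀ : L2 V) (Z₀ : ℝ → VC) : Prop where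
  cont : Continuous Z₀
  vanish : Tendsto Z₀ (cocompact ℝ) (𝓝 0)
  rep : fourierL2 z₀ =ᵐ[volume] Z₀
  bound : DataBound ε Z₀

variable {f g : V → ℝ} {C r C₁ ε : ℝ} {z z' : ℝ → L2 V} {z₀ z₀' : L2 V} {Z₀ Z₀' : ℝ → VC}

theorem MemB0.exists_isDatum (hε : 0 ≤ ε) (h : MemB0 z₀) (hn : normB0 z₀ ≤ ENNReal.ofReal ε) :
    ∃ Z₀, IsDatum ε z₀ Z₀ := by
  obtain ⟨m, hc, h0, hm⟩ := h.exists_fourier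
  rw [normB0_eq, fourierNorm_congr hm] at hn
  exact ⟨m, hc, h0, hm, dataBound_of_fourierNorm hε hc.measurable hn⟩

/-- What is known about the solution with datum `Z₀`. -/
structure IsGood (f g : V → ℝ) (R ε : ℝ) (Z₀ : ℝ → VC) (z : ℝ → L2 V) : Prop where
  decay : Decay R fun t => fourierL2 (z t)
  forcing : Forcing ε (fluxPath f g z)
  eq : ∀ t, 0 ≤ t → fourierL2 (z t) =ᵐ[volume] duhamel Z₀ (fluxPath f g z) t

theorem IsGood.continuousInTime {R : ℝ} (h : IsGood f g R ε Z₀ z) (hZ : IsDatum ε z₀ Z₀) :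
    ContinuousInTime normLow z :=
  continuousInTime_of_duhamel h.forcing (fun s _ => tendsto_fluxPath f g z s) hZ.bound hZ.cont
    hZ.vanish h.decay h.eq

theorem Small.regular (h : Small f g C r C₁ ε) (hz : SolvesInBall f g (4 * C₁ * ε) z₀ z) :
    Regular (12 * (C₁ * ε)) z := by
  have hC := h.one_le
  have hε := h.pos
  have := MemB.regular (by positivity) hz.1 hz.2.2
  rwa [show 3 * (4 * C₁ * ε) = 12 * (C₁ * ε) by ring] at this

theorem Small.exists_solvesInBall (h : Small f g C r C₁ ε) (hZ : IsDatum ε z₀ Z₀) :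
    ∃ z, IsGood f g (C₁ * ε) ε Z₀ z ∧ SolvesInBall f g (4 * C₁ * ε) z₀ z := by
  have hC := h.one_le
  have hC' := h.flux.one_le
  have hε := h.pos
  have hR : 0 < C₁ * ε := by positivity
  have h1 : C * (3 * (C₁ * ε)) ≤ C * (12 * (C₁ * ε)) :=
    mul_le_mul_of_nonneg_left (by linarith) (by linarith)
  obtain ⟨z, hd, hF, hs⟩ := exists_solution h.flux h.lin hR.le (by linarith [h.lt])
    (by linarith [h.le_one]) (h1.trans h.contr) h.quad hZ.bound (fourierL2_rep_neg hZ.cont hZ.rep)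
  have hn := normB_le_of_decay hd
  rw [← mul_assoc] at hn
  have hg : IsGood f g (C₁ * ε) ε Z₀ z := ⟨hd, hF, hs⟩
  exact ⟨z, hg, ⟨fun t ht => memB0_of_duhamel hF (fun s _ => tendsto_fluxPath f g z s) hZ.cont
    hZ.vanish hd hs ht, hg.continuousInTime hZ, hn.trans_lt ENNReal.ofReal_lt_top⟩,
    (isMildSolution_iff hZ.rep).2 hs, hn⟩

theorem Small.enorm_sub_sq_le (h : Small f g C r C₁ ε) (hZ : IsDatum ε z₀ Z₀)
    (hZ' : IsDatum ε z₀' Z₀') (hz : SolvesInBall f g (4 * C₁ * ε) z₀ z)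
    (hz' : SolvesInBall f g (4 * C₁ * ε) z₀' z') {t : ℝ} (ht : 0 ≤ t) :
    ‖z t - z' t‖ₑ ^ 2 ≤ 2 * normB0 (z₀ - z₀') ^ 2 * ENNReal.ofReal (Real.exp t) := by
  have h1 := energy_le_of_solutions h.flux h.lt h.contr (h.regular hz) (h.regular hz')
    hZ.bound.meas hZ'.bound.meas ((isMildSolution_iff hZ.rep).1 hz.2.1)
    ((isMildSolution_iff hZ'.rep).1 hz'.2.1) ht
  have h2 : ∫⁻ ξ, ‖Z₀ ξ - Z₀' ξ‖ₑ ^ 2 = ‖z₀ - z₀'‖ₑ ^ 2 := by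
    rw [enorm_sq_eq]
    refine lintegral_congr_ae ?_
    filter_upwards [fourierL2_sub_ae z₀ z₀', hZ.rep, hZ'.rep] with ξ a b c
    rw [a, b, c]
  rw [h2] at h1
  have h3 : ‖z₀ - z₀'‖ₑ ≤ normB0 (z₀ - z₀') := (le_add_self.trans le_self_add).trans le_self_add
  exact (le_self_add.trans h1).trans (by gcongr)

theorem Small.eq_of_solvesInBall (h : Small f g C r C₁ ε) (hZ : IsDatum ε z₀ Z₀)
    (hz : SolvesInBall f g (4 * C₁ * ε) z₀ z) (hz' : SolvesInBall f g (4 * C₁ * ε) z₀ z') {t : ℝ}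
    (ht : 0 ≤ t) : z t = z' t := by
  have h1 := h.enorm_sub_sq_le hZ hZ hz hz' ht
  have h0 : normB0 (z₀ - z₀) = 0 := by
    have := fourierNorm_congr (m' := 0) (fourierL2_zero)
    rw [sub_self, normB0_eq, this]
    simp [fourierNorm]
  rw [h0] at h1
  simpa [sub_eq_zero] using h1

theorem Small.isGood (h : Small f g C r C₁ ε) (hZ : IsDatum ε z₀ Z₀)
    (hz : SolvesInBall f g (4 * C₁ * ε) z₀ z) : IsGood f g (C₁ * ε) ε Z₀ z := by
  obtain ⟨w, hw, hs⟩ := h.exists_solvesInBall hZ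
  have he : ∀ t, 0 ≤ t → z t = w t := fun t ht => h.eq_of_solvesInBall hZ hz hs ht
  have hf : fluxPath f g z = fluxPath f g w := by
    ext s ξ
    rw [fluxPath, fluxPath, he _ (le_max_right _ _)]
  refine ⟨hw.decay.congr fun t ht => by rw [he t ht], hf ▸ hw.forcing, fun t ht => ?_⟩
  rw [hf, he t ht]
  exact hw.eq t ht

theorem Small.continuous_dependence (h : Small f g C r C₁ ε) {η : ℝ≥0∞} (hη : 0 < η) :
    ∃ δ : ℝ≥0∞, 0 < δ ∧ ∀ (z₀ z₀' : L2 V) (z z' : ℝ → L2 V),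
      MemB0 z₀ → normB0 z₀ ≤ ENNReal.ofReal ε → SolvesInBall f g (4 * C₁ * ε) z₀ z →
      MemB0 z₀' → normB0 z₀' ≤ ENNReal.ofReal ε → SolvesInBall f g (4 * C₁ * ε) z₀' z' →
      normB0 (z₀ - z₀') ≤ δ → ∀ t : ℝ, 0 ≤ t → ‖z t - z' t‖ₑ ≤ η := by
  have hC := h.one_le
  have hε := h.pos
  obtain ⟨e, he0, heη⟩ := ENNReal.lt_iff_exists_real_btwn.1 hη
  have he : 0 < e := ENNReal.ofReal_pos.1 (by simpa using heη.1)
  have hlim : Tendsto (fun t => 2 * (4 * C₁ * ε) * rho t) atTop (𝓝 (2 * (4 * C₁ * ε) * 0)) :=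
    ((tendsto_rpow_neg_atTop (by norm_num : (0 : ℝ) < 1 / 4)).comp
      (tendsto_atTop_add_const_left _ 1 tendsto_id)).const_mul _
  rw [mul_zero] at hlim
  obtain ⟨T, hT⟩ := eventually_atTop.1 (hlim.eventually (gt_mem_nhds he))
  refine ⟨ENNReal.ofReal (e / (2 * Real.exp (T / 2))), ENNReal.ofReal_pos.2 (by positivity),
    fun z₀ z₀' z z' h0 hn hz h0' hn' hz' hδ t ht => le_trans ?_ heη.2.le⟩
  obtain ⟨Z₀, hZ⟩ := h0.exists_isDatum hε.le hn
  obtain ⟨Z₀', hZ'⟩ := h0'.exists_isDatum hε.le hn'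
  rcases le_total T t with hTt | htT
  · have hr := rho_pos ht
    refine (enorm_sub_le.trans (add_le_add (norm_le_of_normB hz.2.2 ht)
      (norm_le_of_normB hz'.2.2 ht))).trans ?_
    rw [← ENNReal.ofReal_add (by positivity) (by positivity)]
    exact ENNReal.ofReal_le_ofReal (by linarith [hT t hTt])
  · refine ennreal_le_ofReal_of_sq he.le ((h.enorm_sub_sq_le hZ hZ' hz hz' ht).trans ?_)
    calc _ ≤ 2 * ENNReal.ofReal (e / (2 * Real.exp (T / 2))) ^ 2
          * ENNReal.ofReal (Real.exp t) := by gcongr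
      _ = ENNReal.ofReal (2 * (e / (2 * Real.exp (T / 2))) ^ 2 * Real.exp t) := by
          rw [ENNReal.ofReal_mul (by positivity), ENNReal.ofReal_mul (by positivity),
            ENNReal.ofReal_pow (by positivity)]
          simp
      _ ≤ _ := by
          refine ENNReal.ofReal_le_ofReal ?_
          have h1 : Real.exp t ≤ Real.exp (T / 2) ^ 2 := by
            rw [← Real.exp_nat_mul]
            exact Real.exp_le_exp.2 (by push_cast; linarith)
          rw [div_pow, mul_pow]
          calc _ ≤ 2 * (e ^ 2 / (2 ^ 2 * Real.exp (T / 2) ^ 2)) * Real.exp (T / 2) ^ 2 := by gcongr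
            _ = e ^ 2 / 2 := by field_simp
            _ ≤ _ := by nlinarith [sq_nonneg e]

end PSystem

namespace PSystem

theorem SecondDiff.of_le {f g : V → ℝ} {K r r' : ℝ} {T : Set (V × ℝ)} (h : SecondDiff f g K r T)
    (hr : r' ≤ r) : SecondDiff f g K r' T :=
  fun A B v₁ v₂ v₁' v₂' p₁ p₂ p₁' p₂' hA => h A B v₁ v₂ v₁' v₂' p₁ p₂ p₁' p₂' (hA.trans_le hr)

theorem lintegral_kn_sub_sq_le {u v : ℝ → ℂ} {w : ℝ → ℝ≥0∞} (hu : Measurable u) (hw : Measurable w)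
    {B : ℝ} (h1 : ∫⁻ ξ, (w ξ * ‖u ξ‖ₑ) ^ 2 ≤ ENNReal.ofReal (B ^ 2))
    (h2 : ∫⁻ ξ, (w ξ * ‖v ξ‖ₑ) ^ 2 ≤ ENNReal.ofReal (B ^ 2)) :
    ∫⁻ ξ, (w ξ * ‖u ξ - v ξ‖ₑ) ^ 2 ≤ 8 * ENNReal.ofReal (B ^ 2) := by
  calc _ ≤ ∫⁻ ξ, 4 * ((w ξ * ‖u ξ‖ₑ) ^ 2 + (w ξ * ‖v ξ‖ₑ) ^ 2) := by
        refine lintegral_mono fun ξ => le_trans ?_ (ennreal_add_sq_le _ _)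
        rw [← mul_add]
        gcongr
        exact enorm_sub_le
    _ ≤ 4 * (ENNReal.ofReal (B ^ 2) + ENNReal.ofReal (B ^ 2)) := by
        rw [lintegral_const_mul' _ _ (by norm_num), lintegral_add_left (by fun_prop)]
        gcongr
    _ = _ := by ring

theorem Forcing.sub {M : ℝ} {η η' : ℝ → ℝ → ℂ} (h : Forcing M η) (h' : Forcing M η') :
    Forcing (3 * M) fun s ξ => η s ξ - η' s ξ := by
  have hM := h.nonneg
  have e8 : ∀ x : ℝ, 8 * ENNReal.ofReal (x ^ 2) ≤ ENNReal.ofReal ((3 * x) ^ 2) := fun x => by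
    rw [show (8 : ℝ≥0∞) = ENNReal.ofReal 8 by norm_num, ← ENNReal.ofReal_mul (by norm_num)]
    exact ENNReal.ofReal_le_ofReal (by nlinarith [sq_nonneg x])
  have hc : ∀ s, Continuous fun ξ => η s ξ := fun s => h.cont.comp (by fun_prop :
    Continuous fun ξ : ℝ => ((s, ξ) : ℝ × ℝ))
  refine ⟨h.cont.sub h'.cont, fun s hs ξ => ?_, fun s hs => ?_, fun δ hδ hδ1 t ht => ?_⟩
  · have := rho_pos hs
    refine (norm_sub_le _ _).trans ((add_le_add (h.sup s hs ξ) (h'.sup s hs ξ)).trans ?_)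
    nlinarith [mul_nonneg hM (sq_nonneg (rho s))]
  · refine (lintegral_kn_sub_sq_le (hc s).measurable measurable_kn (h.deriv s hs)
      (h'.deriv s hs)).trans ((e8 _).trans (le_of_eq ?_))
    rw [mul_assoc]
  · have hd : ∀ {η : ℝ → ℝ → ℂ}, Forcing M η →
        Measurable fun p : ℝ × ℝ => ‖η (p.1 + δ) p.2 - η p.1 p.2‖ₑ ^ 2 := fun {η} h => by
      have c1 : Continuous fun p : ℝ × ℝ => η (p.1 + δ) p.2 :=
        h.cont.comp (by fun_prop : Continuous fun p : ℝ × ℝ => ((p.1 + δ, p.2) : ℝ × ℝ))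
      have c2 : Continuous fun p : ℝ × ℝ => η p.1 p.2 := h.cont
      exact (c1.sub c2).measurable.enorm.pow_const 2
    calc _ ≤ ∫⁻ s in Set.Ioc t (t + 1), 4 * ((∫⁻ ξ, ‖η (s + δ) ξ - η s ξ‖ₑ ^ 2)
          + ∫⁻ ξ, ‖η' (s + δ) ξ - η' s ξ‖ₑ ^ 2) := by
          refine lintegral_mono fun s => ?_
          have m1 : Measurable fun ξ => ‖η (s + δ) ξ - η s ξ‖ₑ ^ 2 :=
            ((hc (s + δ)).sub (hc s)).measurable.enorm.pow_const 2
          rw [← lintegral_add_left m1,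
            ← lintegral_const_mul' _ _ (by norm_num)]
          refine lintegral_mono fun ξ => le_trans ?_ (ennreal_add_sq_le _ _)
          refine pow_le_pow_left' (le_trans (le_of_eq ?_) enorm_sub_le) 2
          congr 1; ring
      _ ≤ 4 * (ENNReal.ofReal ((M * δ * rho t ^ 5) ^ 2)
          + ENNReal.ofReal ((M * δ * rho t ^ 5) ^ 2)) := by
          rw [lintegral_const_mul' _ _ (by norm_num),
            lintegral_add_left (hd h).lintegral_prod_right']
          gcongr
          · exact h.diff δ hδ hδ1 t ht
          · exact h'.diff δ hδ hδ1 t ht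
      _ = 8 * ENNReal.ofReal ((M * δ * rho t ^ 5) ^ 2) := by ring
      _ ≤ _ := (e8 _).trans (le_of_eq (by ring_nf))

theorem DataBound.mono {M M' : ℝ} {Z₀ : ℝ → VC} (h : DataBound M Z₀) (hM : 0 ≤ M) (hM' : M ≤ M') :
    DataBound M' Z₀ := by
  have e : ENNReal.ofReal (M ^ 2) ≤ ENNReal.ofReal (M' ^ 2) :=
    ENNReal.ofReal_le_ofReal (pow_le_pow_left₀ hM hM' 2)
  exact ⟨h.meas, h.sup.mono fun _ h => h.trans hM', h.one.trans e, h.two.trans e⟩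

variable {f g : V → ℝ} {C r C₁ ε K : ℝ} {z z' : ℝ → L2 V} {z₀ z₀' : L2 V} {Z₀ Z₀' : ℝ → VC}

theorem Small.normB_sub_le (h : Small f g C r C₁ ε) (h2 : SecondDiff f g K r Set.univ) (hK : 0 ≤ K)
    (hq : C₁ * (200 * (C + K) * (C₁ * ε)) ≤ 1 / 2) (hZ : IsDatum ε z₀ Z₀) (hZ' : IsDatum ε z₀' Z₀')
    (hz : SolvesInBall f g (4 * C₁ * ε) z₀ z) (hz' : SolvesInBall f g (4 * C₁ * ε) z₀' z') :
    normB (fun t => z t - z' t) ≤ (8 * C₁).toNNReal * normB0 (z₀ - z₀') := by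
  have hC1 := h.one_le
  have hC := h.flux.one_le
  have hε := h.pos
  rcases eq_or_ne (normB0 (z₀ - z₀')) ⊤ with htop | htop
  · rw [htop, ENNReal.mul_top]
    · exact le_top
    · simpa using (by linarith : 0 < C₁)
  have gz := h.isGood hZ hz
  have gz' := h.isGood hZ' hz'
  set d := (normB0 (z₀ - z₀')).toReal with hd
  have hd0 : 0 ≤ d := ENNReal.toReal_nonneg
  have hD : DataBound d fun ξ => Z₀ ξ - Z₀' ξ := by
    refine dataBound_of_fourierNorm hd0 (hZ.bound.meas.sub hZ'.bound.meas) (le_of_eq ?_)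
    rw [hd, ENNReal.ofReal_toReal htop, normB0_eq]
    refine (fourierNorm_congr ?_).symm
    filter_upwards [fourierL2_sub_ae z₀ z₀', hZ.rep, hZ'.rep] with ξ a b c
    rw [a, b, c]
  have hlin : ∀ {M : ℝ}, 0 ≤ M →
      Forcing M (fun s ξ => fluxPath f g z s ξ - fluxPath f g z' s ξ) →
      Decay (C₁ * (d + M)) fun t => fourierL2 (z t - z' t) := by
    intro M hM hF
    refine (h.lin (hF.mono (by linarith)) (hD.mono hd0 (by linarith))).congr fun t ht => ?_
    filter_upwards [fourierL2_sub_ae (z t) (z' t), gz.eq t ht, gz'.eq t ht] with ξ a b c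
    rw [a, b, c, duhamel_sub _ _ gz.forcing.cont gz'.forcing.cont]
  set S₀ := C₁ * (d + 3 * ε) with hS₀
  have hS₀0 : 0 ≤ S₀ := by positivity
  have hstep : ∀ n : ℕ, ∃ S, S ≤ 2 * C₁ * d + S₀ * (1 / 2) ^ n ∧
      Decay S fun t => fourierL2 (z t - z' t) := by
    intro n
    induction n with
    | zero => exact ⟨S₀, by nlinarith [mul_nonneg (zero_le_one.trans hC1) hd0],
        hlin (by positivity) (gz.forcing.sub gz'.forcing)⟩
    | succ n ih =>
      obtain ⟨S, hS, hdec⟩ := ih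
      have hS0 := hdec.nonneg
      have hR0 : 0 ≤ C₁ * ε := by positivity
      refine ⟨_, ?_, hlin (by positivity) (h2.forcing h.flux hK (by linarith [h.lt])
        (by linarith [h.le_one]) gz.decay gz'.decay hdec fun t _ => .of_forall fun x => trivial)⟩
      have h1 : C₁ * (30 * (C + K) * (C₁ * ε) * S) ≤ 1 / 2 * S := by
        rw [← mul_assoc]
        refine mul_le_mul_of_nonneg_right (le_trans ?_ hq) hS0
        gcongr
        norm_num
      rw [pow_succ]
      nlinarith
  have hlim : Tendsto (fun n : ℕ => ENNReal.ofReal (4 * (2 * C₁ * d + S₀ * (1 / 2) ^ n))) atTop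
      (𝓝 (ENNReal.ofReal (4 * (2 * C₁ * d + S₀ * 0)))) :=
    (ENNReal.continuous_ofReal.tendsto _).comp (((tendsto_pow_atTop_nhds_zero_of_lt_one
      (by norm_num) (by norm_num)).const_mul S₀).const_add _ |>.const_mul 4)
  refine (ge_of_tendsto' hlim fun n => ?_).trans (le_of_eq ?_)
  · obtain ⟨S, hS, hdec⟩ := hstep n
    exact (normB_le_of_decay hdec).trans (ENNReal.ofReal_le_ofReal (by linarith))
  · rw [show 4 * (2 * C₁ * d + S₀ * 0) = 8 * C₁ * d by ring, ENNReal.ofReal_mul (by positivity),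
      hd, ENNReal.ofReal_toReal htop]
    rfl

end PSystem

namespace PSystem

variable {f g : V → ℝ} {C r C₁ ε K M : ℝ} {z : ℝ → L2 V} {z₀ : L2 V} {Z₀ : ℝ → VC}
  {η : ℝ → ℝ → ℂ}

theorem Forcing.exists_lintegral_quotient_le (h : Forcing M η) {T : ℝ} (hT : 0 ≤ T) :
    ∃ B : ℝ≥0∞, B ≠ ⊤ ∧ ∀ n : ℕ, ∫⁻ ξ, ∫⁻ s in Set.Ioc 0 T, (ENNReal.ofReal ((n : ℝ) + 1) *
      ‖η (s + ((n : ℝ) + 1)⁻¹) ξ - η s ξ‖ₑ) ^ 2 ≤ B := by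
  obtain ⟨C, hC, hconv⟩ := lintegral_conv_le
  refine ⟨ENNReal.ofReal (Real.exp (T / 6)) * (ENNReal.ofReal C * ENNReal.ofReal (M ^ 2) *
    ENNReal.ofReal (rho T ^ 10)), by finiteness, fun n => le_trans ?_ (mul_le_mul_right
      (hconv (fun s ξ => (ENNReal.ofReal ((n : ℝ) + 1) *
      ‖η (s + ((n : ℝ) + 1)⁻¹) ξ - η s ξ‖ₑ) ^ 2) _ (h.measurable_quotient n)
      (fun s hs => h.lintegral_quotient n hs) T hT) _)⟩
  rw [← lintegral_const_mul' _ _ ENNReal.ofReal_ne_top]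
  refine lintegral_mono fun ξ => ?_
  rw [← lintegral_const_mul' _ _ ENNReal.ofReal_ne_top]
  refine setLIntegral_mono' measurableSet_Ioc fun s hs => ?_
  rw [← mul_assoc, ← ENNReal.ofReal_mul (by positivity)]
  refine le_mul_of_one_le_left' (ENNReal.one_le_ofReal.2 ?_)
  rw [mul_left_comm, ← Real.exp_add]
  have := Real.one_le_exp (x := T / 6 + -(T - s) / 6) (by linarith [hs.1])
  linarith

/-- The time derivative of the second component is continuous in `L²`. -/
theorem tendsto_lintegral_deriv_sub (h : Forcing M η) (hZ : DataBound M Z₀) {t : ℝ} (ht : 0 ≤ t) :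
    Tendsto (fun s => ∫⁻ ξ, ‖deriv (fun u => duhamel Z₀ η u ξ 1) s
      - deriv (fun u => duhamel Z₀ η u ξ 1) t‖ₑ ^ 2) (𝓝[Set.Ici 0] t) (𝓝 0) := by
  have hk : Measurable fun ξ : ℝ => ((2 * Real.pi * ξ : ℝ) : ℂ) := by fun_prop
  have hm : ∀ s, Measurable fun ξ => deriv (fun u => duhamel Z₀ η u ξ 1) s := fun s => by
    have h0 := measurable_applyVC (measurable_duhamel_right hZ.meas h.cont s) 0
    have h1 := measurable_applyVC (measurable_duhamel_right hZ.meas h.cont s) 1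
    have h2 : Measurable fun ξ => η s ξ := (h.cont.comp (by fun_prop :
      Continuous fun ξ : ℝ => ((s, ξ) : ℝ × ℝ))).measurable
    simp only [deriv_duhamel_one h.cont]
    fun_prop
  obtain ⟨B, hB, hq⟩ := h.exists_lintegral_quotient_le (T := t + 1) (by linarith)
  set I : ℕ → ℝ → ℝ≥0∞ := fun n ξ => ∫⁻ s in Set.Ioc 0 (t + 1), (ENNReal.ofReal ((n : ℝ) + 1) *
      ‖η (s + ((n : ℝ) + 1)⁻¹) ξ - η s ξ‖ₑ) ^ 2
  have hIm : ∀ n, Measurable (I n) := fun n =>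
    ((h.measurable_quotient n).comp measurable_swap).lintegral_prod_right'
  set G : ℝ → ℝ≥0∞ := fun ξ => liminf (fun n => I n ξ) atTop
    + (‖deriv (fun s => duhamel Z₀ η s ξ 0) 0‖ₑ ^ 2 + ‖deriv (fun s => duhamel Z₀ η s ξ 1) 0‖ₑ ^ 2)
  have hG : ∀ s, 0 ≤ s → s ≤ t + 1 → ∀ ξ, ‖deriv (fun u => duhamel Z₀ η u ξ 1) s‖ₑ ^ 2 ≤ G ξ := by
    intro s hs hst ξ
    have h2 := (isFlow_duhamel Z₀ h.cont ξ).enorm_deriv_le (h.cont_time ξ) (t := s) (a := 1)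
      (e := fun _ => 1) fun hf hc => hf.enorm_sq_le hc hs
    refine (le_add_self.trans h2).trans ?_
    simp only [ENNReal.ofReal_one, one_mul]
    rw [add_comm]
    refine add_le_add (liminf_le_liminf (.of_forall fun n => ?_)) le_rfl
    exact lintegral_mono_set (Set.Ioc_subset_Ioc_right hst)
  have hGi : ∫⁻ ξ, G ξ ≠ ⊤ := by
    rw [lintegral_add_left (Measurable.liminf hIm)]
    refine ENNReal.add_ne_top.2 ⟨ne_top_of_le_ne_top hB ((lintegral_liminf_le hIm).trans
      ((liminf_le_liminf (.of_forall hq)).trans (liminf_const _).le)),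
      ne_top_of_le_ne_top (by finiteness) (hZ.lintegral_deriv_le h)⟩
  have h2 : ∀ᶠ s in 𝓝[Set.Ici 0] t, s < t + 1 := nhdsWithin_le_nhds (gt_mem_nhds (by linarith))
  rw [← lintegral_zero (μ := (volume : Measure ℝ))]
  refine tendsto_lintegral_filter_of_dominated_convergence (fun ξ => 8 * G ξ)
    (.of_forall fun s => ((hm s).sub (hm t)).enorm.pow_const 2) ?_ ?_ ?_
  · filter_upwards [h2, self_mem_nhdsWithin] with s b (c : 0 ≤ s)
    filter_upwards with ξ
    calc _ ≤ 4 * (G ξ + G ξ) := (pow_le_pow_left' enorm_sub_le 2).trans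
          ((ennreal_add_sq_le _ _).trans (mul_le_mul_right (add_le_add (hG s c b.le ξ)
            (hG t ht (by linarith) ξ)) _))
      _ = _ := by ring
  · rw [lintegral_const_mul' _ _ (by norm_num)]
    finiteness
  · filter_upwards with ξ
    have hc := (isFlow_duhamel Z₀ h.cont ξ).continuous_deriv_right (h.cont_time ξ)
    have hc' : Continuous fun s => ‖deriv (fun u => duhamel Z₀ η u ξ 1) s
      - deriv (fun u => duhamel Z₀ η u ξ 1) t‖ₑ := (hc.sub continuous_const).enorm
    have := hc'.tendsto t
    simp only [sub_self, enorm_zero] at this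
    have := ENNReal.Tendsto.pow (n := 2) (this.mono_left (nhdsWithin_le_nhds (s := Set.Ici 0)))
    simpa using this

theorem lintegral_kn_sq_duhamel_sub_le (h : Forcing M η) (hZ : Measurable Z₀) (s t : ℝ) :
    ∫⁻ ξ, (kn ξ ^ 2 * ‖duhamel Z₀ η s ξ 1 - duhamel Z₀ η t ξ 1‖ₑ) ^ 2
      ≤ 4 * (∫⁻ ξ, ‖deriv (fun u => duhamel Z₀ η u ξ 1) s - deriv (fun u => duhamel Z₀ η u ξ 1) t‖ₑ ^ 2)
        + 16 * (∫⁻ ξ, (kn ξ * ‖duhamel Z₀ η s ξ - duhamel Z₀ η t ξ‖ₑ) ^ 2)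
        + 16 * ∫⁻ ξ, (kn ξ * ‖η s ξ - η t ξ‖ₑ) ^ 2 := by
  have hk := measurable_kn
  have hd := fun s => measurable_duhamel_right hZ h.cont s
  have hη : ∀ s, Measurable fun ξ => η s ξ := fun s => (h.cont.comp (by fun_prop :
      Continuous fun ξ : ℝ => ((s, ξ) : ℝ × ℝ))).measurable
  have m1 : Measurable fun ξ => (kn ξ * ‖duhamel Z₀ η s ξ - duhamel Z₀ η t ξ‖ₑ) ^ 2 :=
    (hk.mul ((hd s).sub (hd t)).enorm).pow_const 2
  have m2 : Measurable fun ξ => (kn ξ * ‖η s ξ - η t ξ‖ₑ) ^ 2 :=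
    (hk.mul ((hη s).sub (hη t)).enorm).pow_const 2
  rw [← lintegral_const_mul' _ _ (by norm_num), ← lintegral_const_mul' _ _ (by norm_num),
    ← lintegral_const_mul' _ _ (by norm_num), ← lintegral_add_right _ (m1.const_mul _),
    ← lintegral_add_right _ (m2.const_mul _)]
  refine lintegral_mono fun ξ => ?_
  have e := kn_sq_mul_enorm_le ξ (a := duhamel Z₀ η s ξ 0 - duhamel Z₀ η t ξ 0)
    (b := duhamel Z₀ η s ξ 1 - duhamel Z₀ η t ξ 1) (e := η s ξ - η t ξ)
    (w := deriv (fun u => duhamel Z₀ η u ξ 1) s - deriv (fun u => duhamel Z₀ η u ξ 1) t)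
    (by rw [deriv_duhamel_one h.cont, deriv_duhamel_one h.cont]; ring)
  have e0 : ‖duhamel Z₀ η s ξ 0 - duhamel Z₀ η t ξ 0‖ₑ ≤ ‖duhamel Z₀ η s ξ - duhamel Z₀ η t ξ‖ₑ := by
    rw [← PiLp.sub_apply]
    exact enormVC_apply_le _ _
  calc _ ≤ 4 * (‖deriv (fun u => duhamel Z₀ η u ξ 1) s - deriv (fun u => duhamel Z₀ η u ξ 1) t‖ₑ ^ 2
        + 4 * ((kn ξ * ‖duhamel Z₀ η s ξ 0 - duhamel Z₀ η t ξ 0‖ₑ) ^ 2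
        + (kn ξ * ‖η s ξ - η t ξ‖ₑ) ^ 2)) := (pow_le_pow_left' e 2).trans
        ((ennreal_add_sq_le _ _).trans (by gcongr; exact ennreal_add_sq_le _ _))
    _ ≤ 4 * (‖deriv (fun u => duhamel Z₀ η u ξ 1) s - deriv (fun u => duhamel Z₀ η u ξ 1) t‖ₑ ^ 2
        + 4 * ((kn ξ * ‖duhamel Z₀ η s ξ - duhamel Z₀ η t ξ‖ₑ) ^ 2
        + (kn ξ * ‖η s ξ - η t ξ‖ₑ) ^ 2)) := by gcongr
    _ = _ := by ring

theorem ennreal_le_of_le_add_half {x y c : ℝ≥0∞} (hx : x ≠ ⊤) (hc : 2 * c ≤ 1)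
    (h : x ≤ y + c * x) : x ≤ 2 * y := by
  have h1 : x + x ≤ 2 * y + x := by
    calc x + x = 2 * x := (two_mul x).symm
      _ ≤ 2 * (y + c * x) := by gcongr
      _ = 2 * y + 2 * c * x := by ring
      _ ≤ 2 * y + 1 * x := by gcongr
      _ = _ := by rw [one_mul]
  exact (ENNReal.add_le_add_iff_right hx).1 h1

theorem lintegral_kn_fluxHat_le_of_norms (h : FluxBound f g C r) (h2 : SecondDiff f g K r Set.univ)
    (hK : 0 ≤ K) {R : ℝ} (hR : 3 * R < r) (hR1 : 3 * R ≤ 1)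
    (hz : Decay R fun t => fourierL2 (z t)) {s t : ℝ} (hs : 0 ≤ s) (ht : 0 ≤ t) :
    ∫⁻ ξ, (kn ξ * ‖fluxHat f g (z s) ξ - fluxHat f g (z t) ξ‖ₑ) ^ 2
      ≤ (ENNReal.ofReal (18 * K * R) *
        ((‖z s - z t‖ₑ + fourierNormOne (z s - z t)) + fourierNormTwo (z s - z t))) ^ 2 := by
  have hR0 := hz.nonneg
  have one_le : ∀ {u}, 0 ≤ u → fourierNormOne (z u) ≤ ENNReal.ofReal R := fun hu =>
    (hz.one_le hu).trans (ENNReal.ofReal_le_ofReal (mul_le_of_le_one_right hR0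
      (pow_le_one₀ (rho_pos hu).le (rho_le_one hu))))
  have two_le : ∀ {u}, 0 ≤ u → fourierNormTwo (z u) ≤ ENNReal.ofReal (4 * R) := fun hu =>
    (hz.two_le hu).trans (ENNReal.ofReal_le_ofReal (mul_le_of_le_one_right (by positivity)
      (pow_le_one₀ (rho_pos hu).le (rho_le_one hu))))
  have f1 : fourierNormOne (z s - z t) ≠ ⊤ := ne_top_of_le_ne_top
    (by finiteness) ((fourierNormOne_sub_le _ _).trans (add_le_add (one_le hs) (one_le ht)))
  have f2 : fourierNormTwo (z s - z t) ≠ ⊤ := ne_top_of_le_ne_top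
    (by finiteness) ((fourierNormTwo_sub_le _ _).trans (add_le_add (two_le hs) (two_le ht)))
  set N := (‖z s - z t‖ₑ + fourierNormOne (z s - z t)) + fourierNormTwo (z s - z t) with hN
  have hNt : N ≠ ⊤ := by finiteness
  have le4 : N.toReal ≤ 4 * N.toReal := by linarith [ENNReal.toReal_nonneg (a := N)]
  have hB : SupBound (3 * N.toReal * 1 ^ 2) (z s - z t) := by
    refine supBound_of_norms ENNReal.toReal_nonneg one_pos le_rfl ?_ ?_ ?_
    · rw [mul_one, ENNReal.ofReal_toReal hNt]
      exact le_self_add.trans le_self_add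
    · rw [one_pow, mul_one, ENNReal.ofReal_toReal hNt]
      exact le_add_self.trans le_self_add
    · rw [one_pow, mul_one]
      refine le_trans ?_ (ENNReal.ofReal_le_ofReal le4)
      rw [ENNReal.ofReal_toReal hNt]
      exact le_add_self
  refine (h2.lintegral_kn_fluxHat_sub_le h hK hR hR1 (hz.supBound_const hs) (hz.supBound_const ht) hB
    (.of_forall fun x => trivial)).trans (pow_le_pow_left' ?_ 2)
  calc _ ≤ ENNReal.ofReal (K * (3 * R)) * N + ENNReal.ofReal (K * (3 * N.toReal * 1 ^ 2)) *
        (ENNReal.ofReal R + ENNReal.ofReal (4 * R)) := by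
        gcongr
        · rw [hN, add_assoc]
          exact le_add_self
        · exact one_le ht
        · exact two_le hs
    _ = ENNReal.ofReal (K * (3 * R)) * N + ENNReal.ofReal (15 * K * R) * N := by
        have hNn := ENNReal.toReal_nonneg (a := N)
        rw [← ENNReal.ofReal_add hR0 (by positivity), ← ENNReal.ofReal_mul (by positivity)]
        nth_rw 4 [← ENNReal.ofReal_toReal hNt]
        rw [← ENNReal.ofReal_mul (by positivity)]
        congr 2; ring
    _ = _ := by
        rw [← add_mul, ← ENNReal.ofReal_add (by positivity) (by positivity)]
        congr 2; ring

theorem Small.continuousInTime_normB0 (h : Small f g C r C₁ ε) (h2 : SecondDiff f g K r Set.univ)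
    (hK : 0 ≤ K) (hq : C₁ * (200 * (C + K) * (C₁ * ε)) ≤ 1 / 2) (hZ : IsDatum ε z₀ Z₀)
    (hz : SolvesInBall f g (4 * C₁ * ε) z₀ z) : ContinuousInTime normB0 z := by
  intro t ht
  have hC1 := h.one_le
  have hC := h.flux.one_le
  have hε := h.pos
  have hgood := h.isGood hZ hz
  have hd := hgood.decay
  have hR0 := hd.nonneg
  have hlow := hz.1.2.1 t ht
  have h01 : Tendsto (fun s => ‖z s - z t‖ₑ + fourierNormOne (z s - z t)) (𝓝[Set.Ici 0] t) (𝓝 0) := by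
    refine tendsto_of_tendsto_of_tendsto_of_le_of_le tendsto_const_nhds hlow (fun _ => bot_le)
      fun s => ?_
    simp only [normLow, ← derivNorm_one_eq]
    rw [add_assoc]
    exact le_add_self
  have hX := tendsto_lintegral_deriv_sub hgood.forcing hZ.bound ht
  have hκ : 64 * ENNReal.ofReal (18 * K * (C₁ * ε)) ^ 2 * 2 ≤ 1 := by
    have hk : 18 * K * (C₁ * ε) ≤ 1 / 20 := by
      have : K * (C₁ * ε) ≤ C₁ * ((C + K) * (C₁ * ε)) := by
        refine le_trans ?_ (le_mul_of_one_le_left (by positivity) hC1)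
        gcongr
        linarith
      linarith
    calc _ ≤ 64 * ENNReal.ofReal (1 / 20) ^ 2 * 2 := by gcongr
      _ = ENNReal.ofReal (64 * (1 / 20) ^ 2 * 2) := by
          rw [ENNReal.ofReal_mul (by norm_num), ENNReal.ofReal_mul (by norm_num),
            ENNReal.ofReal_pow (by norm_num)]
          simp
      _ ≤ 1 := ENNReal.ofReal_le_one.2 (by norm_num)
  have key : ∀ s, 0 ≤ s → fourierNormTwo (z s - z t) ^ 2
      ≤ 2 * (4 * (∫⁻ ξ, ‖deriv (fun u => duhamel Z₀ (fluxPath f g z) u ξ 1) s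
        - deriv (fun u => duhamel Z₀ (fluxPath f g z) u ξ 1) t‖ₑ ^ 2)
        + 17 * (‖z s - z t‖ₑ + fourierNormOne (z s - z t)) ^ 2) := by
    intro s hs
    have e : fourierL2 (z s - z t) =ᵐ[volume] fun ξ => duhamel Z₀ (fluxPath f g z) s ξ
        - duhamel Z₀ (fluxPath f g z) t ξ := by
      filter_upwards [fourierL2_sub_ae (z s) (z t), hgood.eq s hs, hgood.eq t ht] with ξ a b c
      rw [a, b, c]
    have e1 : ∫⁻ ξ, (kn ξ * ‖duhamel Z₀ (fluxPath f g z) s ξ - duhamel Z₀ (fluxPath f g z) t ξ‖ₑ) ^ 2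
        = fourierNormOne (z s - z t) ^ 2 := by
      rw [fourierNormOne_sq]
      exact lintegral_congr_ae (e.mono fun ξ h => by simp only [h])
    have e2 : ∫⁻ ξ, (kn ξ ^ 2 * ‖duhamel Z₀ (fluxPath f g z) s ξ 1
        - duhamel Z₀ (fluxPath f g z) t ξ 1‖ₑ) ^ 2 = fourierNormTwo (z s - z t) ^ 2 := by
      rw [fourierNormTwo_sq]
      exact lintegral_congr_ae (e.mono fun ξ h => by simp only [h, PiLp.sub_apply])
    have e3 := lintegral_kn_fluxHat_le_of_norms h.flux h2 hK (by linarith [h.lt])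
      (by linarith [h.le_one]) hd hs ht
    have e4 := lintegral_kn_sq_duhamel_sub_le hgood.forcing hZ.bound.meas s t
    simp only [fluxPath, max_eq_left hs, max_eq_left ht] at e4
    rw [e1, e2] at e4
    have f2 : fourierNormTwo (z s - z t) ≠ ⊤ := ne_top_of_le_ne_top (by finiteness)
      ((fourierNormTwo_sub_le _ _).trans (add_le_add (hd.two_le hs) (hd.two_le ht)))
    refine ennreal_le_of_le_add_half (c := 64 * ENNReal.ofReal (18 * K * (C₁ * ε)) ^ 2)
      (ENNReal.pow_ne_top f2) (by rw [mul_comm]; exact hκ) (e4.trans ?_)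
    set κ := ENNReal.ofReal (18 * K * (C₁ * ε))
    set a := ‖z s - z t‖ₑ + fourierNormOne (z s - z t)
    have hκ1 : 64 * κ ^ 2 ≤ 1 := (le_mul_of_one_le_right' (by norm_num)).trans hκ
    calc _ ≤ 4 * _ + 16 * a ^ 2 + 16 * (κ ^ 2 * (4 * (a ^ 2 + fourierNormTwo (z s - z t) ^ 2))) := by
          refine add_le_add (add_le_add le_rfl ?_) (mul_le_mul_right (e3.trans ?_) _)
          · gcongr
            exact le_add_self
          · rw [mul_pow]
            gcongr
            exact ennreal_add_sq_le _ _
      _ = 4 * _ + (16 + 64 * κ ^ 2) * a ^ 2 + 64 * κ ^ 2 * fourierNormTwo (z s - z t) ^ 2 := by ring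
      _ ≤ 4 * _ + (16 + 1) * a ^ 2 + 64 * κ ^ 2 * fourierNormTwo (z s - z t) ^ 2 := by gcongr
      _ = _ := by norm_num
  have hP := ENNReal.Tendsto.const_mul (a := 2) ((ENNReal.Tendsto.const_mul (a := 4) hX
    (.inr (by norm_num))).add (ENNReal.Tendsto.const_mul (a := 17) (ENNReal.Tendsto.pow (n := 2) h01)
    (.inr (by norm_num)))) (.inr (by norm_num))
  have hN2 : Tendsto (fun s => fourierNormTwo (z s - z t)) (𝓝[Set.Ici 0] t) (𝓝 0) := by
    refine tendsto_zero_of_sq (tendsto_of_tendsto_of_tendsto_of_le_of_le' tendsto_const_nhds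
      (by simpa using hP) (.of_forall fun _ => bot_le) ?_)
    filter_upwards [self_mem_nhdsWithin] with s (hs : 0 ≤ s)
    exact key s hs
  have := hlow.add hN2
  rw [add_zero] at this
  refine this.congr fun s => ?_
  rw [normB0, derivNorm_two_compB_eq]

theorem exists_small {f g : V → ℝ} (hfg : Admissible f g) : ∃ C r C₁ K ε₁ : ℝ, 1 ≤ C₁ ∧ 0 < ε₁ ∧
    0 ≤ K ∧ (ContDiffAt ℝ 2 f 0 → ContDiffAt ℝ 2 g 0 → SecondDiff f g K r Set.univ) ∧
    ∀ ε, 0 < ε → ε ≤ ε₁ → Small f g C r C₁ ε ∧ C₁ * (200 * (C + K) * (C₁ * ε)) ≤ 1 / 2 := by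
  obtain ⟨C, r₀, hF⟩ := hfg.exists_fluxBound
  obtain ⟨C₁, hC₁, hlin⟩ := decay_duhamel
  have hC := hF.one_le
  obtain ⟨K, r, hr, hr₀, hK, h2⟩ : ∃ K r : ℝ, 0 < r ∧ r ≤ r₀ ∧ 0 ≤ K ∧
      (ContDiffAt ℝ 2 f 0 → ContDiffAt ℝ 2 g 0 → SecondDiff f g K r Set.univ) := by
    by_cases h : ContDiffAt ℝ 2 f 0 ∧ ContDiffAt ℝ 2 g 0
    · obtain ⟨K, r', hr', hK, h2⟩ := hF.exists_secondDiff h.1 h.2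
      exact ⟨K, min r' r₀, lt_min hr' hF.pos, min_le_right _ _, hK,
        fun _ _ => h2.of_le (min_le_left _ _)⟩
    · exact ⟨0, r₀, hF.pos, le_rfl, le_rfl, fun h1 h2 => absurd ⟨h1, h2⟩ h⟩
  have hCK : 0 < C + K := by linarith
  have hD : 0 < 400 * (C + K) * C₁ ^ 2 := by positivity
  refine ⟨C, r, C₁, K, min (r / (24 * C₁)) (1 / (400 * (C + K) * C₁ ^ 2)), hC₁, by positivity, hK,
    h2, fun ε hε hle => ?_⟩
  have h1 : ε * (24 * C₁) ≤ r := (le_div_iff₀ (by positivity)).1 (hle.trans (min_le_left _ _))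
  have h3 : ε * (400 * (C + K) * C₁ ^ 2) ≤ 1 := (le_div_iff₀ hD).1 (hle.trans (min_le_right _ _))
  have hR : 0 < C₁ * ε := by positivity
  have hKR : 0 ≤ K * (C₁ ^ 2 * ε) := by positivity
  have h4 : 400 * (C * (C₁ ^ 2 * ε)) ≤ 1 := by nlinarith
  have h5 : C₁ * ε ≤ C₁ ^ 2 * ε := by nlinarith
  have h6 : C * (C₁ * ε) ≤ C * (C₁ ^ 2 * ε) := mul_le_mul_of_nonneg_left h5 (by linarith)
  have h7 : C₁ * ε ≤ C * (C₁ * ε) := le_mul_of_one_le_left hR.le hC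
  exact ⟨⟨hF.of_le hr hr₀, hC₁, hε, hlin, by linarith, by linarith, by linarith, by
    nlinarith [mul_le_mul_of_nonneg_left h4 hε.le]⟩, by nlinarith⟩

end PSystem

end

open PSystem

theorem mainTheorem2 (f g : V → ℝ) (hfg : Admissible f g) :
    ∃ c : ℝ, 1 < c ∧ ∃ ε₁ : ℝ, 0 < ε₁ ∧ ∀ ε₀ : ℝ, 0 < ε₀ → ε₀ ≤ ε₁ →
      -- existence, and uniqueness in the ball of radius `c ε₀` of `𝓑`
      (∀ z₀ : L2 V, MemB0 z₀ → normB0 z₀ ≤ ENNReal.ofReal ε₀ →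
        ∃ z : ℝ → L2 V, SolvesInBall f g (c * ε₀) z₀ z ∧
          ∀ z' : ℝ → L2 V, SolvesInBall f g (c * ε₀) z₀ z' → ∀ t : ℝ, 0 ≤ t → z' t = z t) ∧
      -- continuous dependence on the initial data, uniformly in time
      (∀ η : ℝ≥0∞, 0 < η → ∃ δ : ℝ≥0∞, 0 < δ ∧
        ∀ (z₀ z₀' : L2 V) (z z' : ℝ → L2 V),
          MemB0 z₀ → normB0 z₀ ≤ ENNReal.ofReal ε₀ → SolvesInBall f g (c * ε₀) z₀ z →
          MemB0 z₀' → normB0 z₀' ≤ ENNReal.ofReal ε₀ → SolvesInBall f g (c * ε₀) z₀' z' →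
          normB0 (z₀ - z₀') ≤ δ → ∀ t : ℝ, 0 ≤ t → ‖z t - z' t‖ₑ ≤ η) ∧
      -- for nonlinearities of class `C²` near the origin: continuity in time with values in `𝓑₀`
      -- and Lipschitz dependence in the norm of `𝓑`
      (ContDiffAt ℝ 2 f 0 → ContDiffAt ℝ 2 g 0 →
        (∀ (z₀ : L2 V) (z : ℝ → L2 V),
          MemB0 z₀ → normB0 z₀ ≤ ENNReal.ofReal ε₀ → SolvesInBall f g (c * ε₀) z₀ z →
          ContinuousInTime normB0 z) ∧
        ∃ K : ℝ≥0, ∀ (z₀ z₀' : L2 V) (z z' : ℝ → L2 V),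
          MemB0 z₀ → normB0 z₀ ≤ ENNReal.ofReal ε₀ → SolvesInBall f g (c * ε₀) z₀ z →
          MemB0 z₀' → normB0 z₀' ≤ ENNReal.ofReal ε₀ → SolvesInBall f g (c * ε₀) z₀' z' →
          normB (fun t => z t - z' t) ≤ K * normB0 (z₀ - z₀')) := by
  obtain ⟨C, r, C₁, K, ε₁, hC₁, hε₁, hK, h2, hs⟩ := exists_small hfg
  refine ⟨4 * C₁, by linarith, ε₁, hε₁, fun ε hε hle => ?_⟩
  obtain ⟨h, hq⟩ := hs ε hε hle
  refine ⟨fun z₀ h₀ hn => ?_, fun η hη => h.continuous_dependence hη, fun hf hg =>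
    ⟨fun z₀ z h₀ hn hz => ?_, (8 * C₁).toNNReal, fun z₀ z₀' z z' h₀ hn hz h₀' hn' hz' => ?_⟩⟩
  · obtain ⟨Z₀, hZ⟩ := h₀.exists_isDatum hε.le hn
    obtain ⟨z, -, hz⟩ := h.exists_solvesInBall hZ
    exact ⟨z, hz, fun z' hz' t ht => h.eq_of_solvesInBall hZ hz' hz ht⟩
  · obtain ⟨Z₀, hZ⟩ := h₀.exists_isDatum hε.le hn
    exact h.continuousInTime_normB0 (h2 hf hg) hK hq hZ hz
  · obtain ⟨Z₀, hZ⟩ := h₀.exists_isDatum hε.le hn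
    obtain ⟨Z₀', hZ'⟩ := h₀'.exists_isDatum hε.le hn'
    exact h.normB_sub_le (h2 hf hg) hK hq hZ hZ' hz hz'
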